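/- Let $1<\alpha<2$, $\omega=\frac1\alpha-\frac12$ and $s\ge s_0>-\frac34(\alpha-1)$. Write $\langle x\rangle=(1+x^2)^{1/2}$ and let $\widehat{\ }$ and $\mathcal F$ be the unitary Fourier transforms in $x\in\mathbb R$ and in $(t,x)\in\mathbb R^2$. For real $\sigma,b$ let $H^{(\sigma,\omega)}$ be the completion of $\mathcal S(\mathbb R)$ (complex-valued functions) for the norm $$\|v\|_{H^{(\sigma,\omega)}}^2=\int_{\mathbb R}\langle\xi\rangle^{2\sigma+2\omega}|\xi|^{-2\omega}|\widehat v(\xi)|^2\,d\xi ,$$ and let $X_{\sigma,\omega,b}$ be the completion of $\mathcal S(\mathbb R^2)$ for the norm $$\|u\|_{X_{\sigma,\omega,b}}^2=\int_{\mathbb R^2}|\xi|^{-2\omega}\langle\xi\rangle^{2\sigma-2\alpha\omega}\langle|\tau|+|\xi|^{1+\alpha}\rangle^{2\omega}\langle\tau-\xi|\xi|^\alpha\rangle^{2b}|\mathcal Fu(\tau,\xi)|^2\,d\tau\,d\xi .$$ For $T>0$ let $X^T_{\sigma,\omega,b}=\{u|_{[-T,T]}: u\in X_{\sigma,\omega,b}\}$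 with the norm $\inf\{\|\tilde u\|_{X_{\sigma,\omega,b}}:\tilde u|_{[-T,T]}=u\}$. Let $\widehat{W_\alpha(t)v}(\xi)=e^{it\xi|\xi|^\alpha}\widehat v(\xi)$. Fix a nonnegative symmetric $\psi\in C_0^\infty([-2,2])$ with $\psi=1$ on $[-1,1]$, put $\psi_T(t)=\psi(t/T)$ and $$\Phi_T(u)(t)=\psi(t)W_\alpha(t)u_0-\tfrac12\psi_T(t)\int_0^tW_\alpha(t-t')\,\partial_x(u^2)(t')\,dt' .$$ The integral is defined for Schwartz functions $u$; it is extended to $X_{s_0,\omega,b}$ by writing it in Fourier variables, $$(2\pi)^{-1/2}\int_{\mathbb R}\mathcal F\big(\partial_x(u^2)\big)(\tau,\xi)\Big(\int_0^te^{i(t-t')\xi|\xi|^\alpha}e^{it'\tau}dt'\Big)d\tau,\qquad \mathcal F\big(\partial_x(u^2)\big)=\frac{i\xi}{2\pi}\,\mathcal Fu*\mathcal Fu .$$ A solution on $[-T,T]$ of the Cauchy problem $$u_t-|D|^\alpha u_x+uu_x=0\ \text{ in }(-T,T)\times\mathbb R,\qquad u(0)=u_0,$$ is a $u\in X^T_{s_0,\omega,b}$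 which has an extension $\tilde u\in X_{s_0,\omega,b}$ with $\tilde u(t)=W_\alpha(t)u_0-\frac12\int_0^tW_\alpha(t-t')\partial_x(\tilde u^2)(t')\,dt'$ for all $t\in[-T,T]$. Then there are $b>\frac12$ and a non-increasing function $T:[0,\infty)\to(0,\infty)$ such that the following hold. 1. For every $T'>0$, $X^{T'}_{s,\omega,b}\subset C([-T',T'],H^{(s,\omega)})$ with continuous inclusion, and for $u\in X_{s_0,\omega,b}$ the convolution above converges absolutely for almost every $(\tau,\xi)$, and for each $t$ the $\tau$-integral above converges absolutely for almost every $\xi$. 2. For every $u_0\in H^{(s,\omega)}$ and $T=T(\|u_0\|_{H^{(s_0,\omega)}})$ there is a solution $u\in X^T_{s,\omega,b}$ on $[-T,T]$; it is the restriction to $[-T,T]$ of a fixed point of $\Phi_T$ in $X_{s,\omega,b}$, and it is the only solution in $X^T_{s_0,\omega,b}$. 3. For every $r>0$, with $T=T(r)$ and $B=\{v_0\in H^{(s,\omega)}:\|v_0\|_{H^{(s_0,\omega)}}\le r\}$, statement 2 holds with this $T$ for all data in $B$, and the flow map $$F:B\to C([-T,T],H^{(s,\omega)})\cap X^T_{s,\omega,b},\qquad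 u_0\mapsto u,$$ is (complex) analytic, that is, it extends to a map which is analytic in a neighbourhood of each point of $B$ in $H^{(s,\omega)}$. -/

import Mathlib

open MeasureTheory Set Filter Topology
open scoped ENNReal

noncomputable section

namespace DispersiveBO

/-! All functions of `x` and of `(t, x)` are represented by their Fourier transforms, taken with the
unitary normalisation: `(2π)^(-1/2) ∫ exp(-i x ξ) f(x) dx` in one variable and
`(2π)^(-1) ∫∫ exp(-i (t τ + x ξ)) u(t, x) dt dx` in two variables.
A frequency pair is written `p = (τ, ξ)`: `p.1 = τ` is dual to `t`, `p.2 = ξ` is dual to `x`. -/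

/-- The Japanese bracket `⟨x⟩ = (1 + x²)^(1/2)`. -/
def bracket (x : ℝ) : ℝ := √(1 + x ^ 2)

/-- The dispersion relation `ξ |ξ|^α` of `u_t - |D|^α u_x = 0`. -/
def phase (α ξ : ℝ) : ℝ := ξ * |ξ| ^ α

/-! ### The spaces of initial data -/

/-- The weight `⟨ξ⟩^(2s+2ω) |ξ|^(-2ω)`. -/
def dataWeight (s ω ξ : ℝ) : ℝ :=
  bracket ξ ^ (2 * s + 2 * ω) * |ξ| ^ (-2 * ω)

/-- The measure `⟨ξ⟩^(2s+2ω) |ξ|^(-2ω) dξ`. -/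
def dataMeasure (s ω : ℝ) : Measure ℝ :=
  volume.withDensity fun ξ => ENNReal.ofReal (dataWeight s ω ξ)

/-- `H^(s,ω)`, the completion of the Schwartz functions for the norm
`(∫ ⟨ξ⟩^(2s+2ω) |ξ|^(-2ω) |û(ξ)|² dξ)^(1/2)`. The map `u ↦ û` identifies it with the
weighted `L²` space below; an element is the spatial Fourier transform of a datum. -/
abbrev DataSpace (s ω : ℝ) : Type := Lp ℂ 2 (dataMeasure s ω)

/-- The norm of `H^(s,ω)`, as a function of the Fourier transform `f = û`. -/
def dataNorm (s ω : ℝ) (f : ℝ → ℂ) : ℝ :=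
  √(∫ ξ, dataWeight s ω ξ * ‖f ξ‖ ^ 2)

/-! ### The resolution spaces -/

/-- The weight `|ξ|^(-2ω) ⟨ξ⟩^(2s-2αω) ⟨|τ|+|ξ|^(1+α)⟩^(2ω) ⟨τ-ξ|ξ|^α⟩^(2b)`, at `p = (τ, ξ)`. -/
def resWeight (α s ω b : ℝ) (p : ℝ × ℝ) : ℝ :=
  |p.2| ^ (-2 * ω) * bracket p.2 ^ (2 * s - 2 * α * ω)
    * bracket (|p.1| + |p.2| ^ (1 + α)) ^ (2 * ω) * bracket (p.1 - phase α p.2) ^ (2 * b)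

/-- The measure with density `resWeight` on the frequency plane. -/
def resMeasure (α s ω b : ℝ) : Measure (ℝ × ℝ) :=
  volume.withDensity fun p => ENNReal.ofReal (resWeight α s ω b p)

/-- `X_{s,ω,b}`, the completion of the Schwartz functions of `(t, x)` for the norm
`(∫∫ resWeight(τ,ξ) |ℱu(τ,ξ)|² dτ dξ)^(1/2)`, identified through `u ↦ ℱu` with a weighted
`L²` space; an element is the space-time Fourier transform of `u`. -/
abbrev ResSpace (α s ω b : ℝ) : Type := Lp ℂ 2 (resMeasure α s ω b)

/-- The spatial Fourier transform of `u(t)` at `ξ`, where `U = ℱu`: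
`(2π)^(-1/2) ∫ exp(i t τ) U(τ, ξ) dτ`. -/
def slice (U : ℝ × ℝ → ℂ) (t ξ : ℝ) : ℂ :=
  (√(2 * Real.pi) : ℂ)⁻¹ * ∫ τ : ℝ, Complex.exp (Complex.I * t * τ) * U (τ, ξ)

/-- `u = v` on the time interval `[-T, T]`, where `U = ℱu` and `V = ℱv`. -/
def EqOnTime (T : ℝ) (U V : ℝ × ℝ → ℂ) : Prop :=
  ∀ t ∈ Icc (-T) T, ∀ᵐ ξ : ℝ, slice U t ξ = slice V t ξ

/-! #### Measure-theoretic facts behind the restriction norm space -/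

lemma one_le_bracket (x : ℝ) : 1 ≤ bracket x := by
  unfold bracket
  rw [Real.one_le_sqrt]
  nlinarith [sq_nonneg x]

lemma bracket_pos (x : ℝ) : 0 < bracket x := lt_of_lt_of_le one_pos (one_le_bracket x)

lemma continuous_bracket : Continuous bracket := by
  unfold bracket
  fun_prop

lemma measurable_resWeight (α s ω b : ℝ) : Measurable (resWeight α s ω b) := by
  have := continuous_bracket.measurable
  unfold resWeight phase
  fun_prop

lemma resWeight_pos (α s ω b : ℝ) {p : ℝ × ℝ} (hp : p.2 ≠ 0) : 0 < resWeight α s ω b p := by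
  have := abs_pos.2 hp
  have h := bracket_pos
  unfold resWeight
  have h1 := Real.rpow_pos_of_pos this (-2 * ω)
  have h2 := Real.rpow_pos_of_pos (h p.2) (2 * s - 2 * α * ω)
  have h3 := Real.rpow_pos_of_pos (h (|p.1| + |p.2| ^ (1 + α))) (2 * ω)
  have h4 := Real.rpow_pos_of_pos (h (p.1 - phase α p.2)) (2 * b)
  positivity

lemma ae_snd_ne_zero : ∀ᵐ p : ℝ × ℝ, p.2 ≠ 0 := by
  have h : Measure.QuasiMeasurePreserving (Prod.snd : ℝ × ℝ → ℝ)
      (volume : Measure (ℝ × ℝ)) volume := Measure.quasiMeasurePreserving_snd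
  exact h.ae (Measure.ae_ne volume (0 : ℝ))

lemma volume_ac_resMeasure (α s ω b : ℝ) :
    (volume : Measure (ℝ × ℝ)) ≪ resMeasure α s ω b := by
  refine withDensity_absolutelyContinuous'
    (measurable_resWeight α s ω b).ennreal_ofReal.aemeasurable ?_
  filter_upwards [ae_snd_ne_zero] with p hp
  simpa using resWeight_pos α s ω b hp

lemma resWeight_inv_le {α s ω b R : ℝ} (hω : 0 ≤ ω) {p : ℝ × ℝ} (hp : p.2 ≠ 0)
    (hR : |p.2| ≤ R) :
    (resWeight α s ω b p)⁻¹ ≤ R ^ (2 * ω) * bracket R ^ |2 * s - 2 * α * ω|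
      * bracket (p.1 - phase α p.2) ^ (-(2 * b)) := by
  have h0 := abs_pos.2 hp
  have hbr : bracket p.2 ≤ bracket R := by
    unfold bracket
    apply Real.sqrt_le_sqrt
    have := pow_le_pow_left₀ h0.le hR 2
    rw [sq_abs] at this
    linarith
  unfold resWeight
  rw [mul_inv, mul_inv, mul_inv, ← Real.rpow_neg h0.le, ← Real.rpow_neg (bracket_pos _).le,
    ← Real.rpow_neg (bracket_pos _).le, ← Real.rpow_neg (bracket_pos _).le]
  have h1 : |p.2| ^ (-(-2 * ω)) ≤ R ^ (2 * ω) := by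
    rw [show -(-2 * ω) = 2 * ω by ring]
    exact Real.rpow_le_rpow h0.le hR (by linarith)
  have h2 : bracket p.2 ^ (-(2 * s - 2 * α * ω)) ≤ bracket R ^ |2 * s - 2 * α * ω| :=
    (Real.rpow_le_rpow_of_exponent_le (one_le_bracket _) (neg_le_abs _)).trans
      (Real.rpow_le_rpow (bracket_pos _).le hbr (abs_nonneg _))
  have h3 : bracket (|p.1| + |p.2| ^ (1 + α)) ^ (-(2 * ω)) ≤ 1 :=
    Real.rpow_le_one_of_one_le_of_nonpos (one_le_bracket _) (by linarith)
  have e1 : 0 ≤ |p.2| ^ (-(-2 * ω)) := Real.rpow_nonneg h0.le _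
  have e2 : 0 ≤ bracket p.2 ^ (-(2 * s - 2 * α * ω)) := Real.rpow_nonneg (bracket_pos _).le _
  have e3 : 0 ≤ bracket (|p.1| + |p.2| ^ (1 + α)) ^ (-(2 * ω)) :=
    Real.rpow_nonneg (bracket_pos _).le _
  have e4 : 0 ≤ bracket (p.1 - phase α p.2) ^ (-(2 * b)) := Real.rpow_nonneg (bracket_pos _).le _
  have e5 : 0 ≤ R ^ (2 * ω) := e1.trans h1
  refine mul_le_mul_of_nonneg_right ?_ e4
  calc _ ≤ R ^ (2 * ω) * bracket R ^ |2 * s - 2 * α * ω| * 1 := by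
          have : 0 ≤ bracket R ^ |2 * s - 2 * α * ω| := e2.trans h2
          gcongr
    _ = _ := by ring

lemma lintegral_bracket_lt_top {b : ℝ} (hb : 1 / 2 < b) :
    ∫⁻ x : ℝ, ENNReal.ofReal (bracket x ^ (-(2 * b))) < ⊤ := by
  have h := integrable_rpow_neg_one_add_norm_sq (E := ℝ) (μ := volume) (r := 2 * b)
    (by simp; linarith)
  refine lt_of_eq_of_lt (lintegral_congr fun x => ?_) h.lintegral_lt_top
  unfold bracket
  rw [Real.sqrt_eq_rpow, ← Real.rpow_mul (by positivity)]
  congr 2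
  · simp
  · ring

lemma lintegral_resWeight_inv_lt_top {α s ω b : ℝ} (hω : 0 ≤ ω) (hb : 1 / 2 < b) (R : ℝ) :
    ∫⁻ p in {p : ℝ × ℝ | |p.2| ≤ R}, ENNReal.ofReal ((resWeight α s ω b p)⁻¹) < ⊤ := by
  have hbm := continuous_bracket.measurable
  set C : ℝ := R ^ (2 * ω) * bracket R ^ |2 * s - 2 * α * ω| with hC
  have hm : MeasurableSet {p : ℝ × ℝ | |p.2| ≤ R} :=
    measurableSet_le (by fun_prop) measurable_const
  have hm' : MeasurableSet {x : ℝ | |x| ≤ R} := measurableSet_le (by fun_prop) measurable_const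
  rw [← lintegral_indicator hm]
  let g : ℝ × ℝ → ℝ≥0∞ := fun p => {x : ℝ | |x| ≤ R}.indicator (fun _ => ENNReal.ofReal |C|) p.2
    * ENNReal.ofReal (bracket (p.1 - phase α p.2) ^ (-(2 * b)))
  have hg : Measurable g := by
    refine Measurable.mul ?_ ?_
    · exact (measurable_const.indicator hm').comp measurable_snd
    · unfold phase
      fun_prop
  have hle : ∫⁻ p : ℝ × ℝ, {p : ℝ × ℝ | |p.2| ≤ R}.indicator
      (fun p => ENNReal.ofReal ((resWeight α s ω b p)⁻¹)) p ≤ ∫⁻ p, g p := by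
    refine lintegral_mono_ae ?_
    filter_upwards [ae_snd_ne_zero] with p hp
    by_cases h : |p.2| ≤ R
    · have h' : p.2 ∈ {x : ℝ | |x| ≤ R} := h
      rw [indicator_of_mem (show p ∈ {p : ℝ × ℝ | |p.2| ≤ R} from h)]
      simp only [g]
      rw [indicator_of_mem h', ← ENNReal.ofReal_mul (abs_nonneg _)]
      refine ENNReal.ofReal_le_ofReal ((resWeight_inv_le hω hp h).trans ?_)
      exact mul_le_mul_of_nonneg_right (le_abs_self _) (Real.rpow_nonneg (bracket_pos _).le _)
    · rw [indicator_of_notMem (show p ∉ {p : ℝ × ℝ | |p.2| ≤ R} from h)]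
      exact zero_le
  refine hle.trans_lt ?_
  rw [Measure.volume_eq_prod, lintegral_prod_symm' _ hg]
  have hin : ∀ ξ : ℝ, ∫⁻ τ : ℝ, g (τ, ξ) =
      {x : ℝ | |x| ≤ R}.indicator (fun _ => ENNReal.ofReal |C|) ξ
        * ∫⁻ x : ℝ, ENNReal.ofReal (bracket x ^ (-(2 * b))) := by
    intro ξ
    simp only [g]
    rw [lintegral_const_mul _ (by fun_prop)]
    congr 1
    exact lintegral_sub_right_eq_self
      (fun x => ENNReal.ofReal (bracket x ^ (-(2 * b)))) (phase α ξ)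
  simp_rw [hin]
  rw [lintegral_mul_const _ (measurable_const.indicator hm'), lintegral_indicator hm',
    setLIntegral_const]
  refine ENNReal.mul_lt_top (ENNReal.mul_lt_top ENNReal.ofReal_lt_top ?_)
    (lintegral_bracket_lt_top hb)
  have : {x : ℝ | |x| ≤ R} = Icc (-R) R := by
    ext x
    simp [abs_le]
  rw [this]
  exact measure_Icc_lt_top

/-- `X_{s,ω,b} ⊂ L¹` on frequency strips `|ξ| ≤ R`, continuously, if `ω ≥ 0` and `b > 1/2`. -/
lemma exists_strip_bound {α s ω b : ℝ} (hω : 0 ≤ ω) (hb : 1 / 2 < b) (R : ℝ) :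
    ∃ C : ℝ≥0∞, C ≠ ⊤ ∧ ∀ U : ResSpace α s ω b,
      ∫⁻ p in {p : ℝ × ℝ | |p.2| ≤ R}, ‖U p‖ₑ ≤ C * ‖U‖ₑ := by
  refine ⟨(∫⁻ p in {p : ℝ × ℝ | |p.2| ≤ R},
    ENNReal.ofReal ((resWeight α s ω b p)⁻¹)) ^ (1 / 2 : ℝ),
    ENNReal.rpow_ne_top_of_nonneg (by norm_num) (lintegral_resWeight_inv_lt_top hω hb R).ne, ?_⟩
  intro U
  have hwm := measurable_resWeight α s ω b
  have hUm : Measurable (U : ℝ × ℝ → ℂ) := (Lp.stronglyMeasurable U).measurable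
  set ν := (volume : Measure (ℝ × ℝ)).restrict {p : ℝ × ℝ | |p.2| ≤ R}
  let f : ℝ × ℝ → ℝ≥0∞ := fun p => ENNReal.ofReal ((resWeight α s ω b p)⁻¹) ^ (1 / 2 : ℝ)
  let g : ℝ × ℝ → ℝ≥0∞ := fun p => ENNReal.ofReal (resWeight α s ω b p) ^ (1 / 2 : ℝ) * ‖U p‖ₑ
  have h := ENNReal.lintegral_mul_le_Lp_mul_Lq ν (p := 2) (q := 2) Real.HolderConjugate.two_two
    (f := f) (g := g) (by fun_prop) (by fun_prop)
  have e1 : ∫⁻ p, ‖U p‖ₑ ∂ν = ∫⁻ p, (f * g) p ∂ν := by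
    refine lintegral_congr_ae ?_
    filter_upwards [ae_restrict_of_ae ae_snd_ne_zero] with p hp
    have hw := resWeight_pos α s ω b hp
    simp only [Pi.mul_apply, f, g]
    rw [← mul_assoc, ← ENNReal.mul_rpow_of_nonneg _ _ (by norm_num),
      ← ENNReal.ofReal_mul (inv_pos.2 hw).le, inv_mul_cancel₀ hw.ne']
    simp
  have e2 : ∀ p, f p ^ (2 : ℝ) = ENNReal.ofReal ((resWeight α s ω b p)⁻¹) := by
    intro p
    simp only [f]
    rw [← ENNReal.rpow_mul]
    norm_num
  have e3 : ∀ p, g p ^ (2 : ℝ) = ENNReal.ofReal (resWeight α s ω b p) * ‖U p‖ₑ ^ (2 : ℝ) := by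
    intro p
    simp only [g]
    rw [ENNReal.mul_rpow_of_nonneg _ _ (by norm_num), ← ENNReal.rpow_mul]
    norm_num
  have e4 : (∫⁻ p, g p ^ (2 : ℝ) ∂ν) ^ (1 / 2 : ℝ) ≤ ‖U‖ₑ := by
    rw [Lp.enorm_def, eLpNorm_eq_lintegral_rpow_enorm_toReal (by norm_num) (by norm_num)]
    simp only [ENNReal.toReal_ofNat]
    refine ENNReal.rpow_le_rpow ?_ (by norm_num)
    unfold resMeasure
    rw [lintegral_withDensity_eq_lintegral_mul _ hwm.ennreal_ofReal (by fun_prop)]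
    refine (setLIntegral_le_lintegral _ _).trans (lintegral_mono fun p => ?_)
    rw [e3]
    exact le_rfl
  rw [e1]
  refine h.trans ?_
  simp_rw [e2]
  gcongr

lemma ae_integrable_slice {α s ω b : ℝ} (hω : 0 ≤ ω) (hb : 1 / 2 < b) (U : ResSpace α s ω b) :
    ∀ᵐ ξ : ℝ, Integrable fun τ : ℝ => U (τ, ξ) := by
  have hUm : StronglyMeasurable (U : ℝ × ℝ → ℂ) := Lp.stronglyMeasurable U
  have key : ∀ n : ℕ, ∀ᵐ ξ : ℝ, |ξ| ≤ n → Integrable fun τ : ℝ => U (τ, ξ) := by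
    intro n
    obtain ⟨C, hC, h⟩ := exists_strip_bound (α := α) (s := s) hω hb (n : ℝ)
    have hm : MeasurableSet {p : ℝ × ℝ | |p.2| ≤ (n : ℝ)} :=
      measurableSet_le (by fun_prop) measurable_const
    have hint : Integrable ({p : ℝ × ℝ | |p.2| ≤ (n : ℝ)}.indicator (U : ℝ × ℝ → ℂ))
        ((volume : Measure ℝ).prod volume) := by
      rw [integrable_indicator_iff hm]
      refine ⟨hUm.aestronglyMeasurable, ?_⟩
      exact (h U).trans_lt (ENNReal.mul_lt_top hC.lt_top enorm_lt_top)
    filter_upwards [hint.prod_left_ae] with ξ hξ hle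
    refine hξ.congr (Eventually.of_forall fun τ => ?_)
    exact indicator_of_mem (show (τ, ξ) ∈ {p : ℝ × ℝ | |p.2| ≤ (n : ℝ)} from hle) _
  filter_upwards [ae_all_iff.2 key] with ξ hξ
  obtain ⟨n, hn⟩ := exists_nat_ge |ξ|
  exact hξ n hn

lemma ae_ae_of_ae_resMeasure {α s ω b : ℝ} {P : ℝ × ℝ → Prop}
    (h : ∀ᵐ p ∂(resMeasure α s ω b), P p) : ∀ᵐ ξ : ℝ, ∀ᵐ τ : ℝ, P (τ, ξ) := by
  have h1 : ∀ᵐ p : ℝ × ℝ, P p := (volume_ac_resMeasure α s ω b).ae_le h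
  have h2 : ∀ᵐ p : ℝ × ℝ, P p.swap :=
    (Measure.measurePreserving_swap (μ := (volume : Measure ℝ))
      (ν := (volume : Measure ℝ))).quasiMeasurePreserving.ae h1
  exact Measure.ae_ae_of_ae_prod h2

lemma integrable_exp_mul {f : ℝ → ℂ} (hf : Integrable f) (t : ℝ) :
    Integrable fun τ : ℝ => Complex.exp (Complex.I * t * τ) * f τ := by
  refine hf.bdd_mul (c := 1) (by fun_prop) (Eventually.of_forall fun τ => ?_)
  rw [show Complex.I * t * τ = ((t * τ : ℝ) : ℂ) * Complex.I by push_cast; ring,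
    Complex.norm_exp_ofReal_mul_I]

lemma slice_add_ae {α s ω b : ℝ} (hω : 0 ≤ ω) (hb : 1 / 2 < b) (U V : ResSpace α s ω b) :
    ∀ᵐ ξ : ℝ, ∀ t : ℝ, slice (U + V : ResSpace α s ω b) t ξ = slice U t ξ + slice V t ξ := by
  filter_upwards [ae_integrable_slice hω hb U, ae_integrable_slice hω hb V,
    ae_ae_of_ae_resMeasure (Lp.coeFn_add U V)] with ξ hU hV h t
  unfold slice
  rw [← mul_add, ← integral_add (integrable_exp_mul hU t) (integrable_exp_mul hV t)]
  congr 1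
  refine integral_congr_ae ?_
  filter_upwards [h] with τ hτ
  rw [hτ, Pi.add_apply, mul_add]

lemma slice_smul_ae {α s ω b : ℝ} (c : ℂ) (U : ResSpace α s ω b) :
    ∀ᵐ ξ : ℝ, ∀ t : ℝ, slice (c • U : ResSpace α s ω b) t ξ = c * slice U t ξ := by
  filter_upwards [ae_ae_of_ae_resMeasure (Lp.coeFn_smul c U)] with ξ h t
  unfold slice
  rw [mul_left_comm, ← integral_const_mul (μ := (volume : Measure ℝ)) c]
  congr 1
  refine integral_congr_ae ?_
  filter_upwards [h] with τ hτ
  rw [hτ, Pi.smul_apply, smul_eq_mul]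
  ring

lemma slice_zero_ae {α s ω b : ℝ} :
    ∀ᵐ ξ : ℝ, ∀ t : ℝ, slice (0 : ResSpace α s ω b) t ξ = 0 := by
  filter_upwards [slice_smul_ae (0 : ℂ) (0 : ResSpace α s ω b)] with ξ h t
  simpa using h t

/-! ### The restriction norm spaces -/

/-- The elements of `X_{s,ω,b}` which vanish on `[-T, T]`. -/
def vanishing (α s ω b T : ℝ) (hω : 0 ≤ ω) (hb : 1 / 2 < b) :
    Submodule ℂ (ResSpace α s ω b) where
  carrier := {U | ∀ t ∈ Icc (-T) T, ∀ᵐ ξ : ℝ, slice U t ξ = 0}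
  add_mem' := by
    intro U V hU hV t ht
    filter_upwards [hU t ht, hV t ht, slice_add_ae hω hb U V] with ξ h1 h2 h3
    rw [h3 t, h1, h2, add_zero]
  zero_mem' := by
    intro t _
    filter_upwards [slice_zero_ae (α := α) (s := s) (ω := ω) (b := b)] with ξ h
    exact h t
  smul_mem' := by
    intro c U hU t ht
    filter_upwards [hU t ht, slice_smul_ae c U] with ξ h1 h2
    rw [h2 t, h1, mul_zero]

lemma enorm_slice_le (U : ℝ × ℝ → ℂ) (t ξ : ℝ) :
    ‖slice U t ξ‖ₑ ≤ ‖(√(2 * Real.pi) : ℂ)⁻¹‖ₑ * ∫⁻ τ : ℝ, ‖U (τ, ξ)‖ₑ := by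
  unfold slice
  rw [enorm_mul]
  gcongr
  refine (enorm_integral_le_lintegral_enorm _).trans (lintegral_mono fun τ => ?_)
  rw [enorm_mul]
  have : ‖Complex.exp (Complex.I * t * τ)‖ₑ = 1 := by
    rw [← ofReal_norm,
      show Complex.I * t * τ = ((t * τ : ℝ) : ℂ) * Complex.I by push_cast; ring,
      Complex.norm_exp_ofReal_mul_I, ENNReal.ofReal_one]
  rw [this, one_mul]

instance isClosed_vanishing (α s ω b T : ℝ) (hω : 0 ≤ ω) (hb : 1 / 2 < b) :
    IsClosed (vanishing α s ω b T hω hb : Set (ResSpace α s ω b)) := by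
  refine isClosed_of_closure_subset fun U hU t ht => ?_
  have key : ∀ n : ℕ, ∀ᵐ ξ : ℝ, |ξ| ≤ n → slice U t ξ = 0 := by
    intro n
    obtain ⟨C, hC, h⟩ := exists_strip_bound (α := α) (s := s) hω hb (n : ℝ)
    have hm : MeasurableSet {p : ℝ × ℝ | |p.2| ≤ (n : ℝ)} :=
      measurableSet_le (by fun_prop) measurable_const
    have hm' : MeasurableSet {x : ℝ | |x| ≤ (n : ℝ)} :=
      measurableSet_le (by fun_prop) measurable_const
    set K : ℝ≥0∞ := ‖(√(2 * Real.pi) : ℂ)⁻¹‖ₑ with hK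
    have hKt : K ≠ ⊤ := enorm_ne_top
    let G : ResSpace α s ω b → ℝ≥0∞ := fun W =>
      ∫⁻ ξ in {x : ℝ | |x| ≤ (n : ℝ)}, ∫⁻ τ : ℝ, ‖W (τ, ξ)‖ₑ
    have hG : ∀ W, G W ≤ C * ‖W‖ₑ := by
      intro W
      refine le_trans (le_of_eq ?_) (h W)
      have hWm : Measurable fun p : ℝ × ℝ => ‖W p‖ₑ :=
        (Lp.stronglyMeasurable W).measurable.enorm
      simp only [G]
      rw [← lintegral_indicator hm, Measure.volume_eq_prod,
        lintegral_prod_symm' _ (hWm.indicator hm), ← lintegral_indicator hm']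
      refine lintegral_congr fun ξ => ?_
      by_cases hξ : |ξ| ≤ (n : ℝ)
      · rw [indicator_of_mem (show ξ ∈ {x : ℝ | |x| ≤ (n : ℝ)} from hξ)]
        refine lintegral_congr fun τ => ?_
        rw [indicator_of_mem (show (τ, ξ) ∈ {p : ℝ × ℝ | |p.2| ≤ (n : ℝ)} from hξ)]
      · rw [indicator_of_notMem (show ξ ∉ {x : ℝ | |x| ≤ (n : ℝ)} from hξ)]
        symm
        refine (lintegral_congr fun τ => ?_).trans lintegral_zero
        rw [indicator_of_notMem (show (τ, ξ) ∉ {p : ℝ × ℝ | |p.2| ≤ (n : ℝ)} from hξ)]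
    have hV : ∀ V ∈ vanishing α s ω b T hω hb,
        ∫⁻ ξ in {x : ℝ | |x| ≤ (n : ℝ)}, ‖slice U t ξ‖ₑ ≤ K * C * ‖U - V‖ₑ := by
      intro V hV
      have e : ∀ᵐ ξ : ℝ, ‖slice U t ξ‖ₑ ≤
          K * ∫⁻ τ : ℝ, ‖(U - V : ResSpace α s ω b) (τ, ξ)‖ₑ := by
        filter_upwards [slice_add_ae hω hb (U - V) V, hV t ht] with ξ h1 h2
        have h3 := h1 t
        rw [sub_add_cancel, h2, add_zero] at h3
        rw [h3]
        exact enorm_slice_le _ _ _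
      calc _ ≤ ∫⁻ ξ in {x : ℝ | |x| ≤ (n : ℝ)},
            K * ∫⁻ τ : ℝ, ‖(U - V : ResSpace α s ω b) (τ, ξ)‖ₑ :=
            lintegral_mono_ae (ae_restrict_of_ae e)
        _ = K * G (U - V) := lintegral_const_mul' _ _ hKt
        _ ≤ K * (C * ‖U - V‖ₑ) := by gcongr; exact hG _
        _ = _ := by ring
    have hzero : ∫⁻ ξ in {x : ℝ | |x| ≤ (n : ℝ)}, ‖slice U t ξ‖ₑ = 0 := by
      obtain ⟨V, hVm, hVt⟩ := mem_closure_iff_seq_limit.1 hU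
      have hlim : Tendsto (fun k => K * C * ‖U - V k‖ₑ) atTop (𝓝 (K * C * 0)) := by
        refine ENNReal.Tendsto.const_mul ?_ (Or.inr (ENNReal.mul_ne_top hKt hC))
        have := (tendsto_const_nhds (x := U)).sub hVt
        rw [sub_self] at this
        simpa using this.enorm
      rw [mul_zero] at hlim
      exact le_antisymm (ge_of_tendsto' hlim fun k => hV (V k) (hVm k)) zero_le
    have hsm : Measurable fun ξ : ℝ => ‖slice U t ξ‖ₑ := by
      have : StronglyMeasurable fun q : ℝ × ℝ =>
          Complex.exp (Complex.I * t * q.2) * U (q.2, q.1) := by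
        refine StronglyMeasurable.mul (Continuous.stronglyMeasurable (by fun_prop)) ?_
        exact (Lp.stronglyMeasurable U).comp_measurable measurable_swap
      have h2 := this.integral_prod_right' (ν := (volume : Measure ℝ))
      exact (h2.const_mul _).measurable.enorm
    have := (lintegral_eq_zero_iff hsm).1 hzero
    rw [Filter.EventuallyEq, ae_restrict_iff' hm'] at this
    filter_upwards [this] with ξ hξ hle
    simpa using hξ hle
  filter_upwards [ae_all_iff.2 key] with ξ hξ
  obtain ⟨n, hn⟩ := exists_nat_ge |ξ|
  exact hξ n hn

/-- `X^T_{s,ω,b} = {u|_[-T,T] : u ∈ X_{s,ω,b}}`, as the quotient of `X_{s,ω,b}` by the elements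
vanishing on `[-T, T]`. The quotient norm of `u` is the infimum of the norms of the extensions
of `u`. (For `b > 1/2` and `ω ≥ 0` the integral defining `slice U t ξ` converges for a.e. `ξ`.) -/
abbrev ResTimeSpace (α s ω b T : ℝ) (hω : 0 ≤ ω) (hb : 1 / 2 < b) : Type :=
  ResSpace α s ω b ⧸ vanishing α s ω b T hω hb

/-- The restriction `u ↦ u|_[-T,T]`. -/
def restrictTime {α s ω b : ℝ} (T : ℝ) (hω : 0 ≤ ω) (hb : 1 / 2 < b) (U : ResSpace α s ω b) :
    ResTimeSpace α s ω b T hω hb :=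
  (vanishing α s ω b T hω hb).mkQ U

lemma omega_nonneg {α ω : ℝ} (h1 : 1 < α) (h2 : α < 2) (hω : ω = 1 / α - 1 / 2) : 0 ≤ ω := by
  rw [hω, sub_nonneg]
  exact one_div_le_one_div_of_le (by linarith) h2.le

/-! ### The integral equation -/

/-- A cutoff: `ψ ∈ C_0^∞([-2, 2])` is nonnegative, symmetric and equal to `1` on `[-1, 1]`. -/
structure IsCutoff (ψ : ℝ → ℝ) : Prop where
  contDiff : ContDiff ℝ (⊤ : ℕ∞) ψ
  tsupport_subset : tsupport ψ ⊆ Icc (-2) 2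
  nonneg : ∀ t, 0 ≤ ψ t
  even : ∀ t, ψ (-t) = ψ t
  eq_one : ∀ t ∈ Icc (-1 : ℝ) 1, ψ t = 1

/-- The Fourier transform at `ξ` of `W_α(t) u₀`, where `f = û₀`. -/
def freeEvolution (α : ℝ) (f : ℝ → ℂ) (t ξ : ℝ) : ℂ :=
  Complex.exp (Complex.I * t * phase α ξ) * f ξ

/-- The space-time Fourier transform of `∂_x(u²)` at `p = (τ, ξ)`, where `U = ℱu`:
`i ξ (2π)^(-1) (U * U)(τ, ξ)`. -/
def dxSquare (U : ℝ × ℝ → ℂ) (p : ℝ × ℝ) : ℂ :=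
  Complex.I * p.2 * ((2 * Real.pi : ℝ) : ℂ)⁻¹ * ∫ q : ℝ × ℝ, U q * U (p - q)

/-- The Fourier symbol `∫_0^t exp(i (t-t') ξ|ξ|^α) exp(i t' τ) dt'` of
`F ↦ ∫_0^t W_α(t-t') F(t') dt'`. -/
def duhamelSymbol (α t τ ξ : ℝ) : ℂ :=
  ∫ t' in (0 : ℝ)..t,
    Complex.exp (Complex.I * (t - t') * phase α ξ) * Complex.exp (Complex.I * t' * τ)

/-- The Fourier transform at `ξ` of `∫_0^t W_α(t-t') ∂_x(u²)(t') dt'`, where `U = ℱu`. For a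
Schwartz function `u` this is the usual integral, with the `t'` integral done first; for
`u ∈ X_{s,ω,b}` it is the extension of the latter. -/
def duhamel (α : ℝ) (U : ℝ × ℝ → ℂ) (t ξ : ℝ) : ℂ :=
  (√(2 * Real.pi) : ℂ)⁻¹ * ∫ τ : ℝ, dxSquare U (τ, ξ) * duhamelSymbol α t τ ξ

/-- The integrals in `duhamel α U` converge absolutely, almost everywhere. -/
def DuhamelConverges (α : ℝ) (U : ℝ × ℝ → ℂ) : Prop :=
  (∀ᵐ p : ℝ × ℝ, Integrable fun q : ℝ × ℝ => U q * U (p - q)) ∧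
  ∀ t : ℝ, ∀ᵐ ξ : ℝ, Integrable fun τ : ℝ => dxSquare U (τ, ξ) * duhamelSymbol α t τ ξ

/-- `u = Φ_T(u)` for all times, where `U = ℱu`, `f = û₀`, `ψ_T(t) = ψ(t/T)` and
`Φ_T(u)(t) = ψ(t) W_α(t) u₀ - (1/2) ψ_T(t) ∫_0^t W_α(t-t') ∂_x(u²)(t') dt'`. -/
def IsFixedPoint (α : ℝ) (ψ : ℝ → ℝ) (T : ℝ) (f : ℝ → ℂ) (U : ℝ × ℝ → ℂ) : Prop :=
  ∀ t : ℝ, ∀ᵐ ξ : ℝ,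
    slice U t ξ = ψ t * freeEvolution α f t ξ - 1 / 2 * ψ (t / T) * duhamel α U t ξ

/-- `u(t) = W_α(t) u₀ - (1/2) ∫_0^t W_α(t-t') ∂_x(u²)(t') dt'` for `t ∈ [-T, T]`, where `U = ℱu`
and `f = û₀`: the restriction of `u` to `[-T, T]` solves the Cauchy problem
`u_t - |D|^α u_x + u u_x = 0`, `u(0) = u₀`. -/
def SolvesOn (α T : ℝ) (f : ℝ → ℂ) (U : ℝ × ℝ → ℂ) : Prop :=
  ∀ t ∈ Icc (-T) T, ∀ᵐ ξ : ℝ,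
    slice U t ξ = freeEvolution α f t ξ - 1 / 2 * duhamel α U t ξ

/-- `u ∈ X_{s,ω,b}` is a fixed point of `Φ_T`, its restriction to `[-T, T]` is a solution for the
datum `u₀`, and every solution in `X^T_{s₀,ω,b}` for the datum `u₀` equals it on `[-T, T]`. -/
def IsUniqueSolution (α s s₀ ω b : ℝ) (ψ : ℝ → ℝ) (T : ℝ) (f : ℝ → ℂ)
    (U : ResSpace α s ω b) : Prop :=
  IsFixedPoint α ψ T f U ∧ SolvesOn α T f U ∧
  ∀ V : ResSpace α s₀ ω b, SolvesOn α T f V → EqOnTime T V U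

end DispersiveBO

end

open DispersiveBO

namespace DispersiveBO

/-! The equation is solved as a quadratic fixed point problem u = y + A(u, u) in X_{s,ω,b}: y is the
cut-off free evolution, and A is -1/2 times the cut-off Duhamel operator applied to ∂_x(uv). With b
= 1/2 + ε and b' = -1/2 + 2ε, the Duhamel operator maps X_{s,ω,b'} to X_{s,ω,b} with norm O(T^ε)
(`weighted_duhamelKernel_le`, `exists_duhamelOp`). What remains is a bilinear estimate for ∂_x(uv)
from X_{s,ω,b} × X_{s,ω,b} to X_{s,ω,b'}.

That estimate is made pointwise in frequency. If ξ₃ = ξ₁ + ξ₂, the modulations satisfy σ₁ + σ₂ - σ₃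
= φ(ξ₃) - φ(ξ₁) - φ(ξ₂), and the right side is at least a multiple of min|ξ_i| · max|ξ_i|^α
(`resonance`), so the largest modulation is large. Spending it, the squared multiplier is bounded by
kernels containing only two of the three modulations, namely ⟨σ_i⟩^(-1-2ε) ⟨σ_j⟩^(-1-2ε) times
`pairKernel` (`multiplier_le`). Up to a factor `pairKernel` is the Jacobian of x ↦ φ(x) + φ(c - x),
enlarged near the zero of this Jacobian, so the kernels have bounded integrals over pairs with a
given sum (`lintegral_modKernel_le`) and Cauchy–Schwarz concludes (`resEnergy_derivConv_le`). In
logarithmic variables the pointwise bound is a short list of linear inequalities. The threshold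
-3(α-1)/4 comes from three comparable frequencies and from two high frequencies producing a low one;
the value of ω is what balances a high frequency against a low one.

Raising the regularity puts the extra derivatives on one factor only (`resEnergy_derivConv_tame`),
so A is tame: linear in the strong norm of X_{s,ω,b}, quadratic in the weak norm of X_{s₀,ω,b}. A
contraction argument then needs smallness in the weak norm alone, which is why the lifespan depends
only on the H^(s₀,ω) norm; the inverse function theorem for v ↦ v - A(v, v) makes the solution map
analytic (`IsTame.exists_solutionMap`).

Uniqueness is asked among all solutions, without smallness. The difference of two solutions
satisfies a linear equation, which is contractive on a short interval whose length depends on the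
norms of the solutions. The Duhamel term is local in time (`duhamelBilinear_mem_vanishing`), so the
difference vanishes there, and translation in time carries this across [-T, T]
(`eqOnTime_of_solvesOn`). -/

/-- Admissible parameters of the bilinear estimate: the modulation exponents are
`b = 1/2 + ε` and `b' = -1/2 + 2ε`, the regularity is `-ρ`. -/
structure Admissible (α ω ρ ε : ℝ) : Prop where
  one_lt : 1 < α
  lt_two : α < 2
  mul_eq : α * ω = 1 - α / 2
  rho_pos : 0 < ρ
  eps_pos : 0 < ε
  -- This is ρ < 3(α-1)/4 with room for the losses of order ε.
  rho_le : 4 * ρ + 8 * ε * (1 + α) ≤ 3 * (α - 1)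
  eps_le : 16 * ε ≤ α - 1
  -- Equivalent to 1/2 + ε + ω ≤ 1 - ε, the limit of what the Duhamel operator can gain, and to 2ω ≤
  -- 1 - 4ε, by which a modulation pays for an elliptic weight.
  omega_le : 4 * ε + 2 * ω ≤ 1

namespace Admissible

variable {α ω ρ ε : ℝ}

lemma omega_pos (h : Admissible α ω ρ ε) : 0 < ω := by
  have h1 := h.mul_eq
  have h2 := h.lt_two
  have h3 := h.one_lt
  by_contra hc
  nlinarith

lemma omega_lt (h : Admissible α ω ρ ε) : ω < 1 / 2 := by
  linarith [h.omega_le, h.eps_pos]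

lemma rho_lt (h : Admissible α ω ρ ε) : ρ < 3 / 4 := by
  nlinarith [h.rho_le, h.eps_pos, h.one_lt, h.lt_two]

end Admissible

/-- The logarithm of the squared multiplier of the bilinear estimate, in terms of the logarithms
`a` of the frequencies, `A` of their brackets, `o` of the elliptic weights, `l` of the
modulations. -/
def logMult (α ω ρ ε a₁ a₂ a₃ A₁ A₂ A₃ o₁ o₂ o₃ l₁ l₂ l₃ : ℝ) : ℝ :=
  (2 * a₃ - 2 * ω * a₃ - (2 * ρ + 2 * α * ω) * A₃ + 2 * ω * o₃ + (-1 + 4 * ε) * l₃)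
    + (2 * ω * a₁ + (2 * ρ + 2 * α * ω) * A₁ - 2 * ω * o₁ - (1 + 2 * ε) * l₁)
    + (2 * ω * a₂ + (2 * ρ + 2 * α * ω) * A₂ - 2 * ω * o₂ - (1 + 2 * ε) * l₂)

/-! ### Linear inequalities between the logarithms, one for each configuration of frequencies -/

section LogEstimates

variable {α ω ρ ε a₁ a₂ a₃ A₁ A₂ A₃ o₁ o₂ o₃ l₁ l₂ l₃ κ ν K₁₂ K₁₃ K₂₃ : ℝ}

/-- Eliminating αω through αω = 1 - α/2 leaves only products of two factors, which linear arithmetic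
can treat as atoms. -/
lemma logMult_eq (h : Admissible α ω ρ ε) : logMult α ω ρ ε a₁ a₂ a₃ A₁ A₂ A₃ o₁ o₂ o₃ l₁ l₂ l₃ =
    (2 * a₃ - 2 * (ω * a₃) - (2 * (ρ * A₃) + 2 * A₃ - α * A₃) + 2 * (ω * o₃) - l₃ + 4 * (ε * l₃))
    + (2 * (ω * a₁) + (2 * (ρ * A₁) + 2 * A₁ - α * A₁) - 2 * (ω * o₁) - l₁ - 2 * (ε * l₁))
    + (2 * (ω * a₂) + (2 * (ρ * A₂) + 2 * A₂ - α * A₂) - 2 * (ω * o₂) - l₂ - 2 * (ε * l₂)) := by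
  have := h.mul_eq
  unfold logMult
  linear_combination (-2 * A₃ + 2 * A₁ + 2 * A₂) * this

/-- Case of frequencies of modulus at most 1. The derivative and the output weight supply the power
2 - 2ω of |ξ₃|, more than the (α-1)/2 asked for by the near-diagonal part of `pairKernel`; the
remaining factors are bounded or have a favourable sign, except the output's elliptic weight, which
one of the inputs controls. -/
lemma logMult_le_of_low (h : Admissible α ω ρ ε) (hκ : 0 ≤ κ)
    (ha₁ : a₁ ≤ 0) (ha₂ : a₂ ≤ 0) (ha₃ : a₃ ≤ 0)
    (hA₁ : A₁ ≤ κ) (hA₂ : A₂ ≤ κ) (hA₃ : 0 ≤ A₃) (ho₁ : 0 ≤ o₁) (ho₂ : 0 ≤ o₂)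
    (hl₃ : 0 ≤ l₃) (ho : o₃ ≤ κ + o₁ ∨ o₃ ≤ κ + o₂) (hK : (α - 1) / 2 * a₃ ≤ K₁₂) :
    logMult α ω ρ ε a₁ a₂ a₃ A₁ A₂ A₃ o₁ o₂ o₃ l₁ l₂ l₃ ≤
      9 * κ + K₁₂ - (1 + 2 * ε) * (l₁ + l₂) := by
  rw [logMult_eq h]
  have hω := h.omega_pos
  have hω' := h.omega_lt
  have hα := h.one_lt
  have hα' := h.lt_two
  have e1 : ω * a₁ ≤ 0 := mul_nonpos_of_nonneg_of_nonpos hω.le ha₁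
  have e2 : ω * a₂ ≤ 0 := mul_nonpos_of_nonneg_of_nonpos hω.le ha₂
  have e3 : (2 - 2 * ω - (α - 1) / 2) * a₃ ≤ 0 :=
    mul_nonpos_of_nonneg_of_nonpos (by linarith) ha₃
  have e4 : (2 * ρ + 2 - α) * A₁ ≤ (2 * ρ + 2 - α) * κ :=
    mul_le_mul_of_nonneg_left hA₁ (by linarith [h.rho_pos])
  have e5 : (2 * ρ + 2 - α) * A₂ ≤ (2 * ρ + 2 - α) * κ :=
    mul_le_mul_of_nonneg_left hA₂ (by linarith [h.rho_pos])
  have e6 : 0 ≤ (2 * ρ + 2 - α) * A₃ := mul_nonneg (by linarith [h.rho_pos]) hA₃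
  have e7 : (2 * ρ + 2 - α) * κ ≤ 4 * κ := mul_le_mul_of_nonneg_right
    (by linarith [h.rho_lt]) hκ
  have e8 : (4 * ε - 1) * l₃ ≤ 0 := mul_nonpos_of_nonpos_of_nonneg (by linarith [h.eps_le]) hl₃
  have e9 : ω * o₃ ≤ κ / 2 + ω * o₁ + ω * o₂ := by
    have : ω * κ ≤ κ / 2 := by linarith [mul_le_mul_of_nonneg_right hω'.le hκ]
    rcases ho with ho | ho
    · linarith [mul_le_mul_of_nonneg_left ho hω.le, mul_nonneg hω.le ho₂]
    · linarith [mul_le_mul_of_nonneg_left ho hω.le, mul_nonneg hω.le ho₁]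
  linarith

-- Case of three frequencies of size N = e^ν. After use of the largest modulation, at least N^(1+α),
-- the multiplier has size N to the power 2ρ + 1 - α + 4ε(1+α), to be compared with the power
-- (α-1)/2 of the kernel. The comparison is exactly `rho_le`: this configuration is one of the two
-- that fix the threshold.
set_option maxHeartbeats 2000000 in
lemma logMult_le_of_comparable (h : Admissible α ω ρ ε) (hκ : 0 ≤ κ) (hν : 0 ≤ ν)
    (ha₁ : a₁ ≤ ν) (ha₂ : a₂ ≤ ν) (ha₃ : |a₃ - ν| ≤ κ)
    (hA₁ : A₁ ≤ ν + κ) (hA₂ : A₂ ≤ ν + κ) (hA₃ : ν - κ ≤ A₃)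
    (ho₁ : (1 + α) * ν - κ ≤ o₁) (ho₂ : (1 + α) * ν - κ ≤ o₂)
    (ho : o₃ ≤ κ + o₁ ∨ o₃ ≤ κ + o₂)
    (hl : (l₁ ≤ l₃ ∧ l₂ ≤ l₃ ∧ (1 + α) * ν - κ ≤ l₃) ∨ (l₃ ≤ l₁ ∧ l₂ ≤ l₁ ∧ (1 + α) * ν - κ ≤ l₁)
      ∨ (l₃ ≤ l₂ ∧ l₁ ≤ l₂ ∧ (1 + α) * ν - κ ≤ l₂))
    (h₁₂ : (α - 1) / 2 * ν - κ ≤ K₁₂) (h₁₃ : (α - 1) / 2 * ν - κ ≤ K₁₃)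
    (h₂₃ : (α - 1) / 2 * ν - κ ≤ K₂₃) :
    logMult α ω ρ ε a₁ a₂ a₃ A₁ A₂ A₃ o₁ o₂ o₃ l₁ l₂ l₃ ≤
        50 * κ + K₁₂ - (1 + 2 * ε) * (l₁ + l₂) ∨
    logMult α ω ρ ε a₁ a₂ a₃ A₁ A₂ A₃ o₁ o₂ o₃ l₁ l₂ l₃ ≤
        50 * κ + K₁₃ - (1 + 2 * ε) * (l₁ + l₃) ∨
    logMult α ω ρ ε a₁ a₂ a₃ A₁ A₂ A₃ o₁ o₂ o₃ l₁ l₂ l₃ ≤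
        50 * κ + K₂₃ - (1 + 2 * ε) * (l₂ + l₃) := by
  simp_rw [logMult_eq h]
  have hω := h.omega_pos
  have hω' := h.omega_lt
  have hα := h.one_lt
  have hα' := h.lt_two
  have hρ := h.rho_pos
  have hε := h.eps_pos
  obtain ⟨ha3, ha3'⟩ := abs_le.1 ha₃
  have e1 : ω * a₁ ≤ ω * ν := mul_le_mul_of_nonneg_left ha₁ hω.le
  have e2 : ω * a₂ ≤ ω * ν := mul_le_mul_of_nonneg_left ha₂ hω.le
  have e3 : (2 - 2 * ω) * a₃ ≤ (2 - 2 * ω) * (ν + κ) :=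
    mul_le_mul_of_nonneg_left (by linarith) (by linarith)
  have hc : 0 ≤ 2 * ρ + 2 - α := by linarith
  have e4 := mul_le_mul_of_nonneg_left hA₁ hc
  have e5 := mul_le_mul_of_nonneg_left hA₂ hc
  have e6 := mul_le_mul_of_nonneg_left hA₃ hc
  have e7 : (2 * ρ + 2 - α) * κ ≤ 4 * κ := mul_le_mul_of_nonneg_right
    (by linarith [h.rho_lt]) hκ
  have f1 : 0 ≤ ω * κ := by positivity
  have f2 : ω * κ ≤ κ / 2 := by linarith [mul_le_mul_of_nonneg_right hω'.le hκ]
  have f3 : α * κ ≤ 2 * κ := mul_le_mul_of_nonneg_right hα'.le hκ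
  have f4 : (α * ω) * ν = (1 - α / 2) * ν := by rw [h.mul_eq]
  have e9 : ω * o₃ - ω * o₁ - ω * o₂ ≤ κ - ω * ((1 + α) * ν) := by
    rcases ho with ho | ho
    · linarith [mul_le_mul_of_nonneg_left ho hω.le, mul_le_mul_of_nonneg_left ho₂ hω.le]
    · linarith [mul_le_mul_of_nonneg_left ho hω.le, mul_le_mul_of_nonneg_left ho₁ hω.le]
  have g : (4 * ρ + 8 * ε * (1 + α)) * ν ≤ 3 * (α - 1) * ν :=
    mul_le_mul_of_nonneg_right h.rho_le hν
  have gε : 0 < 1 - 4 * ε := by linarith [h.eps_le]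
  have gεκ : ε * κ ≤ κ := mul_le_of_le_one_left hκ (by linarith)
  have gεκ0 : 0 ≤ ε * κ := by positivity
  have gεν : 0 ≤ ε * ν := by positivity
  have gεαν : 0 ≤ ε * α * ν := by positivity
  -- The largest modulation is the one left out of the right-hand side. If it belongs to an input,
  -- the output exponent -1 + 4ε misses -1 - 2ε by 6ε, and this is borrowed from the largest
  -- modulation, which keeps the exponent -(1 - 4ε).
  rcases hl with ⟨q1, q2, q3⟩ | ⟨q1, q2, q3⟩ | ⟨q1, q2, q3⟩
  · left
    have r1 := mul_le_mul_of_nonneg_left q3 gε.le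
    linarith
  · right; right
    have r1 := mul_le_mul_of_nonneg_left q3 gε.le
    have r2 := mul_le_mul_of_nonneg_left q1 hε.le
    linarith
  · right; left
    have r1 := mul_le_mul_of_nonneg_left q3 gε.le
    have r2 := mul_le_mul_of_nonneg_left q1 hε.le
    linarith

-- Case of a high frequency against a low one; here ω gets its value. If |ξ₂| ≤ 1 and the output's
-- elliptic weight is bounded by that of the high input, the multiplier exceeds the kernel N^α by
-- (2-α)ν + 2ωa₂ in the logarithm, and 2 - α = 2αω turns this into 2ω(αν + a₂), which is 2ω times
-- the lower bound for the largest modulation. That modulation pays, as 2ω ≤ 1 - 4ε; if it is the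
-- one of the low input, the elliptic weight o₂ pays instead.
set_option maxHeartbeats 2000000 in
lemma logMult_le_of_high_low (h : Admissible α ω ρ ε) (hκ : 0 ≤ κ) (hν : 0 ≤ ν)
    (ha₁ : a₁ ≤ ν) (haν : a₂ ≤ ν) (ha₃ : |a₃ - ν| ≤ κ)
    (hA₁ : A₁ ≤ ν + κ) (hA₃ : ν - κ ≤ A₃)
    (hA₂ : (a₂ ≤ 0 ∧ A₂ ≤ κ) ∨ (0 ≤ a₂ ∧ A₂ ≤ a₂ + κ))
    (ho₁ : (1 + α) * ν - κ ≤ o₁) (ho₂ : (1 + α) * a₂ - κ ≤ o₂) (hol : l₂ - κ ≤ o₂)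
    (ho : o₃ ≤ κ + o₁ ∨ o₃ ≤ κ + o₂)
    (hl₁ : 0 ≤ l₁) (hl₂ : 0 ≤ l₂) (hl₃ : 0 ≤ l₃)
    (hl : (l₁ ≤ l₃ ∧ l₂ ≤ l₃ ∧ a₂ + α * ν - κ ≤ l₃) ∨ (l₃ ≤ l₁ ∧ l₂ ≤ l₁ ∧ a₂ + α * ν - κ ≤ l₁)
      ∨ (l₃ ≤ l₂ ∧ l₁ ≤ l₂ ∧ a₂ + α * ν - κ ≤ l₂))
    (h₁₂ : α * ν - κ ≤ K₁₂) (h₁₃ : a₂ + (α - 1) * ν - κ ≤ K₁₃)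
    (h₂₃ : α * ν - κ ≤ K₂₃) :
    logMult α ω ρ ε a₁ a₂ a₃ A₁ A₂ A₃ o₁ o₂ o₃ l₁ l₂ l₃ ≤
        50 * κ + K₁₂ - (1 + 2 * ε) * (l₁ + l₂) ∨
    logMult α ω ρ ε a₁ a₂ a₃ A₁ A₂ A₃ o₁ o₂ o₃ l₁ l₂ l₃ ≤
        50 * κ + K₁₃ - (1 + 2 * ε) * (l₁ + l₃) ∨
    logMult α ω ρ ε a₁ a₂ a₃ A₁ A₂ A₃ o₁ o₂ o₃ l₁ l₂ l₃ ≤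
        50 * κ + K₂₃ - (1 + 2 * ε) * (l₂ + l₃) := by
  simp_rw [logMult_eq h]
  have hω := h.omega_pos
  have hω' := h.omega_lt
  have hα := h.one_lt
  have hα' := h.lt_two
  have hρ := h.rho_pos
  have hε := h.eps_pos
  obtain ⟨ha3, ha3'⟩ := abs_le.1 ha₃
  have e1 : ω * a₁ ≤ ω * ν := mul_le_mul_of_nonneg_left ha₁ hω.le
  have e3 : (2 - 2 * ω) * a₃ ≤ (2 - 2 * ω) * (ν + κ) :=
    mul_le_mul_of_nonneg_left (by linarith) (by linarith)
  have hc : 0 ≤ 2 * ρ + 2 - α := by linarith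
  have e4 := mul_le_mul_of_nonneg_left hA₁ hc
  have e6 := mul_le_mul_of_nonneg_left hA₃ hc
  have e7 : (2 * ρ + 2 - α) * κ ≤ 4 * κ := mul_le_mul_of_nonneg_right
    (by linarith [h.rho_lt]) hκ
  have f1 : 0 ≤ ω * κ := by positivity
  have f2 : ω * κ ≤ κ / 2 := by linarith [mul_le_mul_of_nonneg_right hω'.le hκ]
  have f3 : α * κ ≤ 2 * κ := mul_le_mul_of_nonneg_right hα'.le hκ
  have f4 : (α * ω) * ν = (1 - α / 2) * ν := by rw [h.mul_eq]
  have f5 : (α * ω) * a₂ = (1 - α / 2) * a₂ := by rw [h.mul_eq]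
  have gε : 0 < 1 - 4 * ε := by linarith [h.eps_le]
  have gεκ : ε * κ ≤ κ := mul_le_of_le_one_left hκ (by linarith)
  have gεκ0 : 0 ≤ ε * κ := by positivity
  have gεν : 0 ≤ ε * ν := by positivity
  have gεαν : 0 ≤ ε * α * ν := by positivity
  have i1 := mul_le_mul_of_nonneg_left ho₁ hω.le
  have i2 := mul_le_mul_of_nonneg_left ho₂ hω.le
  have i3 := mul_le_mul_of_nonneg_left hol hω.le
  have hων : 0 ≤ ω * ν := by positivity
  rcases hA₂ with ⟨hn, hA₂⟩ | ⟨hn, hA₂⟩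
  · have e5 := mul_le_mul_of_nonneg_left hA₂ hc
    have j1 : ω * a₂ ≤ 0 := mul_nonpos_of_nonneg_of_nonpos hω.le hn
    have j2 : 0 ≤ (1 - 4 * ε) * l₃ := by positivity
    have j3 : 0 ≤ (1 - 4 * ε) * l₁ := by positivity
    have hs : 0 ≤ 1 - 4 * ε - 2 * ω := by linarith [h.omega_le]
    rcases ho with ho | ho
    · have i4 := mul_le_mul_of_nonneg_left ho hω.le
      rcases hl with ⟨q1, q2, q3⟩ | ⟨q1, q2, q3⟩ | ⟨q1, q2, q3⟩
      · left
        have r1 := mul_le_mul_of_nonneg_left q3 hω.le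
        have r3 := mul_nonneg hs hl₃
        have r4 := mul_nonneg hω.le hl₂
        linarith
      · right; right
        have r1 := mul_le_mul_of_nonneg_left q3 hω.le
        have r2 := mul_le_mul_of_nonneg_left q1 hε.le
        have r3 := mul_nonneg hs hl₁
        have r4 := mul_nonneg hω.le hl₂
        linarith
      · left
        have r1 := mul_le_mul_of_nonneg_left q3 hω.le
        linarith
    · have i4 := mul_le_mul_of_nonneg_left ho hω.le
      left
      linarith
  · have e5 := mul_le_mul_of_nonneg_left hA₂ hc
    have hνn : 0 ≤ ν - a₂ := by linarith
    have k1 := mul_le_mul_of_nonneg_left haν hω.le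
    have k2 : 0 ≤ α * (ν - a₂) := by positivity
    have k4 : ω * a₂ ≤ a₂ := mul_le_of_le_one_left hn (by linarith)
    have k6 : 0 ≤ ω * (α * (ν - a₂)) := by positivity
    have e9 : ω * o₃ - ω * o₁ - ω * o₂ ≤ κ - ω * ((1 + α) * a₂) := by
      rcases ho with ho | ho
      · linarith [mul_le_mul_of_nonneg_left ho hω.le]
      · linarith [mul_le_mul_of_nonneg_left ho hω.le]
    have s1 : 16 * ε * ν ≤ (α - 1) * ν := mul_le_mul_of_nonneg_right h.eps_le hν
    have s2 : 16 * ε * a₂ ≤ (α - 1) * a₂ := mul_le_mul_of_nonneg_right h.eps_le hn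
    have s4 : 0 ≤ ε * a₂ := by positivity
    have s5 : α * (ε * ν) ≤ 2 * (ε * ν) := mul_le_mul_of_nonneg_right hα'.le gεν
    have g : (4 * ρ + 8 * ε * (1 + α)) * a₂ ≤ 3 * (α - 1) * a₂ :=
      mul_le_mul_of_nonneg_right h.rho_le hn
    have s6 : 0 ≤ ε * α * a₂ := by positivity
    have s7 : α * a₂ ≤ 2 * a₂ := mul_le_mul_of_nonneg_right hα'.le hn
    have s8 : 0 ≤ (α - 1) * (ν - a₂) := mul_nonneg (by linarith) hνn
    rcases hl with ⟨q1, q2, q3⟩ | ⟨q1, q2, q3⟩ | ⟨q1, q2, q3⟩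
    · left
      have r1 := mul_le_mul_of_nonneg_left q3 gε.le
      linarith
    · right; right
      have r1 := mul_le_mul_of_nonneg_left q3 gε.le
      have r2 := mul_le_mul_of_nonneg_left q1 hε.le
      linarith
    · right; left
      have r1 := mul_le_mul_of_nonneg_left q3 gε.le
      have r2 := mul_le_mul_of_nonneg_left q1 hε.le
      have r3 := mul_le_mul_of_nonneg_left q3 hω.le
      -- If the low input has the largest modulation, only the weakest kernel N^(α-1)|ξ₂| is
      -- available. Compensation comes from the elliptic weights: l₂ ≤ o₂ + κ, and (1+α)ν ≥ a₂ + αν,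
      -- so whichever of o₁, o₂ survives contains the whole resonance.
      have e9' : ω * o₃ - ω * o₁ - ω * o₂ ≤ 2 * κ - ω * (a₂ + α * ν) := by
        rcases ho with ho | ho
        · linarith [mul_le_mul_of_nonneg_left ho hω.le]
        · linarith [mul_le_mul_of_nonneg_left ho hω.le]
      linarith

-- Case of two high frequencies producing a low one. The input weights leave N^(4ρ). If |ξ₃| ≤ 1 and
-- the output's elliptic weight is as large as its modulation, the balance reads 4ρ + 4εα ≤ 3(α-1):
-- the second configuration that fixes the threshold.
set_option maxHeartbeats 2000000 in
lemma logMult_le_of_high_high (h : Admissible α ω ρ ε) (hκ : 0 ≤ κ) (hν : 0 ≤ ν)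
    (ha₁ : a₁ ≤ ν) (ha₂ : a₂ ≤ ν) (haν : a₃ ≤ ν)
    (hA₁ : A₁ ≤ ν + κ) (hA₂ : A₂ ≤ ν + κ)
    (hA₃ : (a₃ ≤ 0 ∧ 0 ≤ A₃ ∧ A₃ ≤ κ) ∨ (0 ≤ a₃ ∧ |A₃ - a₃| ≤ κ))
    (ho₁ : (1 + α) * ν - κ ≤ o₁) (ho₂ : (1 + α) * ν - κ ≤ o₂)
    (ho : o₃ ≤ κ + l₃ ∨ o₃ ≤ κ + (1 + α) * A₃)
    (hl₁ : 0 ≤ l₁) (hl₂ : 0 ≤ l₂) (hl₃ : 0 ≤ l₃)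
    (hl : (l₁ ≤ l₃ ∧ l₂ ≤ l₃ ∧ a₃ + α * ν - κ ≤ l₃) ∨ (l₃ ≤ l₁ ∧ l₂ ≤ l₁ ∧ a₃ + α * ν - κ ≤ l₁)
      ∨ (l₃ ≤ l₂ ∧ l₁ ≤ l₂ ∧ a₃ + α * ν - κ ≤ l₂))
    (h₁₂ : a₃ + (α - 1) * ν - κ ≤ K₁₂) (h₁₃ : α * ν - κ ≤ K₁₃)
    (h₂₃ : α * ν - κ ≤ K₂₃) :
    logMult α ω ρ ε a₁ a₂ a₃ A₁ A₂ A₃ o₁ o₂ o₃ l₁ l₂ l₃ ≤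
        50 * κ + K₁₂ - (1 + 2 * ε) * (l₁ + l₂) ∨
    logMult α ω ρ ε a₁ a₂ a₃ A₁ A₂ A₃ o₁ o₂ o₃ l₁ l₂ l₃ ≤
        50 * κ + K₁₃ - (1 + 2 * ε) * (l₁ + l₃) ∨
    logMult α ω ρ ε a₁ a₂ a₃ A₁ A₂ A₃ o₁ o₂ o₃ l₁ l₂ l₃ ≤
        50 * κ + K₂₃ - (1 + 2 * ε) * (l₂ + l₃) := by
  simp_rw [logMult_eq h]
  have hω := h.omega_pos
  have hω' := h.omega_lt
  have hα := h.one_lt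
  have hα' := h.lt_two
  have hρ := h.rho_pos
  have hε := h.eps_pos
  have e1 : ω * a₁ ≤ ω * ν := mul_le_mul_of_nonneg_left ha₁ hω.le
  have e2 : ω * a₂ ≤ ω * ν := mul_le_mul_of_nonneg_left ha₂ hω.le
  have hc : 0 ≤ 2 * ρ + 2 - α := by linarith
  have e4 := mul_le_mul_of_nonneg_left hA₁ hc
  have e5 := mul_le_mul_of_nonneg_left hA₂ hc
  have e7 : (2 * ρ + 2 - α) * κ ≤ 4 * κ := mul_le_mul_of_nonneg_right
    (by linarith [h.rho_lt]) hκ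
  have f1 : 0 ≤ ω * κ := by positivity
  have f2 : ω * κ ≤ κ / 2 := by linarith [mul_le_mul_of_nonneg_right hω'.le hκ]
  have f3 : α * κ ≤ 2 * κ := mul_le_mul_of_nonneg_right hα'.le hκ
  have f4 : (α * ω) * ν = (1 - α / 2) * ν := by rw [h.mul_eq]
  have f5 : (α * ω) * a₃ = (1 - α / 2) * a₃ := by rw [h.mul_eq]
  have f6 : (α * ω) * A₃ = (1 - α / 2) * A₃ := by rw [h.mul_eq]
  have f7 : (α * ω) * κ = (1 - α / 2) * κ := by rw [h.mul_eq]
  have gε : 0 < 1 - 4 * ε := by linarith [h.eps_le]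
  have gεκ : ε * κ ≤ κ := mul_le_of_le_one_left hκ (by linarith)
  have gεκ0 : 0 ≤ ε * κ := by positivity
  have gεν : 0 ≤ ε * ν := by positivity
  have gεαν : 0 ≤ ε * α * ν := by positivity
  have i1 := mul_le_mul_of_nonneg_left ho₁ hω.le
  have i2 := mul_le_mul_of_nonneg_left ho₂ hω.le
  have hων : 0 ≤ ω * ν := by positivity
  have g : (4 * ρ + 8 * ε * (1 + α)) * ν ≤ 3 * (α - 1) * ν :=
    mul_le_mul_of_nonneg_right h.rho_le hν
  have hs : 0 ≤ 1 - 4 * ε - 2 * ω := by linarith [h.omega_le]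
  have s1 : 16 * ε * ν ≤ (α - 1) * ν := mul_le_mul_of_nonneg_right h.eps_le hν
  have s5 : α * (ε * ν) ≤ 2 * (ε * ν) := mul_le_mul_of_nonneg_right hα'.le gεν
  have hνn : 0 ≤ ν - a₃ := by linarith
  have k2 : 0 ≤ α * (ν - a₃) := by positivity
  have t1 : 0 ≤ ε * (ν - a₃) := by positivity
  -- the gain from the dominant modulation, in either of the two regimes of the elliptic weight
  have key : ∀ L, 0 ≤ L → a₃ + α * ν - κ ≤ L →
      2 * a₃ - 2 * (ω * a₃) - (2 * (ρ * A₃) + 2 * A₃ - α * A₃) - (1 - 4 * ε) * L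
        + 4 * (ρ * ν) + (4 - 2 * α) * ν - 4 * (ω * (α * ν)) + 2 * (ω * L) ≤
        15 * κ + a₃ + (α - 1) * ν ∧
      2 * a₃ - 2 * (ω * a₃) - (2 * (ρ * A₃) + 2 * A₃ - α * A₃) - (1 - 4 * ε) * L
        + 4 * (ρ * ν) + (4 - 2 * α) * ν - 4 * (ω * (α * ν)) + 2 * (ω * ((1 + α) * A₃)) ≤
        15 * κ + a₃ + (α - 1) * ν := by
    intro L hL0 hL
    have r1 := mul_le_mul_of_nonneg_left hL hs
    have r2 := mul_le_mul_of_nonneg_left hL gε.le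
    have r3 := mul_nonneg hω.le hL0
    rcases hA₃ with ⟨hn, hA, hA'⟩ | ⟨hn, hA⟩
    · have e6 := mul_nonneg hc hA
      have u1 : ε * a₃ ≤ 0 := mul_nonpos_of_nonneg_of_nonpos hε.le hn
      have u2 := mul_le_mul_of_nonneg_left hA' hω.le
      have fst : 2 * a₃ - 2 * (ω * a₃) - (2 * (ρ * A₃) + 2 * A₃ - α * A₃) - (1 - 4 * ε) * L
        + 4 * (ρ * ν) + (4 - 2 * α) * ν - 4 * (ω * (α * ν)) + 2 * (ω * L) ≤
        5 * κ + a₃ + (α - 1) * ν := by linarith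
      refine ⟨by linarith, ?_⟩
      have u3 : α * A₃ ≤ 2 * A₃ := mul_le_mul_of_nonneg_right hα'.le hA
      have u4 : 0 ≤ (α - 1) * A₃ := mul_nonneg (by linarith) hA
      linarith
    · obtain ⟨hA, hA'⟩ := abs_le.1 hA
      have e6 := mul_le_mul_of_nonneg_left hA hc
      have u2 := mul_le_mul_of_nonneg_left hA' hω.le
      have u5 := mul_le_mul_of_nonneg_left hA hρ.le
      have u6 : ρ * κ ≤ κ := mul_le_of_le_one_left hκ (by linarith [h.rho_lt])
      have u7 : 0 ≤ ρ * κ := by positivity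
      have u8 : 0 ≤ ρ * a₃ := by positivity
      have u3 : α * a₃ ≤ 2 * a₃ := mul_le_mul_of_nonneg_right hα'.le hn
      have u9 : 0 ≤ ε * a₃ := by positivity
      have u10 : 0 ≤ α * κ := by positivity
      have u13 : 0 ≤ (2 - α) * ν := mul_nonneg (by linarith) hν
      have u11 : 0 ≤ (2 - α) * (κ + a₃ - A₃) := mul_nonneg (by linarith) (by linarith)
      have u12 : 0 ≤ (2 - α) * (κ - a₃ + A₃) := mul_nonneg (by linarith) (by linarith)
      constructor
      · linarith
      · linarith
  have ho' : ω * o₃ ≤ ω * κ + ω * l₃ ∨ ω * o₃ ≤ ω * κ + ω * ((1 + α) * A₃) := by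
    rcases ho with ho | ho
    · left; linarith [mul_le_mul_of_nonneg_left ho hω.le]
    · right; linarith [mul_le_mul_of_nonneg_left ho hω.le]
  have v1 : (α * ω) * κ = (1 - α / 2) * κ := f7
  rcases hl with ⟨q1, q2, q3⟩ | ⟨q1, q2, q3⟩ | ⟨q1, q2, q3⟩
  · left
    obtain ⟨k1, k2⟩ := key l₃ hl₃ q3
    rcases ho' with ho' | ho' <;> linarith
  · right; right
    have hs' : 0 ≤ 2 + 2 * ε - 2 * ω := by linarith
    have r2 := mul_le_mul_of_nonneg_left q1 hε.le
    have r3 := mul_le_mul_of_nonneg_left q1 hω.le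
    obtain ⟨k1, k2⟩ := key l₁ hl₁ q3
    rcases ho' with ho' | ho' <;> linarith
  · right; left
    have r2 := mul_le_mul_of_nonneg_left q1 hε.le
    have r3 := mul_le_mul_of_nonneg_left q1 hω.le
    obtain ⟨k1, k2⟩ := key l₂ hl₂ q3
    rcases ho' with ho' | ho' <;> linarith

end LogEstimates


/-! ### Elementary properties of the bracket and of the phase -/

lemma bracket_neg (x : ℝ) : bracket (-x) = bracket x := by simp [bracket]

lemma bracket_abs (x : ℝ) : bracket |x| = bracket x := by simp [bracket]

lemma bracket_sq (x : ℝ) : bracket x ^ 2 = 1 + x ^ 2 := Real.sq_sqrt (by positivity)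

lemma abs_le_bracket (x : ℝ) : |x| ≤ bracket x := by
  refine Real.le_sqrt_of_sq_le ?_
  rw [sq_abs]; linarith

lemma bracket_le_bracket {x y : ℝ} (h : |x| ≤ |y|) : bracket x ≤ bracket y :=
  Real.sqrt_le_sqrt (by linarith [sq_le_sq.2 h])

lemma bracket_le_one_add (x : ℝ) : bracket x ≤ 1 + |x| := by
  refine Real.sqrt_le_iff.2 ⟨by positivity, ?_⟩
  nlinarith [abs_nonneg x, sq_abs x]

lemma bracket_add_le (x y : ℝ) : bracket (x + y) ≤ bracket x + |y| := by
  have h0 := bracket_pos x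
  refine Real.sqrt_le_iff.2 ⟨by positivity, ?_⟩
  have h1 : x * y ≤ bracket x * |y| := (le_abs_self _).trans (by
    rw [abs_mul]; exact mul_le_mul_of_nonneg_right (abs_le_bracket x) (abs_nonneg y))
  nlinarith [bracket_sq x, sq_abs y]

lemma bracket_add_le_mul (x y : ℝ) : bracket (x + y) ≤ 2 * bracket x * bracket y := by
  have h1 := one_le_bracket x
  have h2 := one_le_bracket y
  nlinarith [bracket_add_le x y, abs_le_bracket y]

lemma phase_neg (α x : ℝ) : phase α (-x) = -phase α x := by simp [phase]

lemma phase_of_nonneg {α x : ℝ} (hα : 0 < α) (hx : 0 ≤ x) : phase α x = x ^ (1 + α) := by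
  rw [phase, abs_of_nonneg hx, Real.rpow_one_add' hx (by linarith)]

lemma abs_phase {α : ℝ} (hα : 0 < α) (x : ℝ) : |phase α x| = |x| ^ (1 + α) := by
  rw [phase, abs_mul, Real.rpow_one_add' (abs_nonneg x) (by linarith),
    abs_of_nonneg (Real.rpow_nonneg (abs_nonneg x) α)]

lemma hasDerivAt_phase {α : ℝ} (hα : 1 < α) (x : ℝ) :
    HasDerivAt (phase α) ((1 + α) * |x| ^ α) x := by
  have h := (hasDerivAt_id x).mul (hasDerivAt_abs_rpow x hα)
  refine h.congr_deriv ?_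
  rcases eq_or_ne x 0 with rfl | hx
  · have : (0 : ℝ) ^ α = 0 := Real.zero_rpow (by linarith)
    simp [this]
  · have h1 : |x| ^ α = |x| ^ (α - 2) * (x * x) := by
      rw [← abs_mul_abs_self x, ← pow_two, ← Real.rpow_natCast, ← Real.rpow_add (abs_pos.2 hx)]
      congr 1; norm_num
    simp only [id, h1]
    ring

lemma measurable_phase (α : ℝ) : Measurable (phase α) := by
  unfold phase; fun_prop

/-- Bernoulli's inequality for (1 + b/a)^(1+α) gives (a+b)^(1+α) ≥ a^(1+α) + (1+α) b a^α.
Subtracting b^(1+α) ≤ b a^α leaves α b a^α, and (a+b)^α ≤ 4a^α. -/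
lemma rpow_add_sub_ge {α a b : ℝ} (hα : 1 < α) (hα' : α < 2) (hb : 0 ≤ b) (hab : b ≤ a) :
    b * (a + b) ^ α ≤ 4 * ((a + b) ^ (1 + α) - a ^ (1 + α) - b ^ (1 + α)) := by
  rcases hb.eq_or_lt with rfl | hb'
  · simp [Real.zero_rpow (by linarith : (1 + α) ≠ 0)]
  have ha : 0 < a := hb'.trans_le hab
  have h1 : (1 + α) * (b / a) + 1 ≤ (1 + b / a) ^ (1 + α) := by
    have := one_add_mul_self_le_rpow_one_add (s := b / a) (by
      have : 0 ≤ b / a := by positivity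
      linarith) (p := 1 + α) (by linarith)
    linarith
  have h2 : (a + b) ^ (1 + α) = a ^ (1 + α) * (1 + b / a) ^ (1 + α) := by
    rw [← Real.mul_rpow ha.le (by positivity)]
    congr 1; field_simp
  have h3 : a ^ (1 + α) = a * a ^ α := Real.rpow_one_add' ha.le (by linarith)
  have h4 : b ^ (1 + α) ≤ b * a ^ α := by
    rw [Real.rpow_one_add' hb (by linarith)]
    exact mul_le_mul_of_nonneg_left (Real.rpow_le_rpow hb hab (by linarith)) hb
  have h5 : (a + b) ^ α ≤ 4 * a ^ α := by
    calc (a + b) ^ α ≤ (2 * a) ^ α := Real.rpow_le_rpow (by positivity) (by linarith) (by linarith)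
      _ = 2 ^ α * a ^ α := Real.mul_rpow (by norm_num) ha.le
      _ ≤ 2 ^ (2 : ℝ) * a ^ α := by
          gcongr
          norm_num
      _ = 4 * a ^ α := by norm_num
  have h6 : (1 + α) * b * a ^ α + a ^ (1 + α) ≤ (a + b) ^ (1 + α) := by
    rw [h2]
    calc _ = a ^ (1 + α) * ((1 + α) * (b / a) + 1) := by rw [h3]; field_simp
      _ ≤ _ := mul_le_mul_of_nonneg_left h1 (by positivity)
  have h7 : 0 < a ^ α := by positivity
  have h8 : b * (a + b) ^ α ≤ b * (4 * a ^ α) := mul_le_mul_of_nonneg_left h5 hb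
  have h9 : b * a ^ α ≤ α * (b * a ^ α) := le_mul_of_one_le_left (by positivity) hα.le
  linarith

lemma resonance_of_nonneg {α x y m N : ℝ} (hα : 1 < α) (hα' : α < 2) (hx : 0 ≤ x) (hy : 0 ≤ y)
    (hmx : m ≤ x) (hmy : m ≤ y) (hN : 0 ≤ N) (hNx : N ≤ x + y) :
    m * N ^ α ≤ 4 * |phase α (x + y) - phase α x - phase α y| := by
  have hα0 : 0 < α := by linarith
  rw [phase_of_nonneg hα0 hx, phase_of_nonneg hα0 hy, phase_of_nonneg hα0 (by linarith)]
  have h1 : N ^ α ≤ (x + y) ^ α := Real.rpow_le_rpow hN hNx hα0.le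
  have h2 : 0 ≤ N ^ α := by positivity
  rcases le_total y x with h | h
  · have := rpow_add_sub_ge hα hα' hy h
    calc m * N ^ α ≤ y * (x + y) ^ α := mul_le_mul hmy h1 h2 hy
      _ ≤ _ := this
      _ ≤ _ := by gcongr; exact le_abs_self _
  · have := rpow_add_sub_ge hα hα' hx h
    calc m * N ^ α ≤ x * (x + y) ^ α := mul_le_mul hmx h1 h2 hx
      _ = x * (y + x) ^ α := by rw [add_comm x y]
      _ ≤ _ := this
      _ ≤ 4 * ((x + y) ^ (1 + α) - x ^ (1 + α) - y ^ (1 + α)) := by rw [add_comm x y]; linarith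
      _ ≤ _ := by gcongr; exact le_abs_self _

/-- The resonance function is bounded below by the smallest frequency times the `α`-th power of
the largest. -/
lemma resonance {α x y m N : ℝ} (hα : 1 < α) (hα' : α < 2) (hm : 0 ≤ m) (hmx : m ≤ |x|)
    (hmy : m ≤ |y|) (hmz : m ≤ |x + y|) (hN : 0 ≤ N) (h : N ≤ |x| ∨ N ≤ |y| ∨ N ≤ |x + y|) :
    m * N ^ α ≤ 4 * |phase α (x + y) - phase α x - phase α y| := by
  wlog hx : 0 ≤ x generalizing x y
  · have := this (x := -x) (y := -y) (by simpa) (by simpa)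
      (by rwa [← neg_add, abs_neg]) (by rwa [← neg_add, abs_neg, abs_neg, abs_neg])
      (by linarith)
    rw [← neg_add, phase_neg, phase_neg, phase_neg] at this
    rw [← abs_neg]
    convert this using 3; ring
  rw [abs_of_nonneg hx] at *
  -- Two of x, y, -(x+y) have the same sign and their moduli add up to that of the third; since the
  -- phase is odd, the statement for nonnegative numbers applies to that pair.
  rcases le_total 0 y with hy | hy
  · rw [abs_of_nonneg hy, abs_of_nonneg (add_nonneg hx hy)] at *
    refine resonance_of_nonneg hα hα' hx hy hmx hmy hN ?_
    rcases h with h | h | h <;> linarith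
  · rw [abs_of_nonpos hy] at *
    rcases le_total 0 (x + y) with hz | hz
    · rw [abs_of_nonneg hz] at *
      have := resonance_of_nonneg hα hα' hz (neg_nonneg.2 hy) hmz hmy hN
        (by rcases h with h | h | h <;> linarith)
      rw [phase_neg, add_neg_cancel_right] at this
      rw [← abs_neg]
      convert this using 3; ring
    · rw [abs_of_nonpos hz] at *
      have := resonance_of_nonneg hα hα' hx (neg_nonneg.2 hz) hmx hmz hN
        (by rcases h with h | h | h <;> linarith)
      rw [show x + -(x + y) = -y by ring, phase_neg, phase_neg] at this
      convert this using 3; ring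

/-! ### The kernels attached to pairs of frequencies -/

/-- The derivative of `x ↦ φ(x) + φ(c - x)`, up to a factor, corrected near its zero: this is the
largest density for which the integrals of `⟨a - φ(x) - φ(c - x)⟩^(-2b)` remain bounded. -/
noncomputable def pairKernel (α x y : ℝ) : ℝ :=
  |(|x| ^ α - |y| ^ α)| + if |x - y| ≤ 8 * |x + y| ^ (-((α - 1) / 2)) then |x + y| ^ ((α - 1) / 2)
    else 0

lemma pairKernel_comm (α x y : ℝ) : pairKernel α x y = pairKernel α y x := by
  unfold pairKernel
  rw [abs_sub_comm, abs_sub_comm x y, add_comm x y]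

lemma pairKernel_nonneg (α x y : ℝ) : 0 ≤ pairKernel α x y := by
  unfold pairKernel
  split_ifs <;> positivity

lemma measurable_pairKernel (α : ℝ) : Measurable fun p : ℝ × ℝ => pairKernel α p.1 p.2 := by
  unfold pairKernel
  refine Measurable.add (by fun_prop) (Measurable.ite ?_ (by fun_prop) measurable_const)
  exact measurableSet_le (by fun_prop) (by fun_prop)

lemma rpow_sub_rpow_ge {α a b : ℝ} (hα : 1 < α) (hb : 0 ≤ b) (hab : b ≤ a) :
    a ^ (α - 1) * (a - b) ≤ a ^ α - b ^ α := by
  have ha := hb.trans hab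
  have h1 : ∀ c : ℝ, 0 ≤ c → c ^ α = c ^ (α - 1) * c := fun c hc => by
    rw [← Real.rpow_add_one' hc (by linarith), sub_add_cancel]
  rw [h1 a ha, h1 b hb]
  have := mul_le_mul_of_nonneg_right (Real.rpow_le_rpow hb hab (by linarith : 0 ≤ α - 1)) hb
  linarith

/-- The derivative term alone, through a^α - b^α ≥ a^(α-1)(a - b) at the larger modulus. -/
lemma le_pairKernel {α x y N d : ℝ} (hα : 1 < α) (hN0 : 0 ≤ N) (hN : N ≤ |x| ∨ N ≤ |y|)
    (hd0 : 0 ≤ d) (hd : d ≤ |(|x| - |y|)|) : N ^ (α - 1) * d ≤ pairKernel α x y := by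
  wlog h : |y| ≤ |x| generalizing x y
  · rw [pairKernel_comm]
    exact this hN.symm (by rwa [abs_sub_comm]) (by linarith)
  have h0 : |(|x| ^ α - |y| ^ α)| ≤ pairKernel α x y := by
    unfold pairKernel
    split_ifs
    · have : 0 ≤ |x + y| ^ ((α - 1) / 2) := by positivity
      linarith
    · simp
  refine le_trans ?_ h0
  refine le_trans ?_ (le_abs_self _)
  refine le_trans ?_ (rpow_sub_rpow_ge hα (abs_nonneg y) h)
  rw [abs_of_nonneg (by linarith : 0 ≤ |x| - |y|)] at hd
  have h1 : N ≤ |x| := by rcases hN with h1 | h1 <;> linarith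
  exact mul_le_mul (Real.rpow_le_rpow hN0 h1 (by linarith)) hd hd0 (by positivity)

lemma le_pairKernel_of_near {α x y : ℝ} (h : |x - y| ≤ 8 * |x + y| ^ (-((α - 1) / 2))) :
    |x + y| ^ ((α - 1) / 2) ≤ pairKernel α x y := by
  unfold pairKernel
  rw [if_pos h]
  linarith [abs_nonneg (|x| ^ α - |y| ^ α)]

lemma abs_abs_sub_abs_eq (x y : ℝ) : |(|x| - |y|)| = |x - y| ∨ |(|x| - |y|)| = |x + y| := by
  rcases abs_cases x with ⟨h1, _⟩ | ⟨h1, _⟩ <;> rcases abs_cases y with ⟨h2, _⟩ | ⟨h2, _⟩ <;>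
    rw [h1, h2]
  · left; rfl
  · right; congr 1; ring
  · right; rw [← abs_neg]; congr 1; ring
  · left; rw [← abs_neg]; congr 1; ring

/-- The derivative term degenerates only near x = y. At distance more than 8|x+y|^(-(α-1)/2) from
there it still gives N^(α-1) N^(-(α-1)/2) = N^((α-1)/2); closer, the correction gives the same
power; for opposite signs ||x| - |y|| = |x+y| is of size N. -/
lemma le_pairKernel_of_comparable {α x y N : ℝ} (hα : 1 < α) (hα' : α < 2) (hN : 1 ≤ N)
    (hx : N / 4 ≤ |x|) (hz : N / 4 ≤ |x + y|) (hz' : |x + y| ≤ N) :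
    N ^ ((α - 1) / 2) / 16 ≤ pairKernel α x y := by
  have hN0 : 0 < N := by linarith
  have hq : ∀ c : ℝ, 0 ≤ c → c ≤ 1 → N ^ c / 4 ≤ (N / 4) ^ c := by
    intro c hc hc'
    rw [Real.div_rpow hN0.le (by norm_num)]
    have : (4 : ℝ) ^ c ≤ 4 ^ (1 : ℝ) := Real.rpow_le_rpow_of_exponent_le (by norm_num) hc'
    rw [Real.rpow_one] at this
    gcongr
  have hle : N ^ ((α - 1) / 2) ≤ N ^ (α - 1) :=
    Real.rpow_le_rpow_of_exponent_le hN (by linarith)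
  have hp : 0 < N ^ ((α - 1) / 2) := by positivity
  have hq1 := hq (α - 1) (by linarith) (by linarith)
  rcases abs_abs_sub_abs_eq x y with h | h
  · by_cases hn : |x - y| ≤ 8 * |x + y| ^ (-((α - 1) / 2))
    · refine le_trans ?_ (le_pairKernel_of_near hn)
      have h1 := hq ((α - 1) / 2) (by linarith) (by linarith)
      have h2 : (N / 4) ^ ((α - 1) / 2) ≤ |x + y| ^ ((α - 1) / 2) :=
        Real.rpow_le_rpow (by positivity) hz (by linarith)
      linarith
    · have h1 : N ^ (-((α - 1) / 2)) ≤ |x + y| ^ (-((α - 1) / 2)) :=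
        Real.rpow_le_rpow_of_nonpos (by linarith) hz' (by linarith)
      refine le_trans ?_ (le_pairKernel hα (by positivity) (Or.inl hx)
        (d := 8 * N ^ (-((α - 1) / 2))) (by positivity) (by rw [h]; linarith))
      have h2 : N ^ (α - 1) * N ^ (-((α - 1) / 2)) = N ^ ((α - 1) / 2) := by
        rw [← Real.rpow_add hN0]; congr 1; ring
      have h3 : 0 < N ^ (-((α - 1) / 2)) := by positivity
      have h4 := mul_le_mul_of_nonneg_right hq1 h3.le
      linarith
  · refine le_trans ?_ (le_pairKernel hα (by positivity) (Or.inl hx) (d := N / 4) (by positivity)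
      (by rw [h]; exact hz))
    have h4 := mul_le_mul_of_nonneg_right hq1 (by linarith : 0 ≤ N / 4)
    have h5 : N ^ (α - 1) / 4 ≤ N ^ (α - 1) * N / 4 := by
      have : 0 ≤ N ^ (α - 1) := by positivity
      nlinarith
    nlinarith


/-! ### The pointwise multiplier inequality -/

/-- The modulation `τ - φ(ξ)` of the frequency pair `(τ, ξ)`. -/
noncomputable def modulation (α : ℝ) (p : ℝ × ℝ) : ℝ := p.1 - phase α p.2

/-- The elliptic weight `⟨|τ| + |ξ|^(1+α)⟩`. -/
noncomputable def ellipticWeight (α : ℝ) (p : ℝ × ℝ) : ℝ := bracket (|p.1| + |p.2| ^ (1 + α))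

lemma resWeight_eq (α s ω b : ℝ) (p : ℝ × ℝ) : resWeight α s ω b p =
    |p.2| ^ (-2 * ω) * bracket p.2 ^ (2 * s - 2 * α * ω)
    * ellipticWeight α p ^ (2 * ω) * bracket (modulation α p) ^ (2 * b) := rfl

lemma one_le_ellipticWeight (α : ℝ) (p : ℝ × ℝ) : 1 ≤ ellipticWeight α p := one_le_bracket _

lemma modulation_neg (α : ℝ) (p : ℝ × ℝ) : modulation α (-p) = -modulation α p := by
  simp [modulation, phase_neg]; ring

lemma rpow_le_ellipticWeight (α : ℝ) (p : ℝ × ℝ) : |p.2| ^ (1 + α) ≤ ellipticWeight α p := by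
  refine le_trans ?_ ((le_abs_self _).trans (abs_le_bracket _))
  linarith [abs_nonneg p.1]

lemma bracket_modulation_le_ellipticWeight {α : ℝ} (hα : 0 < α) (p : ℝ × ℝ) :
    bracket (modulation α p) ≤ ellipticWeight α p := by
  refine bracket_le_bracket ?_
  rw [abs_of_nonneg (a := |p.1| + _) (by positivity), ← abs_phase hα]
  exact abs_sub _ _

lemma ellipticWeight_le {α : ℝ} (hα : 0 < α) (p : ℝ × ℝ) :
    ellipticWeight α p ≤ bracket (modulation α p) + 2 * bracket p.2 ^ (1 + α) := by
  have h0 : 0 ≤ |p.2| ^ (1 + α) := by positivity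
  have h1 : |p.1| ≤ |modulation α p| + |p.2| ^ (1 + α) := by
    rw [← abs_phase hα, modulation]
    have := abs_add_le (p.1 - phase α p.2) (phase α p.2)
    simpa using this
  have h2 : ellipticWeight α p ≤ bracket (|modulation α p| + 2 * |p.2| ^ (1 + α)) := by
    refine bracket_le_bracket (abs_le_abs_of_nonneg (by positivity) ?_)
    linarith
  refine h2.trans ((bracket_add_le _ _).trans ?_)
  rw [bracket_abs, abs_of_nonneg (by positivity)]
  have := Real.rpow_le_rpow (abs_nonneg _) (abs_le_bracket p.2) (by linarith : 0 ≤ 1 + α)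
  linarith

lemma ellipticWeight_add_le {α : ℝ} (hα : 1 < α) (hα' : α < 2) (q r : ℝ × ℝ) :
    ellipticWeight α (q + r) ≤ 16 * max (ellipticWeight α q) (ellipticWeight α r) := by
  have h0 : |q.2 + r.2| ^ (1 + α) ≤ 8 * (|q.2| ^ (1 + α) + |r.2| ^ (1 + α)) := by
    have h1 : |q.2 + r.2| ≤ 2 * max |q.2| |r.2| := by
      linarith [abs_add_le q.2 r.2, le_max_left |q.2| |r.2|, le_max_right |q.2| |r.2|]
    have h2 : (0 : ℝ) ≤ max |q.2| |r.2| := le_max_of_le_left (abs_nonneg _)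
    calc |q.2 + r.2| ^ (1 + α) ≤ (2 * max |q.2| |r.2|) ^ (1 + α) :=
          Real.rpow_le_rpow (abs_nonneg _) h1 (by linarith)
      _ = 2 ^ (1 + α) * max |q.2| |r.2| ^ (1 + α) := Real.mul_rpow (by norm_num) h2
      _ ≤ 2 ^ (3 : ℝ) * max |q.2| |r.2| ^ (1 + α) := by
          gcongr
          · norm_num
          · linarith
      _ = 8 * max |q.2| |r.2| ^ (1 + α) := by norm_num
      _ ≤ _ := by
          have e1 : 0 ≤ |q.2| ^ (1 + α) := by positivity
          have e2 : 0 ≤ |r.2| ^ (1 + α) := by positivity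
          rcases max_choice |q.2| |r.2| with h | h <;> rw [h] <;> linarith
  have h3 : ∀ x y : ℝ, 0 ≤ x → 0 ≤ y → bracket (8 * (x + y)) ≤ 16 * max (bracket x) (bracket y) := by
    intro x y hx hy
    have h4 : bracket (8 * (x + y)) ≤ bracket (16 * max x y) := by
      refine bracket_le_bracket ?_
      rw [abs_of_nonneg (by positivity), abs_of_nonneg (by positivity)]
      linarith [le_max_left x y, le_max_right x y]
    have h5 : bracket (16 * max x y) ≤ 16 * bracket (max x y) := by
      have := bracket_pos (max x y)
      refine Real.sqrt_le_iff.2 ⟨by positivity, ?_⟩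
      rw [mul_pow, mul_pow, bracket_sq]
      nlinarith
    refine h4.trans (h5.trans ?_)
    rcases max_choice x y with h | h <;> rw [h]
    · linarith [le_max_left (bracket x) (bracket y)]
    · linarith [le_max_right (bracket x) (bracket y)]
  refine le_trans ?_ (h3 (|q.1| + |q.2| ^ (1 + α)) (|r.1| + |r.2| ^ (1 + α))
    (by positivity) (by positivity))
  refine bracket_le_bracket (abs_le_abs_of_nonneg (by positivity) ?_)
  have : |(q + r).1| ≤ |q.1| + |r.1| := abs_add_le _ _
  simp only [Prod.snd_add]
  linarith [abs_nonneg q.1, abs_nonneg r.1]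

/-- `logMult` at the frequency pairs `q`, `r` and `q + r`. -/
noncomputable def pairLogMult (α ω ρ ε : ℝ) (q r : ℝ × ℝ) : ℝ :=
  logMult α ω ρ ε (Real.log |q.2|) (Real.log |r.2|) (Real.log |q.2 + r.2|)
    (Real.log (bracket q.2)) (Real.log (bracket r.2)) (Real.log (bracket (q.2 + r.2)))
    (Real.log (ellipticWeight α q)) (Real.log (ellipticWeight α r))
    (Real.log (ellipticWeight α (q + r)))
    (Real.log (bracket (modulation α q))) (Real.log (bracket (modulation α r)))
    (Real.log (bracket (modulation α (q + r))))

/-- All numerical factors in the case analysis are at most 64 < e^5. This is the value κ = 5 used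
below, and 250 = 50κ. -/
lemma log_le_of_le_mul {y z : ℝ} (hy : 0 < y) (h : y ≤ 64 * z) :
    Real.log y ≤ 5 + Real.log z := by
  have hz : 0 < z := by linarith
  have h1 : (64 : ℝ) ≤ Real.exp 5 := by
    have := Real.exp_one_gt_d9
    rw [show (5 : ℝ) = ((5 : ℕ) : ℝ) * 1 by norm_num, Real.exp_nat_mul]
    calc (64 : ℝ) ≤ 2.7 ^ 5 := by norm_num
      _ ≤ _ := by gcongr; linarith
  rw [Real.log_le_iff_le_exp hy, Real.exp_add, Real.exp_log hz]
  exact h.trans (mul_le_mul_of_nonneg_right h1 hz.le)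

-- With |ξ₂| ≤ |ξ₁| and N the larger of |ξ₁| and |ξ₁+ξ₂|, four configurations cover everything: N ≤
-- 1, |ξ₂| < N/4, |ξ₁+ξ₂| < N/4, and all three at least N/4. In each, lower bounds for the pair
-- kernels and the resonance feed the corresponding logarithmic inequality. The third frequency
-- enters as -(ξ₁+ξ₂), so that the three sum to zero and can exchange roles.
set_option maxHeartbeats 1000000 in
lemma exists_pairLogMult_le {α ω ρ ε : ℝ} (h : Admissible α ω ρ ε) {q r : ℝ × ℝ}
    (hq : q.2 ≠ 0) (hr : r.2 ≠ 0) (hqr : q.2 + r.2 ≠ 0) (hle : |r.2| ≤ |q.2|) :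
    (∃ K, Real.exp K ≤ pairKernel α q.2 r.2 ∧ pairLogMult α ω ρ ε q r ≤ 250 + K
      - (1 + 2 * ε) * (Real.log (bracket (modulation α q)) + Real.log (bracket (modulation α r)))) ∨
    (∃ K, Real.exp K ≤ pairKernel α q.2 (-(q.2 + r.2)) ∧ pairLogMult α ω ρ ε q r ≤ 250 + K
      - (1 + 2 * ε) * (Real.log (bracket (modulation α q))
        + Real.log (bracket (modulation α (q + r))))) ∨
    (∃ K, Real.exp K ≤ pairKernel α r.2 (-(q.2 + r.2)) ∧ pairLogMult α ω ρ ε q r ≤ 250 + K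
      - (1 + 2 * ε) * (Real.log (bracket (modulation α r))
        + Real.log (bracket (modulation α (q + r))))) := by
  have hα := h.one_lt
  have hα' := h.lt_two
  have hα0 : 0 < α := by linarith
  have c1 : |q.2 + r.2| ≤ |q.2| + |r.2| := abs_add_le _ _
  have c2 : |q.2| ≤ |q.2 + r.2| + |r.2| := by
    have := abs_sub (q.2 + r.2) r.2; simpa using this
  -- As |r.2| ≤ |q.2|, the numbers q.2 and q.2 + r.2 do not have opposite signs.
  have hd13 : |(|q.2| - |(-(q.2 + r.2))|)| = |r.2| := by
    rw [abs_neg]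
    rcases abs_cases q.2 with ⟨h1, _⟩ | ⟨h1, _⟩ <;> rcases abs_cases r.2 with ⟨h2, _⟩ | ⟨h2, _⟩ <;>
    rcases abs_cases (q.2 + r.2) with ⟨h3, _⟩ | ⟨h3, _⟩ <;> rw [h1, h3] <;>
    rw [h1, h2] at hle <;>
    first
    | (rw [← abs_neg r.2]; congr 1; linarith)
    | (congr 1; linarith)
  -- The inequality |q.2 + r.2| < |q.2| forces q.2 and r.2 to have opposite signs.
  have hd12 : |q.2 + r.2| < |q.2| → |(|q.2| - |r.2|)| = |q.2 + r.2| := by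
    intro hlt
    rcases abs_cases q.2 with ⟨h1, _⟩ | ⟨h1, _⟩ <;> rcases abs_cases r.2 with ⟨h2, _⟩ | ⟨h2, _⟩ <;>
    rcases abs_cases (q.2 + r.2) with ⟨h3, _⟩ | ⟨h3, _⟩ <;> rw [h1, h2, abs_of_nonneg (by linarith)]
      <;> linarith
  have hs12 : |q.2 - r.2| ≤ |q.2| + |r.2| := abs_sub _ _
  set x₁ := |q.2| with hx₁
  set x₂ := |r.2| with hx₂
  set x₃ := |q.2 + r.2| with hx₃
  have p1 : 0 < x₁ := abs_pos.2 hq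
  have p2 : 0 < x₂ := abs_pos.2 hr
  have p3 : 0 < x₃ := abs_pos.2 hqr
  set N := max x₁ x₃ with hN
  have hx1N : x₁ ≤ N := le_max_left _ _
  have hx3N : x₃ ≤ N := le_max_right _ _
  have hN0 : 0 < N := p1.trans_le hx1N
  have hNor : N = x₁ ∨ N = x₃ := max_choice _ _
  have lw1 : 0 ≤ Real.log (ellipticWeight α q) := Real.log_nonneg (one_le_ellipticWeight _ _)
  have lw2 : 0 ≤ Real.log (ellipticWeight α r) := Real.log_nonneg (one_le_ellipticWeight _ _)
  have l1 : 0 ≤ Real.log (bracket (modulation α q)) := Real.log_nonneg (one_le_bracket _)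
  have l2 : 0 ≤ Real.log (bracket (modulation α r)) := Real.log_nonneg (one_le_bracket _)
  have l3 : 0 ≤ Real.log (bracket (modulation α (q + r))) := Real.log_nonneg (one_le_bracket _)
  have A1 : 0 ≤ Real.log (bracket q.2) := Real.log_nonneg (one_le_bracket _)
  have A2 : 0 ≤ Real.log (bracket r.2) := Real.log_nonneg (one_le_bracket _)
  have A3 : 0 ≤ Real.log (bracket (q.2 + r.2)) := Real.log_nonneg (one_le_bracket _)
  have w1 : 0 < ellipticWeight α q := bracket_pos _
  have w2 : 0 < ellipticWeight α r := bracket_pos _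
  have w3 : 0 < ellipticWeight α (q + r) := bracket_pos _
  have b1 := bracket_le_one_add q.2
  have b2 := bracket_le_one_add r.2
  have b3 := bracket_le_one_add (q.2 + r.2)
  have b1' := abs_le_bracket q.2
  have b2' := abs_le_bracket r.2
  have b3' := abs_le_bracket (q.2 + r.2)
  rw [← hx₁] at b1 b1'
  rw [← hx₂] at b2 b2'
  rw [← hx₃] at b3 b3'
  have ho : Real.log (ellipticWeight α (q + r)) ≤ 5 + Real.log (ellipticWeight α q) ∨
      Real.log (ellipticWeight α (q + r)) ≤ 5 + Real.log (ellipticWeight α r) := by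
    have := ellipticWeight_add_le hα hα' q r
    rcases max_choice (ellipticWeight α q) (ellipticWeight α r) with h | h <;> rw [h] at this
    · left; exact log_le_of_le_mul w3 (by linarith)
    · right; exact log_le_of_le_mul w3 (by linarith)
  -- the three modulations and the resonance
  have hL : ∀ m R : ℝ, 0 < R → R ≤ 4 * (m * N ^ α) → 0 ≤ m → m ≤ x₁ → m ≤ x₂ → m ≤ x₃ →
      (Real.log (bracket (modulation α q)) ≤ Real.log (bracket (modulation α (q + r))) ∧
        Real.log (bracket (modulation α r)) ≤ Real.log (bracket (modulation α (q + r))) ∧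
        Real.log R - 5 ≤ Real.log (bracket (modulation α (q + r)))) ∨
      (Real.log (bracket (modulation α (q + r))) ≤ Real.log (bracket (modulation α q)) ∧
        Real.log (bracket (modulation α r)) ≤ Real.log (bracket (modulation α q)) ∧
        Real.log R - 5 ≤ Real.log (bracket (modulation α q))) ∨
      (Real.log (bracket (modulation α (q + r))) ≤ Real.log (bracket (modulation α r)) ∧
        Real.log (bracket (modulation α q)) ≤ Real.log (bracket (modulation α r)) ∧
        Real.log R - 5 ≤ Real.log (bracket (modulation α r))) := by
    intro m R hR hRm hm0 hm1 hm2 hm3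
    have h1 := resonance hα hα' hm0 hm1 hm2 hm3 hN0.le
      (by rcases hNor with h | h <;> rw [h] <;> simp [hx₁, hx₃])
    have h2 : |phase α (q.2 + r.2) - phase α q.2 - phase α r.2| ≤ bracket (modulation α q)
        + bracket (modulation α r) + bracket (modulation α (q + r)) := by
      have e : phase α (q.2 + r.2) - phase α q.2 - phase α r.2
          = modulation α q + modulation α r - modulation α (q + r) := by
        simp [modulation]; ring
      rw [e]
      refine (abs_sub _ _).trans (add_le_add ((abs_add_le _ _).trans ?_) (abs_le_bracket _))
      exact add_le_add (abs_le_bracket _) (abs_le_bracket _)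
    have e1 := bracket_pos (modulation α q)
    have e2 := bracket_pos (modulation α r)
    have e3 := bracket_pos (modulation α (q + r))
    have h3 : ∀ L, bracket (modulation α q) ≤ L → bracket (modulation α r) ≤ L →
        bracket (modulation α (q + r)) ≤ L → Real.log R - 5 ≤ Real.log L := by
      intro L g1 g2 g3
      have := log_le_of_le_mul (z := L) hR (by linarith)
      linarith
    rcases le_total (bracket (modulation α q)) (bracket (modulation α r)) with g1 | g1 <;>
    rcases le_total (bracket (modulation α q)) (bracket (modulation α (q + r))) with g2 | g2 <;>
    rcases le_total (bracket (modulation α r)) (bracket (modulation α (q + r))) with g3 | g3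
    · left; exact ⟨Real.log_le_log e1 g2, Real.log_le_log e2 g3, h3 _ g2 g3 le_rfl⟩
    · right; right; exact ⟨Real.log_le_log e3 g3, Real.log_le_log e1 g1, h3 _ g1 le_rfl g3⟩
    · left; exact ⟨Real.log_le_log e1 (g1.trans g3), Real.log_le_log e2 g3,
        h3 _ (g1.trans g3) g3 le_rfl⟩
    · right; right; exact ⟨Real.log_le_log e3 g3, Real.log_le_log e1 g1, h3 _ g1 le_rfl g3⟩
    · left; exact ⟨Real.log_le_log e1 g2, Real.log_le_log e2 g3, h3 _ g2 g3 le_rfl⟩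
    · right; left; exact ⟨Real.log_le_log e3 (g3.trans g1), Real.log_le_log e2 g1,
        h3 _ le_rfl g1 (g3.trans g1)⟩
    · right; left; exact ⟨Real.log_le_log e3 g2, Real.log_le_log e2 g1, h3 _ le_rfl g1 g2⟩
    · right; left; exact ⟨Real.log_le_log e3 g2, Real.log_le_log e2 g1, h3 _ le_rfl g1 g2⟩
  have hlogx : ∀ (x : ℝ) (p : ℝ × ℝ), 0 < x → x ≤ 64 * |p.2| ^ (1 + α) →
      Real.log x - 5 ≤ Real.log (ellipticWeight α p) := by
    intro x p hx hxp
    have := log_le_of_le_mul (z := ellipticWeight α p) hx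
      (hxp.trans (mul_le_mul_of_nonneg_left (rpow_le_ellipticWeight α p) (by norm_num)))
    linarith
  have hlogN : (1 + α) * Real.log N = Real.log (N ^ (1 + α)) := (Real.log_rpow hN0 _).symm
  have hrp : ∀ x, 0 ≤ x → N / 4 ≤ x → N ^ (1 + α) ≤ 64 * x ^ (1 + α) := by
    intro x hx0 hx
    have h1 : N ^ (1 + α) ≤ (4 * x) ^ (1 + α) :=
      Real.rpow_le_rpow hN0.le (by linarith) (by linarith)
    rw [Real.mul_rpow (by norm_num) hx0] at h1
    have h2 : (4 : ℝ) ^ (1 + α) ≤ 4 ^ (3 : ℝ) :=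
      Real.rpow_le_rpow_of_exponent_le (by norm_num) (by linarith)
    have h3 : (4 : ℝ) ^ (3 : ℝ) = 64 := by norm_num
    have h4 : 0 ≤ x ^ (1 + α) := by positivity
    nlinarith
  -- Low frequencies only: the pair lies within the near-diagonal region of the kernel.
  by_cases hN1 : N ≤ 1
  · left
    refine ⟨(α - 1) / 2 * Real.log x₃, ?_, ?_⟩
    · rw [mul_comm, ← Real.rpow_def_of_pos p3]
      apply le_pairKernel_of_near
      have : (1 : ℝ) ≤ x₃ ^ (-((α - 1) / 2)) :=
        Real.one_le_rpow_of_pos_of_le_one_of_nonpos p3 (by linarith) (by linarith)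
      linarith
    · have := logMult_le_of_low (κ := 5) (K₁₂ := (α - 1) / 2 * Real.log x₃)
        (l₁ := Real.log (bracket (modulation α q))) (l₂ := Real.log (bracket (modulation α r)))
        h (by norm_num)
        (Real.log_nonpos p1.le (by linarith)) (Real.log_nonpos p2.le (by linarith))
        (Real.log_nonpos p3.le (by linarith))
        (a₁ := Real.log x₁) (a₂ := Real.log x₂) (a₃ := Real.log x₃)
        (A₁ := Real.log (bracket q.2)) (A₂ := Real.log (bracket r.2))
        (by have := log_le_of_le_mul (z := 1) (bracket_pos q.2) (by linarith); simpa using this)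
        (by have := log_le_of_le_mul (z := 1) (bracket_pos r.2) (by linarith); simpa using this)
        A3 lw1 lw2 l3 ho le_rfl
      unfold pairLogMult
      linarith
  rw [not_le] at hN1
  have hν : 0 ≤ Real.log N := Real.log_nonneg hN1.le
  have hν1 : Real.log x₁ ≤ Real.log N := Real.log_le_log p1 hx1N
  have hν2 : Real.log x₂ ≤ Real.log N := Real.log_le_log p2 (by linarith)
  have hν3 : Real.log x₃ ≤ Real.log N := Real.log_le_log p3 hx3N
  have hA : ∀ x, bracket x ≤ 1 + |x| → |x| ≤ N → Real.log (bracket x) ≤ Real.log N + 5 := by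
    intro x g1 g2
    have := log_le_of_le_mul (z := N) (bracket_pos x) (by linarith)
    linarith
  have hA' : ∀ x, |x| ≠ 0 → bracket x ≤ 1 + |x| →
      (Real.log |x| ≤ 0 ∧ Real.log (bracket x) ≤ 5) ∨
      (0 ≤ Real.log |x| ∧ Real.log (bracket x) ≤ Real.log |x| + 5) := by
    intro x g1 g2
    have g3 : 0 < |x| := lt_of_le_of_ne (abs_nonneg x) g1.symm
    rcases le_total |x| 1 with g | g
    · left
      refine ⟨Real.log_nonpos g3.le g, ?_⟩
      have := log_le_of_le_mul (z := 1) (bracket_pos x) (by linarith)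
      simpa using this
    · right
      refine ⟨Real.log_nonneg g, ?_⟩
      have := log_le_of_le_mul (z := |x|) (bracket_pos x) (by linarith)
      linarith
  have hexp1 : ∀ {N' c k : ℝ}, 0 < N' → N' ^ c / 16 ≤ k → Real.exp (c * Real.log N' - 5) ≤ k := by
    intro N' c k hN' hk
    have e : (1 : ℝ) ≤ Real.exp 5 / 16 := by
      have := log_le_of_le_mul (y := 64) (z := 1) (by norm_num) (by norm_num)
      rw [Real.log_one, add_zero, Real.log_le_iff_le_exp (by norm_num)] at this
      linarith
    have e2 : Real.exp (-5) ≤ 1 / 16 := by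
      rw [Real.exp_neg, inv_le_comm₀ (Real.exp_pos _) (by norm_num)]
      norm_num; linarith
    rw [sub_eq_add_neg, Real.exp_add, mul_comm c, ← Real.rpow_def_of_pos hN']
    refine le_trans ?_ hk
    have : 0 ≤ N' ^ c := by positivity
    nlinarith
  have hexp2 : ∀ {x k : ℝ}, 0 < x → N ^ (α - 1) * x ≤ k →
      Real.exp (Real.log x + (α - 1) * Real.log N - 5) ≤ k := by
    intro x k hx hk
    have e2 : Real.exp (-5) ≤ 1 := by rw [Real.exp_le_one_iff]; norm_num
    rw [sub_eq_add_neg, Real.exp_add, Real.exp_add, mul_comm (α - 1), ← Real.rpow_def_of_pos hN0,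
      Real.exp_log hx]
    refine le_trans ?_ hk
    have : 0 ≤ x * N ^ (α - 1) := by positivity
    nlinarith
  have hN4 : ∀ {x y : ℝ}, N * (3 / 4) ≤ |x| → N / 2 ≤ |(|x| - |y|)| →
      N ^ α / 16 ≤ pairKernel α x y := by
    intro x y g1 g2
    refine le_trans ?_ (le_pairKernel hα (N := N / 2) (d := N / 2) (by positivity)
      (Or.inl (by linarith)) (by positivity) g2)
    rw [← Real.rpow_add_one (by positivity), sub_add_cancel, Real.div_rpow hN0.le (by norm_num)]
    have : (2 : ℝ) ^ α ≤ 2 ^ (2 : ℝ) := Real.rpow_le_rpow_of_exponent_le (by norm_num) hα'.le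
    have h3 : (2 : ℝ) ^ α ≤ 16 := this.trans (by norm_num)
    gcongr
  have hlogR : ∀ x, 0 < x → Real.log (x * N ^ α) = Real.log x + α * Real.log N := by
    intro x hx
    rw [Real.log_mul hx.ne' (by positivity), Real.log_rpow hN0]
  -- High times low: |ξ₁| and |ξ₁+ξ₂| are both at least 3N/4.
  by_cases hB : x₂ < N / 4
  · have hx1 : N * (3 / 4) ≤ x₁ := by rcases hNor with h | h <;> linarith
    have hx3 : N * (3 / 4) ≤ x₃ := by rcases hNor with h | h <;> linarith
    have L := hL x₂ (x₂ * N ^ α) (by positivity) (by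
      have : 0 < x₂ * N ^ α := by positivity
      linarith) p2.le hle le_rfl (by linarith)
    rw [hlogR _ p2] at L
    have k12 := hN4 (x := q.2) (y := r.2) hx1 (by
      rw [← hx₁, ← hx₂, abs_of_nonneg (by linarith)]; linarith)
    have k32 := hN4 (x := -(q.2 + r.2)) (y := r.2) (by rwa [abs_neg, ← hx₃]) (by
      rw [abs_neg, ← hx₃, ← hx₂, abs_of_nonneg (by linarith)]; linarith)
    rw [pairKernel_comm] at k32
    have k13 : N ^ (α - 1) * x₂ ≤ pairKernel α q.2 (-(q.2 + r.2)) :=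
      le_pairKernel hα hN0.le (by rw [abs_neg]; exact hNor.imp le_of_eq le_of_eq) p2.le hd13.ge
    have R := logMult_le_of_high_low (κ := 5) (ν := Real.log N)
      (K₁₂ := α * Real.log N - 5) (K₁₃ := Real.log x₂ + (α - 1) * Real.log N - 5)
      (K₂₃ := α * Real.log N - 5)
      (a₁ := Real.log x₁) (a₂ := Real.log x₂) (a₃ := Real.log x₃)
      (A₁ := Real.log (bracket q.2)) (A₂ := Real.log (bracket r.2))
      (A₃ := Real.log (bracket (q.2 + r.2)))
      (o₁ := Real.log (ellipticWeight α q)) (o₂ := Real.log (ellipticWeight α r))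
      (o₃ := Real.log (ellipticWeight α (q + r)))
      (l₁ := Real.log (bracket (modulation α q))) (l₂ := Real.log (bracket (modulation α r)))
      (l₃ := Real.log (bracket (modulation α (q + r))))
      h (by norm_num) hν hν1 hν2
      (by
        have := log_le_of_le_mul (y := N) (z := x₃) hN0 (by linarith)
        exact abs_le.2 ⟨by linarith, by linarith⟩)
      (hA _ b1 hx1N)
      (by
        have := log_le_of_le_mul (y := N) (z := bracket (q.2 + r.2)) hN0 (by linarith)
        linarith)
      (hA' r.2 p2.ne' b2)
      (by rw [hlogN]; exact hlogx _ _ (by positivity) (hrp _ p1.le (by linarith)))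
      (by
        rw [← Real.log_rpow p2]
        refine hlogx _ _ (by positivity) ?_
        rw [← hx₂]
        have : 0 ≤ x₂ ^ (1 + α) := by positivity
        linarith)
      (by
        have := Real.log_le_log (bracket_pos _) (bracket_modulation_le_ellipticWeight hα0 r)
        linarith)
      ho l1 l2 l3 L le_rfl le_rfl le_rfl
    unfold pairLogMult
    rw [show (50 : ℝ) * 5 = 250 by norm_num] at R
    rcases R with R | R | R
    · left; exact ⟨_, hexp1 hN0 k12, R⟩
    · right; left; exact ⟨_, hexp2 p2 k13, R⟩
    · right; right; exact ⟨_, hexp1 hN0 k32, R⟩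
  rw [not_lt] at hB
  -- High times high into low: |ξ₁| = N and |ξ₂| ≥ 3N/4.
  by_cases hC : x₃ < N / 4
  · have hNx : N = x₁ := by rcases hNor with h | h <;> linarith
    have hx2 : N * (3 / 4) ≤ x₂ := by linarith
    have L := hL x₃ (x₃ * N ^ α) (by positivity) (by
      have : 0 < x₃ * N ^ α := by positivity
      linarith) p3.le (by linarith) (by linarith) le_rfl
    rw [hlogR _ p3] at L
    have k13 := hN4 (x := q.2) (y := -(q.2 + r.2)) (by rw [← hx₁]; linarith) (by
      rw [abs_neg, ← hx₁, ← hx₃, abs_of_nonneg (by linarith)]; linarith)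
    have k23 := hN4 (x := r.2) (y := -(q.2 + r.2)) (by rwa [← hx₂]) (by
      rw [abs_neg, ← hx₃, ← hx₂, abs_of_nonneg (by linarith)]; linarith)
    have k12 : N ^ (α - 1) * x₃ ≤ pairKernel α q.2 r.2 :=
      le_pairKernel hα hN0.le (Or.inl hNx.le) p3.le (hd12 (by linarith)).ge
    have R := logMult_le_of_high_high (κ := 5) (ν := Real.log N)
      (K₁₂ := Real.log x₃ + (α - 1) * Real.log N - 5) (K₁₃ := α * Real.log N - 5)
      (K₂₃ := α * Real.log N - 5)
      (a₁ := Real.log x₁) (a₂ := Real.log x₂) (a₃ := Real.log x₃)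
      (A₁ := Real.log (bracket q.2)) (A₂ := Real.log (bracket r.2))
      (A₃ := Real.log (bracket (q.2 + r.2)))
      (o₁ := Real.log (ellipticWeight α q)) (o₂ := Real.log (ellipticWeight α r))
      (o₃ := Real.log (ellipticWeight α (q + r)))
      (l₁ := Real.log (bracket (modulation α q))) (l₂ := Real.log (bracket (modulation α r)))
      (l₃ := Real.log (bracket (modulation α (q + r))))
      h (by norm_num) hν hν1 hν2 hν3 (hA _ b1 hx1N) (hA _ b2 (by linarith))
      (by
        have h1 : Real.log x₃ ≤ Real.log (bracket (q.2 + r.2)) := Real.log_le_log p3 b3'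
        rcases hA' (q.2 + r.2) p3.ne' b3 with ⟨g1, g2⟩ | ⟨g1, g2⟩
        · left; exact ⟨g1, A3, g2⟩
        · right; exact ⟨g1, abs_le.2 ⟨by linarith, by linarith⟩⟩)
      (by rw [hlogN]; exact hlogx _ _ (by positivity) (hrp _ p1.le (by linarith)))
      (by rw [hlogN]; exact hlogx _ _ (by positivity) (hrp _ p2.le (by linarith)))
      (by
        have h1 := ellipticWeight_le hα0 (q + r)
        have h2 := bracket_pos (modulation α (q + r))
        have h3 := bracket_pos (q.2 + r.2)
        have h4 : 0 < bracket (q.2 + r.2) ^ (1 + α) := by positivity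
        rw [Prod.snd_add] at h1
        rcases le_total (bracket (modulation α (q + r))) (bracket (q.2 + r.2) ^ (1 + α)) with g | g
        · right
          rw [← Real.log_rpow h3]
          exact log_le_of_le_mul w3 (by linarith)
        · left; exact log_le_of_le_mul w3 (by linarith))
      l1 l2 l3 L le_rfl le_rfl le_rfl
    unfold pairLogMult
    rw [show (50 : ℝ) * 5 = 250 by norm_num] at R
    rcases R with R | R | R
    · left; exact ⟨_, hexp2 p3 k12, R⟩
    · right; left; exact ⟨_, hexp1 hN0 k13, R⟩
    · right; right; exact ⟨_, hexp1 hN0 k23, R⟩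
  rw [not_lt] at hC
  -- Three comparable frequencies: the smallest is at least N/4, so the resonance is of size
  -- N^(1+α).
  have hx1 : N / 4 ≤ x₁ := by linarith
  have L := hL (N / 4) (N ^ (1 + α)) (by positivity) (by
    rw [Real.rpow_one_add' hN0.le (by linarith)]
    linarith) (by positivity) hx1 hB hC
  rw [← hlogN] at L
  have k12 := le_pairKernel_of_comparable (x := q.2) (y := r.2) hα hα' hN1.le hx1 hC hx3N
  have k13 := le_pairKernel_of_comparable (x := q.2) (y := -(q.2 + r.2)) hα hα' hN1.le hx1
    (by simpa [← hx₂] using hB) (by simpa [← hx₂] using hle.trans hx1N)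
  have k23 := le_pairKernel_of_comparable (x := r.2) (y := -(q.2 + r.2)) hα hα' hN1.le hB
    (by simpa [← hx₁] using hx1) (by simpa [← hx₁] using hx1N)
  have R := logMult_le_of_comparable (κ := 5) (ν := Real.log N)
      (K₁₂ := (α - 1) / 2 * Real.log N - 5) (K₁₃ := (α - 1) / 2 * Real.log N - 5)
      (K₂₃ := (α - 1) / 2 * Real.log N - 5)
      (a₁ := Real.log x₁) (a₂ := Real.log x₂) (a₃ := Real.log x₃)
      (A₁ := Real.log (bracket q.2)) (A₂ := Real.log (bracket r.2))
      (A₃ := Real.log (bracket (q.2 + r.2)))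
      (o₁ := Real.log (ellipticWeight α q)) (o₂ := Real.log (ellipticWeight α r))
      (o₃ := Real.log (ellipticWeight α (q + r)))
      (l₁ := Real.log (bracket (modulation α q))) (l₂ := Real.log (bracket (modulation α r)))
      (l₃ := Real.log (bracket (modulation α (q + r))))
      h (by norm_num) hν hν1 hν2
      (by
        have := log_le_of_le_mul (y := N) (z := x₃) hN0 (by linarith)
        exact abs_le.2 ⟨by linarith, by linarith⟩)
      (hA _ b1 hx1N) (hA _ b2 (by linarith))
      (by
        have := log_le_of_le_mul (y := N) (z := bracket (q.2 + r.2)) hN0 (by linarith)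
        linarith)
      (by rw [hlogN]; exact hlogx _ _ (by positivity) (hrp _ p1.le (by linarith)))
      (by rw [hlogN]; exact hlogx _ _ (by positivity) (hrp _ p2.le (by linarith)))
      ho L le_rfl le_rfl le_rfl
  unfold pairLogMult
  rw [show (50 : ℝ) * 5 = 250 by norm_num] at R
  rcases R with R | R | R
  · left; exact ⟨_, hexp1 hN0 k12, R⟩
  · right; left; exact ⟨_, hexp1 hN0 k13, R⟩
  · right; right; exact ⟨_, hexp1 hN0 k23, R⟩

lemma log_resWeight {α s ω b : ℝ} {p : ℝ × ℝ} (hp : p.2 ≠ 0) :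
    Real.log (resWeight α s ω b p) = -2 * ω * Real.log |p.2|
      + (2 * s - 2 * α * ω) * Real.log (bracket p.2) + 2 * ω * Real.log (ellipticWeight α p)
      + 2 * b * Real.log (bracket (modulation α p)) := by
  have h1 := abs_pos.2 hp
  have h2 := bracket_pos p.2
  have h3 : 0 < ellipticWeight α p := bracket_pos _
  have h4 := bracket_pos (modulation α p)
  rw [resWeight_eq, Real.log_mul (by positivity) (by positivity),
    Real.log_mul (by positivity) (by positivity), Real.log_mul (by positivity) (by positivity),
    Real.log_rpow h1, Real.log_rpow h2, Real.log_rpow h3, Real.log_rpow h4]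

/-- The kernel of the bilinear operators in which the third modulation is not used. -/
noncomputable def modKernel (α ε : ℝ) (q r : ℝ × ℝ) : ℝ :=
  pairKernel α q.2 r.2 * (bracket (modulation α q) ^ (-(1 + 2 * ε))
    * bracket (modulation α r) ^ (-(1 + 2 * ε)))

lemma modKernel_nonneg (α ε : ℝ) (q r : ℝ × ℝ) : 0 ≤ modKernel α ε q r := by
  have h1 := bracket_pos (modulation α q)
  have h2 := bracket_pos (modulation α r)
  have := pairKernel_nonneg α q.2 r.2
  unfold modKernel; positivity

lemma modKernel_comm (α ε : ℝ) (q r : ℝ × ℝ) : modKernel α ε q r = modKernel α ε r q := by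
  unfold modKernel
  rw [pairKernel_comm, mul_comm (bracket (modulation α q) ^ _)]

lemma le_modKernel {α ε K : ℝ} {q r : ℝ × ℝ} (h : Real.exp K ≤ pairKernel α q.2 r.2) :
    Real.exp (250 + K - (1 + 2 * ε) * (Real.log (bracket (modulation α q))
      + Real.log (bracket (modulation α r)))) ≤ Real.exp 250 * modKernel α ε q r := by
  have h1 := bracket_pos (modulation α q)
  have h2 := bracket_pos (modulation α r)
  unfold modKernel
  rw [show 250 + K - (1 + 2 * ε) * (Real.log (bracket (modulation α q))
      + Real.log (bracket (modulation α r))) = 250 + (K + (Real.log (bracket (modulation α q))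
      * (-(1 + 2 * ε)) + Real.log (bracket (modulation α r)) * (-(1 + 2 * ε)))) by ring,
    Real.exp_add, Real.exp_add, Real.exp_add, ← Real.rpow_def_of_pos h1,
    ← Real.rpow_def_of_pos h2]
  gcongr

/-- The pointwise estimate of the multiplier of the bilinear estimate at regularity `-ρ`. -/
theorem multiplier_le {α ω ρ ε : ℝ} (h : Admissible α ω ρ ε) {q r : ℝ × ℝ}
    (hq : q.2 ≠ 0) (hr : r.2 ≠ 0) (hqr : q.2 + r.2 ≠ 0) :
    (q.2 + r.2) ^ 2 * resWeight α (-ρ) ω (-1 / 2 + 2 * ε) (q + r) ≤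
      Real.exp 250 * (modKernel α ε q r + modKernel α ε q (-(q + r)) + modKernel α ε r (-(q + r)))
        * (resWeight α (-ρ) ω (1 / 2 + ε) q * resWeight α (-ρ) ω (1 / 2 + ε) r) := by
  wlog hle : |r.2| ≤ |q.2| generalizing q r
  · have := this hr hq (by rwa [add_comm]) (by linarith)
    rw [add_comm r.2, add_comm r q] at this
    refine this.trans (le_of_eq ?_)
    rw [modKernel_comm α ε r q]
    ring
  have hqr' : (q + r).2 ≠ 0 := hqr
  have w1 := resWeight_pos α (-ρ) ω (1 / 2 + ε) hq
  have w2 := resWeight_pos α (-ρ) ω (1 / 2 + ε) hr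
  have w3 := resWeight_pos α (-ρ) ω (-1 / 2 + 2 * ε) hqr'
  have n1 := modKernel_nonneg α ε q r
  have n2 := modKernel_nonneg α ε q (-(q + r))
  have n3 := modKernel_nonneg α ε r (-(q + r))
  have e0 := Real.exp_pos 250
  have hlog : pairLogMult α ω ρ ε q r = Real.log ((q.2 + r.2) ^ 2
      * resWeight α (-ρ) ω (-1 / 2 + 2 * ε) (q + r)
      / (resWeight α (-ρ) ω (1 / 2 + ε) q * resWeight α (-ρ) ω (1 / 2 + ε) r)) := by
    rw [Real.log_div (by positivity) (by positivity), Real.log_mul (by positivity) w3.ne',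
      Real.log_mul w1.ne' w2.ne', log_resWeight hq, log_resWeight hr, log_resWeight hqr',
      Real.log_pow, ← Real.log_abs]
    simp only [pairLogMult, logMult, Prod.snd_add, Nat.cast_ofNat]
    ring
  have hkey : Real.exp (pairLogMult α ω ρ ε q r) ≤ Real.exp 250
      * (modKernel α ε q r + modKernel α ε q (-(q + r)) + modKernel α ε r (-(q + r))) := by
    have hb : bracket (modulation α (q + r)) = bracket (modulation α (-(q + r))) := by
      rw [modulation_neg, bracket_neg]
    rcases exists_pairLogMult_le h hq hr hqr hle with ⟨K, hK, hM⟩ | ⟨K, hK, hM⟩ | ⟨K, hK, hM⟩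
    · refine (Real.exp_le_exp.2 hM).trans ((le_modKernel hK).trans ?_)
      gcongr; linarith
    · rw [hb] at hM
      refine (Real.exp_le_exp.2 hM).trans ((le_modKernel (r := -(q + r)) hK).trans ?_)
      gcongr; linarith
    · rw [hb] at hM
      refine (Real.exp_le_exp.2 hM).trans ((le_modKernel (r := -(q + r)) hK).trans ?_)
      gcongr; linarith
  rw [hlog, Real.exp_log (by positivity), div_le_iff₀ (by positivity)] at hkey
  exact hkey


/-! ### Integrals of the kernels -/

/-- The integral of `⟨x⟩^(-1-2ε)`. -/
noncomputable def bracketIntegral (ε : ℝ) : ℝ≥0∞ :=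
  ∫⁻ x : ℝ, ENNReal.ofReal (bracket x ^ (-(1 + 2 * ε)))

lemma bracketIntegral_lt_top {ε : ℝ} (hε : 0 < ε) : bracketIntegral ε < ⊤ := by
  have := lintegral_bracket_lt_top (b := 1 / 2 + ε) (by linarith)
  unfold bracketIntegral
  convert this using 6
  ring

lemma measurable_bracket_rpow (c : ℝ) : Measurable fun x => ENNReal.ofReal (bracket x ^ c) :=
  (continuous_bracket.measurable.pow_const c).ennreal_ofReal

lemma abs_lt_abs_sub_iff (c x : ℝ) : |x| < |c - x| ↔ 0 < c ^ 2 - 2 * c * x := by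
  rw [← sq_lt_sq]
  constructor <;> intro h <;> linarith [sq_nonneg c, (by ring : (c - x) ^ 2 = c ^ 2 - 2 * c * x + x ^ 2)]

lemma abs_sub_lt_abs_iff (c x : ℝ) : |c - x| < |x| ↔ c ^ 2 - 2 * c * x < 0 := by
  rw [← sq_lt_sq]
  constructor <;> intro h <;> linarith [sq_nonneg c, (by ring : (c - x) ^ 2 = c ^ 2 - 2 * c * x + x ^ 2)]

lemma hasDerivAt_phase_add_phase_sub {α : ℝ} (hα : 1 < α) (c x : ℝ) :
    HasDerivAt (fun x => phase α x + phase α (c - x)) ((1 + α) * (|x| ^ α - |c - x| ^ α)) x := by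
  have h := (hasDerivAt_phase hα x).add
    ((hasDerivAt_phase hα (c - x)).comp x ((hasDerivAt_id x).const_sub c))
  refine h.congr_deriv ?_
  ring

/-- The condition |x| < |c - x| is linear in x, so both sets are half-lines or empty, hence convex;
on each of them the derivative (1+α)(|x|^α - |c - x|^α) has a constant sign. -/
lemma injOn_phase_add_phase_sub {α : ℝ} (hα : 1 < α) (c : ℝ) :
    InjOn (fun x => phase α x + phase α (c - x)) {x | |x| < |c - x|} ∧
    InjOn (fun x => phase α x + phase α (c - x)) {x | |c - x| < |x|} := by
  have hd := hasDerivAt_phase_add_phase_sub hα c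
  have hc : Continuous fun x => phase α x + phase α (c - x) :=
    continuous_iff_continuousAt.2 fun x => (hd x).continuousAt
  have hlin : IsLinearMap ℝ fun x : ℝ => 2 * c * x :=
    ⟨fun x y => by ring, fun a x => by simp; ring⟩
  constructor
  · refine (strictAntiOn_of_deriv_neg ?_ hc.continuousOn fun x hx => ?_).injOn
    · have : {x : ℝ | |x| < |c - x|} = {x | 2 * c * x < c ^ 2} := by
        ext x; simp only [mem_ofPred_eq, abs_lt_abs_sub_iff, sub_pos]
      rw [this]
      exact convex_halfSpace_lt hlin _
    · have hx' : |x| < |c - x| := (interior_subset hx : x ∈ {x | |x| < |c - x|})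
      rw [(hd x).deriv]
      have := Real.rpow_lt_rpow (abs_nonneg x) hx' (by linarith : 0 < α)
      exact mul_neg_of_pos_of_neg (by linarith) (by linarith)
  · refine (strictMonoOn_of_deriv_pos ?_ hc.continuousOn fun x hx => ?_).injOn
    · have : {x : ℝ | |c - x| < |x|} = {x | c ^ 2 < 2 * c * x} := by
        ext x; simp only [mem_ofPred_eq, abs_sub_lt_abs_iff, sub_neg]
      rw [this]
      exact convex_halfSpace_gt hlin _
    · have hx' : |c - x| < |x| := (interior_subset hx : x ∈ {x | |c - x| < |x|})
      rw [(hd x).deriv]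
      have := Real.rpow_lt_rpow (abs_nonneg _) hx' (by linarith : 0 < α)
      exact mul_pos (by linarith) (by linarith)

/-- Up to the factor 1 + α ≥ 1 the kernel is the Jacobian of x ↦ φ(x) + φ(c - x). On each half-line
of injectivity the change of variables bounds the integral by that of ⟨a - y⟩^(-1-2ε) over y. -/
lemma lintegral_deriv_kernel_le {α : ℝ} (hα : 1 < α) (ε a c : ℝ) :
    ∫⁻ x : ℝ, ENNReal.ofReal |(|x| ^ α - |c - x| ^ α)|
      * ENNReal.ofReal (bracket (a - (phase α x + phase α (c - x))) ^ (-(1 + 2 * ε)))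
      ≤ 2 * bracketIntegral ε := by
  set h : ℝ → ℝ := fun x => phase α x + phase α (c - x) with hh
  set g : ℝ → ℝ≥0∞ := fun y => ENNReal.ofReal (bracket (a - y) ^ (-(1 + 2 * ε))) with hg
  have hgi : ∫⁻ y, g y = bracketIntegral ε :=
    lintegral_sub_left_eq_self (fun x => ENNReal.ofReal (bracket x ^ (-(1 + 2 * ε)))) a
  have key : ∀ S : Set ℝ, MeasurableSet S → InjOn h S →
      ∫⁻ x in S, ENNReal.ofReal |(|x| ^ α - |c - x| ^ α)| * g (h x) ≤ bracketIntegral ε := by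
    intro S hS hi
    have h1 := lintegral_image_eq_lintegral_abs_deriv_mul hS
      (fun x _ => (hasDerivAt_phase_add_phase_sub hα c x).hasDerivWithinAt) hi g
    rw [← hgi]
    refine le_trans ?_ (h1.symm.le.trans (setLIntegral_le_lintegral _ _))
    refine lintegral_mono fun x => ?_
    refine mul_le_mul_left (ENNReal.ofReal_le_ofReal ?_) _
    rw [abs_mul, abs_of_nonneg (by linarith : 0 ≤ 1 + α)]
    exact le_mul_of_one_le_left (abs_nonneg _) (by linarith)
  have hm1 : MeasurableSet {x : ℝ | |x| < |c - x|} := measurableSet_lt (by fun_prop) (by fun_prop)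
  have hm2 : MeasurableSet {x : ℝ | |c - x| < |x|} := measurableSet_lt (by fun_prop) (by fun_prop)
  obtain ⟨i1, i2⟩ := injOn_phase_add_phase_sub hα c
  have hle : ∀ x, ENNReal.ofReal |(|x| ^ α - |c - x| ^ α)| * g (h x) ≤
      {x : ℝ | |x| < |c - x|}.indicator
        (fun x => ENNReal.ofReal |(|x| ^ α - |c - x| ^ α)| * g (h x)) x
      + {x : ℝ | |c - x| < |x|}.indicator
        (fun x => ENNReal.ofReal |(|x| ^ α - |c - x| ^ α)| * g (h x)) x := by
    intro x
    rcases lt_trichotomy |x| |c - x| with hx | hx | hx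
    · rw [indicator_of_mem (show x ∈ {x : ℝ | |x| < |c - x|} from hx)]
      exact le_self_add
    · rw [hx]; simp
    · rw [indicator_of_mem (show x ∈ {x : ℝ | |c - x| < |x|} from hx)]
      exact le_add_self
  have hhm : Measurable h := by
    have := measurable_phase α
    fun_prop
  have hgm : Measurable g := (measurable_bracket_rpow _).comp (measurable_const.sub measurable_id)
  refine (lintegral_mono hle).trans ?_
  have hmm : Measurable fun x : ℝ => ENNReal.ofReal |(|x| ^ α - |c - x| ^ α)| * g (h x) :=
    Measurable.mul (by fun_prop) (hgm.comp hhm)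
  rw [lintegral_add_left (hmm.indicator hm1), lintegral_indicator hm1, lintegral_indicator hm2, two_mul]
  exact add_le_add (key _ hm1 i1) (key _ hm2 i2)

/-- An interval of length 8|c|^(-κ) times the height |c|^κ: the correction in `pairKernel` is
normalised for this. -/
lemma lintegral_near_kernel_le {κ c : ℝ} :
    ∫⁻ x : ℝ, ENNReal.ofReal (if |x - (c - x)| ≤ 8 * |c| ^ (-κ) then |c| ^ κ else 0) ≤ 8 := by
  set d : ℝ := |c| ^ (-κ) with hd
  have hd0 : 0 ≤ d := by positivity
  have h1 : ∀ x : ℝ, ENNReal.ofReal (if |x - (c - x)| ≤ 8 * d then |c| ^ κ else 0)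
      = (Icc (c / 2 - 4 * d) (c / 2 + 4 * d)).indicator (fun _ => ENNReal.ofReal (|c| ^ κ)) x := by
    intro x
    by_cases hx : |x - (c - x)| ≤ 8 * d
    · rw [if_pos hx, indicator_of_mem]
      rw [abs_le] at hx
      exact ⟨by linarith, by linarith⟩
    · rw [if_neg hx, indicator_of_notMem, ENNReal.ofReal_zero]
      rintro ⟨h1, h2⟩
      exact hx (abs_le.2 ⟨by linarith, by linarith⟩)
  simp_rw [h1]
  rw [lintegral_indicator measurableSet_Icc, setLIntegral_const, Real.volume_Icc,
    ← ENNReal.ofReal_mul (by positivity)]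
  rw [show (8 : ℝ≥0∞) = ENNReal.ofReal 8 by simp]
  refine ENNReal.ofReal_le_ofReal ?_
  have : |c| ^ κ * d ≤ 1 := by
    rw [hd, Real.rpow_neg (abs_nonneg c)]
    exact mul_inv_le_one
  nlinarith

/-- The constant bounding the integrals of `modKernel`. -/
noncomputable def kernelConst (ε : ℝ) : ℝ≥0∞ :=
  (2 * bracketIntegral ε + 8) * bracketIntegral ε

lemma kernelConst_lt_top {ε : ℝ} (hε : 0 < ε) : kernelConst ε < ⊤ := by
  have := bracketIntegral_lt_top hε
  unfold kernelConst
  refine ENNReal.mul_lt_top (ENNReal.add_lt_top.2 ⟨ENNReal.mul_lt_top (by simp) this, by simp⟩) this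

lemma bracket_rpow_le_one {ε : ℝ} (hε : 0 < ε) (x : ℝ) : bracket x ^ (-(1 + 2 * ε)) ≤ 1 :=
  Real.rpow_le_one_of_one_le_of_nonpos (one_le_bracket _) (by linarith)

lemma lintegral_pairKernel_le {α ε : ℝ} (hα : 1 < α) (hε : 0 < ε) (a c : ℝ) :
    ∫⁻ x : ℝ, ENNReal.ofReal (pairKernel α x (c - x))
      * ENNReal.ofReal (bracket (a - (phase α x + phase α (c - x))) ^ (-(1 + 2 * ε)))
      ≤ 2 * bracketIntegral ε + 8 := by
  have h1 : ∀ x : ℝ, ENNReal.ofReal (pairKernel α x (c - x))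
      * ENNReal.ofReal (bracket (a - (phase α x + phase α (c - x))) ^ (-(1 + 2 * ε))) ≤
      ENNReal.ofReal |(|x| ^ α - |c - x| ^ α)|
      * ENNReal.ofReal (bracket (a - (phase α x + phase α (c - x))) ^ (-(1 + 2 * ε)))
      + ENNReal.ofReal (if |x - (c - x)| ≤ 8 * |c| ^ (-((α - 1) / 2)) then |c| ^ ((α - 1) / 2)
        else 0) := by
    intro x
    unfold pairKernel
    rw [add_sub_cancel, ENNReal.ofReal_add (abs_nonneg _) (by split_ifs <;> positivity), add_mul]
    refine add_le_add le_rfl (mul_le_of_le_one_right' ?_)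
    rw [ENNReal.ofReal_le_one]
    exact bracket_rpow_le_one hε _
  refine (lintegral_mono h1).trans ?_
  have hm : Measurable fun x : ℝ => ENNReal.ofReal (bracket (a - (phase α x + phase α (c - x)))
      ^ (-(1 + 2 * ε))) := by
    have := measurable_phase α
    exact (measurable_bracket_rpow _).comp (by fun_prop)
  have hmm : Measurable fun x : ℝ => ENNReal.ofReal |(|x| ^ α - |c - x| ^ α)| * ENNReal.ofReal
      (bracket (a - (phase α x + phase α (c - x))) ^ (-(1 + 2 * ε))) :=
    Measurable.mul (by fun_prop) hm
  rw [lintegral_add_left hmm]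
  exact add_le_add (lintegral_deriv_kernel_le hα ε a c) lintegral_near_kernel_le

lemma measurable_modulation (α : ℝ) : Measurable (modulation α) := by
  have := measurable_phase α
  unfold modulation; fun_prop

lemma measurable_modKernel (α ε : ℝ) :
    Measurable fun p : (ℝ × ℝ) × ℝ × ℝ => modKernel α ε p.1 p.2 := by
  have h1 := measurable_modulation α
  have h2 := continuous_bracket.measurable
  have h3 := (measurable_pairKernel α).comp
    (f := fun p : (ℝ × ℝ) × ℝ × ℝ => (p.1.2, p.2.2)) (by fun_prop)
  unfold modKernel
  refine Measurable.mul h3 ?_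
  fun_prop

/-- Integrals of `modKernel` over the pairs of frequencies with given sum. -/
theorem lintegral_modKernel_le {α ε : ℝ} (hα : 1 < α) (hε : 0 < ε) (P : ℝ × ℝ) :
    ∫⁻ q : ℝ × ℝ, ENNReal.ofReal (modKernel α ε q (P - q)) ≤ kernelConst ε := by
  have hph := measurable_phase α
  have hm : Measurable fun q : ℝ × ℝ => ENNReal.ofReal (modKernel α ε q (P - q)) :=
    ((measurable_modKernel α ε).comp (f := fun q : ℝ × ℝ => (q, P - q)) (by fun_prop)).ennreal_ofReal
  have hpk : Measurable fun x : ℝ => ENNReal.ofReal (pairKernel α x (P.2 - x)) :=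
    ((measurable_pairKernel α).comp (f := fun x : ℝ => (x, P.2 - x)) (by fun_prop)).ennreal_ofReal
  rw [Measure.volume_eq_prod, lintegral_prod_symm' _ hm]
  have h1 : ∀ ξ : ℝ, ∫⁻ τ : ℝ, ENNReal.ofReal (modKernel α ε (τ, ξ) (P - (τ, ξ))) =
      ∫⁻ θ : ℝ, ENNReal.ofReal (bracket θ ^ (-(1 + 2 * ε))) *
        (ENNReal.ofReal (pairKernel α ξ (P.2 - ξ)) * ENNReal.ofReal
          (bracket (P.1 - θ - (phase α ξ + phase α (P.2 - ξ))) ^ (-(1 + 2 * ε)))) := by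
    intro ξ
    -- Shifting τ by φ(ξ) makes the first modulation the variable θ and the second P.1 - θ - φ(ξ) -
    -- φ(P.2 - ξ). After exchanging the integrals, the ξ-integral at fixed θ is the one already
    -- bounded.
    rw [← lintegral_add_right_eq_self _ (phase α ξ)]
    refine lintegral_congr fun θ => ?_
    unfold modKernel
    rw [ENNReal.ofReal_mul (pairKernel_nonneg _ _ _),
      ENNReal.ofReal_mul (Real.rpow_nonneg (bracket_pos _).le _)]
    simp only [modulation, add_sub_cancel_right, Prod.snd_sub, Prod.fst_sub]
    rw [mul_left_comm]
    congr 4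
    ring_nf
  simp_rw [h1]
  rw [lintegral_lintegral_swap]
  · calc _ ≤ ∫⁻ θ : ℝ, ENNReal.ofReal (bracket θ ^ (-(1 + 2 * ε)))
          * (2 * bracketIntegral ε + 8) := by
          refine lintegral_mono fun θ => ?_
          rw [lintegral_const_mul' _ _ ENNReal.ofReal_ne_top]
          gcongr
          exact lintegral_pairKernel_le hα hε _ _
      _ = kernelConst ε := by
          rw [lintegral_mul_const _ (measurable_bracket_rpow _)]
          unfold kernelConst bracketIntegral
          rw [mul_comm]
  · refine Measurable.aemeasurable ?_
    refine Measurable.mul ((measurable_bracket_rpow _).comp measurable_snd)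
      (Measurable.mul (hpk.comp measurable_fst) ((measurable_bracket_rpow _).comp ?_))
    fun_prop

/-! ### Bilinear operators on `L²` -/

lemma lintegral_mul_sq_le {X : Type*} [MeasurableSpace X] {μ : Measure X} {f g : X → ℝ≥0∞}
    (hf : AEMeasurable f μ) (hg : AEMeasurable g μ) :
    (∫⁻ x, f x * g x ∂μ) ^ 2 ≤ (∫⁻ x, f x ^ 2 ∂μ) * ∫⁻ x, g x ^ 2 ∂μ := by
  have h := ENNReal.lintegral_mul_le_Lp_mul_Lq μ Real.HolderConjugate.two_two hf hg
  simp only [Pi.mul_apply, ENNReal.rpow_two] at h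
  refine (pow_le_pow_left' h 2).trans (le_of_eq ?_)
  rw [mul_pow, ← ENNReal.rpow_natCast, ← ENNReal.rpow_natCast, ← ENNReal.rpow_mul,
    ← ENNReal.rpow_mul]
  norm_num

section Bilinear

variable {G : ℝ × ℝ → ℝ × ℝ → ℝ≥0∞} {f g : ℝ × ℝ → ℝ≥0∞} {K : ℝ≥0∞}

lemma lintegral_sq_convolution_mul (hf : Measurable f) (hg : Measurable g) :
    ∫⁻ p : ℝ × ℝ, ∫⁻ q : ℝ × ℝ, (f q * g (p - q)) ^ 2 = (∫⁻ q, f q ^ 2) * ∫⁻ q, g q ^ 2 := by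
  rw [lintegral_lintegral_swap (by fun_prop)]
  simp_rw [mul_pow]
  have : ∀ q : ℝ × ℝ, ∫⁻ p : ℝ × ℝ, f q ^ 2 * g (p - q) ^ 2 = f q ^ 2 * ∫⁻ p, g p ^ 2 := by
    intro q
    rw [lintegral_const_mul _ (by fun_prop)]
    congr 1
    exact lintegral_sub_right_eq_self (fun p => g p ^ 2) q
  simp_rw [this]
  rw [lintegral_mul_const _ (by fun_prop)]

/-- Cauchy–Schwarz in q at a fixed output p, with the kernel alone in one factor. -/
lemma lintegral_sq_le_of_fiber (hG : Measurable fun x : (ℝ × ℝ) × ℝ × ℝ => G x.1 x.2)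
    (hf : Measurable f) (hg : Measurable g) (hK : ∀ p, ∫⁻ q, G p q ^ 2 ≤ K) :
    ∫⁻ p : ℝ × ℝ, (∫⁻ q : ℝ × ℝ, G p q * (f q * g (p - q))) ^ 2 ≤
      K * ((∫⁻ q, f q ^ 2) * ∫⁻ q, g q ^ 2) := by
  rw [← lintegral_sq_convolution_mul hf hg, ← lintegral_const_mul _
    (Measurable.lintegral_prod_right' (f := fun x : (ℝ × ℝ) × ℝ × ℝ => (f x.2 * g (x.1 - x.2)) ^ 2)
      (by fun_prop))]
  refine lintegral_mono fun p => ?_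
  refine (lintegral_mul_sq_le (hG.comp (measurable_prodMk_left (x := p))).aemeasurable
    (by fun_prop)).trans ?_
  exact mul_le_mul_left (hK p) _

/-- Cauchy–Schwarz with f alone in one factor; substituting p = r + q in the other leaves the
squared kernel integrated over q at a fixed second input r. -/
lemma lintegral_sq_le_of_fiber_right (hG : Measurable fun x : (ℝ × ℝ) × ℝ × ℝ => G x.1 x.2)
    (hf : Measurable f) (hg : Measurable g) (hK : ∀ r, ∫⁻ q, G (r + q) q ^ 2 ≤ K) :
    ∫⁻ p : ℝ × ℝ, (∫⁻ q : ℝ × ℝ, G p q * (f q * g (p - q))) ^ 2 ≤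
      K * ((∫⁻ q, f q ^ 2) * ∫⁻ q, g q ^ 2) := by
  have hGp : ∀ p, Measurable (G p) := fun p => hG.comp (measurable_prodMk_left (x := p))
  have h1 : ∀ p : ℝ × ℝ, (∫⁻ q : ℝ × ℝ, G p q * (f q * g (p - q))) ^ 2 ≤
      (∫⁻ q, f q ^ 2) * ∫⁻ q, (G p q * g (p - q)) ^ 2 := by
    intro p
    have := hGp p
    refine le_trans (le_of_eq ?_) (lintegral_mul_sq_le (μ := volume) (f := f)
      (g := fun q => G p q * g (p - q)) (by fun_prop) (by fun_prop))
    congr 2; ext q; ring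
  have hm : Measurable fun x : (ℝ × ℝ) × ℝ × ℝ => (G x.1 x.2 * g (x.1 - x.2)) ^ 2 := by fun_prop
  have hm' : Measurable fun x : (ℝ × ℝ) × ℝ × ℝ => (G (x.2 + x.1) x.1 * g x.2) ^ 2 := by
    have := hG.comp (f := fun x : (ℝ × ℝ) × ℝ × ℝ => (x.2 + x.1, x.1)) (by fun_prop)
    exact (this.mul (by fun_prop)).pow_const 2
  refine (lintegral_mono h1).trans ?_
  rw [lintegral_const_mul _ (Measurable.lintegral_prod_right' hm), mul_left_comm]
  refine mul_le_mul_right ?_ _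
  rw [lintegral_lintegral_swap hm.aemeasurable]
  calc ∫⁻ q : ℝ × ℝ, ∫⁻ p : ℝ × ℝ, (G p q * g (p - q)) ^ 2
      = ∫⁻ q : ℝ × ℝ, ∫⁻ r : ℝ × ℝ, (G (r + q) q * g r) ^ 2 := by
        refine lintegral_congr fun q => ?_
        rw [← lintegral_add_right_eq_self _ q]
        simp
    _ = ∫⁻ r : ℝ × ℝ, ∫⁻ q : ℝ × ℝ, (G (r + q) q * g r) ^ 2 :=
        lintegral_lintegral_swap hm'.aemeasurable
    _ ≤ ∫⁻ r : ℝ × ℝ, K * g r ^ 2 := by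
        refine lintegral_mono fun r => ?_
        simp_rw [mul_pow]
        have : Measurable fun q : ℝ × ℝ => G (r + q) q ^ 2 :=
          (hG.comp (f := fun q : ℝ × ℝ => (r + q, q)) (by fun_prop)).pow_const 2
        rw [lintegral_mul_const _ this]
        exact mul_le_mul_left (hK r) _
    _ = _ := lintegral_const_mul _ (by fun_prop)

/-- Cauchy–Schwarz with g alone in one factor; in the other the squared kernel is integrated over
the output p at a fixed first input q. -/
lemma lintegral_sq_le_of_fiber_left (hG : Measurable fun x : (ℝ × ℝ) × ℝ × ℝ => G x.1 x.2)
    (hf : Measurable f) (hg : Measurable g) (hK : ∀ q, ∫⁻ p, G p q ^ 2 ≤ K) :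
    ∫⁻ p : ℝ × ℝ, (∫⁻ q : ℝ × ℝ, G p q * (f q * g (p - q))) ^ 2 ≤
      K * ((∫⁻ q, f q ^ 2) * ∫⁻ q, g q ^ 2) := by
  have hGp : ∀ p, Measurable (G p) := fun p => hG.comp (measurable_prodMk_left (x := p))
  have hgi : ∀ p : ℝ × ℝ, ∫⁻ q : ℝ × ℝ, g (p - q) ^ 2 = ∫⁻ q, g q ^ 2 := fun p =>
    lintegral_sub_left_eq_self (fun q => g q ^ 2) p
  have h1 : ∀ p : ℝ × ℝ, (∫⁻ q : ℝ × ℝ, G p q * (f q * g (p - q))) ^ 2 ≤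
      (∫⁻ q, g q ^ 2) * ∫⁻ q, (G p q * f q) ^ 2 := by
    intro p
    have := hGp p
    rw [← hgi p]
    refine le_trans (le_of_eq ?_) (lintegral_mul_sq_le (μ := volume) (f := fun q => g (p - q))
      (g := fun q => G p q * f q) (by fun_prop) (by fun_prop))
    congr 2; ext q; ring
  have hm : Measurable fun x : (ℝ × ℝ) × ℝ × ℝ => (G x.1 x.2 * f x.2) ^ 2 := by fun_prop
  refine (lintegral_mono h1).trans ?_
  rw [lintegral_const_mul _ (Measurable.lintegral_prod_right' hm), mul_comm (∫⁻ q, f q ^ 2),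
    mul_left_comm]
  refine mul_le_mul_right ?_ _
  rw [lintegral_lintegral_swap hm.aemeasurable]
  calc ∫⁻ q : ℝ × ℝ, ∫⁻ p : ℝ × ℝ, (G p q * f q) ^ 2
      ≤ ∫⁻ q : ℝ × ℝ, K * f q ^ 2 := by
        refine lintegral_mono fun q => ?_
        simp_rw [mul_pow]
        have : Measurable fun p : ℝ × ℝ => G p q ^ 2 :=
          (hG.comp (f := fun p : ℝ × ℝ => (p, q)) (by fun_prop)).pow_const 2
        rw [lintegral_mul_const _ this]
        exact mul_le_mul_left (hK q) _
    _ = _ := lintegral_const_mul _ (by fun_prop)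

end Bilinear


/-! ### The bilinear estimate -/

/-- The square of the norm of `X_{s,ω,b}`, as a function of the modulus of `ℱu`. -/
noncomputable def resEnergy (α s ω b : ℝ) (u : ℝ × ℝ → ℝ≥0∞) : ℝ≥0∞ :=
  ∫⁻ p, ENNReal.ofReal (resWeight α s ω b p) * u p ^ 2

/-- The modulus of `ξ (u * v)` for nonnegative functions. -/
noncomputable def derivConv (u v : ℝ × ℝ → ℝ≥0∞) (p : ℝ × ℝ) : ℝ≥0∞ :=
  ENNReal.ofReal |p.2| * ∫⁻ q, u q * v (p - q)

lemma measurable_ofReal_resWeight (α s ω b : ℝ) :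
    Measurable fun p => ENNReal.ofReal (resWeight α s ω b p) :=
  (measurable_resWeight α s ω b).ennreal_ofReal

lemma resWeight_nonneg (α s ω b : ℝ) (p : ℝ × ℝ) : 0 ≤ resWeight α s ω b p := by
  have h1 := bracket_pos p.2
  have h2 := bracket_pos (modulation α p)
  have h3 : 0 < ellipticWeight α p := bracket_pos _
  rw [resWeight_eq]; positivity

lemma measurable_derivConv {u v : ℝ × ℝ → ℝ≥0∞} (hu : Measurable u) (hv : Measurable v) :
    Measurable (derivConv u v) := by
  have : Measurable fun p : ℝ × ℝ => ∫⁻ q, u q * v (p - q) :=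
    Measurable.lintegral_prod_right' (f := fun x : (ℝ × ℝ) × ℝ × ℝ => u x.2 * v (x.1 - x.2))
      (by fun_prop)
  unfold derivConv
  fun_prop

lemma ae_snd_sub_ne_zero (p : ℝ × ℝ) : ∀ᵐ q : ℝ × ℝ, (p - q).2 ≠ 0 :=
  (quasiMeasurePreserving_sub_left_of_right_invariant (volume : Measure (ℝ × ℝ)) p).ae
    ae_snd_ne_zero

lemma add_add_sq_le (a b c : ℝ≥0∞) : (a + b + c) ^ 2 ≤ 9 * (a ^ 2 + b ^ 2 + c ^ 2) := by
  have h : ∀ m, a ≤ m → b ≤ m → c ≤ m → (a + b + c) ^ 2 ≤ 9 * m ^ 2 := by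
    intro m h1 h2 h3
    calc (a + b + c) ^ 2 ≤ (m + m + m) ^ 2 := by gcongr
      _ = 9 * m ^ 2 := by ring
  refine (h (max a (max b c)) (le_max_left _ _) ((le_max_left _ _).trans (le_max_right _ _))
    ((le_max_right _ _).trans (le_max_right _ _))).trans (mul_le_mul_right ?_ _)
  rcases max_choice a (max b c) with h1 | h1 <;> rw [h1]
  · exact le_self_add.trans le_self_add
  rcases max_choice b c with h2 | h2 <;> rw [h2]
  · exact le_add_self.trans le_self_add
  · exact le_add_self

lemma half_rpow_sq (a : ℝ≥0∞) : (a ^ (1 / 2 : ℝ)) ^ 2 = a := by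
  rw [← ENNReal.rpow_natCast, ← ENNReal.rpow_mul]; norm_num

lemma sq_half_rpow (a : ℝ≥0∞) : (a ^ 2) ^ (1 / 2 : ℝ) = a := by
  rw [← ENNReal.rpow_natCast, ← ENNReal.rpow_mul]; norm_num

lemma rpow_half_add_add_le (a b c : ℝ≥0∞) :
    (a + b + c) ^ (1 / 2 : ℝ) ≤ a ^ (1 / 2 : ℝ) + b ^ (1 / 2 : ℝ) + c ^ (1 / 2 : ℝ) :=
  (ENNReal.rpow_add_le_add_rpow _ _ (by norm_num) (by norm_num)).trans
    (add_le_add_left (ENNReal.rpow_add_le_add_rpow _ _ (by norm_num) (by norm_num)) _)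

/-- The constant of the bilinear estimate at the lowest regularity. -/
noncomputable def bilinearConst (ε : ℝ) : ℝ≥0∞ :=
  ENNReal.ofReal (Real.exp 250) * (27 * kernelConst ε)

lemma bilinearConst_lt_top {ε : ℝ} (hε : 0 < ε) : bilinearConst ε < ⊤ :=
  ENNReal.mul_lt_top ENNReal.ofReal_lt_top (ENNReal.mul_lt_top (by simp) (kernelConst_lt_top hε))

/-- Taking square roots in `multiplier_le`, with √(a+b+c) ≤ √a + √b + √c, separates the three
kernels into three bilinear operators. -/
lemma rpow_multiplier_le {α ω ρ ε : ℝ} (h : Admissible α ω ρ ε) {p q : ℝ × ℝ}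
    (hp : p.2 ≠ 0) (hq : q.2 ≠ 0) (hpq : (p - q).2 ≠ 0) :
    ENNReal.ofReal (resWeight α (-ρ) ω (-1 / 2 + 2 * ε) p) ^ (1 / 2 : ℝ) * ENNReal.ofReal |p.2| ≤
      ENNReal.ofReal (Real.exp 250) ^ (1 / 2 : ℝ)
      * (ENNReal.ofReal (modKernel α ε q (p - q)) ^ (1 / 2 : ℝ)
        + ENNReal.ofReal (modKernel α ε q (-p)) ^ (1 / 2 : ℝ)
        + ENNReal.ofReal (modKernel α ε (p - q) (-p)) ^ (1 / 2 : ℝ))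
      * (ENNReal.ofReal (resWeight α (-ρ) ω (1 / 2 + ε) q) ^ (1 / 2 : ℝ)
        * ENNReal.ofReal (resWeight α (-ρ) ω (1 / 2 + ε) (p - q)) ^ (1 / 2 : ℝ)) := by
  have h1 := multiplier_le h hq hpq (by simpa using hp)
  rw [add_sub_cancel q p, ← Prod.snd_add, add_sub_cancel q p] at h1
  have h2 := ENNReal.rpow_le_rpow (ENNReal.ofReal_le_ofReal h1) (by norm_num : (0:ℝ) ≤ 1 / 2)
  have n1 := modKernel_nonneg α ε q (p - q)
  have n2 := modKernel_nonneg α ε q (-p)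
  have n3 := modKernel_nonneg α ε (p - q) (-p)
  have w1 := resWeight_nonneg α (-ρ) ω (1 / 2 + ε) q
  have w2 := resWeight_nonneg α (-ρ) ω (1 / 2 + ε) (p - q)
  rw [← sq_abs, ENNReal.ofReal_mul (by positivity), ENNReal.ofReal_pow (abs_nonneg _),
    ENNReal.ofReal_mul (by positivity), ENNReal.ofReal_mul (by positivity),
    ENNReal.ofReal_mul w1, ENNReal.ofReal_add (by positivity) (by positivity),
    ENNReal.ofReal_add (by positivity) (by positivity),
    ENNReal.mul_rpow_of_nonneg _ _ (by norm_num), ENNReal.mul_rpow_of_nonneg _ _ (by norm_num),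
    ENNReal.mul_rpow_of_nonneg _ _ (by norm_num), ENNReal.mul_rpow_of_nonneg _ _ (by norm_num),
    sq_half_rpow] at h2
  rw [mul_comm]
  refine h2.trans ?_
  gcongr
  exact rpow_half_add_add_le _ _ _

lemma const_mul_lintegral_three_le {X : Type*} [MeasurableSpace X] {μ : Measure X}
    {k a b c : X → ℝ≥0∞} {A E : ℝ≥0∞} (hA : A ≠ ⊤) (hE : E ≠ ⊤) (ha : Measurable a)
    (hb : Measurable b) (h : ∀ᵐ x ∂μ, A * k x ≤ E * (a x + b x + c x)) :
    A * ∫⁻ x, k x ∂μ ≤ E * ((∫⁻ x, a x ∂μ) + (∫⁻ x, b x ∂μ) + ∫⁻ x, c x ∂μ) := by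
  rw [← lintegral_add_left ha, ← lintegral_add_left (show Measurable fun x => a x + b x from ha.add hb),
    ← lintegral_const_mul' _ _ hA,
    ← lintegral_const_mul' _ _ hE]
  exact lintegral_mono_ae h

/-- Each kernel involves two of the three points q, p - q, -p, whose total is zero. Fixing the third
point therefore fixes the sum of the two, as `lintegral_modKernel_le` requires, and this selects one
of the three Cauchy–Schwarz schemes for each kernel. The 27 in `bilinearConst` is 9 from squaring a
sum of three terms, times the three kernels. -/
theorem resEnergy_derivConv_le {α ω ρ ε : ℝ} (h : Admissible α ω ρ ε) {u v : ℝ × ℝ → ℝ≥0∞}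
    (hu : Measurable u) (hv : Measurable v) :
    resEnergy α (-ρ) ω (-1 / 2 + 2 * ε) (derivConv u v) ≤
      bilinearConst ε * (resEnergy α (-ρ) ω (1 / 2 + ε) u * resEnergy α (-ρ) ω (1 / 2 + ε) v) := by
  set W : ℝ × ℝ → ℝ≥0∞ := fun p => ENNReal.ofReal (resWeight α (-ρ) ω (1 / 2 + ε) p) ^ (1 / 2 : ℝ)
    with hW
  have hWm : Measurable W := (measurable_ofReal_resWeight _ _ _ _).pow_const _
  set f : ℝ × ℝ → ℝ≥0∞ := fun q => W q * u q with hf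
  set g : ℝ × ℝ → ℝ≥0∞ := fun q => W q * v q with hg
  have hfm : Measurable f := hWm.mul hu
  have hgm : Measurable g := hWm.mul hv
  have hfi : ∫⁻ q, f q ^ 2 = resEnergy α (-ρ) ω (1 / 2 + ε) u :=
    lintegral_congr fun q => by simp only [hf, hW, mul_pow, half_rpow_sq]
  have hgi : ∫⁻ q, g q ^ 2 = resEnergy α (-ρ) ω (1 / 2 + ε) v :=
    lintegral_congr fun q => by simp only [hg, hW, mul_pow, half_rpow_sq]
  have hk := measurable_modKernel α ε
  obtain ⟨G₁, hG₁⟩ : ∃ G : ℝ × ℝ → ℝ × ℝ → ℝ≥0∞, G = fun p q =>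
    ENNReal.ofReal (modKernel α ε q (p - q)) ^ (1 / 2 : ℝ) := ⟨_, rfl⟩
  obtain ⟨G₂, hG₂⟩ : ∃ G : ℝ × ℝ → ℝ × ℝ → ℝ≥0∞, G = fun p q =>
    ENNReal.ofReal (modKernel α ε q (-p)) ^ (1 / 2 : ℝ) := ⟨_, rfl⟩
  obtain ⟨G₃, hG₃⟩ : ∃ G : ℝ × ℝ → ℝ × ℝ → ℝ≥0∞, G = fun p q =>
    ENNReal.ofReal (modKernel α ε (p - q) (-p)) ^ (1 / 2 : ℝ) := ⟨_, rfl⟩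
  have m1 : Measurable fun x : (ℝ × ℝ) × ℝ × ℝ => G₁ x.1 x.2 := by
    rw [hG₁]
    exact (hk.comp (f := fun x : (ℝ × ℝ) × ℝ × ℝ => (x.2, x.1 - x.2))
      (by fun_prop)).ennreal_ofReal.pow_const _
  have m2 : Measurable fun x : (ℝ × ℝ) × ℝ × ℝ => G₂ x.1 x.2 := by
    rw [hG₂]
    exact (hk.comp (f := fun x : (ℝ × ℝ) × ℝ × ℝ => (x.2, -x.1))
      (by fun_prop)).ennreal_ofReal.pow_const _
  have m3 : Measurable fun x : (ℝ × ℝ) × ℝ × ℝ => G₃ x.1 x.2 := by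
    rw [hG₃]
    exact (hk.comp (f := fun x : (ℝ × ℝ) × ℝ × ℝ => (x.1 - x.2, -x.1))
      (by fun_prop)).ennreal_ofReal.pow_const _
  have b1 := lintegral_sq_le_of_fiber m1 hfm hgm (K := kernelConst ε) fun p => by
    simp only [hG₁, half_rpow_sq]
    exact lintegral_modKernel_le h.one_lt h.eps_pos p
  have b2 := lintegral_sq_le_of_fiber_right m2 hfm hgm (K := kernelConst ε) fun r => by
    simp only [hG₂, half_rpow_sq, neg_add']
    exact lintegral_modKernel_le h.one_lt h.eps_pos (-r)
  have b3 := lintegral_sq_le_of_fiber_left m3 hfm hgm (K := kernelConst ε) fun q => by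
    simp only [hG₃, half_rpow_sq]
    rw [← lintegral_neg_eq_self]
    refine le_trans (le_of_eq (lintegral_congr fun p => ?_))
      (lintegral_modKernel_le h.one_lt h.eps_pos (-q))
    rw [modKernel_comm, neg_neg, neg_sub_comm]
  rw [hfi, hgi] at b1 b2 b3
  have hne : ENNReal.ofReal (Real.exp 250) ^ (1 / 2 : ℝ) ≠ ⊤ :=
    ENNReal.rpow_ne_top_of_nonneg (by norm_num) ENNReal.ofReal_ne_top
  have hpt : ∀ᵐ p : ℝ × ℝ, ENNReal.ofReal (resWeight α (-ρ) ω (-1 / 2 + 2 * ε) p)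
      * derivConv u v p ^ 2 ≤ ENNReal.ofReal (Real.exp 250) * (9 *
        ((∫⁻ q, G₁ p q * (f q * g (p - q))) ^ 2 + (∫⁻ q, G₂ p q * (f q * g (p - q))) ^ 2
        + (∫⁻ q, G₃ p q * (f q * g (p - q))) ^ 2)) := by
    filter_upwards [ae_snd_ne_zero] with p hp
    have e1 : ENNReal.ofReal (resWeight α (-ρ) ω (-1 / 2 + 2 * ε) p) ^ (1 / 2 : ℝ)
        * derivConv u v p ≤ ENNReal.ofReal (Real.exp 250) ^ (1 / 2 : ℝ)
          * ((∫⁻ q, G₁ p q * (f q * g (p - q))) + (∫⁻ q, G₂ p q * (f q * g (p - q)))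
          + ∫⁻ q, G₃ p q * (f q * g (p - q))) := by
      have m1' : Measurable (G₁ p) := m1.comp (measurable_prodMk_left (x := p))
      have m2' : Measurable (G₂ p) := m2.comp (measurable_prodMk_left (x := p))
      have m4 : Measurable fun q => f q * g (p - q) := by fun_prop
      rw [derivConv, ← mul_assoc]
      refine const_mul_lintegral_three_le (ENNReal.mul_ne_top (ENNReal.rpow_ne_top_of_nonneg
        (by norm_num) ENNReal.ofReal_ne_top) ENNReal.ofReal_ne_top) hne (m1'.mul m4) (m2'.mul m4) ?_
      filter_upwards [ae_snd_ne_zero, ae_snd_sub_ne_zero p] with q hq hpq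
      refine (mul_le_mul_left (rpow_multiplier_le h hp hq hpq) _).trans (le_of_eq ?_)
      simp only [hG₁, hG₂, hG₃, hf, hg, hW]
      ring
    have e2 := pow_le_pow_left' e1 2
    rw [mul_pow, mul_pow, half_rpow_sq, half_rpow_sq] at e2
    refine e2.trans ?_
    gcongr
    exact add_add_sq_le _ _ _
  have hmi : ∀ {G : ℝ × ℝ → ℝ × ℝ → ℝ≥0∞}, (Measurable fun x : (ℝ × ℝ) × ℝ × ℝ => G x.1 x.2) →
      Measurable fun p => (∫⁻ q, G p q * (f q * g (p - q))) ^ 2 := by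
    intro G hG
    refine Measurable.pow_const ?_ 2
    exact Measurable.lintegral_prod_right'
      (f := fun x : (ℝ × ℝ) × ℝ × ℝ => G x.1 x.2 * (f x.2 * g (x.1 - x.2))) (by fun_prop)
  have n1 := hmi m1
  have n2 := hmi m2
  have n3 := hmi m3
  refine (lintegral_mono_ae hpt).trans ?_
  have n12 : Measurable fun p => (∫⁻ q, G₁ p q * (f q * g (p - q))) ^ 2
      + (∫⁻ q, G₂ p q * (f q * g (p - q))) ^ 2 := n1.add n2
  rw [lintegral_const_mul' _ _ ENNReal.ofReal_ne_top, lintegral_const_mul' _ _ (by simp),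
    lintegral_add_left n12, lintegral_add_left n1, bilinearConst, mul_assoc]
  refine mul_le_mul_right ?_ _
  refine (mul_le_mul_right (add_le_add (add_le_add b1 b2) b3) _).trans (le_of_eq ?_)
  ring

/-! #### Persistence of regularity -/

lemma resWeight_shift (α s ω b ρ : ℝ) (p : ℝ × ℝ) :
    resWeight α s ω b p = (bracket p.2 ^ (s + ρ)) ^ 2 * resWeight α (-ρ) ω b p := by
  have h1 := bracket_pos p.2
  rw [resWeight_eq, resWeight_eq, ← Real.rpow_natCast, ← Real.rpow_mul h1.le,
    show 2 * s - 2 * α * ω = (s + ρ) * (2 : ℕ) + (2 * -ρ - 2 * α * ω) by push_cast; ring,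
    Real.rpow_add h1]
  ring

lemma resWeight_mono {α s s' ω b : ℝ} (hs : s ≤ s') (p : ℝ × ℝ) :
    resWeight α s ω b p ≤ resWeight α s' ω b p := by
  rw [resWeight_shift α s' ω b (-s), neg_neg]
  refine le_mul_of_one_le_left (resWeight_nonneg _ _ _ _ _) ?_
  exact one_le_pow₀ (Real.one_le_rpow (one_le_bracket _) (by linarith))

lemma resEnergy_mono {α s s' ω b : ℝ} (hs : s ≤ s') (u : ℝ × ℝ → ℝ≥0∞) :
    resEnergy α s ω b u ≤ resEnergy α s' ω b u :=
  lintegral_mono fun p => mul_le_mul_left (ENNReal.ofReal_le_ofReal (resWeight_mono hs p)) _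

lemma resEnergy_shift (α s ω b ρ : ℝ) (u : ℝ × ℝ → ℝ≥0∞) :
    resEnergy α s ω b u
      = resEnergy α (-ρ) ω b fun p => ENNReal.ofReal (bracket p.2 ^ (s + ρ)) * u p := by
  have h1 := fun p : ℝ × ℝ => bracket_pos p.2
  refine lintegral_congr fun p => ?_
  have := Real.rpow_nonneg (h1 p).le (s + ρ)
  rw [resWeight_shift α s ω b ρ, ENNReal.ofReal_mul (by positivity), ENNReal.ofReal_pow this,
    mul_pow]
  ring

lemma bracket_add_rpow_le {c : ℝ} (hc : 0 ≤ c) (x y : ℝ) :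
    bracket (x + y) ^ c ≤ 2 ^ c * (bracket x ^ c + bracket y ^ c) := by
  have h1 := bracket_pos x
  have h2 := bracket_pos y
  have h3 : bracket (x + y) ≤ 2 * max (bracket x) (bracket y) := by
    linarith [bracket_add_le x y, abs_le_bracket y, le_max_left (bracket x) (bracket y),
      le_max_right (bracket x) (bracket y)]
  have h4 : 0 ≤ max (bracket x) (bracket y) := le_max_of_le_left h1.le
  calc bracket (x + y) ^ c ≤ (2 * max (bracket x) (bracket y)) ^ c :=
        Real.rpow_le_rpow (bracket_pos _).le h3 hc
    _ = 2 ^ c * max (bracket x) (bracket y) ^ c := Real.mul_rpow (by norm_num) h4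
    _ ≤ _ := by
        gcongr
        have e1 := Real.rpow_nonneg h1.le c
        have e2 := Real.rpow_nonneg h2.le c
        rcases max_choice (bracket x) (bracket y) with h | h <;> rw [h] <;> linarith

lemma add_sq_le (a b : ℝ≥0∞) : (a + b) ^ 2 ≤ 4 * (a ^ 2 + b ^ 2) := by
  rcases le_total a b with h | h
  · calc (a + b) ^ 2 ≤ (b + b) ^ 2 := by gcongr
      _ = 4 * b ^ 2 := by ring
      _ ≤ _ := mul_le_mul_right le_add_self _
  · calc (a + b) ^ 2 ≤ (a + a) ^ 2 := by gcongr
      _ = 4 * a ^ 2 := by ring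
      _ ≤ _ := mul_le_mul_right le_self_add _

/-- The constant of the bilinear estimate at regularity `s`. -/
noncomputable def tameConst (ε c : ℝ) : ℝ≥0∞ :=
  ENNReal.ofReal (2 ^ c) ^ 2 * (4 * bilinearConst ε)

lemma tameConst_lt_top {ε : ℝ} (hε : 0 < ε) (c : ℝ) : tameConst ε c < ⊤ :=
  ENNReal.mul_lt_top (ENNReal.pow_lt_top ENNReal.ofReal_lt_top)
    (ENNReal.mul_lt_top (by simp) (bilinearConst_lt_top hε))

/-- The bilinear estimate. -/
theorem resEnergy_derivConv_tame {α ω ρ ε s s₀ : ℝ} (h : Admissible α ω ρ ε) (hs₀ : -ρ ≤ s₀)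
    (hs : s₀ ≤ s) {u v : ℝ × ℝ → ℝ≥0∞} (hu : Measurable u) (hv : Measurable v) :
    resEnergy α s ω (-1 / 2 + 2 * ε) (derivConv u v) ≤ tameConst ε (s + ρ) *
      (resEnergy α s ω (1 / 2 + ε) u * resEnergy α s₀ ω (1 / 2 + ε) v
        + resEnergy α s₀ ω (1 / 2 + ε) u * resEnergy α s ω (1 / 2 + ε) v) := by
  have hc : 0 ≤ s + ρ := by linarith
  set B : ℝ × ℝ → ℝ≥0∞ := fun p => ENNReal.ofReal (bracket p.2 ^ (s + ρ)) with hB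
  have hBm : Measurable B := (measurable_bracket_rpow _).comp measurable_snd
  -- The weight ⟨ξ⟩^(s+ρ) is subadditive up to a constant, so the s + ρ additional derivatives fall
  -- on one factor and leave the other at regularity -ρ ≤ s₀.
  have hpt : ∀ p, B p * derivConv u v p ≤ ENNReal.ofReal (2 ^ (s + ρ)) *
      (derivConv (fun q => B q * u q) v p + derivConv u (fun q => B q * v q) p) := by
    intro p
    unfold derivConv
    rw [← mul_add, ← lintegral_add_left (by fun_prop), mul_left_comm (B p),
      mul_left_comm (ENNReal.ofReal (2 ^ (s + ρ)))]
    refine mul_le_mul_right ?_ (ENNReal.ofReal |p.2|)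
    rw [← lintegral_const_mul _ (by fun_prop), ← lintegral_const_mul _ (by fun_prop)]
    refine lintegral_mono fun q => ?_
    have h1 : B p ≤ ENNReal.ofReal (2 ^ (s + ρ)) * (B q + B (p - q)) := by
      have := bracket_add_rpow_le hc q.2 (p - q).2
      rw [← Prod.snd_add, add_sub_cancel] at this
      have e1 := Real.rpow_nonneg (bracket_pos q.2).le (s + ρ)
      have e2 := Real.rpow_nonneg (bracket_pos (p - q).2).le (s + ρ)
      simp only [hB]
      rw [← ENNReal.ofReal_add e1 e2, ← ENNReal.ofReal_mul (by positivity)]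
      exact ENNReal.ofReal_le_ofReal this
    refine (mul_le_mul_left h1 _).trans (le_of_eq ?_)
    ring
  have hBu : Measurable fun q => B q * u q := hBm.mul hu
  have hBv : Measurable fun q => B q * v q := hBm.mul hv
  have m1 := measurable_derivConv hBu hv
  have m2 := measurable_derivConv hu hBv
  have hw := measurable_ofReal_resWeight α (-ρ) ω (-1 / 2 + 2 * ε)
  rw [resEnergy_shift α s ω _ ρ]
  calc resEnergy α (-ρ) ω (-1 / 2 + 2 * ε) (fun p => B p * derivConv u v p)
      ≤ ∫⁻ p, (ENNReal.ofReal (2 ^ (s + ρ)) ^ 2 * 4) *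
        (ENNReal.ofReal (resWeight α (-ρ) ω (-1 / 2 + 2 * ε) p)
            * derivConv (fun q => B q * u q) v p ^ 2
        + ENNReal.ofReal (resWeight α (-ρ) ω (-1 / 2 + 2 * ε) p)
            * derivConv u (fun q => B q * v q) p ^ 2) := by
        refine lintegral_mono fun p => ?_
        have h1 := pow_le_pow_left' (hpt p) 2
        rw [mul_pow (ENNReal.ofReal (2 ^ (s + ρ)))] at h1
        have h2 := h1.trans (mul_le_mul_right (add_sq_le _ _) (ENNReal.ofReal (2 ^ (s + ρ)) ^ 2))
        refine (mul_le_mul_right h2 (ENNReal.ofReal (resWeight α (-ρ) ω (-1 / 2 + 2 * ε) p))).trans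
          (le_of_eq ?_)
        ring
    _ = (ENNReal.ofReal (2 ^ (s + ρ)) ^ 2 * 4) *
        (resEnergy α (-ρ) ω (-1 / 2 + 2 * ε) (derivConv (fun q => B q * u q) v)
        + resEnergy α (-ρ) ω (-1 / 2 + 2 * ε) (derivConv u (fun q => B q * v q))) := by
        rw [lintegral_const_mul _ (by fun_prop), lintegral_add_left (by fun_prop)]
        rfl
    _ ≤ (ENNReal.ofReal (2 ^ (s + ρ)) ^ 2 * 4) *
        (bilinearConst ε * (resEnergy α s ω (1 / 2 + ε) u * resEnergy α s₀ ω (1 / 2 + ε) v)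
        + bilinearConst ε * (resEnergy α s₀ ω (1 / 2 + ε) u * resEnergy α s ω (1 / 2 + ε) v)) := by
        refine mul_le_mul_right (add_le_add ?_ ?_) _
        · refine (resEnergy_derivConv_le h hBu hv).trans (mul_le_mul_right ?_ _)
          rw [resEnergy_shift α s ω _ ρ]
          exact mul_le_mul_right (resEnergy_mono hs₀ v) _
        · refine (resEnergy_derivConv_le h hu hBv).trans (mul_le_mul_right ?_ _)
          rw [resEnergy_shift α s ω _ ρ v]
          exact mul_le_mul_left (resEnergy_mono hs₀ u) _
    _ = _ := by unfold tameConst; ring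


/-! ### Weighted `L²` spaces -/

section Weighted

variable {X : Type*} [MeasurableSpace X] {μ : Measure X} {g : X → ℝ≥0∞}

lemma eLpNorm_withDensity_sq (hg : Measurable g) (hg' : ∀ x, g x < ⊤) (f : X → ℂ) :
    eLpNorm f 2 (μ.withDensity g) ^ 2 = ∫⁻ x, g x * ‖f x‖ₑ ^ 2 ∂μ := by
  rw [eLpNorm_eq_lintegral_rpow_enorm_toReal (by norm_num) (by norm_num)]
  simp only [ENNReal.toReal_ofNat, ENNReal.rpow_two]
  rw [half_rpow_sq, lintegral_withDensity_eq_lintegral_mul_non_measurable _ hg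
    (Eventually.of_forall hg')]
  rfl

lemma le_of_sq_le_sq_ennreal {a b : ℝ≥0∞} (h : a ^ 2 ≤ b ^ 2) : a ≤ b :=
  (ENNReal.pow_le_pow_left_iff (by norm_num)).1 h

end Weighted

/-! ### Bounded linear and bilinear operators from formulas on representatives -/

section Builders

variable {X Y Z : Type*} [MeasurableSpace X] [MeasurableSpace Y] [MeasurableSpace Z]
  {μ : Measure X} {ν : Measure Y} {κ : Measure Z}

/-- A linear operator on functions which is bounded on `L²` defines an operator on `L²`. -/
lemma exists_clm_of_bound (T : (X → ℂ) → Y → ℂ) (C : ℝ)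
    (hm : ∀ U : Lp ℂ 2 μ, AEStronglyMeasurable (T U) ν)
    (hb : ∀ U : Lp ℂ 2 μ, eLpNorm (T U) 2 ν ≤ ENNReal.ofReal C * ‖U‖ₑ)
    (hadd : ∀ U V : Lp ℂ 2 μ, T (U + V : Lp ℂ 2 μ) =ᵐ[ν] fun y => T U y + T V y)
    (hsmul : ∀ (c : ℂ) (U : Lp ℂ 2 μ), T (c • U : Lp ℂ 2 μ) =ᵐ[ν] fun y => c * T U y) :
    ∃ L : Lp ℂ 2 μ →L[ℂ] Lp ℂ 2 ν, (∀ U, L U =ᵐ[ν] T U) ∧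
      ∀ U, ‖L U‖ₑ ≤ ENNReal.ofReal C * ‖U‖ₑ := by
  have hmem : ∀ U : Lp ℂ 2 μ, MemLp (T U) 2 ν := fun U =>
    ⟨hm U, (hb U).trans_lt (ENNReal.mul_lt_top ENNReal.ofReal_lt_top enorm_lt_top)⟩
  have hbd : ∀ U, ‖(hmem U).toLp (T U)‖ₑ ≤ ENNReal.ofReal C * ‖U‖ₑ := fun U => by
    rw [Lp.enorm_toLp]; exact hb U
  let L₀ : Lp ℂ 2 μ →ₗ[ℂ] Lp ℂ 2 ν :=
    { toFun := fun U => (hmem U).toLp (T U)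
      map_add' := by
        intro U V
        rw [← MemLp.toLp_add, MemLp.toLp_eq_toLp_iff]
        exact hadd U V
      map_smul' := by
        intro c U
        rw [RingHom.id_apply, ← MemLp.toLp_const_smul, MemLp.toLp_eq_toLp_iff]
        exact hsmul c U }
  have hL₀ : ∀ U, ‖L₀ U‖ ≤ max C 0 * ‖U‖ := by
    intro U
    have := ENNReal.toReal_mono (ENNReal.mul_ne_top ENNReal.ofReal_ne_top enorm_ne_top) (hbd U)
    rwa [ENNReal.toReal_mul, toReal_enorm, toReal_enorm, ENNReal.toReal_ofReal'] at this
  exact ⟨L₀.mkContinuous _ hL₀, fun U => (hmem U).coeFn_toLp, hbd⟩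

/-- A bilinear operator on functions which is bounded on `L²` defines an operator on `L²`. -/
lemma exists_bilinear_of_bound (T : (X → ℂ) → (X → ℂ) → Y → ℂ) (C : ℝ)
    (hm : ∀ U V : Lp ℂ 2 μ, AEStronglyMeasurable (T U V) ν)
    (hb : ∀ U V : Lp ℂ 2 μ, eLpNorm (T U V) 2 ν ≤ ENNReal.ofReal C * ‖U‖ₑ * ‖V‖ₑ)
    (hadd : ∀ U V W : Lp ℂ 2 μ, T (U + V : Lp ℂ 2 μ) W =ᵐ[ν] fun y => T U W y + T V W y)
    (hsmul : ∀ (c : ℂ) (U W : Lp ℂ 2 μ), T (c • U : Lp ℂ 2 μ) W =ᵐ[ν] fun y => c * T U W y)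
    (hadd' : ∀ W U V : Lp ℂ 2 μ, T W (U + V : Lp ℂ 2 μ) =ᵐ[ν] fun y => T W U y + T W V y)
    (hsmul' : ∀ (c : ℂ) (W U : Lp ℂ 2 μ), T W (c • U : Lp ℂ 2 μ) =ᵐ[ν] fun y => c * T W U y) :
    ∃ L : Lp ℂ 2 μ →L[ℂ] Lp ℂ 2 μ →L[ℂ] Lp ℂ 2 ν, ∀ U V, L U V =ᵐ[ν] T U V := by
  have hmem : ∀ U V : Lp ℂ 2 μ, MemLp (T U V) 2 ν := fun U V =>
    ⟨hm U V, (hb U V).trans_lt (ENNReal.mul_lt_top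
      (ENNReal.mul_lt_top ENNReal.ofReal_lt_top enorm_lt_top) enorm_lt_top)⟩
  have hbd : ∀ U V, ‖(hmem U V).toLp (T U V)‖ₑ ≤ ENNReal.ofReal C * ‖U‖ₑ * ‖V‖ₑ := fun U V => by
    rw [Lp.enorm_toLp]; exact hb U V
  let L₀ : Lp ℂ 2 μ →ₗ[ℂ] Lp ℂ 2 μ →ₗ[ℂ] Lp ℂ 2 ν :=
    LinearMap.mk₂ ℂ (fun U V => (hmem U V).toLp (T U V))
      (by
        intro U V W
        rw [← MemLp.toLp_add, MemLp.toLp_eq_toLp_iff]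
        exact hadd U V W)
      (by
        intro c U V
        rw [← MemLp.toLp_const_smul, MemLp.toLp_eq_toLp_iff]
        exact hsmul c U V)
      (by
        intro W U V
        rw [← MemLp.toLp_add, MemLp.toLp_eq_toLp_iff]
        exact hadd' W U V)
      (by
        intro c W U
        rw [← MemLp.toLp_const_smul, MemLp.toLp_eq_toLp_iff]
        exact hsmul' c W U)
  have hL₀ : ∀ U V, ‖L₀ U V‖ ≤ max C 0 * ‖U‖ * ‖V‖ := by
    intro U V
    have := ENNReal.toReal_mono (ENNReal.mul_ne_top (ENNReal.mul_ne_top ENNReal.ofReal_ne_top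
      enorm_ne_top) enorm_ne_top) (hbd U V)
    rwa [ENNReal.toReal_mul, ENNReal.toReal_mul, toReal_enorm, toReal_enorm, toReal_enorm,
      ENNReal.toReal_ofReal'] at this
  exact ⟨L₀.mkContinuous₂ _ hL₀, fun U V => (hmem U V).coeFn_toLp⟩

end Builders

/-! ### The spaces `X_{s,ω,b}` -/

variable {α s s₀ ω b ε ρ : ℝ}

lemma resMeasure_ac (α s ω b : ℝ) : resMeasure α s ω b ≪ (volume : Measure (ℝ × ℝ)) :=
  withDensity_absolutelyContinuous _ _

lemma ae_volume_of_ae_resMeasure {P : ℝ × ℝ → Prop} (h : ∀ᵐ p ∂(resMeasure α s ω b), P p) :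
    ∀ᵐ p : ℝ × ℝ, P p := (volume_ac_resMeasure α s ω b).ae_le h

lemma ae_resMeasure_of_ae_volume {P : ℝ × ℝ → Prop} (h : ∀ᵐ p : ℝ × ℝ, P p) :
    ∀ᵐ p ∂(resMeasure α s ω b), P p := (resMeasure_ac α s ω b).ae_le h

lemma eLpNorm_resMeasure_sq (f : ℝ × ℝ → ℂ) :
    eLpNorm f 2 (resMeasure α s ω b) ^ 2 = resEnergy α s ω b fun p => ‖f p‖ₑ :=
  eLpNorm_withDensity_sq (measurable_ofReal_resWeight _ _ _ _) (fun _ => ENNReal.ofReal_lt_top) f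

lemma resSpace_enorm_sq (U : ResSpace α s ω b) :
    ‖U‖ₑ ^ 2 = resEnergy α s ω b fun p => ‖U p‖ₑ := by
  rw [Lp.enorm_def, eLpNorm_resMeasure_sq]

lemma measurable_resSpace (U : ResSpace α s ω b) : Measurable (U : ℝ × ℝ → ℂ) :=
  (Lp.stronglyMeasurable U).measurable

lemma ae_lt_top_of_resEnergy {u : ℝ × ℝ → ℝ≥0∞} (hu : Measurable u)
    (h : resEnergy α s ω b u < ⊤) : ∀ᵐ p : ℝ × ℝ, u p < ⊤ := by
  have h1 := ae_lt_top ((measurable_ofReal_resWeight α s ω b).mul (hu.pow_const 2)) h.ne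
  filter_upwards [h1, ae_snd_ne_zero] with p hp hp'
  by_contra hc
  rw [not_lt, top_le_iff] at hc
  have : ENNReal.ofReal (resWeight α s ω b p) ≠ 0 := by
    simpa using resWeight_pos α s ω b hp'
  simp [Pi.mul_apply, hc, ENNReal.mul_top this] at hp

/-- The inclusion of `X_{s,ω,b}` in `X_{s₀,ω,b}`. -/
lemma exists_inclusion (α ω b : ℝ) (hs : s₀ ≤ s) :
    ∃ J : ResSpace α s ω b →L[ℂ] ResSpace α s₀ ω b, (∀ U, J U =ᵐ[volume] (U : ℝ × ℝ → ℂ)) ∧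
      ∀ U, ‖J U‖ₑ ≤ ‖U‖ₑ := by
  obtain ⟨J, h1, h2⟩ := exists_clm_of_bound (μ := resMeasure α s ω b) (ν := resMeasure α s₀ ω b)
    (fun f => f) 1 (fun U => (measurable_resSpace U).aestronglyMeasurable)
    (fun U => by
      rw [ENNReal.ofReal_one, one_mul]
      refine le_of_sq_le_sq_ennreal ?_
      rw [eLpNorm_resMeasure_sq, resSpace_enorm_sq]
      exact resEnergy_mono hs _)
    (fun U V => ae_resMeasure_of_ae_volume (ae_volume_of_ae_resMeasure (Lp.coeFn_add U V)))
    (fun c U => ae_resMeasure_of_ae_volume (ae_volume_of_ae_resMeasure (Lp.coeFn_smul c U)))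
  refine ⟨J, fun U => ae_volume_of_ae_resMeasure (h1 U), fun U => ?_⟩
  simpa using h2 U

/-! ### The nonlinear term -/

/-- The Fourier transform of `∂_x(u v)`. -/
noncomputable def dxMul (U V : ℝ × ℝ → ℂ) (p : ℝ × ℝ) : ℂ :=
  Complex.I * p.2 * ((2 * Real.pi : ℝ) : ℂ)⁻¹ * ∫ q : ℝ × ℝ, U q * V (p - q)

lemma measurable_dxMul {U V : ℝ × ℝ → ℂ} (hU : Measurable U) (hV : Measurable V) :
    Measurable (dxMul U V) := by
  have h : StronglyMeasurable fun x : (ℝ × ℝ) × ℝ × ℝ => U x.2 * V (x.1 - x.2) :=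
    Measurable.stronglyMeasurable (by fun_prop)
  have h2 := (h.integral_prod_right' (ν := (volume : Measure (ℝ × ℝ)))).measurable
  unfold dxMul
  refine Measurable.mul ?_ h2
  fun_prop

lemma enorm_dxMul_le (U V : ℝ × ℝ → ℂ) (p : ℝ × ℝ) :
    ‖dxMul U V p‖ₑ ≤ derivConv (fun q => ‖U q‖ₑ) (fun q => ‖V q‖ₑ) p := by
  unfold dxMul derivConv
  rw [enorm_mul]
  refine mul_le_mul' ?_ ((enorm_integral_le_lintegral_enorm _).trans (by simp [enorm_mul]))
  rw [← ofReal_norm]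
  refine ENNReal.ofReal_le_ofReal ?_
  rw [norm_mul, norm_mul, Complex.norm_I, one_mul, norm_inv, Complex.norm_real, Complex.norm_real,
    Real.norm_eq_abs, Real.norm_eq_abs]
  refine mul_le_of_le_one_right (abs_nonneg _) (inv_le_one_of_one_le₀ ?_)
  rw [abs_of_pos (by positivity)]
  linarith [Real.pi_gt_three]

lemma dxMul_congr {U U' V V' : ℝ × ℝ → ℂ} (hU : U =ᵐ[volume] U') (hV : V =ᵐ[volume] V') :
    dxMul U V = dxMul U' V' := by
  ext p
  unfold dxMul
  congr 1
  refine integral_congr_ae ?_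
  filter_upwards [hU, (quasiMeasurePreserving_sub_left_of_right_invariant
    (volume : Measure (ℝ × ℝ)) p).ae hV] with q h1 h2
  rw [h1, h2]

lemma resEnergy_dxMul_le (h : Admissible α ω ρ ε) (hs₀ : -ρ ≤ s₀) (hs : s₀ ≤ s)
    (U V : ResSpace α s ω (1 / 2 + ε)) :
    resEnergy α s ω (-1 / 2 + 2 * ε) (derivConv (fun q => ‖U q‖ₑ) (fun q => ‖V q‖ₑ)) ≤
      tameConst ε (s + ρ) *
      (‖U‖ₑ ^ 2 * resEnergy α s₀ ω (1 / 2 + ε) (fun q => ‖V q‖ₑ)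
        + resEnergy α s₀ ω (1 / 2 + ε) (fun q => ‖U q‖ₑ) * ‖V‖ₑ ^ 2) := by
  rw [resSpace_enorm_sq, resSpace_enorm_sq]
  exact resEnergy_derivConv_tame h hs₀ hs (measurable_resSpace U).enorm (measurable_resSpace V).enorm

lemma resEnergy_dxMul_lt_top (h : Admissible α ω ρ ε) (hs : -ρ ≤ s)
    (U V : ResSpace α s ω (1 / 2 + ε)) :
    resEnergy α s ω (-1 / 2 + 2 * ε) (derivConv (fun q => ‖U q‖ₑ) (fun q => ‖V q‖ₑ)) < ⊤ := by
  refine (resEnergy_dxMul_le h hs le_rfl U V).trans_lt ?_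
  rw [← resSpace_enorm_sq, ← resSpace_enorm_sq]
  have e1 : ‖U‖ₑ ^ 2 < ⊤ := ENNReal.pow_lt_top enorm_lt_top
  have e2 : ‖V‖ₑ ^ 2 < ⊤ := ENNReal.pow_lt_top enorm_lt_top
  exact ENNReal.mul_lt_top (tameConst_lt_top h.eps_pos _)
    (ENNReal.add_lt_top.2 ⟨ENNReal.mul_lt_top e1 e2, ENNReal.mul_lt_top e1 e2⟩)

/-- The bilinear estimate bounds the convolution of the moduli, times |ξ|, in a weighted L² space;
it is therefore finite almost everywhere. -/
lemma ae_integrable_convolution (h : Admissible α ω ρ ε) (hs : -ρ ≤ s)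
    (U V : ResSpace α s ω (1 / 2 + ε)) :
    ∀ᵐ p : ℝ × ℝ, Integrable fun q : ℝ × ℝ => U q * V (p - q) := by
  have hU := measurable_resSpace U
  have hV := measurable_resSpace V
  filter_upwards [ae_lt_top_of_resEnergy (measurable_derivConv hU.enorm hV.enorm)
    (resEnergy_dxMul_lt_top h hs U V), ae_snd_ne_zero] with p hp hp'
  refine ⟨by fun_prop, ?_⟩
  have : ENNReal.ofReal |p.2| ≠ 0 := by simpa using hp'
  unfold HasFiniteIntegral
  simp_rw [enorm_mul]
  by_contra hc
  rw [not_lt, top_le_iff] at hc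
  simp [derivConv, hc, ENNReal.mul_top this] at hp

/-- The bilinear operator `(u, v) ↦ ∂_x(u v)`. -/
theorem exists_nonlinearity (h : Admissible α ω ρ ε) (hs : -ρ ≤ s) :
    ∃ B : ResSpace α s ω (1 / 2 + ε) →L[ℂ] ResSpace α s ω (1 / 2 + ε) →L[ℂ]
        ResSpace α s ω (-1 / 2 + 2 * ε),
      ∀ U V, B U V =ᵐ[volume] dxMul U V := by
  have hqmp := fun p : ℝ × ℝ =>
    quasiMeasurePreserving_sub_left_of_right_invariant (volume : Measure (ℝ × ℝ)) p
  have hadd : ∀ U V : ResSpace α s ω (1 / 2 + ε), ∀ᵐ q : ℝ × ℝ,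
      (U + V : ResSpace α s ω (1 / 2 + ε)) q = U q + V q := fun U V =>
    ae_volume_of_ae_resMeasure (Lp.coeFn_add U V)
  have hsmul : ∀ (c : ℂ) (U : ResSpace α s ω (1 / 2 + ε)), ∀ᵐ q : ℝ × ℝ,
      (c • U : ResSpace α s ω (1 / 2 + ε)) q = c * U q := fun c U =>
    ae_volume_of_ae_resMeasure (Lp.coeFn_smul c U)
  obtain ⟨B, hB⟩ := exists_bilinear_of_bound (μ := resMeasure α s ω (1 / 2 + ε))
    (ν := resMeasure α s ω (-1 / 2 + 2 * ε)) dxMul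
    -- For s₀ = s the two terms of the tame estimate coincide, hence the factor 2.
    (Real.sqrt (2 * (tameConst ε (s + ρ)).toReal))
    (fun U V => (measurable_dxMul (measurable_resSpace U)
      (measurable_resSpace V)).aestronglyMeasurable)
    (fun U V => by
      refine le_of_sq_le_sq_ennreal ?_
      have h1 : resEnergy α s ω (-1 / 2 + 2 * ε) (fun p => ‖dxMul U V p‖ₑ) ≤
          resEnergy α s ω (-1 / 2 + 2 * ε) (derivConv (fun q => ‖U q‖ₑ) (fun q => ‖V q‖ₑ)) :=
        lintegral_mono fun p => mul_le_mul_right (pow_le_pow_left' (enorm_dxMul_le _ _ _) 2) _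
      rw [eLpNorm_resMeasure_sq]
      refine h1.trans ((resEnergy_dxMul_le h hs le_rfl U V).trans (le_of_eq ?_))
      rw [← resSpace_enorm_sq, ← resSpace_enorm_sq, mul_pow, mul_pow,
        ← ENNReal.ofReal_pow (Real.sqrt_nonneg _), Real.sq_sqrt (by positivity),
        ENNReal.ofReal_mul (by norm_num), ENNReal.ofReal_toReal (tameConst_lt_top h.eps_pos _).ne,
        ENNReal.ofReal_ofNat]
      ring)
    (fun U V W => by
      refine ae_resMeasure_of_ae_volume ?_
      filter_upwards [ae_integrable_convolution h hs U W, ae_integrable_convolution h hs V W]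
        with p h1 h2
      unfold dxMul
      rw [← mul_add, ← integral_add h1 h2]
      congr 1
      refine integral_congr_ae ?_
      filter_upwards [hadd U V] with q hq
      rw [hq, add_mul])
    (fun c U W => by
      refine Eventually.of_forall fun p => ?_
      unfold dxMul
      beta_reduce
      rw [mul_left_comm, ← integral_const_mul (μ := (volume : Measure (ℝ × ℝ))) c]
      congr 1
      refine integral_congr_ae ?_
      filter_upwards [hsmul c U] with q hq
      rw [hq, mul_assoc])
    (fun W U V => by
      refine ae_resMeasure_of_ae_volume ?_
      filter_upwards [ae_integrable_convolution h hs W U, ae_integrable_convolution h hs W V]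
        with p h1 h2
      unfold dxMul
      rw [← mul_add, ← integral_add h1 h2]
      congr 1
      refine integral_congr_ae ?_
      filter_upwards [(hqmp p).ae (hadd U V)] with q hq
      rw [hq, mul_add])
    (fun c W U => by
      refine Eventually.of_forall fun p => ?_
      unfold dxMul
      beta_reduce
      rw [mul_left_comm, ← integral_const_mul (μ := (volume : Measure (ℝ × ℝ))) c]
      congr 1
      refine integral_congr_ae ?_
      filter_upwards [(hqmp p).ae (hsmul c U)] with q hq
      rw [hq, mul_left_comm])
  exact ⟨B, fun U V => ae_volume_of_ae_resMeasure (hB U V)⟩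


/-! ### The Fourier transform of the cutoff -/

/-- `Ψ` is the Fourier transform of `ψ`, normalised so that `ψ(t) = ∫ exp(i t σ) Ψ(σ) dσ`, and it
decays rapidly together with its difference quotients. -/
structure IsProfile (ψ : ℝ → ℝ) (Ψ : ℝ → ℂ) (C : ℝ) : Prop where
  continuous : Continuous Ψ
  const_nonneg : 0 ≤ C
  norm_le : ∀ x, ‖Ψ x‖ ≤ C * bracket x ^ (-4 : ℝ)
  norm_sub_le : ∀ x y, ‖Ψ (x - y) - Ψ x‖ ≤
    C * (|y| * (bracket y)⁻¹ * (bracket (x - y) ^ (-4 : ℝ) + bracket x ^ (-4 : ℝ)))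
  inversion : ∀ t : ℝ, ∫ σ : ℝ, Complex.exp (Complex.I * t * σ) * Ψ σ = ψ t

lemma bracket_le_one_add_abs_pow (x : ℝ) (k : ℕ) : bracket x ^ k ≤ (1 + |x|) ^ k :=
  pow_le_pow_left₀ (bracket_pos x).le (bracket_le_one_add x) k

lemma bracket_rpow_neg_four (x : ℝ) : bracket x ^ (-4 : ℝ) = (bracket x ^ 4)⁻¹ := by
  rw [Real.rpow_neg (bracket_pos x).le]
  norm_cast

lemma schwartz_norm_le (f : SchwartzMap ℝ ℂ) :
    ∃ C, 0 ≤ C ∧ ∀ x, ‖f x‖ ≤ C * bracket x ^ (-4 : ℝ) := by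
  obtain ⟨C, hC⟩ : ∃ C, ∀ x, ‖f x‖ ≤ C * bracket x ^ (-4 : ℝ) := by
    refine ⟨2 ^ 4 * ((Finset.Iic (4, 0)).sup fun m => SchwartzMap.seminorm ℂ m.1 m.2) f,
      fun x => ?_⟩
    have h := SchwartzMap.one_add_le_sup_seminorm_apply (𝕜 := ℂ) (m := (4, 0)) (k := 4) (n := 0)
      le_rfl le_rfl f x
    rw [norm_iteratedFDeriv_zero, Real.norm_eq_abs] at h
    rw [bracket_rpow_neg_four, ← div_eq_mul_inv, le_div_iff₀ (pow_pos (bracket_pos x) 4), mul_comm]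
    exact (mul_le_mul_of_nonneg_right (bracket_le_one_add_abs_pow x 4) (norm_nonneg _)).trans h
  refine ⟨|C|, abs_nonneg C, fun x => (hC x).trans ?_⟩
  exact mul_le_mul_of_nonneg_right (le_abs_self C) (Real.rpow_nonneg (bracket_pos x).le _)

/-- For |y| ≥ 1 the factor |y|⟨y⟩⁻¹ is at least 1/2 and the triangle inequality suffices. For |y| ≤
1 the mean value theorem applies: brackets change by at most a factor 4 along the segment, whence
256 = 4⁴, and 512 = 2 · 256 because ⟨y⟩ ≤ 2. -/
lemma schwartz_norm_sub_le (f : SchwartzMap ℝ ℂ) :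
    ∃ C, 0 ≤ C ∧ ∀ x y, ‖f (x - y) - f x‖ ≤
      C * (|y| * (bracket y)⁻¹ * (bracket (x - y) ^ (-4 : ℝ) + bracket x ^ (-4 : ℝ))) := by
  obtain ⟨C₁, h₁, hf⟩ := schwartz_norm_le f
  obtain ⟨C₂, h₂, hf'⟩ := schwartz_norm_le (SchwartzMap.derivCLM ℂ ℂ f)
  refine ⟨2 * C₁ + 512 * C₂, by positivity, fun x y => ?_⟩
  have b1 := bracket_pos y
  have e1 : 0 ≤ bracket (x - y) ^ (-4 : ℝ) := Real.rpow_nonneg (bracket_pos _).le _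
  have e2 : 0 ≤ bracket x ^ (-4 : ℝ) := Real.rpow_nonneg (bracket_pos _).le _
  rcases le_total 1 |y| with hy | hy
  · have h3 : 1 / 2 ≤ |y| * (bracket y)⁻¹ := by
      rw [← div_eq_mul_inv, le_div_iff₀ b1]
      linarith [bracket_le_one_add y]
    calc ‖f (x - y) - f x‖ ≤ ‖f (x - y)‖ + ‖f x‖ := norm_sub_le _ _
      _ ≤ C₁ * bracket (x - y) ^ (-4 : ℝ) + C₁ * bracket x ^ (-4 : ℝ) := add_le_add (hf _) (hf _)
      _ = 2 * C₁ * (1 / 2 * (bracket (x - y) ^ (-4 : ℝ) + bracket x ^ (-4 : ℝ))) := by ring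
      _ ≤ (2 * C₁ + 512 * C₂)
          * (|y| * (bracket y)⁻¹ * (bracket (x - y) ^ (-4 : ℝ) + bracket x ^ (-4 : ℝ))) := by
        gcongr
        linarith
  · have hby : bracket y ≤ 2 := by linarith [bracket_le_one_add y]
    have h3 : |y| / 2 ≤ |y| * (bracket y)⁻¹ := by
      rw [div_eq_mul_inv]; gcongr
    have hd : ∀ z ∈ uIcc x (x - y), ‖(SchwartzMap.derivCLM ℂ ℂ f) z‖
        ≤ 256 * C₂ * bracket x ^ (-4 : ℝ) := by
      intro z hz
      have hz' : |x - z| ≤ |y| := by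
        have := abs_sub_left_of_mem_uIcc hz
        rw [abs_sub_comm x z]
        simpa using this
      have h4 : bracket x ≤ 4 * bracket z := by
        have := bracket_add_le z (x - z)
        rw [add_sub_cancel] at this
        linarith [one_le_bracket z]
      refine (hf' z).trans ?_
      rw [bracket_rpow_neg_four, bracket_rpow_neg_four, ← div_eq_mul_inv, ← div_eq_mul_inv,
        div_le_div_iff₀ (pow_pos (bracket_pos z) 4) (pow_pos (bracket_pos x) 4)]
      have h5 := pow_le_pow_left₀ (bracket_pos x).le h4 4
      nlinarith [mul_le_mul_of_nonneg_left h5 h₂]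
    have hmv := Convex.norm_image_sub_le_of_norm_hasDerivWithin_le (𝕜 := ℝ) (f := f)
      (f' := fun z => (SchwartzMap.derivCLM ℂ ℂ f) z) (s := uIcc x (x - y))
      (fun z _ => (f.differentiableAt.hasDerivAt (x := z)).hasDerivWithinAt) hd
      (convex_uIcc _ _) left_mem_uIcc right_mem_uIcc
    have hyy : ‖x - y - x‖ = |y| := by simp
    rw [hyy] at hmv
    calc ‖f (x - y) - f x‖ ≤ 256 * C₂ * bracket x ^ (-4 : ℝ) * |y| := hmv
      _ = 512 * C₂ * (|y| / 2 * (bracket x ^ (-4 : ℝ))) := by ring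
      _ ≤ (2 * C₁ + 512 * C₂)
          * (|y| * (bracket y)⁻¹ * (bracket (x - y) ^ (-4 : ℝ) + bracket x ^ (-4 : ℝ))) := by
        gcongr
        · linarith
        · linarith

lemma bracket_div_le (x : ℝ) {c : ℝ} (hc : 1 ≤ c) : bracket x ≤ c * bracket (x / c) := by
  have hc0 : 0 < c := by linarith
  have := bracket_pos (x / c)
  refine Real.sqrt_le_iff.2 ⟨by positivity, ?_⟩
  rw [mul_pow, bracket_sq, mul_add, ← mul_pow, mul_div_cancel₀ _ hc0.ne']
  nlinarith

lemma bracket_div_rpow_neg_four_le (x : ℝ) {c : ℝ} (hc : 1 ≤ c) :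
    bracket (x / c) ^ (-4 : ℝ) ≤ c ^ 4 * bracket x ^ (-4 : ℝ) := by
  have h1 := pow_le_pow_left₀ (bracket_pos x).le (bracket_div_le x hc) 4
  rw [bracket_rpow_neg_four, bracket_rpow_neg_four, ← div_eq_mul_inv,
    le_div_iff₀ (pow_pos (bracket_pos x) 4), inv_mul_le_iff₀ (pow_pos (bracket_pos _) 4)]
  rw [mul_pow] at h1
  linarith

/-- Fourier inversion with the kernel exp(2πitw), after the substitution σ = 2πw. -/
lemma schwartz_inversion (f : SchwartzMap ℝ ℂ) (t : ℝ) :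
    ∫ σ : ℝ, Complex.exp (Complex.I * t * σ) * ((((2 * Real.pi)⁻¹ : ℝ) : ℂ)
      * (FourierTransform.fourier f) (σ / (2 * Real.pi))) = f t := by
  have hinv : FourierTransformInv.fourierInv (FourierTransform.fourier (f : ℝ → ℂ)) = f :=
    Continuous.fourierInv_fourier_eq f.continuous f.integrable (by
      rw [← SchwartzMap.fourier_coe]
      exact (FourierTransform.fourier f).integrable)
  have h6 := congrFun hinv t
  rw [Real.fourierInv_eq', ← SchwartzMap.fourier_coe] at h6
  rw [← h6]
  generalize FourierTransform.fourier f = g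
  set c : ℝ := 2 * Real.pi with hc
  have hc0 : 0 < c := by positivity
  have h4 := Measure.integral_comp_mul_left
    (fun w : ℝ => Complex.exp (((c * w * t : ℝ) : ℂ) * Complex.I) * g w) c⁻¹
  rw [inv_inv, abs_of_pos hc0] at h4
  have h5 : ∫ σ : ℝ, Complex.exp (Complex.I * t * σ) * (((c⁻¹ : ℝ) : ℂ) * g (σ / c))
      = ((c⁻¹ : ℝ) : ℂ) * ∫ σ : ℝ, Complex.exp (((c * (c⁻¹ * σ) * t : ℝ) : ℂ)
        * Complex.I) * g (c⁻¹ * σ) := by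
    rw [← integral_const_mul]
    refine integral_congr_ae (Eventually.of_forall fun σ => ?_)
    have e1 : (c * (c⁻¹ * σ) * t : ℝ) = t * σ := by field_simp
    have e2 : σ / c = c⁻¹ * σ := by rw [div_eq_inv_mul]
    simp only [e1, e2]
    rw [show Complex.I * t * σ = ((t * σ : ℝ) : ℂ) * Complex.I by push_cast; ring]
    ring
  rw [h5, h4, Complex.real_smul, ← mul_assoc, ← Complex.ofReal_mul, inv_mul_cancel₀ hc0.ne',
    Complex.ofReal_one, one_mul]
  refine integral_congr_ae (Eventually.of_forall fun w => ?_)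
  simp only [smul_eq_mul]
  congr 3
  simp [hc]
  ring

lemma norm_le_of_rescale {g : ℝ → ℂ} {C₁ c : ℝ} (hc1 : 1 ≤ c) (h₁ : 0 ≤ C₁)
    (hg₁ : ∀ x, ‖g x‖ ≤ C₁ * bracket x ^ (-4 : ℝ)) (x : ℝ) :
    ‖((c⁻¹ : ℝ) : ℂ) * g (x / c)‖ ≤ C₁ * c ^ 4 * bracket x ^ (-4 : ℝ) := by
  have hc0 : 0 < c := by linarith
  have hcn : ‖((c⁻¹ : ℝ) : ℂ)‖ ≤ 1 := by
    rw [Complex.norm_real, Real.norm_eq_abs, abs_of_pos (by positivity)]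
    exact inv_le_one_of_one_le₀ hc1
  rw [norm_mul]
  have e2 : 0 ≤ bracket x ^ (-4 : ℝ) := Real.rpow_nonneg (bracket_pos _).le _
  calc ‖((c⁻¹ : ℝ) : ℂ)‖ * ‖g (x / c)‖ ≤ 1 * (C₁ * bracket (x / c) ^ (-4 : ℝ)) :=
        mul_le_mul hcn (hg₁ _) (norm_nonneg _) zero_le_one
    _ ≤ 1 * (C₁ * (c ^ 4 * bracket x ^ (-4 : ℝ))) := by
        gcongr; exact bracket_div_rpow_neg_four_le x hc1
    _ = C₁ * c ^ 4 * bracket x ^ (-4 : ℝ) := by ring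

lemma norm_sub_le_of_rescale {g : ℝ → ℂ} {C₂ c : ℝ} (hc1 : 1 ≤ c) (h₂ : 0 ≤ C₂)
    (hg₂ : ∀ x y, ‖g (x - y) - g x‖ ≤
      C₂ * (|y| * (bracket y)⁻¹ * (bracket (x - y) ^ (-4 : ℝ) + bracket x ^ (-4 : ℝ)))) (x y : ℝ) :
    ‖((c⁻¹ : ℝ) : ℂ) * g ((x - y) / c) - ((c⁻¹ : ℝ) : ℂ) * g (x / c)‖ ≤ C₂ * c * c ^ 4
      * (|y| * (bracket y)⁻¹ * (bracket (x - y) ^ (-4 : ℝ) + bracket x ^ (-4 : ℝ))) := by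
  have hc0 : 0 < c := by linarith
  have hcn : ‖((c⁻¹ : ℝ) : ℂ)‖ ≤ 1 := by
    rw [Complex.norm_real, Real.norm_eq_abs, abs_of_pos (by positivity)]
    exact inv_le_one_of_one_le₀ hc1
  rw [← mul_sub, norm_mul, sub_div]
  have e1 : 0 ≤ bracket (x - y) ^ (-4 : ℝ) := Real.rpow_nonneg (bracket_pos _).le _
  have e2 : 0 ≤ bracket x ^ (-4 : ℝ) := Real.rpow_nonneg (bracket_pos _).le _
  have b1 := bracket_pos y
  have b2 := bracket_pos (y / c)
  have h3 : |y / c| * (bracket (y / c))⁻¹ ≤ c * (|y| * (bracket y)⁻¹) := by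
    rw [abs_div, abs_of_pos hc0]
    have : (bracket (y / c))⁻¹ ≤ c * (bracket y)⁻¹ := by
      rw [← div_eq_mul_inv, le_div_iff₀ b1, inv_mul_le_iff₀ b2, mul_comm]
      exact bracket_div_le y hc1
    calc |y| / c * (bracket (y / c))⁻¹ ≤ |y| * (c * (bracket y)⁻¹) := by
          gcongr; exact div_le_self (abs_nonneg _) hc1
      _ = _ := by ring
  have h4 := bracket_div_rpow_neg_four_le (x - y) hc1
  have h5 := bracket_div_rpow_neg_four_le x hc1
  rw [sub_div] at h4
  calc ‖((c⁻¹ : ℝ) : ℂ)‖ * ‖g (x / c - y / c) - g (x / c)‖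
      ≤ 1 * (C₂ * (|y / c| * (bracket (y / c))⁻¹
        * (bracket (x / c - y / c) ^ (-4 : ℝ) + bracket (x / c) ^ (-4 : ℝ)))) :=
        mul_le_mul hcn (hg₂ _ _) (norm_nonneg _) zero_le_one
    _ ≤ 1 * (C₂ * (c * (|y| * (bracket y)⁻¹)
        * (c ^ 4 * bracket (x - y) ^ (-4 : ℝ) + c ^ 4 * bracket x ^ (-4 : ℝ)))) := by
        have : 0 ≤ bracket (x / c - y / c) ^ (-4 : ℝ) := Real.rpow_nonneg (bracket_pos _).le _
        have : 0 ≤ bracket (x / c) ^ (-4 : ℝ) := Real.rpow_nonneg (bracket_pos _).le _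
        gcongr
    _ = C₂ * c * c ^ 4 * (|y| * (bracket y)⁻¹
        * (bracket (x - y) ^ (-4 : ℝ) + bracket x ^ (-4 : ℝ))) := by ring

lemma exists_schwartzMap_eq {ψ : ℝ → ℝ} (hψ : IsCutoff ψ) :
    ∃ f : SchwartzMap ℝ ℂ, ∀ t, f t = (ψ t : ℂ) := by
  have hcs : HasCompactSupport ψ := HasCompactSupport.of_support_subset_isCompact isCompact_Icc
    ((subset_tsupport ψ).trans hψ.tsupport_subset)
  obtain ⟨φ, hφ⟩ : ∃ φ : ℝ → ℂ, φ = fun t => (ψ t : ℂ) := ⟨_, rfl⟩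
  have hcs' : HasCompactSupport φ := hφ ▸ hcs.comp_left (g := fun x : ℝ => (x : ℂ)) (by simp)
  have hcd : ContDiff ℝ (⊤ : ℕ∞) φ := by
    rw [hφ]
    exact Complex.ofRealCLM.contDiff.comp hψ.contDiff
  refine ⟨hcs'.toSchwartzMap hcd, fun t => ?_⟩
  rw [HasCompactSupport.toSchwartzMap_toFun, hφ]

lemma exists_isProfile {ψ : ℝ → ℝ} (hψ : IsCutoff ψ) : ∃ Ψ C, IsProfile ψ Ψ C := by
  obtain ⟨f, hfv⟩ := exists_schwartzMap_eq hψ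
  have hinv := schwartz_inversion f
  generalize FourierTransform.fourier f = g at hinv
  obtain ⟨C₁, h₁, hg₁⟩ := schwartz_norm_le g
  obtain ⟨C₂, h₂, hg₂⟩ := schwartz_norm_sub_le g
  obtain ⟨c, hc⟩ : ∃ c : ℝ, c = 2 * Real.pi := ⟨_, rfl⟩
  rw [← hc] at hinv
  have hc1 : 1 ≤ c := by rw [hc]; linarith [Real.pi_gt_three]
  have hc0 : 0 < c := by linarith
  refine ⟨fun x => ((c⁻¹ : ℝ) : ℂ) * g (x / c), C₁ * c ^ 4 + C₂ * c * c ^ 4, ?_, by positivity,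
    fun x => ?_, fun x y => ?_, fun t => (hinv t).trans (hfv t)⟩
  · have := g.continuous; fun_prop
  · refine (norm_le_of_rescale hc1 h₁ hg₁ x).trans ?_
    have := Real.rpow_nonneg (bracket_pos x).le (-4)
    have : 0 ≤ C₂ * c * c ^ 4 := by positivity
    gcongr
    linarith
  · refine (norm_sub_le_of_rescale hc1 h₂ hg₂ x y).trans ?_
    have := Real.rpow_nonneg (bracket_pos x).le (-4)
    have := Real.rpow_nonneg (bracket_pos (x - y)).le (-4)
    have := bracket_pos y
    have : 0 ≤ C₁ * c ^ 4 := by positivity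
    gcongr
    linarith


/-! ### The kernel of the Duhamel operator -/

/-- The kernel of `F ↦ ψ_T(t) ∫_0^t W_α(t-t') F(t') dt'`, as a function of the modulations. -/
noncomputable def duhamelKernel (Ψ : ℝ → ℂ) (T σ σ' : ℝ) : ℂ :=
  T * (Ψ (T * (σ - σ')) - Ψ (T * σ)) * (Complex.I * σ')⁻¹

/-- The majorant of the Duhamel kernel in the weighted spaces. -/
noncomputable def gainKernel (ε T σ σ' : ℝ) : ℝ :=
  T * bracket (T * (σ - σ')) ^ (-2 : ℝ)
    + T * (bracket (T * σ) ^ (-2 : ℝ) * bracket (T * σ') ^ (-(1 / 2 + ε)))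

lemma bracket_le_scaled {T : ℝ} (hT : 0 < T) (hT1 : T ≤ 1) (x : ℝ) :
    bracket x ≤ T⁻¹ * bracket (T * x) := by
  have h := bracket_div_le x (c := T⁻¹) (one_le_inv_iff₀.2 ⟨hT, hT1⟩)
  rwa [div_inv_eq_mul, mul_comm x T] at h

/-- The difference bound for Ψ with the increment Tσ' carries a factor T|σ'|, which cancels the
singularity 1/σ' of the kernel. -/
lemma norm_duhamelKernel_le {ψ : ℝ → ℝ} {Ψ : ℝ → ℂ} {C T : ℝ} (h : IsProfile ψ Ψ C) (hT : 0 < T)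
    (σ σ' : ℝ) : ‖duhamelKernel Ψ T σ σ'‖ ≤ C * (T ^ 2 * (bracket (T * σ'))⁻¹
      * (bracket (T * (σ - σ')) ^ (-4 : ℝ) + bracket (T * σ) ^ (-4 : ℝ))) := by
  have hC := h.const_nonneg
  have b1 := bracket_pos (T * σ')
  have e1 := Real.rpow_nonneg (bracket_pos (T * (σ - σ'))).le (-4)
  have e2 := Real.rpow_nonneg (bracket_pos (T * σ)).le (-4)
  unfold duhamelKernel
  rw [norm_mul, norm_mul, norm_inv, norm_mul, Complex.norm_I, one_mul, Complex.norm_real,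
    Complex.norm_real, Real.norm_eq_abs, Real.norm_eq_abs, abs_of_pos hT]
  have hR : 0 ≤ C * (T ^ 2 * (bracket (T * σ'))⁻¹
      * (bracket (T * (σ - σ')) ^ (-4 : ℝ) + bracket (T * σ) ^ (-4 : ℝ))) := by positivity
  -- At σ' = 0 the kernel is zero by the convention 0⁻¹ = 0.
  rcases eq_or_ne σ' 0 with rfl | hσ
  · refine le_trans (le_of_eq ?_) hR
    simp
  have hσ' := abs_pos.2 hσ
  have h1 := h.norm_sub_le (T * σ) (T * σ')
  rw [← mul_sub, abs_mul, abs_of_pos hT] at h1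
  rw [← div_eq_mul_inv, div_le_iff₀ hσ']
  calc _ ≤ T * (C * (T * |σ'| * (bracket (T * σ'))⁻¹
      * (bracket (T * (σ - σ')) ^ (-4 : ℝ) + bracket (T * σ) ^ (-4 : ℝ)))) := by gcongr
    _ = _ := by ring

/-- In the rescaled variables x = Tσ, y = Tσ' the powers of ⟨σ⟩ and ⟨σ'⟩, of total degree 1 - ε,
cost T^(-(1-ε)) and turn T² into T · T^ε. Then ⟨x⟩ ≤ 2⟨y⟩⟨x-y⟩ moves the weight onto ⟨y⟩, where it
is cancelled, and onto the rapidly decaying factor. The values used later are β = 1/2 + ε and β =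
1/2 + ε + ω, the second because of the elliptic weight. -/
lemma weighted_kernel_le {ε β T : ℝ} (hε : 0 < ε) (hβ : 1 / 2 + ε ≤ β) (hβ' : β ≤ 1 - ε)
    (hT : 0 < T) (hT1 : T ≤ 1) (σ σ' : ℝ) :
    bracket σ ^ β * bracket σ' ^ (1 - ε - β) * (T ^ 2 * (bracket (T * σ'))⁻¹
      * (bracket (T * (σ - σ')) ^ (-4 : ℝ) + bracket (T * σ) ^ (-4 : ℝ)))
      ≤ 2 * T ^ ε * gainKernel ε T σ σ' := by
  have hβ0 : 0 < β := by linarith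
  set x := T * σ
  set y := T * σ'
  have hxy : T * (σ - σ') = x - y := mul_sub _ _ _
  unfold gainKernel
  rw [hxy]
  have bx := bracket_pos x
  have by' := bracket_pos y
  have bz := bracket_pos (x - y)
  have h1 : bracket σ ^ β ≤ (T⁻¹ * bracket x) ^ β :=
    Real.rpow_le_rpow (bracket_pos _).le (bracket_le_scaled hT hT1 σ) hβ0.le
  have h2 : bracket σ' ^ (1 - ε - β) ≤ (T⁻¹ * bracket y) ^ (1 - ε - β) :=
    Real.rpow_le_rpow (bracket_pos _).le (bracket_le_scaled hT hT1 σ') (by linarith)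
  have hTi : 0 < T⁻¹ := inv_pos.2 hT
  have hpow : T ^ 2 * (T⁻¹ ^ β * T⁻¹ ^ (1 - ε - β)) = T ^ ε * T := by
    rw [← Real.rpow_add hTi, Real.inv_rpow hT.le, ← Real.rpow_neg hT.le,
      show (T : ℝ) ^ 2 = T ^ (2 : ℝ) by norm_cast, ← Real.rpow_add hT]
    nth_rw 3 [← Real.rpow_one T]
    rw [← Real.rpow_add hT]
    congr 1; ring
  have hA : bracket x ^ β * bracket y ^ (-(β + ε)) * bracket (x - y) ^ (-4 : ℝ)
      ≤ 2 * bracket (x - y) ^ (-2 : ℝ) := by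
    have h3 : bracket x ≤ 2 * bracket y * bracket (x - y) := by
      simpa using bracket_add_le_mul y (x - y)
    have h4 : bracket x ^ β ≤ 2 * (bracket y ^ β * bracket (x - y)) := by
      calc bracket x ^ β ≤ (2 * bracket y * bracket (x - y)) ^ β :=
            Real.rpow_le_rpow bx.le h3 hβ0.le
        _ = 2 ^ β * bracket y ^ β * bracket (x - y) ^ β := by
            rw [Real.mul_rpow (by positivity) bz.le, Real.mul_rpow (by norm_num) by'.le]
        _ ≤ 2 ^ (1 : ℝ) * bracket y ^ β * bracket (x - y) ^ (1 : ℝ) := by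
            gcongr
            · norm_num
            · linarith
            · exact one_le_bracket _
            · linarith
        _ = _ := by rw [Real.rpow_one, Real.rpow_one]; ring
    have h5 : bracket y ^ β * bracket y ^ (-(β + ε)) ≤ 1 := by
      rw [← Real.rpow_add by']
      exact Real.rpow_le_one_of_one_le_of_nonpos (one_le_bracket _) (by linarith)
    have h6 : bracket (x - y) * bracket (x - y) ^ (-4 : ℝ) ≤ bracket (x - y) ^ (-2 : ℝ) := by
      nth_rw 1 [← Real.rpow_one (bracket (x - y))]
      rw [← Real.rpow_add bz]
      exact Real.rpow_le_rpow_of_exponent_le (one_le_bracket _) (by norm_num)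
    calc _ ≤ 2 * (bracket y ^ β * bracket (x - y)) * bracket y ^ (-(β + ε))
          * bracket (x - y) ^ (-4 : ℝ) := by gcongr
      _ = 2 * ((bracket y ^ β * bracket y ^ (-(β + ε)))
          * (bracket (x - y) * bracket (x - y) ^ (-4 : ℝ))) := by ring
      _ ≤ 2 * (1 * bracket (x - y) ^ (-2 : ℝ)) := by gcongr
      _ = _ := by ring
  have hB : bracket x ^ β * bracket y ^ (-(β + ε)) * bracket x ^ (-4 : ℝ)
      ≤ 2 * (bracket x ^ (-2 : ℝ) * bracket y ^ (-(1 / 2 + ε))) := by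
    have h6 : bracket x ^ β * bracket x ^ (-4 : ℝ) ≤ bracket x ^ (-2 : ℝ) := by
      rw [← Real.rpow_add bx]
      exact Real.rpow_le_rpow_of_exponent_le (one_le_bracket _) (by linarith)
    have h7 : bracket y ^ (-(β + ε)) ≤ bracket y ^ (-(1 / 2 + ε)) :=
      Real.rpow_le_rpow_of_exponent_le (one_le_bracket _) (by linarith)
    calc _ = (bracket x ^ β * bracket x ^ (-4 : ℝ)) * bracket y ^ (-(β + ε)) := by ring
      _ ≤ bracket x ^ (-2 : ℝ) * bracket y ^ (-(1 / 2 + ε)) := by gcongr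
      _ ≤ _ := le_mul_of_one_le_left (by positivity) (by norm_num)
  have hy : bracket y ^ (1 - ε - β) * (bracket y)⁻¹ = bracket y ^ (-(β + ε)) := by
    rw [← Real.rpow_neg_one, ← Real.rpow_add by']; congr 1; ring
  calc _ ≤ (T⁻¹ * bracket x) ^ β * (T⁻¹ * bracket y) ^ (1 - ε - β) * (T ^ 2 * (bracket y)⁻¹
      * (bracket (x - y) ^ (-4 : ℝ) + bracket x ^ (-4 : ℝ))) := by
        have := Real.rpow_nonneg bz.le (-4)
        have := Real.rpow_nonneg bx.le (-4)
        have := bracket_pos σ'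
        gcongr
    _ = (T ^ 2 * (T⁻¹ ^ β * T⁻¹ ^ (1 - ε - β))) * (bracket x ^ β
        * (bracket y ^ (1 - ε - β) * (bracket y)⁻¹)
        * (bracket (x - y) ^ (-4 : ℝ) + bracket x ^ (-4 : ℝ))) := by
        rw [Real.mul_rpow hTi.le bx.le, Real.mul_rpow hTi.le by'.le]; ring
    _ = T ^ ε * T * (bracket x ^ β * bracket y ^ (-(β + ε)) * bracket (x - y) ^ (-4 : ℝ)
        + bracket x ^ β * bracket y ^ (-(β + ε)) * bracket x ^ (-4 : ℝ)) := by
        rw [hpow, hy]; ring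
    _ ≤ T ^ ε * T * (2 * bracket (x - y) ^ (-2 : ℝ)
        + 2 * (bracket x ^ (-2 : ℝ) * bracket y ^ (-(1 / 2 + ε)))) := by
        have := Real.rpow_nonneg hT.le ε
        gcongr
    _ = _ := by ring

/-- Between two points of a line the elliptic weight changes by at most |τ - τ'| ≤ ⟨σ⟩ + ⟨σ'⟩, and
⟨σ'⟩ is itself at most the elliptic weight at τ'. -/
lemma ellipticWeight_rpow_le {α ω : ℝ} (hα : 0 < α) (hω : 0 ≤ ω) (hω1 : ω ≤ 1) (τ τ' ξ : ℝ) :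
    ellipticWeight α (τ, ξ) ^ ω ≤ ellipticWeight α (τ', ξ) ^ ω
      * (2 + bracket (modulation α (τ, ξ)) ^ ω * bracket (modulation α (τ', ξ)) ^ (-ω)) := by
  set s := bracket (modulation α (τ, ξ)) with hs
  set s' := bracket (modulation α (τ', ξ)) with hs'
  set Ω := ellipticWeight α (τ', ξ) with hΩ
  have p1 : 0 < s := bracket_pos _
  have p2 : 0 < s' := bracket_pos _
  have p3 : 0 < Ω := bracket_pos _
  have h1 : s' ≤ Ω := bracket_modulation_le_ellipticWeight hα _
  have h2 : ellipticWeight α (τ, ξ) ≤ Ω * (2 + s * s'⁻¹) := by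
    have e1 : ellipticWeight α (τ, ξ) ≤ Ω + |τ - τ'| := by
      unfold ellipticWeight at hΩ ⊢
      have h0 : 0 ≤ |ξ| ^ (1 + α) := by positivity
      refine le_trans (bracket_le_bracket (y := |τ'| + |ξ| ^ (1 + α) + |τ - τ'|) ?_) ?_
      · rw [abs_of_nonneg (by positivity : 0 ≤ |τ'| + |ξ| ^ (1 + α) + |τ - τ'|),
          abs_of_nonneg (a := |(τ, ξ).1| + |(τ, ξ).2| ^ (1 + α)) (by positivity)]
        dsimp only
        have := abs_add_le τ' (τ - τ')
        rw [add_sub_cancel] at this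
        linarith
      · refine (bracket_add_le _ _).trans (le_of_eq ?_)
        rw [abs_abs, hΩ]
    have e2 : |τ - τ'| ≤ s + s' := by
      have : τ - τ' = modulation α (τ, ξ) - modulation α (τ', ξ) := by simp [modulation]
      rw [this]
      exact (abs_sub _ _).trans (add_le_add (abs_le_bracket _) (abs_le_bracket _))
    have e3 : s ≤ Ω * (s * s'⁻¹) := by
      calc s = s' * (s * s'⁻¹) := by field_simp
        _ ≤ _ := by gcongr
    linarith
  calc _ ≤ (Ω * (2 + s * s'⁻¹)) ^ ω := Real.rpow_le_rpow (bracket_pos _).le h2 hω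
    _ = Ω ^ ω * (2 + s * s'⁻¹) ^ ω := Real.mul_rpow p3.le (by positivity)
    _ ≤ Ω ^ ω * (2 ^ ω + (s * s'⁻¹) ^ ω) := by
        gcongr
        exact Real.rpow_add_le_add_rpow (by norm_num) (by positivity) hω hω1
    _ ≤ Ω ^ ω * (2 + s ^ ω * s' ^ (-ω)) := by
        rw [Real.mul_rpow p1.le (by positivity), Real.inv_rpow p2.le, Real.rpow_neg p2.le]
        gcongr
        calc (2 : ℝ) ^ ω ≤ 2 ^ (1 : ℝ) := Real.rpow_le_rpow_of_exponent_le (by norm_num) hω1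
          _ = 2 := by norm_num

lemma sqrt_resWeight (α s ω b : ℝ) (p : ℝ × ℝ) : √(resWeight α s ω b p) =
    √(|p.2| ^ (-2 * ω) * bracket p.2 ^ (2 * s - 2 * α * ω))
      * (ellipticWeight α p ^ ω * bracket (modulation α p) ^ b) := by
  have h1 := bracket_pos p.2
  have h2 := bracket_pos (modulation α p)
  have h3 : 0 < ellipticWeight α p := bracket_pos _
  rw [resWeight_eq, mul_assoc, Real.sqrt_mul (by positivity)]
  congr 1
  rw [mul_comm 2 ω, mul_comm 2 b, Real.rpow_mul h3.le, Real.rpow_mul h2.le, Real.rpow_two,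
    Real.rpow_two, ← mul_pow, Real.sqrt_sq (by positivity)]

/-- The Duhamel kernel gains a power of `T` and one modulation up to `ε`. -/
theorem weighted_duhamelKernel_le {α ω ρ ε C T : ℝ} {ψ : ℝ → ℝ} {Ψ : ℝ → ℂ}
    (h : Admissible α ω ρ ε) (hΨ : IsProfile ψ Ψ C) (hT : 0 < T) (hT1 : T ≤ 1) (s τ τ' ξ : ℝ) :
    √(resWeight α s ω (1 / 2 + ε) (τ, ξ))
      * ‖duhamelKernel Ψ T (modulation α (τ, ξ)) (modulation α (τ', ξ))‖ ≤
    6 * C * T ^ ε * gainKernel ε T (modulation α (τ, ξ)) (modulation α (τ', ξ))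
      * √(resWeight α s ω (-1 / 2 + 2 * ε) (τ', ξ)) := by
  have hω := h.omega_pos
  have hα := h.one_lt
  have hε := h.eps_pos
  have hωε := h.omega_le
  have hC := hΨ.const_nonneg
  have hK := norm_duhamelKernel_le hΨ hT (modulation α (τ, ξ)) (modulation α (τ', ξ))
  have hΩ := ellipticWeight_rpow_le (α := α) (by linarith) hω.le (by linarith) τ τ' ξ
  rw [sqrt_resWeight, sqrt_resWeight]
  dsimp only
  generalize modulation α (τ, ξ) = σ at *
  generalize modulation α (τ', ξ) = σ' at *
  have b1 := bracket_pos σ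
  have b2 := bracket_pos σ'
  have hΩ0 : 0 ≤ ellipticWeight α (τ', ξ) ^ ω := Real.rpow_nonneg (bracket_pos _).le _
  have w1 := weighted_kernel_le hε (le_refl (1 / 2 + ε)) (by linarith) hT hT1 σ σ'
  -- The requirement β ≤ 1 - ε is here exactly 4ε + 2ω ≤ 1.
  have w2 := weighted_kernel_le (β := 1 / 2 + ε + ω) hε (by linarith) (by linarith) hT hT1 σ σ'
  have ha := Real.sqrt_nonneg (|ξ| ^ (-2 * ω) * bracket ξ ^ (2 * s - 2 * α * ω))
  generalize √(|ξ| ^ (-2 * ω) * bracket ξ ^ (2 * s - 2 * α * ω)) = a at ha ⊢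
  set M := T ^ 2 * (bracket (T * σ'))⁻¹
      * (bracket (T * (σ - σ')) ^ (-4 : ℝ) + bracket (T * σ) ^ (-4 : ℝ)) with hM
  obtain ⟨g, hg⟩ : ∃ g, g = gainKernel ε T σ σ' := ⟨_, rfl⟩
  rw [← hg] at w1 w2 ⊢
  have hM0 : 0 ≤ M := by
    have e1 := Real.rpow_nonneg (bracket_pos (T * (σ - σ'))).le (-4)
    have e2 := Real.rpow_nonneg (bracket_pos (T * σ)).le (-4)
    have e3 := bracket_pos (T * σ')
    positivity
  have c1 : bracket σ' ^ (1 - ε - (1 / 2 + ε)) * bracket σ' ^ (-1 / 2 + 2 * ε) = 1 := by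
    rw [← Real.rpow_add b2, show 1 - ε - (1 / 2 + ε) + (-1 / 2 + 2 * ε) = 0 by ring,
      Real.rpow_zero]
  have c2 : bracket σ' ^ (1 - ε - (1 / 2 + ε + ω)) * bracket σ' ^ (-1 / 2 + 2 * ε)
      = bracket σ' ^ (-ω) := by
    rw [← Real.rpow_add b2]; congr 1; ring
  have c3 : bracket σ ^ (1 / 2 + ε + ω) = bracket σ ^ (1 / 2 + ε) * bracket σ ^ ω :=
    Real.rpow_add b1 _ _
  rw [c3] at w2
  have d0 : 0 ≤ bracket σ' ^ (-1 / 2 + 2 * ε) := Real.rpow_nonneg b2.le _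
  have key : bracket σ ^ (1 / 2 + ε) * (2 + bracket σ ^ ω * bracket σ' ^ (-ω)) * M
      ≤ 6 * T ^ ε * g * bracket σ' ^ (-1 / 2 + 2 * ε) := by
    have w1' := mul_le_mul_of_nonneg_right w1 d0
    have w2' := mul_le_mul_of_nonneg_right w2 d0
    calc _ = 2 * (bracket σ ^ (1 / 2 + ε) * (bracket σ' ^ (1 - ε - (1 / 2 + ε))
          * bracket σ' ^ (-1 / 2 + 2 * ε)) * M) + bracket σ ^ (1 / 2 + ε) * bracket σ ^ ω
          * (bracket σ' ^ (1 - ε - (1 / 2 + ε + ω)) * bracket σ' ^ (-1 / 2 + 2 * ε)) * M := by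
          rw [c1, c2]; ring
      _ ≤ _ := by linarith
  calc _ ≤ a * (ellipticWeight α (τ', ξ) ^ ω * (2 + bracket σ ^ ω * bracket σ' ^ (-ω))
        * bracket σ ^ (1 / 2 + ε)) * (C * M) := by gcongr
    _ = a * C * ellipticWeight α (τ', ξ) ^ ω
        * (bracket σ ^ (1 / 2 + ε) * (2 + bracket σ ^ ω * bracket σ' ^ (-ω)) * M) := by ring
    _ ≤ a * C * ellipticWeight α (τ', ξ) ^ ω
        * (6 * T ^ ε * g * bracket σ' ^ (-1 / 2 + 2 * ε)) := by gcongr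
    _ = _ := by ring

/-! ### `L²` bounds for the majorant -/

lemma lintegral_comp_mul_sub {T : ℝ} (hT : 0 < T) (c : ℝ) {f : ℝ → ℝ≥0∞} (hf : Measurable f) :
    ∫⁻ x, f (T * (x - c)) = ENNReal.ofReal T⁻¹ * ∫⁻ x, f x := by
  rw [lintegral_sub_right_eq_self (fun x => f (T * x)) c,
    ← lintegral_map (μ := volume) hf (measurable_const_mul T), Real.map_volume_mul_left hT.ne',
    lintegral_smul_measure, abs_of_pos (inv_pos.2 hT), smul_eq_mul]

lemma lintegral_scaled_bracket {ε T : ℝ} (hT : 0 < T) (c : ℝ) :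
    ∫⁻ x, ENNReal.ofReal (bracket (T * (x - c)) ^ (-(1 + 2 * ε)))
      = ENNReal.ofReal T⁻¹ * bracketIntegral ε :=
  lintegral_comp_mul_sub hT c (measurable_bracket_rpow _)

/-- Young's inequality for a convolution operator on `L²`. -/
lemma lintegral_conv_sq_le {k f : ℝ → ℝ≥0∞} (hk : Measurable k) (hf : Measurable f) :
    ∫⁻ x, (∫⁻ y, k (x - y) * f y) ^ 2 ≤ (∫⁻ x, k x) ^ 2 * ∫⁻ y, f y ^ 2 := by
  have h1 : ∀ x, (∫⁻ y, k (x - y) * f y) ^ 2 ≤ (∫⁻ x, k x) * ∫⁻ y, k (x - y) * f y ^ 2 := by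
    intro x
    have h2 := lintegral_mul_sq_le (μ := (volume : Measure ℝ))
      (f := fun y => k (x - y) ^ (1 / 2 : ℝ)) (g := fun y => k (x - y) ^ (1 / 2 : ℝ) * f y)
      (by fun_prop) (by fun_prop)
    have h3 : ∀ y, k (x - y) ^ (1 / 2 : ℝ) * (k (x - y) ^ (1 / 2 : ℝ) * f y) = k (x - y) * f y := by
      intro y
      rw [← mul_assoc, ← sq, half_rpow_sq]
    simp only [h3, mul_pow, half_rpow_sq] at h2
    rwa [lintegral_sub_left_eq_self k x] at h2
  calc _ ≤ ∫⁻ x, (∫⁻ x, k x) * ∫⁻ y, k (x - y) * f y ^ 2 := lintegral_mono h1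
    _ = (∫⁻ x, k x) * ∫⁻ x, ∫⁻ y, k (x - y) * f y ^ 2 :=
        lintegral_const_mul _ (Measurable.lintegral_prod_right'
          (f := fun x : ℝ × ℝ => k (x.1 - x.2) * f x.2 ^ 2) (by fun_prop))
    _ = (∫⁻ x, k x) * ∫⁻ y, ∫⁻ x, k (x - y) * f y ^ 2 := by
        rw [lintegral_lintegral_swap (by fun_prop)]
    _ = (∫⁻ x, k x) * ∫⁻ y, (∫⁻ x, k x) * f y ^ 2 := by
        congr 1
        refine lintegral_congr fun y => ?_
        rw [lintegral_mul_const _ (by fun_prop), lintegral_sub_right_eq_self k y]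
    _ = _ := by rw [lintegral_const_mul _ (by fun_prop), sq, mul_assoc]

/-- The constant in `lintegral_gainKernel_sq_le`. -/
noncomputable def gainConst (ε : ℝ) : ℝ≥0∞ :=
  4 * (bracketIntegral (1 / 2) ^ 2 + bracketIntegral (1 / 2) * bracketIntegral ε)

lemma gainConst_lt_top {ε : ℝ} (hε : 0 < ε) : gainConst ε < ⊤ := by
  have h1 := bracketIntegral_lt_top hε
  have h2 := bracketIntegral_lt_top (ε := 1 / 2) (by norm_num)
  exact ENNReal.mul_lt_top (by norm_num)
    (ENNReal.add_lt_top.2 ⟨ENNReal.pow_lt_top h2, ENNReal.mul_lt_top h2 h1⟩)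

lemma measurable_gainKernel (ε T : ℝ) :
    Measurable fun p : ℝ × ℝ => ENNReal.ofReal (gainKernel ε T p.1 p.2) := by
  have := continuous_bracket.measurable
  unfold gainKernel
  fun_prop

/-- One part of the majorant is convolution with a function whose L¹ norm does not depend on T, so
Young's inequality applies. The other has rank one, with factors of L² norm of order T^(-1/2) each,
compensated by the prefactor T. The bound is thus uniform in T and in the translation c. -/
lemma lintegral_gainKernel_sq_le (ε : ℝ) {T : ℝ} (hT : 0 < T) (c : ℝ) {f : ℝ → ℝ≥0∞}
    (hf : Measurable f) :
    ∫⁻ τ, (∫⁻ τ', ENNReal.ofReal (gainKernel ε T (τ - c) (τ' - c)) * f τ') ^ 2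
      ≤ gainConst ε * ∫⁻ τ', f τ' ^ 2 := by
  have hbm := continuous_bracket.measurable
  have hTi : ENNReal.ofReal T * ENNReal.ofReal T⁻¹ = 1 := by
    rw [← ENNReal.ofReal_mul hT.le, mul_inv_cancel₀ hT.ne', ENNReal.ofReal_one]
  obtain ⟨k, hk⟩ : ∃ k : ℝ → ℝ≥0∞, k = fun x => ENNReal.ofReal T *
    ENNReal.ofReal (bracket (T * x) ^ (-2 : ℝ)) := ⟨_, rfl⟩
  have hkm : Measurable k := by rw [hk]; fun_prop
  have hki : ∫⁻ x, k x = bracketIntegral (1 / 2) := by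
    have := lintegral_scaled_bracket (ε := 1 / 2) hT 0
    simp only [sub_zero] at this
    rw [show -(1 + 2 * (1 / 2 : ℝ)) = -2 by norm_num] at this
    rw [hk, lintegral_const_mul _ (by fun_prop), this, ← mul_assoc, hTi, one_mul]
  obtain ⟨w, hw⟩ : ∃ w : ℝ → ℝ≥0∞, w = fun x =>
    ENNReal.ofReal (bracket (T * (x - c)) ^ (-(1 / 2 + ε))) := ⟨_, rfl⟩
  have hwm : Measurable w := by rw [hw]; fun_prop
  have hwi : ∫⁻ x, w x ^ 2 = ENNReal.ofReal T⁻¹ * bracketIntegral ε := by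
    rw [← lintegral_scaled_bracket hT c, hw]
    refine lintegral_congr fun x => ?_
    have := bracket_pos (T * (x - c))
    rw [← ENNReal.ofReal_pow (by positivity), ← Real.rpow_natCast, ← Real.rpow_mul this.le]
    congr 2
    push_cast; ring
  have hsplit : ∀ τ τ', ENNReal.ofReal (gainKernel ε T (τ - c) (τ' - c)) * f τ'
      = k (τ - τ') * f τ' + k (τ - c) * (w τ' * f τ') := by
    intro τ τ'
    have e1 := Real.rpow_nonneg (bracket_pos (T * (τ - τ'))).le (-2)
    have e2 := Real.rpow_nonneg (bracket_pos (T * (τ - c))).le (-2)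
    have e3 := Real.rpow_nonneg (bracket_pos (T * (τ' - c))).le (-(1 / 2 + ε))
    rw [gainKernel, hk, hw, sub_sub_sub_cancel_right, ENNReal.ofReal_add (by positivity)
      (by positivity), ENNReal.ofReal_mul hT.le, ENNReal.ofReal_mul hT.le, ENNReal.ofReal_mul e2]
    ring
  have hk2 : ∀ x, k x ^ 2 ≤ ENNReal.ofReal T * k x := by
    intro x
    rw [sq]
    refine mul_le_mul_left ?_ _
    rw [hk]
    refine mul_le_of_le_one_right' ?_
    rw [← ENNReal.ofReal_one]
    exact ENNReal.ofReal_le_ofReal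
      (Real.rpow_le_one_of_one_le_of_nonpos (one_le_bracket _) (by norm_num))
  calc _ = ∫⁻ τ, ((∫⁻ τ', k (τ - τ') * f τ') + k (τ - c) * ∫⁻ τ', w τ' * f τ') ^ 2 := by
        refine lintegral_congr fun τ => ?_
        simp_rw [hsplit]
        rw [lintegral_add_left (show Measurable fun τ' => k (τ - τ') * f τ' by fun_prop),
          lintegral_const_mul _ (show Measurable fun τ' => w τ' * f τ' by fun_prop)]
    _ ≤ ∫⁻ τ, 4 * ((∫⁻ τ', k (τ - τ') * f τ') ^ 2
          + ENNReal.ofReal T * k (τ - c) * (ENNReal.ofReal T⁻¹ * bracketIntegral ε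
            * ∫⁻ τ', f τ' ^ 2)) := by
        refine lintegral_mono fun τ => (add_sq_le _ _).trans ?_
        gcongr
        rw [mul_pow]
        refine mul_le_mul' (hk2 _) ?_
        rw [← hwi]
        exact lintegral_mul_sq_le hwm.aemeasurable hf.aemeasurable
    _ = 4 * ((∫⁻ τ, (∫⁻ τ', k (τ - τ') * f τ') ^ 2)
          + ENNReal.ofReal T * (∫⁻ τ, k (τ - c)) * (ENNReal.ofReal T⁻¹ * bracketIntegral ε
            * ∫⁻ τ', f τ' ^ 2)) := by
        have hm1 : Measurable fun τ => ∫⁻ τ', k (τ - τ') * f τ' :=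
          Measurable.lintegral_prod_right' (f := fun x : ℝ × ℝ => k (x.1 - x.2) * f x.2)
            (by fun_prop)
        rw [lintegral_const_mul _ (by fun_prop), lintegral_add_left (by fun_prop),
          lintegral_mul_const _ (by fun_prop), lintegral_const_mul _ (by fun_prop)]
    _ ≤ 4 * (bracketIntegral (1 / 2) ^ 2 * (∫⁻ τ', f τ' ^ 2)
          + ENNReal.ofReal T * bracketIntegral (1 / 2) * (ENNReal.ofReal T⁻¹ * bracketIntegral ε
            * ∫⁻ τ', f τ' ^ 2)) := by
        rw [lintegral_sub_right_eq_self k c, hki]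
        gcongr
        rw [← hki]
        exact lintegral_conv_sq_le hkm hf
    _ = 4 * (bracketIntegral (1 / 2) ^ 2 * (∫⁻ τ', f τ' ^ 2)
          + (ENNReal.ofReal T * ENNReal.ofReal T⁻¹) * (bracketIntegral (1 / 2)
            * (bracketIntegral ε * ∫⁻ τ', f τ' ^ 2))) := by ring
    _ = _ := by rw [hTi, gainConst]; ring


variable {α ω ρ ε s C T : ℝ} {ψ : ℝ → ℝ} {Ψ : ℝ → ℂ}

/-! ### The Duhamel operator -/

/-- The space-time Fourier transform of `ψ_T(t) ∫_0^t W_α(t-t') g(t') dt'`, where `G = ℱg`. -/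
noncomputable def duhamelOp (Ψ : ℝ → ℂ) (α T : ℝ) (G : ℝ × ℝ → ℂ) (p : ℝ × ℝ) : ℂ :=
  ∫ τ' : ℝ, duhamelKernel Ψ T (modulation α p) (modulation α (τ', p.2)) * G (τ', p.2)

lemma measurable_duhamelKernel (hΨ : Continuous Ψ) (T : ℝ) :
    Measurable fun x : ℝ × ℝ => duhamelKernel Ψ T x.1 x.2 := by
  have := hΨ.measurable
  unfold duhamelKernel
  fun_prop

lemma measurable_duhamelIntegrand (hΨ : Continuous Ψ) (α T : ℝ) {G : ℝ × ℝ → ℂ}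
    (hG : Measurable G) : Measurable fun x : (ℝ × ℝ) × ℝ =>
      duhamelKernel Ψ T (modulation α x.1) (modulation α (x.2, x.1.2)) * G (x.2, x.1.2) := by
  have h1 := measurable_modulation α
  have h2 : Measurable fun x : (ℝ × ℝ) × ℝ =>
      duhamelKernel Ψ T (modulation α x.1) (modulation α (x.2, x.1.2)) :=
    (measurable_duhamelKernel hΨ T).comp
      (f := fun x : (ℝ × ℝ) × ℝ => (modulation α x.1, modulation α (x.2, x.1.2))) (by fun_prop)
  exact h2.mul (hG.comp (by fun_prop))

lemma measurable_duhamelOp (hΨ : Continuous Ψ) (α T : ℝ) {G : ℝ × ℝ → ℂ} (hG : Measurable G) :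
    Measurable (duhamelOp Ψ α T G) :=
  ((measurable_duhamelIntegrand hΨ α T hG).stronglyMeasurable.integral_prod_right'
    (ν := (volume : Measure ℝ))).measurable

/-- The majorant of `duhamelOp`. -/
noncomputable def duhamelMajorant (Ψ : ℝ → ℂ) (α T : ℝ) (G : ℝ × ℝ → ℂ) (p : ℝ × ℝ) : ℝ≥0∞ :=
  ∫⁻ τ' : ℝ, ‖duhamelKernel Ψ T (modulation α p) (modulation α (τ', p.2)) * G (τ', p.2)‖ₑ

lemma measurable_duhamelMajorant (hΨ : Continuous Ψ) (α T : ℝ) {G : ℝ × ℝ → ℂ}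
    (hG : Measurable G) : Measurable (duhamelMajorant Ψ α T G) :=
  (measurable_duhamelIntegrand hΨ α T hG).enorm.lintegral_prod_right'

/-- The Duhamel operator acts on each line of constant ξ separately, where its weighted kernel is
dominated by `gainKernel`. Estimating the integral of absolute values also yields the convergence of
the integral defining `duhamelOp`. -/
theorem resEnergy_duhamelMajorant_le (h : Admissible α ω ρ ε) (hΨ : IsProfile ψ Ψ C)
    (hT : 0 < T) (hT1 : T ≤ 1) (s : ℝ) {G : ℝ × ℝ → ℂ} (hG : Measurable G) :
    resEnergy α s ω (1 / 2 + ε) (duhamelMajorant Ψ α T G) ≤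
      ENNReal.ofReal (6 * C * T ^ ε) ^ 2 * gainConst ε
        * resEnergy α s ω (-1 / 2 + 2 * ε) fun p => ‖G p‖ₑ := by
  have hC := hΨ.const_nonneg
  have hTε := Real.rpow_nonneg hT.le ε
  have hwm := measurable_resWeight α s ω (-1 / 2 + 2 * ε)
  obtain ⟨f, hf⟩ : ∃ f : ℝ × ℝ → ℝ≥0∞, f = fun p =>
    ENNReal.ofReal √(resWeight α s ω (-1 / 2 + 2 * ε) p) * ‖G p‖ₑ := ⟨_, rfl⟩
  have hfm : Measurable f := by rw [hf]; fun_prop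
  have hf2 : ∀ p, f p ^ 2 = ENNReal.ofReal (resWeight α s ω (-1 / 2 + 2 * ε) p) * ‖G p‖ₑ ^ 2 := by
    intro p
    rw [hf]
    dsimp only
    rw [mul_pow, ← ENNReal.ofReal_pow (Real.sqrt_nonneg _), Real.sq_sqrt (resWeight_nonneg _ _ _ _ _)]
  have hgm : Measurable fun x : (ℝ × ℝ) × ℝ => ENNReal.ofReal (gainKernel ε T
      (x.1.1 - phase α x.1.2) (x.2 - phase α x.1.2)) * f (x.2, x.1.2) := by
    have h1 := measurable_phase α
    have h2 : Measurable fun x : (ℝ × ℝ) × ℝ => ENNReal.ofReal (gainKernel ε T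
        (x.1.1 - phase α x.1.2) (x.2 - phase α x.1.2)) :=
      (measurable_gainKernel ε T).comp
        (f := fun x : (ℝ × ℝ) × ℝ => (x.1.1 - phase α x.1.2, x.2 - phase α x.1.2)) (by fun_prop)
    exact h2.mul (hfm.comp (by fun_prop))
  have hpt : ∀ p : ℝ × ℝ, ENNReal.ofReal (resWeight α s ω (1 / 2 + ε) p)
      * duhamelMajorant Ψ α T G p ^ 2 ≤ ENNReal.ofReal (6 * C * T ^ ε) ^ 2
        * (∫⁻ τ', ENNReal.ofReal (gainKernel ε T (p.1 - phase α p.2) (τ' - phase α p.2))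
          * f (τ', p.2)) ^ 2 := by
    intro p
    rw [← Real.sq_sqrt (resWeight_nonneg α s ω (1 / 2 + ε) p),
      ENNReal.ofReal_pow (Real.sqrt_nonneg _), ← mul_pow, ← mul_pow]
    refine pow_le_pow_left' ?_ 2
    rw [duhamelMajorant, ← lintegral_const_mul' _ _ ENNReal.ofReal_ne_top,
      ← lintegral_const_mul' _ _ ENNReal.ofReal_ne_top]
    refine lintegral_mono fun τ' => ?_
    have h1 := weighted_duhamelKernel_le h hΨ hT hT1 s p.1 τ' p.2
    rw [hf, enorm_mul, ← mul_assoc, ← mul_assoc, ← mul_assoc, ← ofReal_norm (duhamelKernel _ _ _ _),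
      ← ENNReal.ofReal_mul (Real.sqrt_nonneg _), ← ENNReal.ofReal_mul (by positivity)]
    dsimp only
    rw [← ENNReal.ofReal_mul' (Real.sqrt_nonneg _)]
    exact mul_le_mul_left (ENNReal.ofReal_le_ofReal h1) _
  calc _ ≤ ∫⁻ p : ℝ × ℝ, ENNReal.ofReal (6 * C * T ^ ε) ^ 2
        * (∫⁻ τ', ENNReal.ofReal (gainKernel ε T (p.1 - phase α p.2) (τ' - phase α p.2))
          * f (τ', p.2)) ^ 2 := lintegral_mono hpt
    _ = ENNReal.ofReal (6 * C * T ^ ε) ^ 2 * ∫⁻ ξ, ∫⁻ τ,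
        (∫⁻ τ', ENNReal.ofReal (gainKernel ε T (τ - phase α ξ) (τ' - phase α ξ))
          * f (τ', ξ)) ^ 2 := by
        rw [lintegral_const_mul' _ _ (by finiteness), Measure.volume_eq_prod,
          lintegral_prod_symm' _ ((hgm.lintegral_prod_right').pow_const 2)]
    _ ≤ ENNReal.ofReal (6 * C * T ^ ε) ^ 2 * ∫⁻ ξ, gainConst ε * ∫⁻ τ, f (τ, ξ) ^ 2 := by
        gcongr with ξ
        exact lintegral_gainKernel_sq_le ε hT _ (hfm.comp (by fun_prop))
    _ = _ := by
        rw [lintegral_const_mul' _ _ (gainConst_lt_top h.eps_pos).ne, resEnergy,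
          ← lintegral_prod_symm' _ (hfm.pow_const 2), ← Measure.volume_eq_prod]
        simp_rw [hf2]
        rw [← mul_assoc]

lemma enorm_duhamelOp_le (Ψ : ℝ → ℂ) (α T : ℝ) (G : ℝ × ℝ → ℂ) (p : ℝ × ℝ) :
    ‖duhamelOp Ψ α T G p‖ₑ ≤ duhamelMajorant Ψ α T G p := enorm_integral_le_lintegral_enorm _

/-- The norm of the Duhamel operator is at most `duhamelConst ε C * T ^ ε`. -/
noncomputable def duhamelConst (ε C : ℝ) : ℝ := 6 * C * √(gainConst ε).toReal

lemma ae_fiber {P : ℝ × ℝ → Prop} (h : ∀ᵐ p : ℝ × ℝ, P p) : ∀ᵐ ξ : ℝ, ∀ᵐ τ : ℝ, P (τ, ξ) := by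
  have h2 : ∀ᵐ p : ℝ × ℝ, P p.swap :=
    (Measure.measurePreserving_swap (μ := (volume : Measure ℝ))
      (ν := (volume : Measure ℝ))).quasiMeasurePreserving.ae h
  exact Measure.ae_ae_of_ae_prod h2

lemma duhamelOp_congr_ae {G G' : ℝ × ℝ → ℂ} (h : G =ᵐ[volume] G') (Ψ : ℝ → ℂ) (α T : ℝ) :
    duhamelOp Ψ α T G =ᵐ[volume] duhamelOp Ψ α T G' := by
  have h1 := (Measure.quasiMeasurePreserving_snd (μ := (volume : Measure ℝ))
    (ν := (volume : Measure ℝ))).ae (ae_fiber h)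
  rw [Measure.volume_eq_prod]
  filter_upwards [h1] with p hp
  refine integral_congr_ae ?_
  filter_upwards [hp] with τ hτ
  rw [hτ]

theorem exists_duhamelOp (h : Admissible α ω ρ ε) (hΨ : IsProfile ψ Ψ C)
    (hT : 0 < T) (hT1 : T ≤ 1) (s : ℝ) :
    ∃ D : ResSpace α s ω (-1 / 2 + 2 * ε) →L[ℂ] ResSpace α s ω (1 / 2 + ε),
      (∀ G, D G =ᵐ[volume] duhamelOp Ψ α T G) ∧
      ∀ G, ‖D G‖ₑ ≤ ENNReal.ofReal (duhamelConst ε C * T ^ ε) * ‖G‖ₑ := by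
  have hC := hΨ.const_nonneg
  have hTε := Real.rpow_nonneg hT.le ε
  have hb : ∀ G : ResSpace α s ω (-1 / 2 + 2 * ε),
      resEnergy α s ω (1 / 2 + ε) (duhamelMajorant Ψ α T G) ≤
        (ENNReal.ofReal (duhamelConst ε C * T ^ ε) * ‖G‖ₑ) ^ 2 := by
    intro G
    refine (resEnergy_duhamelMajorant_le h hΨ hT hT1 s (measurable_resSpace G)).trans
      (le_of_eq ?_)
    rw [← resSpace_enorm_sq, mul_pow, duhamelConst,
      show 6 * C * √(gainConst ε).toReal * T ^ ε = 6 * C * T ^ ε * √(gainConst ε).toReal by ring,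
      ENNReal.ofReal_mul (p := 6 * C * T ^ ε) (by positivity), mul_pow,
      ← ENNReal.ofReal_pow (Real.sqrt_nonneg _), Real.sq_sqrt (by positivity), ENNReal.ofReal_toReal (gainConst_lt_top h.eps_pos).ne]
  have hint : ∀ G : ResSpace α s ω (-1 / 2 + 2 * ε), ∀ᵐ p : ℝ × ℝ, Integrable fun τ' : ℝ =>
      duhamelKernel Ψ T (modulation α p) (modulation α (τ', p.2)) * G (τ', p.2) := by
    intro G
    have hm := measurable_duhamelIntegrand hΨ.continuous α T (measurable_resSpace G)
    filter_upwards [ae_lt_top_of_resEnergy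
      (measurable_duhamelMajorant hΨ.continuous α T (measurable_resSpace G))
      ((hb G).trans_lt (ENNReal.pow_lt_top
        (ENNReal.mul_lt_top ENNReal.ofReal_lt_top enorm_lt_top)))] with p hp
    exact ⟨(hm.comp (measurable_prodMk_left (x := p))).aestronglyMeasurable, hp⟩
  obtain ⟨D, h1, h2⟩ := exists_clm_of_bound (μ := resMeasure α s ω (-1 / 2 + 2 * ε))
    (ν := resMeasure α s ω (1 / 2 + ε)) (duhamelOp Ψ α T) (duhamelConst ε C * T ^ ε)
    (fun G => (measurable_duhamelOp hΨ.continuous α T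
      (measurable_resSpace G)).aestronglyMeasurable)
    (fun G => by
      refine le_of_sq_le_sq_ennreal ?_
      rw [eLpNorm_resMeasure_sq]
      exact (lintegral_mono fun p => mul_le_mul_right (pow_le_pow_left'
        (enorm_duhamelOp_le _ _ _ _ _) 2) _).trans (hb G))
    (fun U V => by
      refine ae_resMeasure_of_ae_volume ?_
      filter_upwards [hint U, hint V,
        duhamelOp_congr_ae (ae_volume_of_ae_resMeasure (Lp.coeFn_add U V)) Ψ α T] with p a1 a2 a3
      rw [a3]
      unfold duhamelOp
      rw [← integral_add a1 a2]
      simp only [Pi.add_apply, mul_add])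
    (fun c U => by
      refine ae_resMeasure_of_ae_volume ?_
      filter_upwards [duhamelOp_congr_ae (ae_volume_of_ae_resMeasure (Lp.coeFn_smul c U)) Ψ α T]
        with p a3
      rw [a3]
      unfold duhamelOp
      rw [← integral_const_mul]
      refine integral_congr_ae (Eventually.of_forall fun τ => ?_)
      simp only [Pi.smul_apply, smul_eq_mul]
      ring)
  exact ⟨D, fun G => ae_volume_of_ae_resMeasure (h1 G), h2⟩


variable {α ω ρ ε s C T : ℝ} {ψ : ℝ → ℝ} {Ψ : ℝ → ℂ}

/-! ### The Duhamel operator in the time variable -/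

lemma enorm_exp_I_mul (t τ : ℝ) : ‖Complex.exp (Complex.I * t * τ)‖ₑ = 1 := by
  rw [← ofReal_norm, show Complex.I * t * τ = ((t * τ : ℝ) : ℂ) * Complex.I by push_cast; ring,
    Complex.norm_exp_ofReal_mul_I, ENNReal.ofReal_one]

lemma norm_exp_I_mul (t τ : ℝ) : ‖Complex.exp (Complex.I * t * τ)‖ = 1 := by
  rw [show Complex.I * t * τ = ((t * τ : ℝ) : ℂ) * Complex.I by push_cast; ring,
    Complex.norm_exp_ofReal_mul_I]

/-- A bound in L¹ of the output variable, uniform in T ≤ 1, which justifies Fubini when the operator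
is evaluated at a given time. The parameter 3/2 corresponds to the decay ⟨x⟩⁻⁴ of the profile. -/
lemma lintegral_enorm_duhamelKernel_le (hΨ : IsProfile ψ Ψ C) (hT : 0 < T) (hT1 : T ≤ 1)
    (c σ' : ℝ) : ∫⁻ τ, ‖duhamelKernel Ψ T (τ - c) σ'‖ₑ ≤
      2 * ENNReal.ofReal C * bracketIntegral (3 / 2) * ENNReal.ofReal (bracket σ')⁻¹ := by
  have hC := hΨ.const_nonneg
  have hbm := continuous_bracket.measurable
  have hTi : ENNReal.ofReal T * ENNReal.ofReal T⁻¹ = 1 := by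
    rw [← ENNReal.ofReal_mul hT.le, mul_inv_cancel₀ hT.ne', ENNReal.ofReal_one]
  have b1 := bracket_pos σ'
  have b2 := bracket_pos (T * σ')
  have h1 : T * (bracket (T * σ'))⁻¹ ≤ (bracket σ')⁻¹ := by
    have := bracket_le_scaled hT hT1 σ'
    rw [← div_eq_mul_inv, div_le_iff₀ b2, inv_mul_eq_div, le_div_iff₀ b1]
    calc T * bracket σ' ≤ T * (T⁻¹ * bracket (T * σ')) := by gcongr
      _ = _ := by field_simp
  have h2 : ∀ τ, ‖duhamelKernel Ψ T (τ - c) σ'‖ₑ ≤ ENNReal.ofReal C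
      * ENNReal.ofReal (bracket σ')⁻¹ * (ENNReal.ofReal T
      * (ENNReal.ofReal (bracket (T * (τ - (c + σ'))) ^ (-(1 + 2 * (3 / 2 : ℝ))))
      + ENNReal.ofReal (bracket (T * (τ - c)) ^ (-(1 + 2 * (3 / 2 : ℝ)))))) := by
    intro τ
    have e1 := Real.rpow_nonneg (bracket_pos (T * (τ - (c + σ')))).le (-4)
    have e2 := Real.rpow_nonneg (bracket_pos (T * (τ - c))).le (-4)
    have h3 := norm_duhamelKernel_le hΨ hT (τ - c) σ'
    rw [show -(1 + 2 * (3 / 2 : ℝ)) = -4 by norm_num, ← ofReal_norm, ← ENNReal.ofReal_add e1 e2,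
      ← ENNReal.ofReal_mul hT.le, ← ENNReal.ofReal_mul hC, ← ENNReal.ofReal_mul (by positivity)]
    refine ENNReal.ofReal_le_ofReal (h3.trans ?_)
    rw [sub_sub]
    calc _ = C * (T * (bracket (T * σ'))⁻¹) * (T * (bracket (T * (τ - (c + σ'))) ^ (-4 : ℝ)
          + bracket (T * (τ - c)) ^ (-4 : ℝ))) := by ring
      _ ≤ _ := by gcongr
  refine (lintegral_mono h2).trans (le_of_eq ?_)
  rw [lintegral_const_mul' _ _ (by finiteness), lintegral_const_mul' _ _ (by finiteness),
    lintegral_add_left (by fun_prop), lintegral_scaled_bracket hT, lintegral_scaled_bracket hT]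
  calc _ = ENNReal.ofReal C * ENNReal.ofReal (bracket σ')⁻¹
        * ((ENNReal.ofReal T * ENNReal.ofReal T⁻¹) * (2 * bracketIntegral (3 / 2))) := by ring
    _ = _ := by rw [hTi]; ring

lemma IsProfile.integrable (hΨ : IsProfile ψ Ψ C) : Integrable Ψ := by
  refine ⟨hΨ.continuous.aestronglyMeasurable, ?_⟩
  have h1 : ∀ x, ‖Ψ x‖ₑ ≤ ENNReal.ofReal C
      * ENNReal.ofReal (bracket x ^ (-(1 + 2 * (3 / 2 : ℝ)))) := by
    intro x
    rw [show -(1 + 2 * (3 / 2 : ℝ)) = -4 by norm_num, ← ofReal_norm,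
      ← ENNReal.ofReal_mul hΨ.const_nonneg]
    exact ENNReal.ofReal_le_ofReal (hΨ.norm_le x)
  refine (lintegral_mono h1).trans_lt ?_
  rw [lintegral_const_mul' _ _ (by finiteness)]
  exact ENNReal.mul_lt_top (by finiteness) (bracketIntegral_lt_top (by norm_num))

lemma IsProfile.integrable_scaled (hΨ : IsProfile ψ Ψ C) (hT : 0 < T) (a : ℝ) :
    Integrable fun τ => Ψ (T * (τ - a)) :=
  (hΨ.integrable.comp_mul_left' hT.ne').comp_sub_right a

/-- The inversion formula, dilated and translated. -/
lemma IsProfile.inversion_scaled (hΨ : IsProfile ψ Ψ C) (hT : 0 < T) (t a : ℝ) :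
    ∫ τ : ℝ, Complex.exp (Complex.I * t * τ) * (T * Ψ (T * (τ - a)))
      = Complex.exp (Complex.I * t * a) * ψ (t / T) := by
  have hT' : (T : ℂ) ≠ 0 := by exact_mod_cast hT.ne'
  obtain ⟨g, hg⟩ : ∃ g : ℝ → ℂ, g = fun u : ℝ =>
    T * (Complex.exp (Complex.I * t * a) * (Complex.exp (Complex.I * (t / T : ℝ) * u) * Ψ u)) :=
    ⟨_, rfl⟩
  have h1 : ∀ τ : ℝ, Complex.exp (Complex.I * t * τ) * (T * Ψ (T * (τ - a))) = g (T * (τ - a)) := by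
    intro τ
    rw [hg]
    dsimp only
    rw [← mul_assoc (Complex.exp _) (Complex.exp _), ← Complex.exp_add]
    have : Complex.I * t * a + Complex.I * (t / T : ℝ) * (T * (τ - a) : ℝ)
        = Complex.I * t * τ := by
      push_cast
      field_simp
      ring
    rw [this]
    ring
  simp_rw [h1]
  rw [integral_sub_right_eq_self (fun x => g (T * x)) a, Measure.integral_comp_mul_left g T, hg,
    integral_const_mul, integral_const_mul, hΨ.inversion, abs_of_pos (inv_pos.2 hT),
    Complex.real_smul]
  push_cast
  field_simp

/-- The two translates of the dilated profile invert to ψ(t/T) times exp(it(c+σ')) and exp(itc);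
their difference divided by iσ' is the time integral of the Duhamel formula. -/
lemma integral_exp_mul_duhamelKernel (hΨ : IsProfile ψ Ψ C) (hT : 0 < T) (t c σ' : ℝ) :
    ∫ τ : ℝ, Complex.exp (Complex.I * t * τ) * duhamelKernel Ψ T (τ - c) σ'
      = ψ (t / T) * (Complex.exp (Complex.I * t * c)
        * (Complex.exp (Complex.I * t * σ') - 1) * (Complex.I * σ')⁻¹) := by
  have h1 : ∀ τ : ℝ, Complex.exp (Complex.I * t * τ) * duhamelKernel Ψ T (τ - c) σ'
      = (Complex.exp (Complex.I * t * τ) * (T * Ψ (T * (τ - (c + σ'))))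
        - Complex.exp (Complex.I * t * τ) * (T * Ψ (T * (τ - c)))) * (Complex.I * σ')⁻¹ := by
    intro τ
    rw [duhamelKernel, sub_sub]
    ring
  simp_rw [h1]
  rw [integral_mul_const, integral_sub
    (integrable_exp_mul ((hΨ.integrable_scaled hT _).const_mul _) t)
    (integrable_exp_mul ((hΨ.integrable_scaled hT _).const_mul _) t),
    hΨ.inversion_scaled hT, hΨ.inversion_scaled hT]
  push_cast
  rw [mul_add, Complex.exp_add]
  ring

lemma duhamelSymbol_eq {α t τ ξ : ℝ} (h : modulation α (τ, ξ) ≠ 0) : duhamelSymbol α t τ ξ =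
    Complex.exp (Complex.I * t * phase α ξ)
      * (Complex.exp (Complex.I * t * modulation α (τ, ξ)) - 1)
      * (Complex.I * modulation α (τ, ξ))⁻¹ := by
  have h' : (modulation α (τ, ξ) : ℂ) ≠ 0 := by exact_mod_cast h
  have h1 : ∀ t' : ℝ, Complex.exp (Complex.I * (t - t') * phase α ξ)
      * Complex.exp (Complex.I * t' * τ) = Complex.exp (Complex.I * t * phase α ξ)
        * Complex.exp (Complex.I * modulation α (τ, ξ) * t') := by
    intro t'
    rw [← Complex.exp_add, ← Complex.exp_add]
    congr 1
    simp only [modulation]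
    push_cast
    ring
  unfold duhamelSymbol
  simp_rw [h1]
  rw [intervalIntegral.integral_const_mul,
    integral_exp_mul_complex (mul_ne_zero Complex.I_ne_zero h')]
  simp only [Complex.ofReal_zero, mul_zero, Complex.exp_zero]
  rw [mul_right_comm Complex.I t]
  ring_nf

/-- The length of the interval bounds the symbol by |t|, and integrating the exponential bounds it
by 2/|σ|. -/
lemma bracket_mul_norm_duhamelSymbol_le (α t τ ξ : ℝ) :
    ‖duhamelSymbol α t τ ξ‖ ≤ (|t| + 2) * (bracket (modulation α (τ, ξ)))⁻¹ := by
  set σ := modulation α (τ, ξ) with hσ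
  have b := bracket_pos σ
  rw [← div_eq_mul_inv, le_div_iff₀ b]
  have h1 : ‖duhamelSymbol α t τ ξ‖ ≤ |t| := by
    have := intervalIntegral.norm_integral_le_of_norm_le_const (a := 0) (b := t) (C := 1)
      (f := fun t' : ℝ => Complex.exp (Complex.I * (t - t') * phase α ξ)
        * Complex.exp (Complex.I * t' * τ)) (fun t' _ => by
          rw [norm_mul, norm_exp_I_mul, mul_one, ← Complex.ofReal_sub, norm_exp_I_mul])
    rw [one_mul, sub_zero] at this
    exact this
  have h2 : ‖duhamelSymbol α t τ ξ‖ * |σ| ≤ 2 := by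
    rcases eq_or_ne σ 0 with h0 | h0
    · simp [h0]
    rw [duhamelSymbol_eq h0, norm_mul, norm_mul, norm_exp_I_mul, norm_inv, norm_mul,
      Complex.norm_I, one_mul, one_mul, Complex.norm_real, Real.norm_eq_abs, ← hσ,
      inv_mul_cancel_right₀ (abs_pos.2 h0).ne']
    refine (norm_sub_le _ _).trans ?_
    rw [norm_exp_I_mul]
    norm_num
  calc _ ≤ ‖duhamelSymbol α t τ ξ‖ * (1 + |σ|) := by gcongr; exact bracket_le_one_add σ
    _ ≤ _ := by linarith

lemma ae_modulation_ne_zero (α ξ : ℝ) : ∀ᵐ τ : ℝ, modulation α (τ, ξ) ≠ 0 := by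
  filter_upwards [Measure.ae_ne volume (phase α ξ)] with τ hτ
  simpa [modulation, sub_eq_zero] using hτ

lemma aestronglyMeasurable_duhamelSymbol (α t ξ : ℝ) :
    AEStronglyMeasurable (fun τ : ℝ => duhamelSymbol α t τ ξ) volume := by
  have h1 := measurable_modulation α
  have h2 : Measurable fun τ : ℝ => modulation α (τ, ξ) := h1.comp (by fun_prop)
  refine AEStronglyMeasurable.congr (f := fun τ => Complex.exp (Complex.I * t * phase α ξ)
      * (Complex.exp (Complex.I * t * modulation α (τ, ξ)) - 1)
      * (Complex.I * modulation α (τ, ξ))⁻¹) (by fun_prop) ?_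
  filter_upwards [ae_modulation_ne_zero α ξ] with τ hτ
  rw [duhamelSymbol_eq hτ]

/-- Elements of `X_{s,ω,b'}` are integrable on fibers after division by the modulation. -/
lemma ae_lintegral_div_modulation_lt_top (h : Admissible α ω ρ ε) {G : ℝ × ℝ → ℂ}
    (hG : Measurable G) (hE : resEnergy α s ω (-1 / 2 + 2 * ε) (fun p => ‖G p‖ₑ) < ⊤) :
    ∀ᵐ ξ : ℝ, ∫⁻ τ, ENNReal.ofReal (bracket (modulation α (τ, ξ)))⁻¹ * ‖G (τ, ξ)‖ₑ < ⊤ := by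
  have hε := h.eps_pos
  have hω := h.omega_pos
  have hbm := continuous_bracket.measurable
  have hm : Measurable fun p => ENNReal.ofReal (resWeight α s ω (-1 / 2 + 2 * ε) p) * ‖G p‖ₑ ^ 2 :=
    (measurable_ofReal_resWeight α s ω (-1 / 2 + 2 * ε)).mul (hG.enorm.pow_const 2)
  rw [resEnergy, Measure.volume_eq_prod, lintegral_prod_symm' _ hm] at hE
  have hfin := ae_lt_top (hm.lintegral_prod_left' (μ := (volume : Measure ℝ))) hE.ne
  filter_upwards [hfin, Measure.ae_ne volume (0 : ℝ)] with ξ hξ hξ0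
  have h0 := abs_pos.2 hξ0
  have b1 := bracket_pos ξ
  have hmod : Measurable fun τ : ℝ => modulation α (τ, ξ) :=
    (measurable_modulation α).comp (by fun_prop)
  have hGξ : Measurable fun τ : ℝ => G (τ, ξ) := hG.comp (by fun_prop)
  set a : ℝ := |ξ| ^ (-2 * ω) * bracket ξ ^ (2 * s - 2 * α * ω) with ha
  have ha0 : 0 < a := mul_pos (Real.rpow_pos_of_pos h0 _) (Real.rpow_pos_of_pos b1 _)
  have hw : ∀ τ, ENNReal.ofReal a * (ENNReal.ofReal (bracket (modulation α (τ, ξ))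
      ^ (-1 / 2 + 2 * ε)) * ‖G (τ, ξ)‖ₑ) ^ 2
      ≤ ENNReal.ofReal (resWeight α s ω (-1 / 2 + 2 * ε) (τ, ξ)) * ‖G (τ, ξ)‖ₑ ^ 2 := by
    intro τ
    have b2 := bracket_pos (modulation α (τ, ξ))
    rw [mul_pow, ← mul_assoc, ← ENNReal.ofReal_pow (Real.rpow_nonneg b2.le _),
      ← ENNReal.ofReal_mul ha0.le, ← Real.rpow_natCast, ← Real.rpow_mul b2.le]
    refine mul_le_mul_left (ENNReal.ofReal_le_ofReal ?_) _
    rw [resWeight_eq, mul_comm (-1 / 2 + 2 * ε) ((2 : ℕ) : ℝ)]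
    refine mul_le_mul_of_nonneg_right ?_ (Real.rpow_nonneg b2.le _)
    exact le_mul_of_one_le_right ha0.le
      (Real.one_le_rpow (one_le_ellipticWeight _ _) (by linarith))
  have h1 : ∫⁻ τ, (ENNReal.ofReal (bracket (modulation α (τ, ξ))
      ^ (-1 / 2 + 2 * ε)) * ‖G (τ, ξ)‖ₑ) ^ 2 < ⊤ := by
    have h2 := (lintegral_mono hw).trans_lt hξ
    rw [lintegral_const_mul' _ _ ENNReal.ofReal_ne_top] at h2
    by_contra hc
    rw [not_lt, top_le_iff] at hc
    rw [hc, ENNReal.mul_top (by simpa using ha0)] at h2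
    exact lt_irrefl _ h2
  -- Cauchy–Schwarz with ⟨σ⟩⁻¹ = ⟨σ⟩^(-1/2-2ε) ⟨σ⟩^(-1/2+2ε): the first factor is square integrable,
  -- the second belongs to the weight.
  have h3 : ∀ τ, ENNReal.ofReal (bracket (modulation α (τ, ξ)))⁻¹ * ‖G (τ, ξ)‖ₑ =
      ENNReal.ofReal (bracket (modulation α (τ, ξ)) ^ (-(1 / 2 + 2 * ε)))
      * (ENNReal.ofReal (bracket (modulation α (τ, ξ)) ^ (-1 / 2 + 2 * ε)) * ‖G (τ, ξ)‖ₑ) := by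
    intro τ
    have b2 := bracket_pos (modulation α (τ, ξ))
    rw [← mul_assoc, ← ENNReal.ofReal_mul (Real.rpow_nonneg b2.le _), ← Real.rpow_add b2,
      ← Real.rpow_neg_one]
    congr 3
    ring
  have h4 : ∫⁻ τ, ENNReal.ofReal (bracket (modulation α (τ, ξ)) ^ (-(1 / 2 + 2 * ε))) ^ 2 < ⊤ := by
    refine lt_of_eq_of_lt ?_ (bracketIntegral_lt_top (ε := 2 * ε) (by linarith))
    rw [bracketIntegral, ← lintegral_sub_right_eq_self
      (fun x => ENNReal.ofReal (bracket x ^ (-(1 + 2 * (2 * ε))))) (phase α ξ)]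
    refine lintegral_congr fun τ => ?_
    have b2 := bracket_pos (τ - phase α ξ)
    simp only [modulation]
    rw [← ENNReal.ofReal_pow (Real.rpow_nonneg b2.le _), ← Real.rpow_natCast, ← Real.rpow_mul b2.le]
    congr 2
    push_cast; ring
  simp_rw [h3]
  by_contra hc
  rw [not_lt, top_le_iff] at hc
  have h5 := lintegral_mul_sq_le (μ := (volume : Measure ℝ))
    (f := fun τ => ENNReal.ofReal (bracket (modulation α (τ, ξ)) ^ (-(1 / 2 + 2 * ε))))
    (g := fun τ => ENNReal.ofReal (bracket (modulation α (τ, ξ)) ^ (-1 / 2 + 2 * ε)) * ‖G (τ, ξ)‖ₑ)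
    (Measurable.aemeasurable (by fun_prop)) (Measurable.aemeasurable (by fun_prop))
  rw [hc] at h5
  have h6 := ENNReal.mul_lt_top h4 h1
  simp only [ne_eq, OfNat.ofNat_ne_zero, not_false_eq_true, ENNReal.top_pow, top_le_iff] at h5
  exact h6.ne h5

lemma integrable_mul_duhamelSymbol {G : ℝ × ℝ → ℂ} {ξ : ℝ} (hG : Measurable G)
    (h : ∫⁻ τ, ENNReal.ofReal (bracket (modulation α (τ, ξ)))⁻¹ * ‖G (τ, ξ)‖ₑ < ⊤) (t : ℝ) :
    Integrable fun τ : ℝ => G (τ, ξ) * duhamelSymbol α t τ ξ := by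
  refine ⟨(hG.comp (by fun_prop : Measurable fun τ : ℝ => (τ, ξ))).aestronglyMeasurable.mul
    (aestronglyMeasurable_duhamelSymbol α t ξ), ?_⟩
  have h1 : ∀ τ, ‖G (τ, ξ) * duhamelSymbol α t τ ξ‖ₑ ≤ ENNReal.ofReal (|t| + 2) *
      (ENNReal.ofReal (bracket (modulation α (τ, ξ)))⁻¹ * ‖G (τ, ξ)‖ₑ) := by
    intro τ
    rw [enorm_mul, mul_comm, ← mul_assoc, ← ENNReal.ofReal_mul (by positivity),
      ← ofReal_norm (duhamelSymbol _ _ _ _)]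
    exact mul_le_mul_left (ENNReal.ofReal_le_ofReal (bracket_mul_norm_duhamelSymbol_le α t τ ξ)) _
  refine (lintegral_mono h1).trans_lt ?_
  rw [lintegral_const_mul' _ _ ENNReal.ofReal_ne_top]
  exact ENNReal.mul_lt_top ENNReal.ofReal_lt_top h

/-- By Fubini the τ-integral of the kernel may be done first, and it is explicit. This identifies
the operator built in frequency variables with the cutoff times the Duhamel integral at every time
t. -/
lemma slice_duhamelOp_of_integrable (hΨ : IsProfile ψ Ψ C) (hT : 0 < T) (hT1 : T ≤ 1)
    {G : ℝ × ℝ → ℂ} {ξ : ℝ} (hG : Measurable G)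
    (h : ∫⁻ τ, ENNReal.ofReal (bracket (modulation α (τ, ξ)))⁻¹ * ‖G (τ, ξ)‖ₑ < ⊤) (t : ℝ) :
    slice (duhamelOp Ψ α T G) t ξ = ψ (t / T) * ((√(2 * Real.pi) : ℂ)⁻¹
      * ∫ τ : ℝ, G (τ, ξ) * duhamelSymbol α t τ ξ) := by
  obtain ⟨k, hk⟩ : ∃ k : ℝ × ℝ → ℂ, k = fun x => Complex.exp (Complex.I * t * x.1)
    * (duhamelKernel Ψ T (x.1 - phase α ξ) (modulation α (x.2, ξ)) * G (x.2, ξ)) := ⟨_, rfl⟩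
  have hm2 : Measurable fun x : ℝ × ℝ => G (x.2, ξ) := hG.comp (by fun_prop)
  have hkm : Measurable k := by
    have h1 := measurable_modulation α
    have h2 : Measurable fun x : ℝ × ℝ =>
        duhamelKernel Ψ T (x.1 - phase α ξ) (modulation α (x.2, ξ)) :=
      (measurable_duhamelKernel hΨ.continuous T).comp
        (f := fun x : ℝ × ℝ => (x.1 - phase α ξ, modulation α (x.2, ξ))) (by fun_prop)
    rw [hk]
    fun_prop
  have hki : Integrable k ((volume : Measure ℝ).prod volume) := by
    refine ⟨hkm.aestronglyMeasurable, ?_⟩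
    unfold HasFiniteIntegral
    rw [lintegral_prod_symm' _ hkm.enorm]
    have h1 : ∀ τ', ∫⁻ τ, ‖k (τ, τ')‖ₑ ≤ 2 * ENNReal.ofReal C * bracketIntegral (3 / 2)
        * (ENNReal.ofReal (bracket (modulation α (τ', ξ)))⁻¹ * ‖G (τ', ξ)‖ₑ) := by
      intro τ'
      rw [hk]
      simp only [enorm_mul, enorm_exp_I_mul, one_mul]
      rw [lintegral_mul_const' _ _ enorm_ne_top, ← mul_assoc]
      exact mul_le_mul_left (lintegral_enorm_duhamelKernel_le hΨ hT hT1 _ _) _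
    refine (lintegral_mono h1).trans_lt ?_
    have hJ := (bracketIntegral_lt_top (ε := 3 / 2) (by norm_num)).ne
    rw [lintegral_const_mul' _ _ (by finiteness)]
    exact ENNReal.mul_lt_top (by finiteness) h
  have h1 : ∫ τ : ℝ, Complex.exp (Complex.I * t * τ) * duhamelOp Ψ α T G (τ, ξ)
      = ∫ τ : ℝ, ∫ τ' : ℝ, k (τ, τ') := by
    rw [hk]
    refine integral_congr_ae (Eventually.of_forall fun τ => ?_)
    dsimp only
    rw [integral_const_mul]
    rfl
  have h2 : ∫ τ' : ℝ, ∫ τ : ℝ, k (τ, τ')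
      = ∫ τ' : ℝ, ψ (t / T) * (G (τ', ξ) * duhamelSymbol α t τ' ξ) := by
    refine integral_congr_ae ?_
    filter_upwards [ae_modulation_ne_zero α ξ] with τ' hτ'
    rw [hk]
    dsimp only
    simp_rw [← mul_assoc]
    rw [integral_mul_const, integral_exp_mul_duhamelKernel hΨ hT, duhamelSymbol_eq hτ']
    ring
  rw [slice, h1, integral_integral_swap (f := fun τ τ' => k (τ, τ')) hki, h2, integral_const_mul]
  ring

/-! ### The free evolution -/

/-- The space-time Fourier transform of `ψ(t) W_α(t) u₀`, where `f = û₀`. -/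
noncomputable def freeOp (Ψ : ℝ → ℂ) (α : ℝ) (f : ℝ → ℂ) (p : ℝ × ℝ) : ℂ :=
  (√(2 * Real.pi) : ℂ) * Ψ (modulation α p) * f p.2

lemma slice_freeOp (hΨ : IsProfile ψ Ψ C) (α : ℝ) (f : ℝ → ℂ) (t ξ : ℝ) :
    slice (freeOp Ψ α f) t ξ = ψ t * freeEvolution α f t ξ := by
  have h0 : (√(2 * Real.pi) : ℂ) ≠ 0 := by
    have : √(2 * Real.pi) ≠ 0 := by positivity
    exact_mod_cast this
  have h1 := hΨ.inversion_scaled one_pos t (phase α ξ)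
  simp only [Complex.ofReal_one, one_mul, div_one] at h1
  have h2 : ∀ τ : ℝ, Complex.exp (Complex.I * t * τ) * freeOp Ψ α f (τ, ξ)
      = (√(2 * Real.pi) : ℂ) * f ξ * (Complex.exp (Complex.I * t * τ) * Ψ (τ - phase α ξ)) := by
    intro τ
    simp only [freeOp, modulation]
    ring
  unfold slice
  simp_rw [h2]
  rw [integral_const_mul, h1, freeEvolution]
  field_simp


variable {α ω ρ ε s s₀ C T : ℝ} {ψ : ℝ → ℝ} {Ψ : ℝ → ℂ}

/-! ### The spaces of initial data -/

lemma measurable_dataWeight (s ω : ℝ) : Measurable (dataWeight s ω) := by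
  have := continuous_bracket.measurable
  unfold dataWeight
  fun_prop

lemma dataWeight_nonneg (s ω ξ : ℝ) : 0 ≤ dataWeight s ω ξ := by
  have := bracket_pos ξ
  unfold dataWeight
  positivity

lemma dataWeight_pos (s ω : ℝ) {ξ : ℝ} (hξ : ξ ≠ 0) : 0 < dataWeight s ω ξ :=
  mul_pos (Real.rpow_pos_of_pos (bracket_pos ξ) _) (Real.rpow_pos_of_pos (abs_pos.2 hξ) _)

lemma dataWeight_mono (hs : s₀ ≤ s) (ω ξ : ℝ) : dataWeight s₀ ω ξ ≤ dataWeight s ω ξ := by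
  unfold dataWeight
  gcongr
  exact one_le_bracket ξ

lemma measurable_ofReal_dataWeight (s ω : ℝ) :
    Measurable fun ξ => ENNReal.ofReal (dataWeight s ω ξ) := (measurable_dataWeight s ω).ennreal_ofReal

lemma ae_volume_of_ae_dataMeasure {P : ℝ → Prop} (h : ∀ᵐ ξ ∂(dataMeasure s ω), P ξ) :
    ∀ᵐ ξ : ℝ, P ξ := by
  refine (withDensity_absolutelyContinuous' (measurable_ofReal_dataWeight s ω).aemeasurable
    ?_).ae_le h
  filter_upwards [Measure.ae_ne volume (0 : ℝ)] with ξ hξ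
  simpa using dataWeight_pos s ω hξ

lemma ae_dataMeasure_of_ae_volume {P : ℝ → Prop} (h : ∀ᵐ ξ : ℝ, P ξ) :
    ∀ᵐ ξ ∂(dataMeasure s ω), P ξ := (withDensity_absolutelyContinuous _ _).ae_le h

/-- The square of the norm of `H^(s,ω)`. -/
noncomputable def dataEnergy (s ω : ℝ) (f : ℝ → ℂ) : ℝ≥0∞ :=
  ∫⁻ ξ, ENNReal.ofReal (dataWeight s ω ξ) * ‖f ξ‖ₑ ^ 2

lemma eLpNorm_dataMeasure_sq (f : ℝ → ℂ) :
    eLpNorm f 2 (dataMeasure s ω) ^ 2 = dataEnergy s ω f :=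
  eLpNorm_withDensity_sq (measurable_ofReal_dataWeight _ _) (fun _ => ENNReal.ofReal_lt_top) f

lemma dataSpace_enorm_sq (f : DataSpace s ω) : ‖f‖ₑ ^ 2 = dataEnergy s ω f := by
  rw [Lp.enorm_def, eLpNorm_dataMeasure_sq]

lemma measurable_dataSpace (f : DataSpace s ω) : Measurable (f : ℝ → ℂ) :=
  (Lp.stronglyMeasurable f).measurable

lemma dataEnergy_mono (hs : s₀ ≤ s) (ω : ℝ) (f : ℝ → ℂ) :
    dataEnergy s₀ ω f ≤ dataEnergy s ω f :=
  lintegral_mono fun ξ => mul_le_mul_left (ENNReal.ofReal_le_ofReal (dataWeight_mono hs ω ξ)) _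

lemma dataNorm_nonneg (s ω : ℝ) (f : ℝ → ℂ) : 0 ≤ dataNorm s ω f := Real.sqrt_nonneg _

lemma dataEnergy_eq_dataNorm (hs : s₀ ≤ s) (f : DataSpace s ω) :
    dataEnergy s₀ ω f = ENNReal.ofReal (dataNorm s₀ ω f) ^ 2 := by
  have hm := measurable_dataSpace f
  have hw := measurable_dataWeight s₀ ω
  have hpos : ∀ ξ, 0 ≤ dataWeight s₀ ω ξ * ‖f ξ‖ ^ 2 := fun ξ =>
    mul_nonneg (dataWeight_nonneg _ _ _) (by positivity)
  have h1 : ∀ ξ, ENNReal.ofReal (dataWeight s₀ ω ξ * ‖f ξ‖ ^ 2)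
      = ENNReal.ofReal (dataWeight s₀ ω ξ) * ‖f ξ‖ₑ ^ 2 := fun ξ => by
    rw [ENNReal.ofReal_mul (dataWeight_nonneg _ _ _), ENNReal.ofReal_pow (norm_nonneg _),
      ofReal_norm]
  have hfin : dataEnergy s₀ ω f < ⊤ := by
    refine (dataEnergy_mono hs ω f).trans_lt ?_
    rw [← dataSpace_enorm_sq]
    exact ENNReal.pow_lt_top enorm_lt_top
  rw [dataNorm, ← ENNReal.ofReal_pow (Real.sqrt_nonneg _),
    Real.sq_sqrt (integral_nonneg hpos), integral_eq_lintegral_of_nonneg_ae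
    (Eventually.of_forall hpos) (by fun_prop)]
  simp_rw [h1]
  exact (ENNReal.ofReal_toReal hfin.ne).symm

/-! ### The operator of the free evolution -/

lemma measurable_freeOp (hΨ : Continuous Ψ) (α : ℝ) {f : ℝ → ℂ} (hf : Measurable f) :
    Measurable (freeOp Ψ α f) := by
  have := measurable_modulation α
  have := hΨ.measurable
  unfold freeOp
  fun_prop

/-- The elliptic weight is at most 3⟨σ⟩⟨ξ⟩^(1+α), and its power 2ω turns ⟨ξ⟩^(2s-2αω) into
⟨ξ⟩^(2s+2ω), the weight of the data space. The remaining power of ⟨σ⟩ is harmless because the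
profile decays rapidly in σ. -/
lemma resWeight_le_dataWeight (h : Admissible α ω ρ ε) (s : ℝ) (p : ℝ × ℝ) :
    resWeight α s ω (1 / 2 + ε) p ≤ 3 * dataWeight s ω p.2 * bracket (modulation α p) ^ 2 := by
  have hω := h.omega_pos
  have hα := h.one_lt
  have hε := h.eps_pos
  have b1 := bracket_pos p.2
  have b2 := bracket_pos (modulation α p)
  have h1 := one_le_bracket (modulation α p)
  have h2 : 1 ≤ bracket p.2 ^ (1 + α) := Real.one_le_rpow (one_le_bracket _) (by linarith)
  have h3 : ellipticWeight α p ≤ 3 * (bracket (modulation α p) * bracket p.2 ^ (1 + α)) := by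
    have := ellipticWeight_le (by linarith : 0 < α) p
    nlinarith
  have h4 : ellipticWeight α p ^ (2 * ω) ≤ 3 * (bracket (modulation α p) ^ (2 * ω)
      * bracket p.2 ^ ((1 + α) * (2 * ω))) := by
    calc _ ≤ (3 * (bracket (modulation α p) * bracket p.2 ^ (1 + α))) ^ (2 * ω) :=
          Real.rpow_le_rpow (bracket_pos _).le h3 (by linarith)
      _ = 3 ^ (2 * ω) * (bracket (modulation α p) ^ (2 * ω)
          * bracket p.2 ^ ((1 + α) * (2 * ω))) := by
          rw [Real.mul_rpow (by norm_num) (by positivity), Real.mul_rpow b2.le (by positivity),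
            ← Real.rpow_mul b1.le]
      _ ≤ 3 ^ (1 : ℝ) * (bracket (modulation α p) ^ (2 * ω)
          * bracket p.2 ^ ((1 + α) * (2 * ω))) := by
          gcongr
          · norm_num
          · linarith [h.omega_lt]
      _ = _ := by rw [Real.rpow_one]
  have h5 : bracket (modulation α p) ^ (2 * ω) * bracket (modulation α p) ^ (2 * (1 / 2 + ε))
      ≤ bracket (modulation α p) ^ 2 := by
    rw [← Real.rpow_add b2, ← Real.rpow_natCast]
    refine Real.rpow_le_rpow_of_exponent_le h1 ?_
    push_cast
    linarith [h.omega_le]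
  have h6 : bracket p.2 ^ (2 * s - 2 * α * ω) * bracket p.2 ^ ((1 + α) * (2 * ω))
      = bracket p.2 ^ (2 * s + 2 * ω) := by
    rw [← Real.rpow_add b1]; congr 1; ring
  rw [resWeight_eq, dataWeight, ← h6]
  calc _ ≤ |p.2| ^ (-2 * ω) * bracket p.2 ^ (2 * s - 2 * α * ω)
        * (3 * (bracket (modulation α p) ^ (2 * ω) * bracket p.2 ^ ((1 + α) * (2 * ω))))
        * bracket (modulation α p) ^ (2 * (1 / 2 + ε)) := by gcongr
    _ = 3 * (bracket p.2 ^ (2 * s - 2 * α * ω) * bracket p.2 ^ ((1 + α) * (2 * ω))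
        * |p.2| ^ (-2 * ω)) * (bracket (modulation α p) ^ (2 * ω)
          * bracket (modulation α p) ^ (2 * (1 / 2 + ε))) := by ring
    _ ≤ _ := by gcongr

/-- The square of the norm of the free evolution is at most `freeConst C ^ 2`. -/
noncomputable def freeConst (C : ℝ) : ℝ := √(6 * Real.pi * C ^ 2 * (bracketIntegral (1 / 2)).toReal)

theorem resEnergy_freeOp_le (h : Admissible α ω ρ ε) (hΨ : IsProfile ψ Ψ C) (s : ℝ) {f : ℝ → ℂ}
    (hf : Measurable f) : resEnergy α s ω (1 / 2 + ε) (fun p => ‖freeOp Ψ α f p‖ₑ) ≤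
      ENNReal.ofReal (freeConst C) ^ 2 * dataEnergy s ω f := by
  have hJ := (bracketIntegral_lt_top (ε := 1 / 2) (by norm_num)).ne
  have hbm := continuous_bracket.measurable
  have hmod := measurable_modulation α
  have hwm := measurable_dataWeight s ω
  have hC : ENNReal.ofReal (freeConst C) ^ 2
      = ENNReal.ofReal (6 * Real.pi * C ^ 2) * bracketIntegral (1 / 2) := by
    rw [freeConst, ← ENNReal.ofReal_pow (Real.sqrt_nonneg _), Real.sq_sqrt (by positivity),
      ENNReal.ofReal_mul (by positivity), ENNReal.ofReal_toReal hJ]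
  have h1 : ∀ p : ℝ × ℝ, ENNReal.ofReal (resWeight α s ω (1 / 2 + ε) p) * ‖freeOp Ψ α f p‖ₑ ^ 2 ≤
      ENNReal.ofReal (6 * Real.pi * C ^ 2) * (ENNReal.ofReal (dataWeight s ω p.2) * ‖f p.2‖ₑ ^ 2
        * ENNReal.ofReal (bracket (p.1 - phase α p.2) ^ (-(1 + 2 * (1 / 2 : ℝ))))) := by
    intro p
    change _ ≤ _ * (_ * ENNReal.ofReal (bracket (modulation α p) ^ (-(1 + 2 * (1 / 2 : ℝ)))))
    have b := bracket_pos (modulation α p)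
    have hd := dataWeight_nonneg s ω p.2
    rw [show -(1 + 2 * (1 / 2 : ℝ)) = -2 by norm_num]
    have e1 := Real.rpow_nonneg b.le (-2)
    rw [← ofReal_norm, ← ofReal_norm (f p.2), ← ENNReal.ofReal_pow (norm_nonneg _),
      ← ENNReal.ofReal_pow (norm_nonneg _), ← ENNReal.ofReal_mul (resWeight_nonneg _ _ _ _ _),
      ← ENNReal.ofReal_mul hd, ← ENNReal.ofReal_mul (by positivity),
      ← ENNReal.ofReal_mul (by positivity)]
    refine ENNReal.ofReal_le_ofReal ?_
    have h2 : ‖freeOp Ψ α f p‖ ^ 2 = 2 * Real.pi * ‖Ψ (modulation α p)‖ ^ 2 * ‖f p.2‖ ^ 2 := by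
      rw [freeOp, norm_mul, norm_mul, mul_pow, mul_pow, Complex.norm_real, Real.norm_eq_abs, sq_abs,
        Real.sq_sqrt (by positivity)]
    have h3 : ‖Ψ (modulation α p)‖ ^ 2 ≤ (C * bracket (modulation α p) ^ (-4 : ℝ)) ^ 2 :=
      pow_le_pow_left₀ (norm_nonneg _) (hΨ.norm_le _) 2
    have h4 : bracket (modulation α p) ^ 2 * (bracket (modulation α p) ^ (-4 : ℝ)) ^ 2
        ≤ bracket (modulation α p) ^ (-2 : ℝ) := by
      rw [← Real.rpow_natCast, ← Real.rpow_natCast, ← Real.rpow_mul b.le, ← Real.rpow_add b]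
      exact Real.rpow_le_rpow_of_exponent_le (one_le_bracket _) (by norm_num)
    rw [h2]
    calc _ ≤ (3 * dataWeight s ω p.2 * bracket (modulation α p) ^ 2) * (2 * Real.pi
          * (C * bracket (modulation α p) ^ (-4 : ℝ)) ^ 2 * ‖f p.2‖ ^ 2) := by
          gcongr
          exact resWeight_le_dataWeight h s p
      _ = 6 * Real.pi * C ^ 2 * (dataWeight s ω p.2 * ‖f p.2‖ ^ 2
          * (bracket (modulation α p) ^ 2 * (bracket (modulation α p) ^ (-4 : ℝ)) ^ 2)) := by ring
      _ ≤ _ := by gcongr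
  have hm : Measurable fun p : ℝ × ℝ => ENNReal.ofReal (dataWeight s ω p.2) * ‖f p.2‖ₑ ^ 2
      * ENNReal.ofReal (bracket (p.1 - phase α p.2) ^ (-(1 + 2 * (1 / 2 : ℝ)))) := by
    have := measurable_phase α
    fun_prop
  rw [hC]
  refine (lintegral_mono h1).trans (le_of_eq ?_)
  rw [lintegral_const_mul' _ _ ENNReal.ofReal_ne_top, Measure.volume_eq_prod,
    lintegral_prod_symm' _ hm]
  have h5 : ∀ ξ : ℝ, ∫⁻ τ, ENNReal.ofReal (dataWeight s ω ξ) * ‖f ξ‖ₑ ^ 2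
      * ENNReal.ofReal (bracket (τ - phase α ξ) ^ (-(1 + 2 * (1 / 2 : ℝ))))
      = ENNReal.ofReal (dataWeight s ω ξ) * ‖f ξ‖ₑ ^ 2 * bracketIntegral (1 / 2) := by
    intro ξ
    rw [lintegral_const_mul' _ _ (by finiteness), lintegral_sub_right_eq_self
      (fun x => ENNReal.ofReal (bracket x ^ (-(1 + 2 * (1 / 2 : ℝ))))) (phase α ξ)]
    rfl
  rw [lintegral_congr h5, lintegral_mul_const' _ _ hJ, mul_assoc _ (bracketIntegral _),
    mul_comm (bracketIntegral _)]
  rfl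

lemma freeOp_congr_ae {f g : ℝ → ℂ} (h : f =ᵐ[volume] g) (Ψ : ℝ → ℂ) (α : ℝ) :
    freeOp Ψ α f =ᵐ[volume] freeOp Ψ α g := by
  have h1 := (Measure.quasiMeasurePreserving_snd (μ := (volume : Measure ℝ))
    (ν := (volume : Measure ℝ))).ae h
  rw [Measure.volume_eq_prod]
  filter_upwards [h1] with p hp
  simp only [freeOp, hp]

theorem exists_freeOp (h : Admissible α ω ρ ε) (hΨ : IsProfile ψ Ψ C) (s : ℝ) :
    ∃ L : DataSpace s ω →L[ℂ] ResSpace α s ω (1 / 2 + ε),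
      ∀ f, L f =ᵐ[volume] freeOp Ψ α f := by
  obtain ⟨L, h1, -⟩ := exists_clm_of_bound (μ := dataMeasure s ω)
    (ν := resMeasure α s ω (1 / 2 + ε)) (freeOp Ψ α) (freeConst C)
    (fun f => (measurable_freeOp hΨ.continuous α (measurable_dataSpace f)).aestronglyMeasurable)
    (fun f => by
      refine le_of_sq_le_sq_ennreal ?_
      rw [eLpNorm_resMeasure_sq, mul_pow, dataSpace_enorm_sq]
      exact resEnergy_freeOp_le h hΨ s (measurable_dataSpace f))
    (fun f g => by
      refine ae_resMeasure_of_ae_volume ?_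
      filter_upwards [freeOp_congr_ae (ae_volume_of_ae_dataMeasure (Lp.coeFn_add f g)) Ψ α]
        with p hp
      rw [hp]
      simp only [freeOp, Pi.add_apply, mul_add])
    (fun c f => by
      refine ae_resMeasure_of_ae_volume ?_
      filter_upwards [freeOp_congr_ae (ae_volume_of_ae_dataMeasure (Lp.coeFn_smul c f)) Ψ α]
        with p hp
      rw [hp]
      simp only [freeOp, Pi.smul_apply, smul_eq_mul]
      ring)
  exact ⟨L, fun f => ae_volume_of_ae_resMeasure (h1 f)⟩


variable {α ω ρ ε s s₀ C T : ℝ} {ψ : ℝ → ℝ} {Ψ : ℝ → ℂ}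

/-! ### The embedding in the continuous functions of time -/

/-- Conversely the elliptic weight is at least ⟨ξ⟩^(1+α)/8, so the power 2ω of it recovers the
weight of the data space. -/
lemma dataWeight_le_resWeight (h : Admissible α ω ρ ε) (s : ℝ) (p : ℝ × ℝ) :
    dataWeight s ω p.2 * bracket (modulation α p) ^ (1 + 2 * ε)
      ≤ 8 * resWeight α s ω (1 / 2 + ε) p := by
  have hω := h.omega_pos
  have hα := h.one_lt
  have b1 := bracket_pos p.2
  have b2 := bracket_pos (modulation α p)
  have hΩ := one_le_ellipticWeight α p
  have h3 : bracket p.2 ^ (1 + α) ≤ 8 * ellipticWeight α p := by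
    have h4 : bracket p.2 ≤ 2 * max 1 |p.2| := by
      linarith [bracket_le_one_add p.2, le_max_left 1 |p.2|, le_max_right 1 |p.2|]
    calc bracket p.2 ^ (1 + α) ≤ (2 * max 1 |p.2|) ^ (1 + α) :=
          Real.rpow_le_rpow b1.le h4 (by linarith)
      _ = 2 ^ (1 + α) * max 1 |p.2| ^ (1 + α) := Real.mul_rpow (by norm_num) (by positivity)
      _ ≤ 2 ^ (3 : ℝ) * ellipticWeight α p := by
          gcongr
          · norm_num
          · linarith [h.lt_two]
          · rcases max_choice 1 |p.2| with hm | hm <;> rw [hm]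
            · rwa [Real.one_rpow]
            · exact rpow_le_ellipticWeight α p
      _ = _ := by norm_num
  have h4 : bracket p.2 ^ ((1 + α) * (2 * ω)) ≤ 8 * ellipticWeight α p ^ (2 * ω) := by
    calc bracket p.2 ^ ((1 + α) * (2 * ω)) = (bracket p.2 ^ (1 + α)) ^ (2 * ω) :=
          Real.rpow_mul b1.le _ _
      _ ≤ (8 * ellipticWeight α p) ^ (2 * ω) := Real.rpow_le_rpow (by positivity) h3 (by linarith)
      _ = 8 ^ (2 * ω) * ellipticWeight α p ^ (2 * ω) := Real.mul_rpow (by norm_num) (by linarith)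
      _ ≤ 8 ^ (1 : ℝ) * ellipticWeight α p ^ (2 * ω) := by
          gcongr
          · norm_num
          · linarith [h.omega_lt]
      _ = _ := by rw [Real.rpow_one]
  have h6 : bracket p.2 ^ (2 * s - 2 * α * ω) * bracket p.2 ^ ((1 + α) * (2 * ω))
      = bracket p.2 ^ (2 * s + 2 * ω) := by
    rw [← Real.rpow_add b1]; congr 1; ring
  rw [resWeight_eq, dataWeight, ← h6, show 2 * (1 / 2 + ε) = 1 + 2 * ε by ring]
  calc _ ≤ bracket p.2 ^ (2 * s - 2 * α * ω) * (8 * ellipticWeight α p ^ (2 * ω))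
        * |p.2| ^ (-2 * ω) * bracket (modulation α p) ^ (1 + 2 * ε) := by gcongr
    _ = _ := by ring

/-- The norm of the evaluation of `u ∈ X_{s,ω,b}` at a time is at most `evalConst ε`. -/
noncomputable def evalConst (ε : ℝ) : ℝ := √(8 * (bracketIntegral ε).toReal)

lemma evalConst_sq (hε : 0 < ε) : ENNReal.ofReal (evalConst ε) ^ 2 = 8 * bracketIntegral ε := by
  rw [evalConst, ← ENNReal.ofReal_pow (Real.sqrt_nonneg _), Real.sq_sqrt (by positivity),
    ENNReal.ofReal_mul (by norm_num), ENNReal.ofReal_toReal (bracketIntegral_lt_top hε).ne,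
    ENNReal.ofReal_ofNat]

/-- Cauchy–Schwarz in τ against ⟨σ⟩^(-(1/2+ε)), square integrable because b > 1/2. -/
lemma dataWeight_mul_lintegral_sq_le (h : Admissible α ω ρ ε) (s ξ : ℝ) {u : ℝ × ℝ → ℝ≥0∞}
    (hu : Measurable u) : ENNReal.ofReal (dataWeight s ω ξ) * (∫⁻ τ, u (τ, ξ)) ^ 2 ≤
      8 * bracketIntegral ε
        * ∫⁻ τ, ENNReal.ofReal (resWeight α s ω (1 / 2 + ε) (τ, ξ)) * u (τ, ξ) ^ 2 := by
  have hJ := (bracketIntegral_lt_top h.eps_pos).ne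
  have hbm := continuous_bracket.measurable
  have hmod : Measurable fun τ : ℝ => modulation α (τ, ξ) :=
    (measurable_modulation α).comp (by fun_prop)
  have huξ : Measurable fun τ : ℝ => u (τ, ξ) := hu.comp (by fun_prop)
  have hd := dataWeight_nonneg s ω ξ
  have h1 := lintegral_mul_sq_le (μ := (volume : Measure ℝ))
    (f := fun τ => ENNReal.ofReal (bracket (modulation α (τ, ξ)) ^ (-(1 / 2 + ε))))
    (g := fun τ => ENNReal.ofReal (bracket (modulation α (τ, ξ)) ^ (1 / 2 + ε)) * u (τ, ξ))
    (Measurable.aemeasurable (by fun_prop)) (Measurable.aemeasurable (by fun_prop))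
  have h2 : ∀ τ, ENNReal.ofReal (bracket (modulation α (τ, ξ)) ^ (-(1 / 2 + ε)))
      * (ENNReal.ofReal (bracket (modulation α (τ, ξ)) ^ (1 / 2 + ε)) * u (τ, ξ)) = u (τ, ξ) := by
    intro τ
    have b := bracket_pos (modulation α (τ, ξ))
    rw [← mul_assoc, ← ENNReal.ofReal_mul (Real.rpow_nonneg b.le _), ← Real.rpow_add b,
      neg_add_cancel, Real.rpow_zero, ENNReal.ofReal_one, one_mul]
  have h3 : ∫⁻ τ, ENNReal.ofReal (bracket (modulation α (τ, ξ)) ^ (-(1 / 2 + ε))) ^ 2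
      = bracketIntegral ε := by
    rw [bracketIntegral, ← lintegral_sub_right_eq_self
      (fun x => ENNReal.ofReal (bracket x ^ (-(1 + 2 * ε)))) (phase α ξ)]
    refine lintegral_congr fun τ => ?_
    have b := bracket_pos (τ - phase α ξ)
    simp only [modulation]
    rw [← ENNReal.ofReal_pow (Real.rpow_nonneg b.le _), ← Real.rpow_natCast, ← Real.rpow_mul b.le]
    congr 2
    push_cast; ring
  have h4 : ∀ τ, ENNReal.ofReal (dataWeight s ω ξ)
      * (ENNReal.ofReal (bracket (modulation α (τ, ξ)) ^ (1 / 2 + ε)) * u (τ, ξ)) ^ 2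
      ≤ 8 * (ENNReal.ofReal (resWeight α s ω (1 / 2 + ε) (τ, ξ)) * u (τ, ξ) ^ 2) := by
    intro τ
    have b := bracket_pos (modulation α (τ, ξ))
    rw [mul_pow, ← mul_assoc, ← mul_assoc, ← ENNReal.ofReal_pow (Real.rpow_nonneg b.le _),
      ← ENNReal.ofReal_mul hd, ← ENNReal.ofReal_ofNat, ← ENNReal.ofReal_mul (by norm_num)]
    refine mul_le_mul_left (ENNReal.ofReal_le_ofReal ?_) _
    refine le_trans (le_of_eq ?_) (dataWeight_le_resWeight h s (τ, ξ))
    rw [← Real.rpow_natCast, ← Real.rpow_mul b.le]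
    congr 2
    push_cast; ring
  simp_rw [h2, h3] at h1
  calc _ ≤ ENNReal.ofReal (dataWeight s ω ξ) * (bracketIntegral ε * ∫⁻ τ,
        (ENNReal.ofReal (bracket (modulation α (τ, ξ)) ^ (1 / 2 + ε)) * u (τ, ξ)) ^ 2) :=
        mul_le_mul_right h1 _
    _ = bracketIntegral ε * ∫⁻ τ, ENNReal.ofReal (dataWeight s ω ξ)
        * (ENNReal.ofReal (bracket (modulation α (τ, ξ)) ^ (1 / 2 + ε)) * u (τ, ξ)) ^ 2 := by
        rw [lintegral_const_mul' _ _ ENNReal.ofReal_ne_top]; ring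
    _ ≤ bracketIntegral ε * ∫⁻ τ,
        8 * (ENNReal.ofReal (resWeight α s ω (1 / 2 + ε) (τ, ξ)) * u (τ, ξ) ^ 2) :=
        mul_le_mul_right (lintegral_mono h4) _
    _ = _ := by rw [lintegral_const_mul' _ _ (by finiteness)]; ring

lemma enorm_slice_sq_le (U : ℝ × ℝ → ℂ) (t ξ : ℝ) :
    ‖slice U t ξ‖ₑ ≤ ∫⁻ τ : ℝ, ‖U (τ, ξ)‖ₑ := by
  refine (enorm_slice_le U t ξ).trans (mul_le_of_le_one_left' ?_)
  rw [← ofReal_norm, ← ENNReal.ofReal_one]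
  refine ENNReal.ofReal_le_ofReal ?_
  rw [norm_inv, Complex.norm_real, Real.norm_eq_abs, abs_of_nonneg (Real.sqrt_nonneg _)]
  refine inv_le_one_of_one_le₀ (Real.one_le_sqrt.2 ?_)
  linarith [Real.pi_gt_three]

/-- Evaluation at a time is bounded from `X_{s,ω,b}` to `H^(s,ω)`. -/
theorem dataEnergy_slice_le (h : Admissible α ω ρ ε) (s : ℝ) {U : ℝ × ℝ → ℂ} (hU : Measurable U)
    (t : ℝ) : dataEnergy s ω (slice U t) ≤ ENNReal.ofReal (evalConst ε) ^ 2
      * resEnergy α s ω (1 / 2 + ε) fun p => ‖U p‖ₑ := by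
  have hm : Measurable fun p => ENNReal.ofReal (resWeight α s ω (1 / 2 + ε) p) * ‖U p‖ₑ ^ 2 :=
    (measurable_ofReal_resWeight α s ω (1 / 2 + ε)).mul (hU.enorm.pow_const 2)
  have hJ := (bracketIntegral_lt_top h.eps_pos).ne
  rw [evalConst_sq h.eps_pos, resEnergy, Measure.volume_eq_prod, lintegral_prod_symm' _ hm,
    ← lintegral_const_mul' _ _ (by finiteness)]
  refine lintegral_mono fun ξ => ?_
  refine le_trans (mul_le_mul_right (pow_le_pow_left' (enorm_slice_sq_le U t ξ) 2) _) ?_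
  exact dataWeight_mul_lintegral_sq_le h s ξ hU.enorm

lemma measurable_slice {U : ℝ × ℝ → ℂ} (hU : Measurable U) (t : ℝ) : Measurable (slice U t) := by
  have : StronglyMeasurable fun q : ℝ × ℝ =>
      Complex.exp (Complex.I * t * q.2) * U (q.2, q.1) := by
    refine StronglyMeasurable.mul (Continuous.stronglyMeasurable (by fun_prop)) ?_
    exact hU.stronglyMeasurable.comp_measurable measurable_swap
  have h2 := this.integral_prod_right' (ν := (volume : Measure ℝ))
  exact (h2.const_mul _).measurable

lemma exists_eval (h : Admissible α ω ρ ε) (s t : ℝ) :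
    ∃ E : ResSpace α s ω (1 / 2 + ε) →L[ℂ] DataSpace s ω, (∀ U, E U =ᵐ[volume] slice U t) ∧
      ∀ U, ‖E U‖ₑ ≤ ENNReal.ofReal (evalConst ε) * ‖U‖ₑ := by
  have hb : (1 : ℝ) / 2 < 1 / 2 + ε := by linarith [h.eps_pos]
  obtain ⟨L, h1, h2⟩ := exists_clm_of_bound (μ := resMeasure α s ω (1 / 2 + ε))
    (ν := dataMeasure s ω) (fun U => slice U t) (evalConst ε)
    (fun U => (measurable_slice (measurable_resSpace U) t).aestronglyMeasurable)
    (fun U => by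
      refine le_of_sq_le_sq_ennreal ?_
      rw [eLpNorm_dataMeasure_sq, mul_pow, resSpace_enorm_sq]
      exact dataEnergy_slice_le h s (measurable_resSpace U) t)
    (fun U V => by
      refine ae_dataMeasure_of_ae_volume ?_
      filter_upwards [slice_add_ae h.omega_pos.le hb U V] with ξ hξ using hξ t)
    (fun c U => by
      refine ae_dataMeasure_of_ae_volume ?_
      filter_upwards [slice_smul_ae c U] with ξ hξ using hξ t)
  exact ⟨L, fun f => ae_volume_of_ae_dataMeasure (h1 f), h2⟩

/-- The Fourier transform of the translate `u(· + t₀)`, where `U = ℱu`. -/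
noncomputable def timeShift (t₀ : ℝ) (U : ℝ × ℝ → ℂ) (p : ℝ × ℝ) : ℂ :=
  Complex.exp (Complex.I * t₀ * p.1) * U p

lemma slice_timeShift (t₀ : ℝ) (U : ℝ × ℝ → ℂ) (t ξ : ℝ) :
    slice (timeShift t₀ U) t ξ = slice U (t + t₀) ξ := by
  unfold slice timeShift
  congr 1
  refine integral_congr_ae (Eventually.of_forall fun τ => ?_)
  dsimp only
  rw [← mul_assoc, ← Complex.exp_add]
  congr 2
  push_cast; ring

lemma measurable_timeShift (t₀ : ℝ) {U : ℝ × ℝ → ℂ} (hU : Measurable U) :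
    Measurable (timeShift t₀ U) := by
  unfold timeShift
  fun_prop

/-- A time translation multiplies ℱu by a unimodular factor, so dominated convergence gives strong
continuity of translations. -/
lemma tendsto_resEnergy_timeShift_sub {b : ℝ} (U : ResSpace α s ω b) (t₀ : ℝ) :
    Tendsto (fun t => resEnergy α s ω b fun p => ‖timeShift t U p - timeShift t₀ U p‖ₑ)
      (𝓝 t₀) (𝓝 0) := by
  have hU := measurable_resSpace U
  have hw := measurable_ofReal_resWeight α s ω b
  have hb : ∀ t p, ‖timeShift t U p - timeShift t₀ U p‖ₑ ≤ 2 * ‖U p‖ₑ := by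
    intro t p
    refine (enorm_sub_le).trans (le_of_eq ?_)
    simp only [timeShift, enorm_mul, enorm_exp_I_mul]
    ring
  have h0 : (0 : ℝ≥0∞) = ∫⁻ _ : ℝ × ℝ, 0 := by simp
  rw [h0]
  refine tendsto_lintegral_filter_of_dominated_convergence
    (fun p => ENNReal.ofReal (resWeight α s ω b p) * (2 * ‖U p‖ₑ) ^ 2)
    (Eventually.of_forall fun t => ?_)
    (Eventually.of_forall fun t => Eventually.of_forall fun p =>
      mul_le_mul_right (pow_le_pow_left' (hb t p) 2) _) ?_ ?_
  · have h1 := measurable_timeShift t hU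
    have h2 := measurable_timeShift t₀ hU
    fun_prop
  · have h1 : ∀ p, ENNReal.ofReal (resWeight α s ω b p) * (2 * ‖U p‖ₑ) ^ 2
        = 4 * (ENNReal.ofReal (resWeight α s ω b p) * ‖U p‖ₑ ^ 2) := fun p => by ring
    simp_rw [h1]
    rw [lintegral_const_mul' _ _ (by finiteness)]
    refine ENNReal.mul_ne_top (by finiteness) ?_
    change resEnergy α s ω b (fun p => ‖U p‖ₑ) ≠ ⊤
    rw [← resSpace_enorm_sq]
    finiteness
  · refine Eventually.of_forall fun p => ?_
    have h1 : Tendsto (fun t => timeShift t U p - timeShift t₀ U p) (𝓝 t₀) (𝓝 0) := by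
      have h2 : Continuous fun t : ℝ => timeShift t U p - timeShift t₀ U p := by
        unfold timeShift
        fun_prop
      simpa using h2.tendsto t₀
    have h3 := ENNReal.Tendsto.const_mul (a := ENNReal.ofReal (resWeight α s ω b p))
      ((ENNReal.continuous_pow 2).tendsto _ |>.comp h1.enorm) (Or.inr ENNReal.ofReal_ne_top)
    simpa using h3

lemma slice_sub_slice_ae (h : Admissible α ω ρ ε) (U : ResSpace α s ω (1 / 2 + ε)) (t t₀ : ℝ) :
    ∀ᵐ ξ : ℝ, slice U t ξ - slice U t₀ ξ
      = slice (fun p => timeShift t U p - timeShift t₀ U p) 0 ξ := by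
  have hb : (1 : ℝ) / 2 < 1 / 2 + ε := by linarith [h.eps_pos]
  filter_upwards [ae_integrable_slice h.omega_pos.le hb U] with ξ hξ
  unfold slice
  rw [← mul_sub, ← integral_sub (integrable_exp_mul hξ t) (integrable_exp_mul hξ t₀)]
  simp [timeShift]

/-- Elements of `X_{s,ω,b}` are continuous functions of time with values in `H^(s,ω)`. -/
theorem exists_evalOn (h : Admissible α ω ρ ε) (s T : ℝ) :
    ∃ E : ResSpace α s ω (1 / 2 + ε) →L[ℂ] C(Icc (-T) T, DataSpace s ω),
      ∀ U (t : Icc (-T) T), (E U t : DataSpace s ω) =ᵐ[volume] slice U t := by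
  choose E hE hEb using exists_eval (α := α) (ω := ω) (ρ := ρ) (ε := ε) h s
  -- The difference u(t) - u(t₀) is the value at time 0 of a difference of translates; the bounded
  -- evaluation at time 0 and the strong continuity of translations give continuity.
  have hcont : ∀ U, Continuous fun t => E t U := by
    intro U
    rw [continuous_iff_continuousAt]
    intro t₀
    rw [ContinuousAt, tendsto_iff_edist_tendsto_0]
    have h1 := tendsto_resEnergy_timeShift_sub U t₀
    have h2 : ∀ t, edist (E t U) (E t₀ U) ≤ (ENNReal.ofReal (evalConst ε) ^ 2
        * resEnergy α s ω (1 / 2 + ε) fun p => ‖timeShift t U p - timeShift t₀ U p‖ₑ)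
          ^ (1 / 2 : ℝ) := by
      intro t
      have hm := (measurable_timeShift t (measurable_resSpace U)).sub
        (measurable_timeShift t₀ (measurable_resSpace U))
      refine le_trans ?_ (ENNReal.rpow_le_rpow (dataEnergy_slice_le h s hm 0) (by norm_num))
      rw [edist_eq_enorm_sub, ← sq_half_rpow ‖_‖ₑ, dataSpace_enorm_sq]
      refine ENNReal.rpow_le_rpow (le_of_eq ?_) (by norm_num)
      refine lintegral_congr_ae ?_
      filter_upwards [hE t U, hE t₀ U, slice_sub_slice_ae h U t t₀,
        ae_volume_of_ae_dataMeasure (Lp.coeFn_sub (E t U) (E t₀ U))] with ξ a1 a2 a3 a4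
      rw [a4, Pi.sub_apply, a1, a2, a3]
      rfl
    refine tendsto_of_tendsto_of_tendsto_of_le_of_le tendsto_const_nhds ?_ (fun _ => zero_le) h2
    have h3 := (ENNReal.Tendsto.const_mul (a := ENNReal.ofReal (evalConst ε) ^ 2) h1
      (Or.inr (by finiteness))).ennrpow_const (1 / 2)
    simpa using h3
  let L : ResSpace α s ω (1 / 2 + ε) →ₗ[ℂ] C(Icc (-T) T, DataSpace s ω) :=
    { toFun := fun U => ⟨fun t => E t U, (hcont U).comp continuous_subtype_val⟩
      map_add' := fun U V => by ext t : 1; simp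
      map_smul' := fun c U => by ext t : 1; simp }
  have hL : ∀ U, ‖L U‖ ≤ evalConst ε * ‖U‖ := by
    intro U
    have h0 : 0 ≤ evalConst ε := Real.sqrt_nonneg _
    rw [ContinuousMap.norm_le _ (by positivity)]
    intro t
    have h1 := ENNReal.toReal_mono (by finiteness) (hEb t U)
    rwa [ENNReal.toReal_mul, toReal_enorm, toReal_enorm, ENNReal.toReal_ofReal h0] at h1
  exact ⟨L.mkContinuous _ hL, fun U t => hE t U⟩

/-- The embedding of the restriction norm space in the continuous functions of time. -/
theorem exists_embedding (h : Admissible α ω ρ ε) (s T : ℝ) (hω : 0 ≤ ω)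
    (hb : 1 / 2 < 1 / 2 + ε) :
    ∃ ι : ResTimeSpace α s ω (1 / 2 + ε) T hω hb →L[ℂ] C(Icc (-T) T, DataSpace s ω),
      Function.Injective ι ∧
      ∀ (U : ResSpace α s ω (1 / 2 + ε)) (t : Icc (-T) T), ∀ᵐ ξ : ℝ,
        (ι (restrictTime T hω hb U) t : DataSpace s ω) ξ = slice U t ξ := by
  obtain ⟨E, hE⟩ := exists_evalOn (α := α) (ω := ω) (ρ := ρ) (ε := ε) h s T
  -- The kernel of the evaluation map is exactly the subspace divided out, whence a well-defined and
  -- injective map on the quotient.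
  have hker : ∀ U, U ∈ vanishing α s ω (1 / 2 + ε) T hω hb ↔ E U = 0 := by
    intro U
    constructor
    · intro hU
      ext t : 1
      refine Lp.ext (ae_dataMeasure_of_ae_volume ?_)
      filter_upwards [hE U t, hU t t.2, ae_volume_of_ae_dataMeasure
        (Lp.coeFn_zero ℂ 2 (dataMeasure s ω))] with ξ a1 a2 a3
      rw [a1, a2, ContinuousMap.zero_apply, a3]
      rfl
    · intro hU t ht
      have h1 := hE U ⟨t, ht⟩
      rw [hU] at h1
      filter_upwards [h1, ae_volume_of_ae_dataMeasure
        (Lp.coeFn_zero ℂ 2 (dataMeasure s ω))] with ξ a1 a3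
      rw [← a1, ContinuousMap.zero_apply, a3]
      rfl
  refine ⟨(vanishing α s ω (1 / 2 + ε) T hω hb).liftQL E fun U hU => (hker U).1 hU, ?_,
    fun U t => hE U t⟩
  rw [injective_iff_map_eq_zero]
  intro x hx
  obtain ⟨U, rfl⟩ := Submodule.mkQ_surjective _ x
  exact (Submodule.Quotient.mk_eq_zero _).2 ((hker U).2 hx)


variable {α ω ρ ε s s₀ C T : ℝ} {ψ : ℝ → ℝ} {Ψ : ℝ → ℂ}

/-! ### The bilinear operator of the integral equation -/

lemma slice_congr_ae {U V : ℝ × ℝ → ℂ} (h : U =ᵐ[volume] V) :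
    ∀ᵐ ξ : ℝ, ∀ t, slice U t ξ = slice V t ξ := by
  filter_upwards [ae_fiber h] with ξ hξ t
  unfold slice
  congr 1
  refine integral_congr_ae ?_
  filter_upwards [hξ] with τ hτ
  rw [hτ]

/-- The Fourier transform at `ξ` of `∫_0^t W_α(t-t') ∂_x(u v)(t') dt'`. -/
noncomputable def duhamelMul (α : ℝ) (U V : ℝ × ℝ → ℂ) (t ξ : ℝ) : ℂ :=
  (√(2 * Real.pi) : ℂ)⁻¹ * ∫ τ : ℝ, dxMul U V (τ, ξ) * duhamelSymbol α t τ ξ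

lemma duhamel_eq_duhamelMul (α : ℝ) (U : ℝ × ℝ → ℂ) : duhamel α U = duhamelMul α U U := rfl

lemma resEnergy_enorm_dxMul_lt_top (h : Admissible α ω ρ ε) (hs : -ρ ≤ s)
    (U V : ResSpace α s ω (1 / 2 + ε)) :
    resEnergy α s ω (-1 / 2 + 2 * ε) (fun p => ‖dxMul U V p‖ₑ) < ⊤ :=
  (lintegral_mono fun p => mul_le_mul_right (pow_le_pow_left' (enorm_dxMul_le U V p) 2) _).trans_lt
    (resEnergy_dxMul_lt_top h hs U V)

lemma ae_integrable_dxMul_mul_duhamelSymbol (h : Admissible α ω ρ ε) (hs : -ρ ≤ s)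
    (U V : ResSpace α s ω (1 / 2 + ε)) :
    ∀ᵐ ξ : ℝ, ∀ t, Integrable fun τ : ℝ => dxMul U V (τ, ξ) * duhamelSymbol α t τ ξ := by
  have hm := measurable_dxMul (measurable_resSpace U) (measurable_resSpace V)
  filter_upwards [ae_lintegral_div_modulation_lt_top h hm (resEnergy_enorm_dxMul_lt_top h hs U V)]
    with ξ hξ t
  exact integrable_mul_duhamelSymbol hm hξ t

lemma duhamelConverges (h : Admissible α ω ρ ε) (hs : -ρ ≤ s) (U : ResSpace α s ω (1 / 2 + ε)) :
    DuhamelConverges α U := by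
  refine ⟨ae_integrable_convolution h hs U U, fun t => ?_⟩
  filter_upwards [ae_integrable_dxMul_mul_duhamelSymbol h hs U U] with ξ hξ
  exact hξ t

lemma duhamelMul_congr {U U' V V' : ℝ × ℝ → ℂ} (hU : U =ᵐ[volume] U') (hV : V =ᵐ[volume] V') :
    duhamelMul α U V = duhamelMul α U' V' := by
  unfold duhamelMul
  rw [dxMul_congr hU hV]

/-- `A = -(1/2) ψ_T(t) ∫_0^t W_α(t-t') ∂_x(u v)(t') dt'` as an operator on frequency functions. -/
def IsDuhamelBilinear (α T : ℝ) (Ψ : ℝ → ℂ) {s ω b : ℝ}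
    (A : ResSpace α s ω b →L[ℂ] ResSpace α s ω b →L[ℂ] ResSpace α s ω b) : Prop :=
  ∀ U V, A U V =ᵐ[volume] fun p => -(1 / 2) * duhamelOp Ψ α T (dxMul U V) p

lemma norm_le_of_enorm_sq_le {E F G : Type*} [NormedAddCommGroup E] [NormedAddCommGroup F]
    [NormedAddCommGroup G] {K : ℝ≥0∞} (hK : K ≠ ⊤) {x : E} {a b' : F} {a' b : G}
    (h : ‖x‖ₑ ^ 2 ≤ K * (‖a‖ₑ ^ 2 * ‖b‖ₑ ^ 2 + ‖a'‖ₑ ^ 2 * ‖b'‖ₑ ^ 2)) :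
    ‖x‖ ≤ √K.toReal * (‖a‖ * ‖b‖ + ‖a'‖ * ‖b'‖) := by
  have h1 := ENNReal.toReal_mono (by finiteness) h
  rw [ENNReal.toReal_mul, ENNReal.toReal_add (by finiteness) (by finiteness), ENNReal.toReal_mul,
    ENNReal.toReal_mul] at h1
  simp only [ENNReal.toReal_pow, toReal_enorm] at h1
  refine le_of_sq_le_sq (h1.trans ?_) (by positivity)
  rw [mul_pow, Real.sq_sqrt (by positivity)]
  gcongr
  have : 0 ≤ 2 * (‖a‖ * ‖b‖) * (‖a'‖ * ‖b'‖) := by positivity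
  nlinarith

/-- The nonlinearity maps into X_{s,ω,b'} with the tame bound, and the Duhamel operator returns to
X_{s,ω,b} with a factor T^ε. The constant κ does not depend on T, which is what allows a choice of
lifespan. -/
theorem exists_duhamelBilinear (h : Admissible α ω ρ ε) (hΨ : IsProfile ψ Ψ C) (hs₀ : -ρ ≤ s₀)
    (hs : s₀ ≤ s) {J : ResSpace α s ω (1 / 2 + ε) →L[ℂ] ResSpace α s₀ ω (1 / 2 + ε)}
    (hJ : ∀ U, J U =ᵐ[volume] (U : ℝ × ℝ → ℂ)) :
    ∃ κ : ℝ, 0 ≤ κ ∧ ∀ T, 0 < T → T ≤ 1 →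
      ∃ A : ResSpace α s ω (1 / 2 + ε) →L[ℂ] ResSpace α s ω (1 / 2 + ε) →L[ℂ]
          ResSpace α s ω (1 / 2 + ε), IsDuhamelBilinear α T Ψ A ∧
        ∀ U V, ‖A U V‖ ≤ κ * T ^ ε * (‖U‖ * ‖J V‖ + ‖J U‖ * ‖V‖) := by
  obtain ⟨N, hN⟩ := exists_nonlinearity h (hs₀.trans hs)
  have hC := hΨ.const_nonneg
  have hJE : ∀ U, resEnergy α s₀ ω (1 / 2 + ε) (fun q => ‖U q‖ₑ) = ‖J U‖ₑ ^ 2 := by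
    intro U
    rw [resSpace_enorm_sq]
    refine lintegral_congr_ae ?_
    filter_upwards [hJ U] with p hp
    rw [hp]
  have hNb : ∀ U V, ‖N U V‖ ≤ √(tameConst ε (s + ρ)).toReal * (‖U‖ * ‖J V‖ + ‖J U‖ * ‖V‖) := by
    intro U V
    refine norm_le_of_enorm_sq_le (tameConst_lt_top h.eps_pos _).ne ?_
    have h1 := resEnergy_dxMul_le h hs₀ hs U V
    rw [hJE, hJE] at h1
    refine le_trans ?_ h1
    rw [resSpace_enorm_sq]
    refine lintegral_mono_ae ?_
    filter_upwards [hN U V] with p hp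
    rw [hp]
    exact mul_le_mul_right (pow_le_pow_left' (enorm_dxMul_le U V p) 2) _
  refine ⟨duhamelConst ε C * √(tameConst ε (s + ρ)).toReal,
    by unfold duhamelConst; positivity, fun T hT hT1 => ?_⟩
  have hTε := Real.rpow_nonneg hT.le ε
  have hD0 : 0 ≤ duhamelConst ε C * T ^ ε := by unfold duhamelConst; positivity
  obtain ⟨D, hD, hDb⟩ := exists_duhamelOp h hΨ hT hT1 s
  refine ⟨(-(1 / 2) : ℂ) • (ContinuousLinearMap.compL ℂ _ _ _ D).comp N, fun U V => ?_,
    fun U V => ?_⟩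
  · have h1 : (((-(1 / 2) : ℂ) • (ContinuousLinearMap.compL ℂ _ _ _ D).comp N) U) V
        = (-(1 / 2) : ℂ) • D (N U V) := rfl
    rw [h1]
    filter_upwards [ae_volume_of_ae_resMeasure (Lp.coeFn_smul (-(1 / 2) : ℂ) (D (N U V))),
      hD (N U V), duhamelOp_congr_ae (hN U V) Ψ α T] with p a1 a2 a3
    rw [a1, Pi.smul_apply, a2, a3, smul_eq_mul]
  · have h1 : (((-(1 / 2) : ℂ) • (ContinuousLinearMap.compL ℂ _ _ _ D).comp N) U) V
        = (-(1 / 2) : ℂ) • D (N U V) := rfl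
    have h2 : ‖D (N U V)‖ ≤ duhamelConst ε C * T ^ ε * ‖N U V‖ := by
      have := ENNReal.toReal_mono (by finiteness) (hDb (N U V))
      rwa [ENNReal.toReal_mul, toReal_enorm, toReal_enorm, ENNReal.toReal_ofReal hD0] at this
    rw [h1, norm_smul]
    calc ‖(-(1 / 2) : ℂ)‖ * ‖D (N U V)‖ ≤ 1 * (duhamelConst ε C * T ^ ε
          * (√(tameConst ε (s + ρ)).toReal * (‖U‖ * ‖J V‖ + ‖J U‖ * ‖V‖))) := by
          gcongr
          · norm_num
          · exact h2.trans (mul_le_mul_of_nonneg_left (hNb U V) hD0)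
      _ = _ := by ring

lemma slice_duhamelBilinear (h : Admissible α ω ρ ε) (hΨ : IsProfile ψ Ψ C) (hs : -ρ ≤ s)
    (hT : 0 < T) (hT1 : T ≤ 1)
    {A : ResSpace α s ω (1 / 2 + ε) →L[ℂ] ResSpace α s ω (1 / 2 + ε) →L[ℂ]
      ResSpace α s ω (1 / 2 + ε)} (hA : IsDuhamelBilinear α T Ψ A)
    (U V : ResSpace α s ω (1 / 2 + ε)) :
    ∀ᵐ ξ : ℝ, ∀ t, slice (A U V) t ξ = -(1 / 2) * (ψ (t / T) * duhamelMul α U V t ξ) := by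
  have hm := measurable_dxMul (measurable_resSpace U) (measurable_resSpace V)
  filter_upwards [slice_congr_ae (hA U V),
    ae_lintegral_div_modulation_lt_top h hm (resEnergy_enorm_dxMul_lt_top h hs U V)] with ξ h1 h2 t
  rw [h1, duhamelMul, ← slice_duhamelOp_of_integrable hΨ hT hT1 hm h2 t]
  unfold slice
  rw [mul_left_comm (-(1 / 2) : ℂ), ← integral_const_mul (μ := (volume : Measure ℝ)) (-(1 / 2) : ℂ)]
  congr 1
  refine integral_congr_ae (Eventually.of_forall fun τ => ?_)
  dsimp only
  ring

/-- The difference of two quadratic Duhamel terms. -/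
lemma duhamelMul_sub_ae (h : Admissible α ω ρ ε) (hs : -ρ ≤ s)
    (U V : ResSpace α s ω (1 / 2 + ε)) :
    ∀ᵐ ξ : ℝ, ∀ t, duhamelMul α V V t ξ - duhamelMul α U U t ξ =
      duhamelMul α V (V - U : ResSpace α s ω (1 / 2 + ε)) t ξ
        + duhamelMul α (V - U : ResSpace α s ω (1 / 2 + ε)) U t ξ := by
  obtain ⟨N, hN⟩ := exists_nonlinearity h hs
  have e1 : N V V - N U U = N V (V - U) + N (V - U) U := by
    simp
  have hae : ∀ᵐ p : ℝ × ℝ, dxMul V V p - dxMul U U p = dxMul V (V - U : ResSpace α s ω (1 / 2 + ε)) p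
      + dxMul (V - U : ResSpace α s ω (1 / 2 + ε)) U p := by
    have h1 := ae_volume_of_ae_resMeasure (Lp.coeFn_sub (N V V) (N U U))
    have h2 := ae_volume_of_ae_resMeasure (Lp.coeFn_add (N V (V - U)) (N (V - U) U))
    rw [e1] at h1
    filter_upwards [h1, h2, hN V V, hN U U, hN V (V - U), hN (V - U) U] with p a1 a2 a3 a4 a5 a6
    rw [← a3, ← a4, ← a5, ← a6, ← Pi.sub_apply, ← a1, a2, Pi.add_apply]
  filter_upwards [ae_fiber hae, ae_integrable_dxMul_mul_duhamelSymbol h hs V V,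
    ae_integrable_dxMul_mul_duhamelSymbol h hs U U,
    ae_integrable_dxMul_mul_duhamelSymbol h hs V (V - U),
    ae_integrable_dxMul_mul_duhamelSymbol h hs (V - U) U] with ξ a1 a2 a3 a4 a5 t
  unfold duhamelMul
  rw [← mul_sub, ← mul_add, ← integral_sub (a2 t) (a3 t), ← integral_add (a4 t) (a5 t)]
  congr 1
  refine integral_congr_ae ?_
  filter_upwards [a1] with τ hτ
  rw [← sub_mul, hτ, add_mul]


/-! ### Quadratic equations in Banach spaces with a tame nonlinearity -/

/-- The contraction is measured by a functional N dominating the norm, which need not be a norm: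
geometric decay of N on consecutive differences makes the iterates a Cauchy sequence. -/
lemma exists_fixedPoint_of_contraction {X : Type*} [NormedAddCommGroup X] [CompleteSpace X]
    {N : X → ℝ} (hN : ∀ x, ‖x‖ ≤ N x) {f : X → X} (hf : Continuous f) {S : Set X}
    (hS : IsClosed S) {x₀ : X} (hx₀ : x₀ ∈ S) (hm : MapsTo f S S) {c : ℝ} (hc0 : 0 ≤ c) (hc : c < 1)
    (hN' : ∀ u ∈ S, ∀ v ∈ S, N (f u - f v) ≤ c * N (u - v)) : ∃ u ∈ S, f u = u := by
  have hmem : ∀ n, f^[n] x₀ ∈ S := fun n => hm.iterate n hx₀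
  have hgeo : ∀ n, N (f^[n + 1] x₀ - f^[n] x₀) ≤ N (f x₀ - x₀) * c ^ n := by
    intro n
    induction n with
    | zero => simp
    | succ n ih =>
      rw [Function.iterate_succ_apply' f (n + 1), Function.iterate_succ_apply' f n]
      rw [← Function.iterate_succ_apply' f n]
      have h1 := hN' _ (hmem (n + 1)) _ (hmem n)
      rw [← Function.iterate_succ_apply' f n] at h1
      calc _ ≤ c * N (f^[n + 1] x₀ - f^[n] x₀) := h1
        _ ≤ c * (N (f x₀ - x₀) * c ^ n) := by gcongr
        _ = _ := by ring
  have hcauchy : CauchySeq fun n => f^[n] x₀ := by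
    refine cauchySeq_of_le_geometric c (N (f x₀ - x₀)) hc fun n => ?_
    rw [dist_comm, dist_eq_norm]
    exact (hN _).trans (hgeo n)
  obtain ⟨u, hu⟩ := cauchySeq_tendsto_of_complete hcauchy
  refine ⟨u, hS.mem_of_tendsto hu (Eventually.of_forall hmem), ?_⟩
  have h1 : Tendsto (fun n => f^[n + 1] x₀) atTop (𝓝 (f u)) := by
    simp_rw [Function.iterate_succ_apply']
    exact (hf.tendsto u).comp hu
  exact tendsto_nhds_unique h1 (hu.comp (tendsto_add_atTop_nat 1))

variable {X X₀ : Type*} [NormedAddCommGroup X] [NormedSpace ℂ X] [NormedAddCommGroup X₀]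
  [NormedSpace ℂ X₀]

/-- A bilinear operator on `X` with a bound that is linear in the strong norm, and a bound in the
weak norm `‖J u‖`. -/
structure IsTame (J : X →L[ℂ] X₀) (B : X →L[ℂ] X →L[ℂ] X) (c : ℝ) : Prop where
  nonneg : 0 ≤ c
  weak : ∀ u v, ‖J (B u v)‖ ≤ c * (‖J u‖ * ‖J v‖)
  strong : ∀ u v, ‖B u v‖ ≤ c * (‖u‖ * ‖J v‖ + ‖J u‖ * ‖v‖)

namespace IsTame

variable {J : X →L[ℂ] X₀} {B : X →L[ℂ] X →L[ℂ] X} {c : ℝ}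

/-- The linearisation is a contraction for a suitable norm. -/
lemma linear_le (h : IsTame J B c) {u u' : X} {M : ℝ} (hu : 6 * c * ‖J u‖ ≤ 1)
    (hu' : 6 * c * ‖J u'‖ ≤ 1) (hM : ‖u‖ ≤ M) (hM' : ‖u'‖ ≤ M) (v : X) :
    ‖B u v + B v u'‖ + 6 * c * M * ‖J (B u v + B v u')‖
      ≤ 2 / 3 * (‖v‖ + 6 * c * M * ‖J v‖) := by
  have hc := h.nonneg
  have hM0 : 0 ≤ M := (norm_nonneg _).trans hM
  have hv := norm_nonneg v
  have hJv := norm_nonneg (J v)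
  -- The strong bound contains 2cM‖Jv‖, which is not small. The weak norm contracts by 1/3, so its
  -- multiple 6cM‖Jv‖ returns only 2cM‖Jv‖; the sum 4cM‖Jv‖ is 2/3 of 6cM‖Jv‖.
  have e1 : c * (‖u‖ * ‖J v‖) ≤ c * (M * ‖J v‖) := by gcongr
  have e2 : c * (‖J v‖ * ‖u'‖) ≤ c * (‖J v‖ * M) := by gcongr
  have e3 : 6 * c * ‖J u‖ * ‖v‖ ≤ 1 * ‖v‖ := by gcongr
  have e4 : 6 * c * ‖J u'‖ * ‖v‖ ≤ 1 * ‖v‖ := by gcongr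
  have e5 : (6 * c * ‖J u‖) * (c * M * ‖J v‖) ≤ 1 * (c * M * ‖J v‖) := by gcongr
  have e6 : (6 * c * ‖J u'‖) * (c * M * ‖J v‖) ≤ 1 * (c * M * ‖J v‖) := by gcongr
  have n1 : ‖B u v + B v u'‖ ≤ c * (‖u‖ * ‖J v‖ + ‖J u‖ * ‖v‖)
      + c * (‖v‖ * ‖J u'‖ + ‖J v‖ * ‖u'‖) :=
    (norm_add_le _ _).trans (add_le_add (h.strong _ _) (h.strong _ _))
  have n2 : ‖J (B u v + B v u')‖ ≤ c * (‖J u‖ * ‖J v‖) + c * (‖J v‖ * ‖J u'‖) := by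
    rw [map_add]
    exact (norm_add_le _ _).trans (add_le_add (h.weak _ _) (h.weak _ _))
  have n3 : 6 * c * M * ‖J (B u v + B v u')‖
      ≤ 6 * c * M * (c * (‖J u‖ * ‖J v‖) + c * (‖J v‖ * ‖J u'‖)) := by gcongr
  nlinarith

lemma sub_eq_linear (B : X →L[ℂ] X →L[ℂ] X) (u v : X) :
    B u u - B v v = B u (u - v) + B (u - v) v := by
  simp

lemma eq_of_fixedPoint (h : IsTame J B c) {y u u' : X} (hu : u = y + B u u) (hu' : u' = y + B u' u')
    (hs : 6 * c * ‖J u‖ ≤ 1) (hs' : 6 * c * ‖J u'‖ ≤ 1) : u = u' := by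
  have h1 := h.linear_le hs hs' (le_max_left ‖u‖ ‖u'‖) (le_max_right ‖u‖ ‖u'‖) (u - u')
  have h2 : u - u' = B u (u - u') + B (u - u') u' := by
    rw [← sub_eq_linear]
    nth_rw 1 [hu, hu']
    abel
  rw [← h2] at h1
  have hM : 0 ≤ 6 * c * max ‖u‖ ‖u'‖ * ‖J (u - u')‖ := by
    have := h.nonneg
    positivity
  have h3 : ‖u - u'‖ ≤ 0 := by linarith [norm_nonneg (u - u')]
  exact sub_eq_zero.1 (norm_le_zero_iff.1 h3)

/-- Contraction on the set where both norms of u are at most twice those of y. Only the weak norm of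
y is small; the strong norm is controlled because each term of the strong bound has a weak factor.
-/
lemma exists_fixedPoint [CompleteSpace X] (h : IsTame J B c) {y : X} (hy : 16 * c * ‖J y‖ ≤ 1) :
    ∃ u, u = y + B u u ∧ ‖J u‖ ≤ 2 * ‖J y‖ := by
  have hc := h.nonneg
  obtain ⟨u, hu, hfix⟩ := exists_fixedPoint_of_contraction (X := X)
    (N := fun x => ‖x‖ + 6 * c * (2 * ‖y‖) * ‖J x‖) (fun x => le_add_of_nonneg_right (by positivity))
    (f := fun u => y + B u u) (by fun_prop) (S := {u | ‖J u‖ ≤ 2 * ‖J y‖} ∩ {u | ‖u‖ ≤ 2 * ‖y‖})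
    ((isClosed_le (by fun_prop) continuous_const).inter
      (isClosed_le continuous_norm continuous_const)) (x₀ := 0)
    ⟨by simp, by simp⟩ (c := 2 / 3) (by
      rintro u ⟨h1 : ‖J u‖ ≤ _, h2 : ‖u‖ ≤ _⟩
      have hJy := norm_nonneg (J y)
      have hyn := norm_nonneg y
      constructor
      · change ‖J (y + B u u)‖ ≤ 2 * ‖J y‖
        rw [map_add]
        have e1 : c * (‖J u‖ * ‖J u‖) ≤ c * ((2 * ‖J y‖) * (2 * ‖J y‖)) := by gcongr
        have e2 : 16 * c * ‖J y‖ * ‖J y‖ ≤ 1 * ‖J y‖ := by gcongr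
        linarith [norm_add_le (J y) (J (B u u)), h.weak u u]
      · change ‖y + B u u‖ ≤ 2 * ‖y‖
        have e1 : c * (‖u‖ * ‖J u‖ + ‖J u‖ * ‖u‖)
            ≤ c * ((2 * ‖y‖) * (2 * ‖J y‖) + (2 * ‖J y‖) * (2 * ‖y‖)) := by gcongr
        have e2 : 16 * c * ‖J y‖ * ‖y‖ ≤ 1 * ‖y‖ := by gcongr
        linarith [norm_add_le y (B u u), h.strong u u]) (by norm_num) (by norm_num) (by
      rintro u ⟨h1 : ‖J u‖ ≤ _, h2 : ‖u‖ ≤ _⟩ v ⟨h3 : ‖J v‖ ≤ _, h4 : ‖v‖ ≤ _⟩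
      have e1 : 6 * c * ‖J u‖ ≤ 6 * c * (2 * ‖J y‖) := by gcongr
      have e2 : 6 * c * ‖J v‖ ≤ 6 * c * (2 * ‖J y‖) := by gcongr
      have e3 : 0 ≤ c * ‖J y‖ := by positivity
      have := h.linear_le (by linarith) (by linarith) h2 h4 (u - v)
      rw [← sub_eq_linear] at this
      simpa only [add_sub_add_left_eq_sub] using this)
  exact ⟨u, hfix.symm, hu.1⟩

/-- The derivative of `u ↦ u - B(u, u)`. -/
lemma exists_linear_equiv [CompleteSpace X] (h : IsTame J B c) {u : X} (hu : 6 * c * ‖J u‖ ≤ 1) :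
    ∃ e : X ≃L[ℂ] X, (e : X →L[ℂ] X) = ContinuousLinearMap.id ℂ X - (B u + B.flip u) := by
  set L : X →L[ℂ] X := ContinuousLinearMap.id ℂ X - (B u + B.flip u) with hL
  have hLv : ∀ v, L v = v - (B u v + B v u) := fun v => rfl
  have hc := h.nonneg
  have hinj : LinearMap.ker (L : X →ₗ[ℂ] X) = ⊥ := by
    rw [LinearMap.ker_eq_bot']
    intro v hv
    have h1 : v = B u v + B v u := sub_eq_zero.1 ((hLv v).symm.trans hv)
    have h2 := h.linear_le hu hu le_rfl le_rfl v
    rw [← h1] at h2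
    have hM : 0 ≤ 6 * c * ‖u‖ * ‖J v‖ := by positivity
    exact norm_le_zero_iff.1 (by linarith [norm_nonneg v])
  have hsurj : LinearMap.range (L : X →ₗ[ℂ] X) = ⊤ := by
    rw [LinearMap.range_eq_top]
    intro w
    obtain ⟨v, -, hv⟩ := exists_fixedPoint_of_contraction (X := X)
      (N := fun x => ‖x‖ + 6 * c * ‖u‖ * ‖J x‖) (fun x => le_add_of_nonneg_right (by positivity))
      (f := fun v => w + (B u v + B v u)) (by fun_prop) isClosed_univ (mem_univ 0)
      (mapsTo_univ _ _) (c := 2 / 3) (by norm_num) (by norm_num) (by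
        intro v _ v' _
        have h2 := h.linear_le hu hu le_rfl le_rfl (v - v')
        have h3 : B u (v - v') + B (v - v') u = B u v + B v u - (B u v' + B v' u) := by
          simp only [map_sub, sub_apply]
          abel
        rw [h3] at h2
        simpa only [add_sub_add_left_eq_sub] using h2)
    refine ⟨v, ?_⟩
    change L v = w
    rw [hLv]
    nth_rw 1 [← hv]
    abel
  exact ⟨ContinuousLinearEquiv.ofBijective L hinj hsurj, by ext v; rfl⟩

/-- The solution map of `u = y + B(u, u)` for data which are small in the weak norm. -/
theorem exists_solutionMap [CompleteSpace X] (h : IsTame J B c) :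
    ∃ S : X → X, ∀ y, 16 * c * ‖J y‖ ≤ 1 → S y = y + B (S y) (S y) ∧ AnalyticAt ℂ S y := by
  classical
  -- S selects the solution that is small in the weak norm, unique by `eq_of_fixedPoint`, and is 0
  -- where there is none.
  obtain ⟨S, hS⟩ : ∃ S : X → X, ∀ y u, u = y + B u u → 6 * c * ‖J u‖ ≤ 1 → S y = u := by
    refine ⟨fun y => if hy : ∃ u, u = y + B u u ∧ 6 * c * ‖J u‖ ≤ 1 then hy.choose else 0,
      fun y u hu hs => ?_⟩
    have hy : ∃ u, u = y + B u u ∧ 6 * c * ‖J u‖ ≤ 1 := ⟨u, hu, hs⟩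
    simp only [dif_pos hy]
    exact h.eq_of_fixedPoint hy.choose_spec.1 hu hy.choose_spec.2 hs
  refine ⟨S, fun y hy => ?_⟩
  obtain ⟨u, hu, hs⟩ := h.exists_fixedPoint hy
  have hc := h.nonneg
  -- From ‖Ju‖ ≤ 2‖Jy‖ and 16c‖Jy‖ ≤ 1. The gap between 8 and 6 gives a strict inequality, which
  -- persists near u even when the smallness condition on y is an equality.
  have hs' : 8 * c * ‖J u‖ ≤ 1 := by
    have : c * ‖J u‖ ≤ c * (2 * ‖J y‖) := by gcongr
    linarith
  have hlt : 6 * c * ‖J u‖ < 1 := by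
    have : 0 ≤ c * ‖J u‖ := by positivity
    linarith
  have hSy := hS y u hu hlt.le
  refine ⟨by rw [hSy]; exact hu, ?_⟩
  obtain ⟨e, he⟩ := h.exists_linear_equiv hlt.le
  obtain ⟨G, hG⟩ : ∃ G : X → X, G = fun v => v - B v v := ⟨_, rfl⟩
  have hGv : ∀ v, G v = v - B v v := fun v => by rw [hG]
  have hGu : G u = y := by
    rw [hGv]
    exact sub_eq_iff_eq_add.2 hu
  -- The order `⊤` in `WithTop ℕ∞` means analytic, beyond smooth; it is what the local inverse
  -- inherits.
  have hcd : ContDiffAt ℂ ⊤ G u := by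
    rw [hG]
    have : ContDiff ℂ ⊤ fun v => B v v := B.isBoundedBilinearMap.contDiff.comp
      (contDiff_id.prodMk contDiff_id)
    exact (contDiff_id.sub this).contDiffAt
  have hfd : HasFDerivAt G (e : X →L[ℂ] X) u := by
    rw [he, hG]
    have h1 := B.hasFDerivAt_of_bilinear (hasFDerivAt_id u) (hasFDerivAt_id u)
    refine ((hasFDerivAt_id u).sub h1).congr_fderiv ?_
    ext v
    simp
  have hn : (⊤ : WithTop ℕ∞) ≠ 0 := by simp
  have hinv := hcd.to_localInverse hfd hn
  rw [hGu] at hinv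
  have han : AnalyticAt ℂ (hcd.localInverse hfd hn) y := hinv.analyticAt
  -- Near y the local inverse solves the equation and stays small in the weak norm, so it agrees
  -- with S by uniqueness.
  have hev : hcd.localInverse hfd hn =ᶠ[𝓝 y] S := by
    have hst := hcd.hasStrictFDerivAt' hfd hn
    have r1 := hst.eventually_right_inverse
    have r2 := hst.localInverse_tendsto
    rw [hGu] at r1 r2
    have r3 : ∀ᶠ v in 𝓝 u, 6 * c * ‖J v‖ < 1 := by
      have : Continuous fun v => 6 * c * ‖J v‖ := by fun_prop
      exact this.continuousAt.eventually_lt continuousAt_const hlt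
    filter_upwards [r1, r2.eventually r3] with z a1 a2
    refine (hS z _ ?_ a2.le).symm
    rw [hGv] at a1
    exact sub_eq_iff_eq_add.1 a1
  exact han.congr hev

end IsTame


variable {α ω ρ ε s s₀ b C T : ℝ} {ψ : ℝ → ℝ} {Ψ : ℝ → ℂ}

/-! ### Translation in time -/

lemma exists_timeShift (t₀ : ℝ) (U : ResSpace α s ω b) :
    ∃ V : ResSpace α s ω b, V =ᵐ[volume] timeShift t₀ U ∧ ‖V‖ = ‖U‖ := by
  have hm := measurable_timeShift t₀ (measurable_resSpace U)
  have hn : eLpNorm (timeShift t₀ U) 2 (resMeasure α s ω b) = ‖U‖ₑ := by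
    rw [Lp.enorm_def]
    refine eLpNorm_congr_enorm_ae (Eventually.of_forall fun p => ?_)
    rw [timeShift, enorm_mul, enorm_exp_I_mul, one_mul]
  have hL : MemLp (timeShift t₀ U) 2 (resMeasure α s ω b) :=
    ⟨hm.aestronglyMeasurable, by rw [hn]; exact enorm_lt_top⟩
  refine ⟨hL.toLp _, ae_volume_of_ae_resMeasure hL.coeFn_toLp, ?_⟩
  rw [Lp.norm_toLp, hn, toReal_enorm]

lemma dxMul_timeShift (t₀ : ℝ) (U V : ℝ × ℝ → ℂ) (p : ℝ × ℝ) :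
    dxMul (timeShift t₀ U) (timeShift t₀ V) p
      = Complex.exp (Complex.I * t₀ * p.1) * dxMul U V p := by
  unfold dxMul
  rw [mul_left_comm (Complex.exp _),
    ← integral_const_mul (μ := (volume : Measure (ℝ × ℝ))) (Complex.exp (Complex.I * t₀ * p.1))]
  congr 1
  refine integral_congr_ae (Eventually.of_forall fun q => ?_)
  simp only [timeShift]
  rw [show Complex.I * t₀ * p.1 = Complex.I * t₀ * q.1 + Complex.I * t₀ * (p - q).1 by
    simp only [Prod.fst_sub]; push_cast; ring, Complex.exp_add]
  ring

lemma dxMul_comm (U V : ℝ × ℝ → ℂ) : dxMul U V = dxMul V U := by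
  ext p
  unfold dxMul
  congr 1
  rw [← integral_sub_left_eq_self _ _ p]
  refine integral_congr_ae (Eventually.of_forall fun q => ?_)
  dsimp only
  rw [sub_sub_cancel, mul_comm]

/-- The interval from 0 to t + t₀ is split at t₀ and the second piece is translated back to start at
0. -/
lemma duhamelSymbol_add (α t t₀ τ ξ : ℝ) : duhamelSymbol α (t + t₀) τ ξ =
    Complex.exp (Complex.I * t * phase α ξ) * duhamelSymbol α t₀ τ ξ
      + Complex.exp (Complex.I * t₀ * τ) * duhamelSymbol α t τ ξ := by
  unfold duhamelSymbol
  have hint : ∀ r a b : ℝ, IntervalIntegrable (fun t' : ℝ => Complex.exp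
      (Complex.I * (r - t') * phase α ξ) * Complex.exp (Complex.I * t' * τ)) volume a b :=
    fun r a b => Continuous.intervalIntegrable (by fun_prop) _ _
  have h1 := intervalIntegral.integral_add_adjacent_intervals (hint (t + t₀ : ℝ) 0 t₀)
    (hint (t + t₀ : ℝ) t₀ (t + t₀))
  have h2 := intervalIntegral.integral_comp_add_right (a := 0) (b := t)
    (fun t' : ℝ => Complex.exp (Complex.I * ((t + t₀ : ℝ) - t') * phase α ξ)
      * Complex.exp (Complex.I * t' * τ)) t₀
  rw [zero_add] at h2
  rw [← h1, ← h2, ← intervalIntegral.integral_const_mul, ← intervalIntegral.integral_const_mul]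
  congr 1
  · refine intervalIntegral.integral_congr fun t' _ => ?_
    simp only [← Complex.exp_add]
    congr 1
    push_cast; ring
  · refine intervalIntegral.integral_congr fun t' _ => ?_
    simp only [← Complex.exp_add]
    congr 1
    push_cast; ring

/-- Restarting the Duhamel integral at t₀ removes the free evolution of what had accumulated up to
t₀. -/
lemma duhamelMul_timeShift_ae (h : Admissible α ω ρ ε) (hs : -ρ ≤ s) (t₀ : ℝ)
    (U V : ResSpace α s ω (1 / 2 + ε)) :
    ∀ᵐ ξ : ℝ, ∀ t, duhamelMul α (timeShift t₀ U) (timeShift t₀ V) t ξ =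
      duhamelMul α U V (t + t₀) ξ
        - Complex.exp (Complex.I * t * phase α ξ) * duhamelMul α U V t₀ ξ := by
  filter_upwards [ae_integrable_dxMul_mul_duhamelSymbol h hs U V] with ξ hξ t
  unfold duhamelMul
  rw [mul_left_comm, ← integral_const_mul (μ := (volume : Measure ℝ))
    (Complex.exp (Complex.I * t * phase α ξ)), ← mul_sub,
    ← integral_sub (hξ _) ((hξ _).const_mul _)]
  congr 1
  refine integral_congr_ae (Eventually.of_forall fun τ => ?_)
  dsimp only
  rw [dxMul_timeShift, duhamelSymbol_add]
  ring

/-! ### Truncation to bounded frequencies -/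

/-- Truncation to the frequencies `|ξ| ≤ R`. -/
noncomputable def lowFreq (R : ℝ) (U : ℝ × ℝ → ℂ) : ℝ × ℝ → ℂ :=
  {p : ℝ × ℝ | |p.2| ≤ R}.indicator U

lemma measurableSet_strip (R : ℝ) : MeasurableSet {p : ℝ × ℝ | |p.2| ≤ R} :=
  measurableSet_le (by fun_prop) measurable_const

lemma measurable_lowFreq (R : ℝ) {U : ℝ × ℝ → ℂ} (hU : Measurable U) :
    Measurable (lowFreq R U) := hU.indicator (measurableSet_strip R)

lemma slice_lowFreq_eq_zero {R : ℝ} {U : ℝ × ℝ → ℂ} {t ξ : ℝ} (h : slice U t ξ = 0) :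
    slice (lowFreq R U) t ξ = 0 := by
  by_cases hξ : |ξ| ≤ R
  · have : ∀ τ : ℝ, lowFreq R U (τ, ξ) = U (τ, ξ) := fun τ =>
      indicator_of_mem (show (τ, ξ) ∈ {p : ℝ × ℝ | |p.2| ≤ R} from hξ) _
    unfold slice at h ⊢
    simpa only [this] using h
  · have : ∀ τ : ℝ, lowFreq R U (τ, ξ) = 0 := fun τ =>
      indicator_of_notMem (show (τ, ξ) ∉ {p : ℝ × ℝ | |p.2| ≤ R} from hξ) _
    simp [slice, this]

lemma exists_lowFreq (U : ResSpace α s ω b) : ∃ V : ℕ → ResSpace α s ω b,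
    (∀ n, V n =ᵐ[volume] lowFreq n U) ∧ Tendsto V atTop (𝓝 U) := by
  have hU := measurable_resSpace U
  have hw := measurable_ofReal_resWeight α s ω b
  have hL : ∀ n : ℕ, MemLp (lowFreq n U) 2 (resMeasure α s ω b) := fun n =>
    (Lp.memLp U).indicator (measurableSet_strip n)
  have hV : ∀ n : ℕ, (hL n).toLp _ =ᵐ[volume] lowFreq n U := fun n =>
    ae_volume_of_ae_resMeasure (hL n).coeFn_toLp
  refine ⟨fun n => (hL n).toLp _, hV, ?_⟩
  rw [tendsto_iff_edist_tendsto_0]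
  have h1 : Tendsto (fun n : ℕ => resEnergy α s ω b fun p => ‖lowFreq n U p - U p‖ₑ) atTop
      (𝓝 0) := by
    have h0 : (0 : ℝ≥0∞) = ∫⁻ _ : ℝ × ℝ, 0 := by simp
    rw [h0]
    refine tendsto_lintegral_filter_of_dominated_convergence
      (fun p => ENNReal.ofReal (resWeight α s ω b p) * ‖U p‖ₑ ^ 2)
      (Eventually.of_forall fun n => ?_)
      (Eventually.of_forall fun n => Eventually.of_forall fun p => ?_) ?_
      (Eventually.of_forall fun p => ?_)
    · have := measurable_lowFreq n hU
      fun_prop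
    · refine mul_le_mul_right (pow_le_pow_left' ?_ 2) _
      beta_reduce
      by_cases hp : p ∈ {p : ℝ × ℝ | |p.2| ≤ n}
      · rw [lowFreq, indicator_of_mem hp]; simp
      · rw [lowFreq, indicator_of_notMem hp]; simp
    · change resEnergy α s ω b (fun p => ‖U p‖ₑ) ≠ ⊤
      rw [← resSpace_enorm_sq]
      finiteness
    · refine tendsto_const_nhds.congr' ?_
      obtain ⟨n₀, hn₀⟩ := exists_nat_ge |p.2|
      filter_upwards [eventually_ge_atTop n₀] with n hn
      have hp : p ∈ {p : ℝ × ℝ | |p.2| ≤ n} :=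
        show |p.2| ≤ n from hn₀.trans (by exact_mod_cast hn)
      rw [lowFreq, indicator_of_mem hp]; simp
  have h2 : ∀ n : ℕ, edist ((hL n).toLp _) U
      = (resEnergy α s ω b fun p => ‖lowFreq n U p - U p‖ₑ) ^ (1 / 2 : ℝ) := by
    intro n
    rw [edist_eq_enorm_sub, ← sq_half_rpow ‖_‖ₑ, resSpace_enorm_sq]
    congr 1
    refine lintegral_congr_ae ?_
    filter_upwards [hV n, ae_volume_of_ae_resMeasure (Lp.coeFn_sub ((hL n).toLp _) U)]
      with p a1 a2
    rw [a2, Pi.sub_apply, a1]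
  simp_rw [h2]
  have h3 := h1.ennrpow_const (1 / 2)
  simpa using h3

lemma integrable_lowFreq (hω : 0 ≤ ω) (hb : 1 / 2 < b) (R : ℝ) (U : ResSpace α s ω b) :
    Integrable (lowFreq R U) := by
  unfold lowFreq
  rw [integrable_indicator_iff (measurableSet_strip R)]
  obtain ⟨K, hK, h⟩ := exists_strip_bound (α := α) (s := s) hω hb R
  exact ⟨(measurable_resSpace U).aestronglyMeasurable,
    (h U).trans_lt (ENNReal.mul_lt_top hK.lt_top enorm_lt_top)⟩

/-! ### Locality in time of the nonlinear term -/

/-- Convolution of integrable functions on the plane, read on almost every line of constant ξ.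
Elements of X_{s,ω,b} are integrable on strips |ξ| ≤ R, hence the truncation. -/
lemma ae_integrable_convolution_fiber {U V : ℝ × ℝ → ℂ} (hU : Measurable U) (hV : Measurable V)
    (hUi : Integrable U) (hVi : Integrable V) : ∀ᵐ ξ : ℝ,
      Integrable (fun x : ℝ × ℝ × ℝ => U x.2 * V ((x.1, ξ) - x.2)) (volume.prod volume) := by
  have hm : Measurable fun x : (ℝ × ℝ) × ℝ × ℝ => ‖U x.2 * V (x.1 - x.2)‖ₑ := by fun_prop
  have h1 : ∫⁻ p : ℝ × ℝ, ∫⁻ q : ℝ × ℝ, ‖U q * V (p - q)‖ₑ < ⊤ := by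
    rw [lintegral_lintegral_swap hm.aemeasurable]
    have h2 : ∀ q : ℝ × ℝ, ∫⁻ p : ℝ × ℝ, ‖U q * V (p - q)‖ₑ = ‖U q‖ₑ * ∫⁻ p, ‖V p‖ₑ := by
      intro q
      simp_rw [enorm_mul]
      rw [lintegral_const_mul' _ _ enorm_ne_top,
        lintegral_sub_right_eq_self (fun p => ‖V p‖ₑ) q]
    simp_rw [h2]
    rw [lintegral_mul_const' _ _ hVi.2.ne]
    exact ENNReal.mul_lt_top hUi.2 hVi.2
  obtain ⟨F, hF⟩ : ∃ F : ℝ × ℝ → ℝ≥0∞, ∀ p, F p = ∫⁻ q : ℝ × ℝ, ‖U q * V (p - q)‖ₑ :=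
    ⟨_, fun _ => rfl⟩
  have hm2 : Measurable F := by
    rw [show F = _ from funext hF]
    exact hm.lintegral_prod_right'
  simp_rw [← hF] at h1
  rw [Measure.volume_eq_prod, lintegral_prod_symm' _ hm2] at h1
  have h3 := ae_lt_top (hm2.lintegral_prod_left' (μ := (volume : Measure ℝ))) h1.ne
  simp_rw [hF] at h3
  filter_upwards [h3] with ξ hξ
  have hmξ : Measurable fun x : ℝ × ℝ × ℝ => U x.2 * V ((x.1, ξ) - x.2) := by fun_prop
  refine ⟨hmξ.aestronglyMeasurable, ?_⟩
  unfold HasFiniteIntegral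
  rw [lintegral_prod _ hmξ.enorm.aemeasurable]
  exact hξ

/-- Inverting the convolution in τ turns it into a product in time, convolved in ξ only; each term
contains a value of v at time t, which is zero. -/
lemma integral_exp_mul_dxMul_eq_zero {U V : ℝ × ℝ → ℂ} {t ξ : ℝ}
    (hi : Integrable (fun x : ℝ × ℝ × ℝ => U x.2 * V ((x.1, ξ) - x.2)) (volume.prod volume))
    (hV : ∀ᵐ η : ℝ, slice V t η = 0) :
    ∫ τ : ℝ, Complex.exp (Complex.I * t * τ) * dxMul U V (τ, ξ) = 0 := by
  have h0 : (√(2 * Real.pi) : ℂ)⁻¹ ≠ 0 := by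
    have : √(2 * Real.pi) ≠ 0 := by positivity
    exact inv_ne_zero (by exact_mod_cast this)
  have hV' : ∀ᵐ q : ℝ × ℝ, slice V t (ξ - q.2) = 0 := by
    have h1 := (quasiMeasurePreserving_sub_left_of_right_invariant
      (volume : Measure ℝ) ξ).ae hV
    exact (Measure.quasiMeasurePreserving_snd (μ := (volume : Measure ℝ))
      (ν := (volume : Measure ℝ))).ae h1
  have hint : Integrable (fun x : ℝ × ℝ × ℝ => Complex.exp (Complex.I * t * x.1)
      * (U x.2 * V ((x.1, ξ) - x.2))) (volume.prod volume) := by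
    refine hi.bdd_mul (c := 1) (by fun_prop) (Eventually.of_forall fun x => ?_)
    rw [norm_exp_I_mul]
  have h2 : ∫ τ : ℝ, ∫ q : ℝ × ℝ, Complex.exp (Complex.I * t * τ) * (U q * V ((τ, ξ) - q))
      = 0 := by
    rw [integral_integral_swap (f := fun (τ : ℝ) (q : ℝ × ℝ) =>
      Complex.exp (Complex.I * t * τ) * (U q * V ((τ, ξ) - q))) hint]
    refine integral_eq_zero_of_ae ?_
    filter_upwards [hV'] with q hq
    have h3 : ∫ τ : ℝ, Complex.exp (Complex.I * t * τ) * V (τ, ξ - q.2) = 0 := by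
      rcases mul_eq_zero.1 hq with h | h
      · exact absurd h h0
      · exact h
    have h4 : ∀ τ : ℝ, Complex.exp (Complex.I * t * τ) * (U q * V ((τ, ξ) - q))
        = U q * Complex.exp (Complex.I * t * q.1)
          * (Complex.exp (Complex.I * t * (τ - q.1 : ℝ)) * V (τ - q.1, ξ - q.2)) := by
      intro τ
      have : Complex.exp (Complex.I * t * τ) = Complex.exp (Complex.I * t * q.1)
          * Complex.exp (Complex.I * t * (τ - q.1 : ℝ)) := by
        rw [← Complex.exp_add]; congr 1; push_cast; ring
      rw [this]
      change _ * (_ * V (τ - q.1, ξ - q.2)) = _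
      ring
    simp_rw [h4]
    rw [integral_const_mul, integral_sub_right_eq_self
      (fun τ : ℝ => Complex.exp (Complex.I * t * τ) * V (τ, ξ - q.2)) q.1, h3, mul_zero]
    rfl
  have h5 : ∀ τ : ℝ, Complex.exp (Complex.I * t * τ) * dxMul U V (τ, ξ)
      = Complex.I * ξ * ((2 * Real.pi : ℝ) : ℂ)⁻¹
        * ∫ q : ℝ × ℝ, Complex.exp (Complex.I * t * τ) * (U q * V ((τ, ξ) - q)) := by
    intro τ
    rw [integral_const_mul]
    unfold dxMul
    ring
  simp_rw [h5]
  rw [integral_const_mul, h2, mul_zero]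

/-- After exchanging the integrals in τ and t', the integrand at each t' between 0 and t contains
the product uv at time t', which vanishes. -/
lemma duhamelMul_eq_zero {U V : ℝ × ℝ → ℂ} {δ t : ℝ} {ξ : ℝ}
    (hi : Integrable (fun x : ℝ × ℝ × ℝ => U x.2 * V ((x.1, ξ) - x.2)) (volume.prod volume))
    (hV : ∀ t ∈ Icc (-δ) δ, ∀ᵐ η : ℝ, slice V t η = 0) (ht : t ∈ Icc (-δ) δ) :
    duhamelMul α U V t ξ = 0 := by
  have hG : Integrable fun τ : ℝ => dxMul U V (τ, ξ) := by
    exact hi.integral_prod_left.const_mul (Complex.I * ξ * ((2 * Real.pi : ℝ) : ℂ)⁻¹)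
  have hsub : uIoc 0 t ⊆ Icc (-δ) δ := by
    intro x hx
    have h0 : (0 : ℝ) ∈ Icc (-δ) δ := by
      have : 0 ≤ δ := by linarith [ht.1, ht.2]
      exact ⟨by linarith, this⟩
    exact (uIcc_subset_Icc h0 ht) (uIoc_subset_uIcc hx)
  have : IsFiniteMeasure ((volume : Measure ℝ).restrict (uIoc 0 t)) :=
    ⟨by rw [Measure.restrict_apply_univ]; exact measure_Ioc_lt_top⟩
  have hint : Integrable (fun x : ℝ × ℝ => (Complex.exp (Complex.I * (t - x.2) * phase α ξ)
      * Complex.exp (Complex.I * x.2 * x.1)) * dxMul U V (x.1, ξ))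
      (volume.prod (volume.restrict (uIoc 0 t))) := by
    have h1 : Integrable (fun x : ℝ × ℝ => dxMul U V (x.1, ξ))
        (volume.prod (volume.restrict (uIoc 0 t))) := hG.comp_fst _
    refine h1.bdd_mul (c := 1) (by fun_prop) (Eventually.of_forall fun x => ?_)
    rw [norm_mul, norm_exp_I_mul, mul_one, ← Complex.ofReal_sub, norm_exp_I_mul]
  have h2 : ∫ τ : ℝ, ∫ t' in uIoc 0 t, (Complex.exp (Complex.I * (t - t') * phase α ξ)
      * Complex.exp (Complex.I * t' * τ)) * dxMul U V (τ, ξ) = 0 := by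
    rw [integral_integral_swap (f := fun (τ t' : ℝ) => (Complex.exp (Complex.I * (t - t') * phase α ξ)
      * Complex.exp (Complex.I * t' * τ)) * dxMul U V (τ, ξ)) hint]
    refine integral_eq_zero_of_ae ?_
    filter_upwards [ae_restrict_mem measurableSet_uIoc] with t' ht'
    have h4 : ∀ τ : ℝ, Complex.exp (Complex.I * (t - t') * phase α ξ)
        * Complex.exp (Complex.I * t' * τ) * dxMul U V (τ, ξ)
        = Complex.exp (Complex.I * (t - t') * phase α ξ)
          * (Complex.exp (Complex.I * t' * τ) * dxMul U V (τ, ξ)) := fun τ => mul_assoc _ _ _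
    simp_rw [h4]
    rw [integral_const_mul, integral_exp_mul_dxMul_eq_zero hi (hV t' (hsub ht')), mul_zero]
    rfl
  unfold duhamelMul duhamelSymbol
  rw [mul_eq_zero]
  right
  have h3 : ∀ τ : ℝ, dxMul U V (τ, ξ) * ∫ t' in (0 : ℝ)..t,
      Complex.exp (Complex.I * (t - t') * phase α ξ) * Complex.exp (Complex.I * t' * τ)
      = (if 0 ≤ t then 1 else -1 : ℝ) • ∫ t' in uIoc 0 t,
        (Complex.exp (Complex.I * (t - t') * phase α ξ)
          * Complex.exp (Complex.I * t' * τ)) * dxMul U V (τ, ξ) := by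
    intro τ
    rw [intervalIntegral.intervalIntegral_eq_integral_uIoc, integral_mul_const, mul_smul_comm,
      mul_comm]
  simp_rw [h3]
  rw [integral_smul, h2, smul_zero]


variable {α ω ρ ε s s₀ b C T δ : ℝ} {ψ : ℝ → ℝ} {Ψ : ℝ → ℂ}

/-! ### Uniqueness -/

lemma IsDuhamelBilinear.comm
    {A : ResSpace α s ω b →L[ℂ] ResSpace α s ω b →L[ℂ] ResSpace α s ω b}
    (hA : IsDuhamelBilinear α T Ψ A) (U V : ResSpace α s ω b) : A U V = A V U := by
  refine Lp.ext (ae_resMeasure_of_ae_volume ?_)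
  filter_upwards [hA U V, hA V U] with p h1 h2
  rw [h1, h2, dxMul_comm]

/-- If `y` vanishes on `[-δ, δ]` then so does the Duhamel term of `∂_x(u y)`. -/
lemma duhamelBilinear_mem_vanishing (h : Admissible α ω ρ ε) (hΨ : IsProfile ψ Ψ C)
    (hs : -ρ ≤ s) (hδ : 0 < δ) (hδ1 : δ ≤ 1) (hω : 0 ≤ ω) (hb : 1 / 2 < 1 / 2 + ε)
    {A : ResSpace α s ω (1 / 2 + ε) →L[ℂ] ResSpace α s ω (1 / 2 + ε) →L[ℂ]
      ResSpace α s ω (1 / 2 + ε)} (hA : IsDuhamelBilinear α δ Ψ A)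
    (U : ResSpace α s ω (1 / 2 + ε)) {Y : ResSpace α s ω (1 / 2 + ε)}
    (hY : Y ∈ vanishing α s ω (1 / 2 + ε) δ hω hb) :
    A U Y ∈ vanishing α s ω (1 / 2 + ε) δ hω hb := by
  -- Truncation makes both factors integrable, where locality is Fubini's theorem. Continuity of A
  -- and closedness of the subspace remove the truncation.
  obtain ⟨Un, hUn, hUt⟩ := exists_lowFreq U
  obtain ⟨Yn, hYn, hYt⟩ := exists_lowFreq Y
  have hlim : Tendsto (fun n => A (Un n) (Yn n)) atTop (𝓝 (A U Y)) :=
    (A.isBoundedBilinearMap.continuous.tendsto (U, Y)).comp (hUt.prodMk_nhds hYt)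
  refine (isClosed_vanishing α s ω (1 / 2 + ε) δ hω hb).mem_of_tendsto hlim
    (Eventually.of_forall fun n t ht => ?_)
  filter_upwards [slice_duhamelBilinear h hΨ hs hδ hδ1 hA (Un n) (Yn n),
    ae_integrable_convolution_fiber (measurable_lowFreq n (measurable_resSpace U))
      (measurable_lowFreq n (measurable_resSpace Y)) (integrable_lowFreq hω hb n U)
      (integrable_lowFreq hω hb n Y)] with ξ h1 h2
  rw [h1 t, duhamelMul_congr (hUn n) (hYn n), duhamelMul_eq_zero h2 (fun t ht => ?_) ht, mul_zero,
    mul_zero]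
  filter_upwards [hY t ht] with η hη using slice_lowFreq_eq_zero hη

/-- Local uniqueness for the linearised equation with zero data. -/
lemma mem_vanishing_of_linear (h : Admissible α ω ρ ε) (hΨ : IsProfile ψ Ψ C)
    (hψ : ∀ t ∈ Icc (-1 : ℝ) 1, ψ t = 1)
    (hs : -ρ ≤ s) (hδ : 0 < δ) (hδ1 : δ ≤ 1) (hω : 0 ≤ ω) (hb : 1 / 2 < 1 / 2 + ε)
    {A : ResSpace α s ω (1 / 2 + ε) →L[ℂ] ResSpace α s ω (1 / 2 + ε) →L[ℂ]
      ResSpace α s ω (1 / 2 + ε)} (hA : IsDuhamelBilinear α δ Ψ A) {c : ℝ}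
    (hAc : ∀ U V, ‖A U V‖ ≤ c * (‖U‖ * ‖V‖)) {U V Z : ResSpace α s ω (1 / 2 + ε)}
    (hc : c * (‖U‖ + ‖V‖) ≤ 1 / 2)
    (hZ : ∀ t ∈ Icc (-δ) δ, ∀ᵐ ξ : ℝ, slice Z t ξ
      = -(1 / 2) * (duhamelMul α V Z t ξ + duhamelMul α Z U t ξ)) :
    Z ∈ vanishing α s ω (1 / 2 + ε) δ hω hb := by
  -- The operator K has norm at most 1/2, preserves the elements vanishing on [-δ, δ], and Z - KZ is
  -- such an element. Hence all Z - KⁿZ are, and they converge to Z.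
  obtain ⟨K, hK⟩ : ∃ K : ResSpace α s ω (1 / 2 + ε) →L[ℂ] ResSpace α s ω (1 / 2 + ε),
    ∀ W, K W = A V W + A W U := ⟨A V + A.flip U, fun W => rfl⟩
  have hKn : ∀ W, ‖K W‖ ≤ 1 / 2 * ‖W‖ := by
    intro W
    rw [hK]
    calc _ ≤ c * (‖V‖ * ‖W‖) + c * (‖W‖ * ‖U‖) :=
          (norm_add_le _ _).trans (add_le_add (hAc _ _) (hAc _ _))
      _ = c * (‖U‖ + ‖V‖) * ‖W‖ := by ring
      _ ≤ _ := by gcongr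
  have hKv : ∀ W ∈ vanishing α s ω (1 / 2 + ε) δ hω hb,
      K W ∈ vanishing α s ω (1 / 2 + ε) δ hω hb := by
    intro W hW
    rw [hK, hA.comm W U]
    exact Submodule.add_mem _ (duhamelBilinear_mem_vanishing h hΨ hs hδ hδ1 hω hb hA V hW)
      (duhamelBilinear_mem_vanishing h hΨ hs hδ hδ1 hω hb hA U hW)
  have h0 : Z - K Z ∈ vanishing α s ω (1 / 2 + ε) δ hω hb := by
    intro t ht
    have ht1 : t / δ ∈ Icc (-1 : ℝ) 1 := by
      constructor
      · rw [le_div_iff₀ hδ]; linarith [ht.1]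
      · rw [div_le_iff₀ hδ]; linarith [ht.2]
    have e1 : (Z - K Z) + (A V Z + A Z U) = Z := by rw [hK]; abel
    have h1 := slice_add_ae hω hb (Z - K Z) (A V Z + A Z U)
    rw [e1] at h1
    filter_upwards [hZ t ht, h1, slice_add_ae hω hb (A V Z) (A Z U),
      slice_duhamelBilinear h hΨ hs hδ hδ1 hA V Z, slice_duhamelBilinear h hΨ hs hδ hδ1 hA Z U]
      with ξ a1 a2 a3 a4 a5
    have := a2 t
    rw [a1, a3 t, a4 t, a5 t, hψ _ ht1] at this
    simp only [Complex.ofReal_one] at this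
    linear_combination -this
  have hn : ∀ n : ℕ, Z - (K^[n]) Z ∈ vanishing α s ω (1 / 2 + ε) δ hω hb := by
    intro n
    induction n with
    | zero => simp
    | succ n ih =>
      have : Z - (K^[n + 1]) Z = (Z - K Z) + K (Z - (K^[n]) Z) := by
        rw [Function.iterate_succ_apply', map_sub]; abel
      rw [this]
      exact Submodule.add_mem _ h0 (hKv _ ih)
  have hnorm : ∀ n : ℕ, ‖(K^[n]) Z‖ ≤ (1 / 2) ^ n * ‖Z‖ := by
    intro n
    induction n with
    | zero => simp
    | succ n ih =>
      rw [Function.iterate_succ_apply', pow_succ']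
      calc _ ≤ 1 / 2 * ‖(K^[n]) Z‖ := hKn _
        _ ≤ 1 / 2 * ((1 / 2) ^ n * ‖Z‖) := by gcongr
        _ = _ := by ring
  have hlim : Tendsto (fun n : ℕ => Z - (K^[n]) Z) atTop (𝓝 Z) := by
    have h1 : Tendsto (fun n : ℕ => (K^[n]) Z) atTop (𝓝 0) := by
      refine squeeze_zero_norm hnorm ?_
      have := (tendsto_pow_atTop_nhds_zero_of_lt_one (r := (1 / 2 : ℝ)) (by norm_num)
        (by norm_num)).mul_const ‖Z‖
      simpa using this
    simpa using h1.const_sub Z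
  exact (isClosed_vanishing α s ω (1 / 2 + ε) δ hω hb).mem_of_tendsto hlim
    (Eventually.of_forall hn)

lemma duhamelMul_zero_time (α : ℝ) (U V : ℝ × ℝ → ℂ) (ξ : ℝ) : duhamelMul α U V 0 ξ = 0 := by
  simp [duhamelMul, duhamelSymbol]

/-- Solutions of the Cauchy problem are unique. -/
theorem eqOnTime_of_solvesOn (h : Admissible α ω ρ ε) (hΨ : IsProfile ψ Ψ C)
    (hψ : ∀ t ∈ Icc (-1 : ℝ) 1, ψ t = 1) (hs : -ρ ≤ s) (hT : 0 < T) (hT1 : T ≤ 1) {f : ℝ → ℂ}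
    {U V : ResSpace α s ω (1 / 2 + ε)} (hU : SolvesOn α T f U) (hV : SolvesOn α T f V) :
    EqOnTime T V U := by
  have hω := h.omega_pos.le
  have hε := h.eps_pos
  have hb : (1 : ℝ) / 2 < 1 / 2 + ε := by linarith
  obtain ⟨J, hJ, hJb⟩ := exists_inclusion (s₀ := s) (s := s) α ω (1 / 2 + ε) le_rfl
  have hJn : ∀ W, ‖J W‖ ≤ ‖W‖ := fun W => by
    have := ENNReal.toReal_mono (by finiteness) (hJb W)
    rwa [toReal_enorm, toReal_enorm] at this
  obtain ⟨κ, hκ, hA⟩ := exists_duhamelBilinear h hΨ hs le_rfl hJ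
  -- The step δ = T/(m+1) is chosen from the size of the two given solutions, with no smallness
  -- assumed. Translations preserve the norms, so the same δ serves at every step.
  obtain ⟨m, hm⟩ : ∃ m : ℕ, 2 * κ * (T / (m + 1)) ^ ε * (‖U‖ + ‖V‖) ≤ 1 / 2 := by
    have h1 : Tendsto (fun m : ℕ => T / ((m : ℝ) + 1)) atTop (𝓝 0) := by
      have := (tendsto_one_div_add_atTop_nhds_zero_nat (𝕜 := ℝ)).const_mul T
      simpa [div_eq_mul_inv] using this
    have h2 := (h1.rpow_const (p := ε) (Or.inr hε.le)).const_mul (2 * κ) |>.mul_const (‖U‖ + ‖V‖)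
    rw [Real.zero_rpow hε.ne', mul_zero, zero_mul] at h2
    exact (h2.eventually_le_const (by norm_num : (0 : ℝ) < 1 / 2)).exists
  obtain ⟨δ, hδdef⟩ : ∃ δ, δ = T / ((m : ℝ) + 1) := ⟨_, rfl⟩
  have hm1 : (0 : ℝ) < (m : ℝ) + 1 := by positivity
  have hδ : 0 < δ := by rw [hδdef]; positivity
  have hδT : ((m : ℝ) + 1) * δ = T := by rw [hδdef]; field_simp
  have hδ1 : δ ≤ 1 := by nlinarith [(Nat.cast_nonneg m : (0 : ℝ) ≤ m)]
  rw [← hδdef] at hm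
  obtain ⟨A, hAd, hAb⟩ := hA δ hδ hδ1
  have hAc : ∀ U V, ‖A U V‖ ≤ 2 * κ * δ ^ ε * (‖U‖ * ‖V‖) := by
    intro U V
    have h1 := Real.rpow_nonneg hδ.le ε
    calc _ ≤ κ * δ ^ ε * (‖U‖ * ‖J V‖ + ‖J U‖ * ‖V‖) := hAb U V
      _ ≤ κ * δ ^ ε * (‖U‖ * ‖V‖ + ‖U‖ * ‖V‖) := by
          gcongr
          · exact hJn V
          · exact hJn U
      _ = _ := by ring
  obtain ⟨Z, hZdef⟩ : ∃ Z, Z = V - U := ⟨_, rfl⟩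
  have hZs : ∀ᵐ ξ : ℝ, ∀ t, slice Z t ξ = slice V t ξ - slice U t ξ := by
    have := slice_add_ae hω hb Z U
    rw [hZdef, sub_add_cancel] at this
    rw [hZdef]
    filter_upwards [this] with ξ hξ t
    rw [hξ t]; ring
  have hZ : ∀ t ∈ Icc (-T) T, ∀ᵐ ξ : ℝ, slice Z t ξ
      = -(1 / 2) * (duhamelMul α V Z t ξ + duhamelMul α Z U t ξ) := by
    intro t ht
    have h1 := duhamelMul_sub_ae h hs U V
    rw [← hZdef] at h1
    filter_upwards [hU t ht, hV t ht, hZs, h1] with ξ a1 a2 a3 a4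
    rw [a3 t, a1, a2, ← a4 t, duhamel_eq_duhamelMul, duhamel_eq_duhamelMul]
    ring
  -- Induction on j, for the times |t| ≤ jδ. To reach a time beyond, restart at t₀ = ±jδ, where Z
  -- vanishes: the translated difference solves the linear equation with zero data on [-δ, δ].
  have main : ∀ j : ℕ, (j : ℝ) ≤ m + 1 → ∀ t, |t| ≤ j * δ → ∀ᵐ ξ : ℝ, slice Z t ξ = 0 := by
    intro j
    induction j with
    | zero =>
      intro _ t ht
      have ht0 : t = 0 := by simpa using ht
      subst ht0
      filter_upwards [hZ 0 ⟨by linarith, hT.le⟩] with ξ hξ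
      rw [hξ, duhamelMul_zero_time, duhamelMul_zero_time]
      ring
    | succ j ih =>
      intro hj t ht
      push_cast at hj ht
      have ih' := ih (by linarith)
      by_cases htj : |t| ≤ j * δ
      · exact ih' t htj
      push Not at htj
      have hjδ : 0 ≤ (j : ℝ) * δ := by positivity
      have hjT : ((j : ℝ) + 1) * δ ≤ T := by rw [← hδT]; gcongr
      obtain ⟨t₀, ht₀, htt₀⟩ : ∃ t₀, |t₀| ≤ j * δ ∧ |t - t₀| ≤ δ := by
        rcases le_total 0 t with h0 | h0
        · rw [abs_of_nonneg h0] at ht htj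
          refine ⟨j * δ, (abs_of_nonneg hjδ).le, ?_⟩
          rw [abs_le]; constructor <;> linarith
        · rw [abs_of_nonpos h0] at ht htj
          refine ⟨-(j * δ), by rw [abs_neg, abs_of_nonneg hjδ], ?_⟩
          rw [abs_le]; constructor <;> linarith
      obtain ⟨U', hU', hUn⟩ := exists_timeShift t₀ U
      obtain ⟨V', hV', hVn⟩ := exists_timeShift t₀ V
      obtain ⟨Z', hZ', -⟩ := exists_timeShift t₀ Z
      have ht₀T : t₀ ∈ Icc (-T) T := by
        have := abs_le.1 ht₀
        constructor <;> nlinarith [this.1, this.2]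
      have hmem : Z' ∈ vanishing α s ω (1 / 2 + ε) δ hω hb := by
        refine mem_vanishing_of_linear h hΨ hψ hs hδ hδ1 hω hb hAd hAc (U := U') (V := V')
          (by rwa [hUn, hVn]) fun t' ht' => ?_
        have hmem : t' + t₀ ∈ Icc (-T) T := by
          have := abs_le.1 ht₀
          constructor <;> nlinarith [this.1, this.2, ht'.1, ht'.2]
        filter_upwards [slice_congr_ae hZ', hZ _ hmem, hZ _ ht₀T, ih' t₀ ht₀,
          duhamelMul_timeShift_ae h hs t₀ V Z, duhamelMul_timeShift_ae h hs t₀ Z U]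
          with ξ a1 a2 a3 a4 a5 a6
        rw [a4] at a3
        rw [a1, slice_timeShift, a2, duhamelMul_congr hV' hZ', duhamelMul_congr hZ' hU', a5 t',
          a6 t']
        -- The terms left over at t₀ cancel by the equation at time t₀, where Z is zero, multiplied
        -- by the free propagator.
        linear_combination (-Complex.exp (Complex.I * t' * phase α ξ)) * a3
      have htm : t - t₀ ∈ Icc (-δ) δ := abs_le.1 htt₀
      filter_upwards [hmem _ htm, slice_congr_ae hZ'] with ξ a1 a2
      rw [a2, slice_timeShift, sub_add_cancel] at a1
      exact a1
  intro t ht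
  filter_upwards [main (m + 1) (by push_cast; exact le_rfl) t (by
    push_cast; rw [hδT]; exact abs_le.2 ht), hZs] with ξ a1 a2
  rw [a2 t] at a1
  exact sub_eq_zero.1 a1


variable {α ω ρ ε s s₀ b C T κ : ℝ} {ψ : ℝ → ℝ} {Ψ : ℝ → ℂ}

/-! ### The flow map -/

/-- The bound ρ ≥ (α-1)/2 keeps ρ positive when s₀ is large and makes ε small compared with α - 1.
As 80ε = 3(α-1) - 4ρ and 8ε(1+α) ≤ 24ε, there is ample room in `rho_le`; and 2ω ≤ 2 - α gives
`omega_le`. -/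
lemma exists_admissible (hα1 : 1 < α) (hα2 : α < 2) (hω : ω = 1 / α - 1 / 2)
    (hs₀ : -(3 / 4) * (α - 1) < s₀) : ∃ ρ ε, Admissible α ω ρ ε ∧ -ρ ≤ s₀ := by
  have hα0 : α ≠ 0 := by linarith
  obtain ⟨ρ, hρ⟩ : ∃ ρ, ρ = max (-s₀) ((α - 1) / 2) := ⟨_, rfl⟩
  have h1 : -s₀ ≤ ρ := hρ ▸ le_max_left _ _
  have h2 : (α - 1) / 2 ≤ ρ := hρ ▸ le_max_right _ _
  have h3 : ρ < 3 / 4 * (α - 1) := by rw [hρ]; exact max_lt (by linarith) (by linarith)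
  have h4 : α * ω = 1 - α / 2 := by rw [hω]; field_simp
  refine ⟨ρ, (3 / 4 * (α - 1) - ρ) / 20, ⟨hα1, hα2, h4, by linarith, by linarith, by nlinarith,
    by linarith, ?_⟩, by linarith⟩
  have h5 : 2 * ω ≤ 2 - α := by
    have : 0 ≤ ω := omega_nonneg hα1 hα2 hω
    nlinarith
  linarith

/-- An antitone time `T(r) ∈ (0, 1]` with `K r T(r)^ε ≤ 1`. -/
lemma exists_lifespan (hε : 0 < ε) {K : ℝ} (hK : 0 ≤ K) :
    ∃ T : ℝ → ℝ, (∀ r, 0 ≤ r → 0 < T r ∧ T r ≤ 1 ∧ K * r * T r ^ ε ≤ 1) ∧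
      AntitoneOn T (Ici 0) := by
  -- The solution of (1 + Kr) T^ε = 1.
  refine ⟨fun r => ((1 + K * r)⁻¹) ^ ε⁻¹, fun r hr => ?_, fun r hr r' _ hrr' => ?_⟩
  · have h0 : 0 ≤ K * r := mul_nonneg hK hr
    refine ⟨by positivity, Real.rpow_le_one (by positivity) (inv_le_one_of_one_le₀ (by linarith))
      (by positivity), ?_⟩
    rw [← Real.rpow_mul (by positivity), inv_mul_cancel₀ hε.ne', Real.rpow_one,
      ← div_eq_mul_inv, div_le_one (by positivity)]
    linarith
  · have h0 : 0 ≤ K * r := mul_nonneg hK hr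
    have h1 : K * r ≤ K * r' := mul_le_mul_of_nonneg_left hrr' hK
    exact Real.rpow_le_rpow (inv_nonneg.2 (by linarith))
      (inv_anti₀ (by linarith) (by linarith)) (by positivity)

lemma norm_freeOp_le (h : Admissible α ω ρ ε) (hΨ : IsProfile ψ Ψ C) (hs : s₀ ≤ s)
    {f : DataSpace s ω} {W : ResSpace α s₀ ω (1 / 2 + ε)} (hW : W =ᵐ[volume] freeOp Ψ α f) :
    ‖W‖ ≤ freeConst C * dataNorm s₀ ω f := by
  have h1 := resEnergy_freeOp_le h hΨ s₀ (measurable_dataSpace f)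
  have hC : 0 ≤ freeConst C := Real.sqrt_nonneg _
  rw [dataEnergy_eq_dataNorm hs, ← mul_pow, ← ENNReal.ofReal_mul hC] at h1
  have h2 : ‖W‖ₑ ^ 2 ≤ ENNReal.ofReal (freeConst C * dataNorm s₀ ω f) ^ 2 := by
    refine le_trans (le_of_eq ?_) h1
    rw [resSpace_enorm_sq]
    refine lintegral_congr_ae ?_
    filter_upwards [hW] with p hp
    rw [hp]
  have h3 := ENNReal.toReal_mono ENNReal.ofReal_ne_top (le_of_sq_le_sq_ennreal h2)
  rwa [toReal_enorm, ENNReal.toReal_ofReal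
    (mul_nonneg hC (dataNorm_nonneg _ _ _))] at h3

/-- A tame Duhamel bilinear map at regularity `s`, relative to `s₀ ≤ s`. -/
lemma exists_tame_duhamelBilinear (h : Admissible α ω ρ ε) (hΨ : IsProfile ψ Ψ C) (hs₀ : -ρ ≤ s₀)
    (hs : s₀ ≤ s) {J : ResSpace α s ω (1 / 2 + ε) →L[ℂ] ResSpace α s₀ ω (1 / 2 + ε)}
    (hJ : ∀ U, J U =ᵐ[volume] (U : ℝ × ℝ → ℂ)) :
    ∃ κ, 0 ≤ κ ∧ ∀ T, 0 < T → T ≤ 1 → ∃ A, IsDuhamelBilinear α T Ψ A ∧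
      IsTame J A (κ * T ^ ε) := by
  obtain ⟨J₀, hJ₀, hJ₀b⟩ := exists_inclusion (s₀ := s₀) (s := s₀) α ω (1 / 2 + ε) le_rfl
  have hJ₀n : ∀ W, ‖J₀ W‖ ≤ ‖W‖ := fun W => by
    have := ENNReal.toReal_mono (by finiteness) (hJ₀b W)
    rwa [toReal_enorm, toReal_enorm] at this
  obtain ⟨κ, hκ, hA⟩ := exists_duhamelBilinear h hΨ hs₀ hs hJ
  obtain ⟨κ₀, hκ₀, hA₀⟩ := exists_duhamelBilinear h hΨ hs₀ le_rfl hJ₀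
  refine ⟨max κ (2 * κ₀), hκ.trans (le_max_left _ _), fun T hT hT1 => ?_⟩
  have hTε := Real.rpow_nonneg hT.le ε
  obtain ⟨A, hAd, hAb⟩ := hA T hT hT1
  obtain ⟨A₀, hA₀d, hA₀b⟩ := hA₀ T hT hT1
  refine ⟨A, hAd, mul_nonneg (hκ.trans (le_max_left _ _)) hTε, fun U V => ?_, fun U V => ?_⟩
  · have e : J (A U V) = A₀ (J U) (J V) := by
      refine Lp.ext (ae_resMeasure_of_ae_volume ?_)
      filter_upwards [hJ (A U V), hAd U V, hA₀d (J U) (J V)] with p h1 h2 h3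
      rw [h1, h2, h3, dxMul_congr (hJ U) (hJ V)]
    rw [e]
    have h1 := hJ₀n (J U)
    have h2 := hJ₀n (J V)
    calc ‖A₀ (J U) (J V)‖
        ≤ κ₀ * T ^ ε * (‖J U‖ * ‖J₀ (J V)‖ + ‖J₀ (J U)‖ * ‖J V‖) := hA₀b _ _
      _ ≤ κ₀ * T ^ ε * (‖J U‖ * ‖J V‖ + ‖J U‖ * ‖J V‖) := by gcongr
      _ = 2 * κ₀ * T ^ ε * (‖J U‖ * ‖J V‖) := by ring
      _ ≤ _ := by gcongr; exact le_max_right _ _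
  · refine (hAb U V).trans ?_
    gcongr
    exact le_max_left _ _

lemma isFixedPoint_of_eq_add (h : Admissible α ω ρ ε) (hΨ : IsProfile ψ Ψ C) (hs : -ρ ≤ s)
    (hT : 0 < T) (hT1 : T ≤ 1)
    {A : ResSpace α s ω (1 / 2 + ε) →L[ℂ] ResSpace α s ω (1 / 2 + ε) →L[ℂ]
      ResSpace α s ω (1 / 2 + ε)} (hA : IsDuhamelBilinear α T Ψ A) {f : ℝ → ℂ}
    {U Y : ResSpace α s ω (1 / 2 + ε)} (hY : Y =ᵐ[volume] freeOp Ψ α f) (hU : U = Y + A U U) :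
    IsFixedPoint α ψ T f U := by
  intro t
  have hb : (1 : ℝ) / 2 < 1 / 2 + ε := by linarith [h.eps_pos]
  filter_upwards [slice_add_ae h.omega_pos.le hb Y (A U U), slice_congr_ae hY,
    slice_duhamelBilinear h hΨ hs hT hT1 hA U U] with ξ h1 h2 h3
  rw [← hU] at h1
  rw [h1, h2, h3, slice_freeOp hΨ, duhamel_eq_duhamelMul]
  ring

/-- Since T ≤ 1, both cutoffs ψ and ψ_T equal 1 on [-T, T]. -/
lemma IsFixedPoint.solvesOn (hψ : ∀ t ∈ Icc (-1 : ℝ) 1, ψ t = 1) (hT : 0 < T) (hT1 : T ≤ 1)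
    {f : ℝ → ℂ} {U : ℝ × ℝ → ℂ} (hU : IsFixedPoint α ψ T f U) : SolvesOn α T f U := by
  intro t ht
  filter_upwards [hU t] with ξ hξ
  rw [hξ, hψ t ⟨by linarith [ht.1], ht.2.trans hT1⟩,
    hψ (t / T) ⟨by rw [le_div_iff₀ hT]; linarith [ht.1], by rw [div_le_one hT]; exact ht.2⟩]
  push_cast
  ring

lemma SolvesOn.congr {f : ℝ → ℂ} {U V : ℝ × ℝ → ℂ} (hU : SolvesOn α T f U)
    (hV : V =ᵐ[volume] U) : SolvesOn α T f V := by
  intro t ht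
  filter_upwards [hU t ht, slice_congr_ae hV] with ξ h1 h2
  rw [h2, h1, duhamel_eq_duhamelMul, duhamel_eq_duhamelMul, duhamelMul_congr hV hV]

/-- The solution map on the ball of radius `r`, for a lifespan with `16 κ C r T^ε ≤ 1`. -/
lemma exists_flow (h : Admissible α ω ρ ε) (hΨ : IsProfile ψ Ψ C)
    (hψ : ∀ t ∈ Icc (-1 : ℝ) 1, ψ t = 1) (hs₀ : -ρ ≤ s₀) (hs : s₀ ≤ s) :
    ∃ K, 0 ≤ K ∧ ∀ r T : ℝ, 0 < T → T ≤ 1 → K * r * T ^ ε ≤ 1 →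
      ∃ G : DataSpace s ω → ResSpace α s ω (1 / 2 + ε), ∀ f : DataSpace s ω, dataNorm s₀ ω f ≤ r →
        IsUniqueSolution α s s₀ ω (1 / 2 + ε) ψ T f (G f) ∧ AnalyticAt ℂ G f := by
  obtain ⟨J, hJ, -⟩ := exists_inclusion α ω (1 / 2 + ε) hs
  obtain ⟨L, hL⟩ := exists_freeOp h hΨ s
  obtain ⟨κ, hκ, hA⟩ := exists_tame_duhamelBilinear h hΨ hs₀ hs hJ
  have hC : 0 ≤ freeConst C := Real.sqrt_nonneg _
  -- 16 is the smallness constant of `IsTame.exists_solutionMap`, κT^ε the norm of the bilinear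
  -- operator, and `freeConst C` bounds the free evolution in the weak norm.
  refine ⟨16 * κ * freeConst C, by positivity, fun r T hT hT1 hr => ?_⟩
  obtain ⟨A, hAd, hAt⟩ := hA T hT hT1
  obtain ⟨S, hS⟩ := hAt.exists_solutionMap
  refine ⟨fun f => S (L f), fun f hf => ?_⟩
  have hsmall : 16 * (κ * T ^ ε) * ‖J (L f)‖ ≤ 1 := by
    have h1 : ‖J (L f)‖ ≤ freeConst C * r :=
      (norm_freeOp_le h hΨ hs ((hJ (L f)).trans (hL f))).trans (mul_le_mul_of_nonneg_left hf hC)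
    have hTε := Real.rpow_nonneg hT.le ε
    calc 16 * (κ * T ^ ε) * ‖J (L f)‖ ≤ 16 * (κ * T ^ ε) * (freeConst C * r) := by gcongr
      _ = 16 * κ * freeConst C * r * T ^ ε := by ring
      _ ≤ 1 := hr
  obtain ⟨hfix, han⟩ := hS (L f) hsmall
  have hfp := isFixedPoint_of_eq_add h hΨ (hs₀.trans hs) hT hT1 hAd (hL f) hfix
  have hsol := hfp.solvesOn hψ hT hT1
  refine ⟨⟨hfp, hsol, fun V hV t ht => ?_⟩, ?_⟩
  -- Uniqueness is applied at regularity s₀, where the constructed solution is compared with V after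
  -- inclusion.
  · have h1 := eqOnTime_of_solvesOn h hΨ hψ hs₀ hT hT1 (hsol.congr (hJ (S (L f)))) hV t ht
    filter_upwards [h1, slice_congr_ae (hJ (S (L f)))] with ξ h2 h3
    rw [h2, h3]
  · exact AnalyticAt.fun_comp (f := fun f => L f) han (L.analyticAt f)

end DispersiveBO

/-! ### Conclusion -/

open DispersiveBO

theorem theorem3p2 (α : ℝ) (hα1 : 1 < α) (hα2 : α < 2) (ω : ℝ) (hω : ω = 1 / α - 1 / 2)
    (s s₀ : ℝ) (hs : s₀ ≤ s) (hs₀ : -(3 / 4) * (α - 1) < s₀) (ψ : ℝ → ℝ) (hψ : IsCutoff ψ) :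
    ∃ (b : ℝ) (hb : 1 / 2 < b),
      -- `X^T_{s,ω,b} ⊂ C([-T,T], H^(s,ω))`, by a continuous injection
      (∀ T : ℝ, 0 < T →
        ∃ ι : ResTimeSpace α s ω b T (omega_nonneg hα1 hα2 hω) hb →L[ℂ]
            C(Icc (-T) T, DataSpace s ω),
          Function.Injective ι ∧
          ∀ (U : ResSpace α s ω b) (t : Icc (-T) T), ∀ᵐ ξ : ℝ,
            (ι (restrictTime T (omega_nonneg hα1 hα2 hω) hb U) t : DataSpace s ω) ξ
              = slice U t ξ) ∧
      -- the nonlinear term makes sense on `X_{s₀,ω,b}` (and hence on `X_{s,ω,b}`)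
      (∀ U : ResSpace α s₀ ω b, DuhamelConverges α U) ∧
      ∃ T : ℝ → ℝ, (∀ r, 0 ≤ r → 0 < T r) ∧ AntitoneOn T (Ici 0) ∧
        -- existence and uniqueness
        (∀ u₀ : DataSpace s ω, ∃ U : ResSpace α s ω b,
          IsUniqueSolution α s s₀ ω b ψ (T (dataNorm s₀ ω u₀)) u₀ U) ∧
        -- analyticity of the flow map into `C([-T,T], H^(s,ω)) ∩ X^T_{s,ω,b}`, `T = T(r)`
        ∀ r : ℝ, 0 < r →
          ∃ F : DataSpace s ω → C(Icc (-(T r)) (T r), DataSpace s ω) ×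
              ResTimeSpace α s ω b (T r) (omega_nonneg hα1 hα2 hω) hb,
            AnalyticOnNhd ℂ F {v₀ : DataSpace s ω | dataNorm s₀ ω v₀ ≤ r} ∧
            ∀ v₀ : DataSpace s ω, dataNorm s₀ ω v₀ ≤ r →
              ∃ V : ResSpace α s ω b,
                IsUniqueSolution α s s₀ ω b ψ (T r) v₀ V ∧
                (F v₀).2 = restrictTime (T r) (omega_nonneg hα1 hα2 hω) hb V ∧
                ∀ t : Icc (-(T r)) (T r), ∀ᵐ ξ : ℝ, ((F v₀).1 t : DataSpace s ω) ξ = slice V t ξ := by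
  obtain ⟨ρ, ε, h, hρ⟩ := exists_admissible hα1 hα2 hω hs₀
  obtain ⟨Ψ, C, hΨ⟩ := exists_isProfile hψ
  have hb : (1 : ℝ) / 2 < 1 / 2 + ε := by linarith [h.eps_pos]
  have hω0 := omega_nonneg hα1 hα2 hω
  obtain ⟨K, hK, hflow⟩ := exists_flow h hΨ hψ.eq_one hρ hs
  obtain ⟨T, hT, hTanti⟩ := exists_lifespan h.eps_pos hK
  refine ⟨1 / 2 + ε, hb, fun T _ => exists_embedding h s T hω0 hb, duhamelConverges h hρ, T,
    fun r hr => (hT r hr).1, hTanti, fun u₀ => ?_, fun r hr => ?_⟩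
  · obtain ⟨h1, h2, h3⟩ := hT _ (dataNorm_nonneg s₀ ω u₀)
    obtain ⟨G, hG⟩ := hflow _ _ h1 h2 h3
    exact ⟨G u₀, (hG u₀ le_rfl).1⟩
  · obtain ⟨h1, h2, h3⟩ := hT r hr.le
    obtain ⟨G, hG⟩ := hflow _ _ h1 h2 h3
    obtain ⟨ι, -, hι⟩ := exists_embedding h s (T r) hω0 hb
    obtain ⟨R, hR⟩ : ∃ R : ResSpace α s ω (1 / 2 + ε) →L[ℂ]
        ResTimeSpace α s ω (1 / 2 + ε) (T r) hω0 hb, ∀ U, R U = restrictTime (T r) hω0 hb U :=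
      ⟨(vanishing α s ω (1 / 2 + ε) (T r) hω0 hb).mkQL, fun _ => rfl⟩
    -- Both components are continuous linear images of the analytic map G into X_{s,ω,b}.
    refine ⟨fun v => (ι (R (G v)), R (G v)), fun v hv => ?_, fun v hv => ?_⟩
    · have h4 : AnalyticAt ℂ (fun v => R (G v)) v :=
        AnalyticAt.fun_comp (R.analyticAt _) (hG v hv).2
      exact (AnalyticAt.fun_comp (ι.analyticAt _) h4).prod h4
    · refine ⟨G v, (hG v hv).1, hR _, fun t => ?_⟩
      have h5 := hι (G v) t
      rw [← hR] at h5
      exact h5
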